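/- Let $U\subset\mathbb C$ be an open neighbourhood of $0$ (a coordinate neighbourhood of a point $p$ of a Riemann surface, with centred holomorphic coordinate $w$ and a holomorphic trivialization of the bundle), and let $\varphi=\Phi\,dw$ be an $SL(n,\mathbb C)$-Higgs field on $U$, i.e. $\Phi$ is a holomorphic traceless $n\times n$ matrix function. Assume simple eigenvalue crossing: the spectral curve $\{\det(\lambda-\Phi(w))=0\}$ is smooth and no eigenvalue of any $\Phi(w)$ has multiplicity larger than $2$. Assume that $p$ is a branch point at which the discriminant $\Delta_\varphi=\prod_{i<j}(\lambda_i-\lambda_j)^2$ has a zero of order $\ell\ge1$. Let $h_\infty$ be a limiting metric: off the zeros of $\Delta_\varphi$ it is smooth and solves $F_{D(\bar\partial,h_\infty)}=0$, $[\varphi,\varphi^{\dagger_{h_\infty}}]=0$, and near each point of $U$ one has $h_\infty(v,v)\asymp|\partial_\lambda\mathrm{char}_\Phi(\lambda)|$ uniformly for eigenvectors $v$ of Euclidean norm one with eigenvalue $\lambda$ (the parabolic weights at the ramification points). (1) On some disk $\{|w|<R\}\subset U$ without branch points other than $p$, there are local holomorphic coordinates $z_1,\dots,z_\ell$ centred at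 $p$ and a holomorphic frame in which $$\bar\partial_E=\bar\partial,\quad \varphi=\bigoplus_{j=1}^{\ell}\begin{pmatrix}\hat\lambda_{(j)}&z_j\,dz_j\\ dz_j&\hat\lambda_{(j)}\end{pmatrix}\oplus\mathrm{diag}(\lambda_{2\ell+1},\dots,\lambda_n),\quad h_\infty=\bigoplus_{j=1}^{\ell}\begin{pmatrix}|z_j|^{-1/2}&0\\0&|z_j|^{1/2}\end{pmatrix}\oplus\mathrm{Id}_{n-2\ell},$$ with holomorphic one-forms $\hat\lambda_{(j)},\lambda_k$. (2) In every such frame, let $(\dot\eta,\dot\varphi)$ be a smooth infinitesimal deformation on $\{|w|<R\}$, i.e. $\bar\partial\dot\varphi+[\dot\eta,\varphi]=0$, and let $\mathbb D=\{|w|<\rho\}$ with $0<\rho<R$. On $\mathbb D$ there is exactly one representative of its class modulo $(\dot\eta,\dot\varphi)\mapsto(\dot\eta+\bar\partial\dot\gamma,\dot\varphi+[\varphi,\dot\gamma])$, $\dot\gamma$ smooth, of the form $$\dot\eta=0,\qquad \dot\varphi=\bigoplus_{j=1}^{\ell}\begin{pmatrix}\hat{\dot\lambda}_{(j)}&\dot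 P_{(j)}\,dz_j\\0&\hat{\dot\lambda}_{(j)}\end{pmatrix}\oplus\mathrm{diag}(\dot\lambda_{2\ell+1},\dots,\dot\lambda_n)$$ with $\hat{\dot\lambda}_{(j)},\dot P_{(j)},\dot\lambda_k$ holomorphic. For this representative, $$\dot\nu_\infty=\bigoplus_{j=1}^{\ell}-\frac{\dot P_{(j)}}{4z_j}\begin{pmatrix}1&0\\0&-1\end{pmatrix}\oplus\mathbf 0_{n-2\ell}$$ is a variation of $h_\infty$ on $\mathbb D\setminus\{p\}$ associated with $(0,t\dot\varphi)$ at $(\bar\partial,t\varphi)$ for every $t\in\mathbb R$: it solves $\partial^{h_\infty}\bar\partial\dot\nu-\partial^{h_\infty}\dot\eta-[\varphi^{\dagger},\dot\varphi+[\dot\nu,\varphi]]=0$ (formal Coulomb gauge) and $[\dot\varphi,\varphi^\dagger]+[\varphi,\dot\varphi^\dagger]+[\varphi,[\varphi^\dagger,\dot\nu+\dot\nu^\dagger]]=0$, $\dagger=\dagger_{h_\infty}$ (with $\varphi,\dot\varphi$ scaled by $t$). Moreover, if $\dot\nu$ is any smooth solution of these two equations for the original $(\dot\eta,\dot\varphi)$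 on $\mathbb D\setminus\{p\}$ with $\dot\eta=\bar\partial\dot\nu$ there and $\dot\nu-\dot\nu_\infty$ bounded near $p$, then one smooth $\dot\gamma$ on $\mathbb D$ takes the triple $(\dot\eta,\dot\varphi,\dot\nu)$ to the above normal form, $\dot\nu+\dot\gamma=\dot\nu_\infty$. (3) For $t>0$ let $u_t$ be the solution on $(0,\infty)$ of $u''+\frac1ru'-8t^2r\sinh(2u)=0$ with $u_t\sim\frac1\pi K_0(\frac{8t}3r^{3/2})$ as $r\to\infty$ and $u_t\sim-\frac12\log r$ as $r\to0$; let $\chi:\mathbb R\to[0,1]$ be a smooth cutoff, $\chi=1$ on some $[0,r_0]$, $r_0>0$, and $$h_t^{\rm app}=\bigoplus_{j=1}^{\ell}\begin{pmatrix}|z_j|^{-1/2}e^{-u_t(|z_j|)\chi(|z_j|)}&0\\0&|z_j|^{1/2}e^{u_t(|z_j|)\chi(|z_j|)}\end{pmatrix}\oplus\mathbf 1_{n-2\ell}.$$ Let $\Omega$ be open with $\overline\Omega\subset\mathbb D$ and $\chi(|z_j|)=0$ on $\mathbb D\setminus\Omega$ for all $j$, and let $\dot\nu_t^{\rm app}$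 be continuous on $\mathbb D$, smooth on $\Omega$, equal to $\dot\nu_\infty$ on $\mathbb D\setminus\Omega$, and solve on $\Omega$ the formal Coulomb equation $\partial^{h}\bar\partial\dot\nu-t^2[\varphi^{\dagger_h},\dot\varphi+[\dot\nu,\varphi]]=0$ for $h=h_t^{\rm app}$, $\dot\varphi$ being the normal form. Then there is $\gamma>0$ such that, as $t\to\infty$, $$\|(0,t\dot\varphi,\dot\nu_t^{\rm app})\|^2_{g_{\rm app}(\mathbb D)}-\|(0,t\dot\varphi,\dot\nu_\infty)\|^2_{g_{\rm sf}(\mathbb D)}=O(e^{-\gamma t}),$$ where $\|(0,t\dot\varphi,\dot\nu)\|^2=2t^2\int_{\mathbb D}\langle\dot\varphi+[\dot\nu,\varphi],\dot\varphi\rangle_h$ with $h=h_t^{\rm app}$, resp. $h=h_\infty$, and $\langle\alpha,\beta\rangle_h=\mathrm{tr}(\alpha\wedge\bar\star\beta^{\dagger_h})$; both integrals converge absolutely. -/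

import Mathlib

open Filter Topology Asymptotics MeasureTheory
open scoped ContDiff Matrix ComplexOrder

noncomputable section

namespace HiggsLocal

/-! Everything is written over a coordinate neighbourhood of a point `p` of a Riemann surface, with a
centred holomorphic coordinate `w` (so `p` is `w = 0`) and a holomorphic frame of the bundle.
Endomorphism-valued functions and forms are matrix-valued functions of `w`: a `(1,0)`-form `V dw` and
a `(0,1)`-form `E dw̄` are given by their coefficients. -/

section Calculus

variable {ι : Type*}

/-- `∂f/∂w` for a complex function `f` of `w = x + iy`. -/
def dw (f : ℂ → ℂ) (w : ℂ) : ℂ :=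
  (1 / 2) * (fderiv ℝ f w 1 - Complex.I * fderiv ℝ f w Complex.I)

/-- `∂f/∂w̄`. -/
def dwbar (f : ℂ → ℂ) (w : ℂ) : ℂ :=
  (1 / 2) * (fderiv ℝ f w 1 + Complex.I * fderiv ℝ f w Complex.I)

/-- Entrywise `∂/∂w`. -/
def dMat (A : ℂ → Matrix ι ι ℂ) (w : ℂ) : Matrix ι ι ℂ :=
  Matrix.of fun a b => dw (fun x => A x a b) w

/-- Entrywise `∂/∂w̄`. -/
def dbarMat (A : ℂ → Matrix ι ι ℂ) (w : ℂ) : Matrix ι ι ℂ :=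
  Matrix.of fun a b => dwbar (fun x => A x a b) w

/-- Entrywise (real) smoothness on a set. -/
def SmoothMatOn (A : ℂ → Matrix ι ι ℂ) (S : Set ℂ) : Prop :=
  ∀ a b, ContDiffOn ℝ ∞ (fun w => A w a b) S

/-- Entrywise holomorphy on a set, also for rectangular matrices. -/
def HolMatOn {κ : Type*} (A : ℂ → Matrix ι κ ℂ) (S : Set ℂ) : Prop :=
  ∀ a b, DifferentiableOn ℂ (fun w => A w a b) S

variable [Fintype ι]

/-- The commutator `[A, B]`. -/
def comm (A B : Matrix ι ι ℂ) : Matrix ι ι ℂ := A * B - B * A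

variable [DecidableEq ι]

/-- The adjoint of `B` for the hermitian form `h(v, v') = v'^* H v`. -/
def adj (H B : Matrix ι ι ℂ) : Matrix ι ι ℂ := H⁻¹ * Bᴴ * H

/-- The `(1,0)`-part of the Chern connection of `(∂̄, H)` on endomorphisms,
`∂^h A = ∂A + [H⁻¹ ∂H, A]`. -/
def covD (H A : ℂ → Matrix ι ι ℂ) (w : ℂ) : Matrix ι ι ℂ :=
  dMat A w + comm ((H w)⁻¹ * dMat H w) (A w)

end Calculus

section HiggsBundles

variable {ι : Type*} [Fintype ι] [DecidableEq ι]

/-- An `SL(n,ℂ)` Higgs field `φ = Φ dw` on `U`: holomorphic and traceless. -/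
def IsSLHiggsField (U : Set ℂ) (Φ : ℂ → Matrix ι ι ℂ) : Prop :=
  HolMatOn Φ U ∧ ∀ w ∈ U, (Φ w).trace = 0

/-- The spectral curve `{(w, lam) : char_{Φ(w)}(lam) = 0}` is smooth over `U` (the regular locus). -/
def SpectralCurveSmooth (U : Set ℂ) (Φ : ℂ → Matrix ι ι ℂ) : Prop :=
  ∀ w ∈ U, ∀ lam : ℂ, (Φ w).charpoly.eval lam = 0 →
    (Φ w).charpoly.derivative.eval lam ≠ 0 ∨
      deriv (fun x => (Φ x).charpoly.eval lam) w ≠ 0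

/-- Simple eigenvalue crossing: the Higgs field is in the regular locus and at most pairs of
eigenvalues come together. -/
def SimpleEigenvalueCrossing (U : Set ℂ) (Φ : ℂ → Matrix ι ι ℂ) : Prop :=
  SpectralCurveSmooth U Φ ∧
    ∀ w ∈ U, ∀ lam : ℂ, (Φ w).charpoly.rootMultiplicity lam ≤ 2

/-- `H` is (the matrix of) a limiting metric `h_∞` of the Higgs field `Φ dw` on `U`: off the branch
points it is a smooth hermitian metric that solves the decoupled Hitchin equations
`F = 0`, `[φ, φ^†] = 0` (the latter says that the eigenlines are orthogonal, so that `H` is an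
orthogonal push-forward from the spectral curve), and on the eigenlines it has the prescribed
parabolic growth: `h(v,v)` is comparable to `|∂_λ char|` for an eigenvector `v` of Euclidean norm
one. Near a simple ramification point with local coordinate `x` on the spectral curve,
`|∂_λ char|` is comparable to `|x|`; away from ramification it is comparable to `1`. -/
structure IsLimitingMetric (U : Set ℂ) (Φ H : ℂ → Matrix ι ι ℂ) : Prop where
  smooth : SmoothMatOn H {w ∈ U | (Φ w).discr ≠ 0}
  posDef : ∀ w ∈ U, (Φ w).discr ≠ 0 → (H w).PosDef
  flat : ∀ w ∈ U, (Φ w).discr ≠ 0 → dbarMat (fun x => (H x)⁻¹ * dMat H x) w = 0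
  normal : ∀ w ∈ U, (Φ w).discr ≠ 0 → comm (Φ w) (adj (H w) (Φ w)) = 0
  adapted : ∀ p ∈ U, ∃ C : ℝ, 0 < C ∧ ∀ᶠ w in 𝓝[≠] p, ∀ (lam : ℂ) (v : ι → ℂ),
    Φ w *ᵥ v = lam • v →
      (star v ⬝ᵥ (H w *ᵥ v)).re ≤ C * ‖(Φ w).charpoly.derivative.eval lam‖ * ∑ a, ‖v a‖ ^ 2 ∧
      ‖(Φ w).charpoly.derivative.eval lam‖ * ∑ a, ‖v a‖ ^ 2 ≤ C * (star v ⬝ᵥ (H w *ᵥ v)).re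

/-- An infinitesimal Higgs bundle deformation `(η̇, φ̇) = (E dw̄, V dw)` on `S`:
`∂̄ φ̇ + [η̇, φ] = 0`. -/
structure IsDeformation (Φ : ℂ → Matrix ι ι ℂ) (S : Set ℂ) (E V : ℂ → Matrix ι ι ℂ) : Prop where
  smooth_eta : SmoothMatOn E S
  smooth_phi : SmoothMatOn V S
  eq : ∀ w ∈ S, dbarMat V w + comm (E w) (Φ w) = 0

/-- `(E₁, V₁)` and `(E₂, V₂)` differ on `S` by the infinitesimal gauge transformation `γ`. -/
structure IsGauge (Φ : ℂ → Matrix ι ι ℂ) (S : Set ℂ) (γ E₁ V₁ E₂ V₂ : ℂ → Matrix ι ι ℂ) :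
    Prop where
  smooth : SmoothMatOn γ S
  eta : ∀ w ∈ S, E₂ w - E₁ w = dbarMat γ w
  phi : ∀ w ∈ S, V₂ w - V₁ w = comm (Φ w) (γ w)

/-- The equation `∂^h ∂̄ ν̇ - ∂^h η̇ - [φ^†, φ̇ + [ν̇, φ]] = 0` at `w` for the metric variation `ν̇`
(linearized Hitchin equation and formal Coulomb gauge together). It is the coefficient of
`dw ∧ dw̄`; the bracket of a `(0,1)`- with a `(1,0)`-form contributes the sign. -/
def CoulombEq (Φ H E V ν : ℂ → Matrix ι ι ℂ) (w : ℂ) : Prop :=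
  covD H (dbarMat ν) w - covD H E w
    + comm (adj (H w) (Φ w)) (V w + comm (ν w) (Φ w)) = 0

/-- The linearization of `[φ, φ^†] = 0`:
`[φ̇, φ^†] + [φ, φ̇^†] + [φ, [φ^†, ν̇ + ν̇^†]] = 0` at `w`. -/
def DecoupledEq (Φ H V ν : ℂ → Matrix ι ι ℂ) (w : ℂ) : Prop :=
  comm (V w) (adj (H w) (Φ w)) + comm (Φ w) (adj (H w) (V w))
    + comm (Φ w) (comm (adj (H w) (Φ w)) (ν w + adj (H w) (ν w))) = 0

/-- `ν` is a metric variation of the limiting metric `H` on `S`, associated with `(E, V)`. -/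
structure IsLimitingVariation (Φ H : ℂ → Matrix ι ι ℂ) (S : Set ℂ)
    (E V ν : ℂ → Matrix ι ι ℂ) : Prop where
  smooth : SmoothMatOn ν S
  coulomb : ∀ w ∈ S, CoulombEq Φ H E V ν w
  decoupled : ∀ w ∈ S, DecoupledEq Φ H V ν w

/-- The density of the two-form `⟨η̇ - ∂̄ν̇, η̇⟩_h + ⟨φ̇ + [ν̇, φ], φ̇⟩_h` with respect to Lebesgue
measure `dx dy`, where `⟨α, β⟩ = tr(α ∧ ⋆̄ β^†)`; the factor 2 is `i dw ∧ dw̄ = 2 dx dy`. -/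
def density (Φ H E V ν : ℂ → Matrix ι ι ℂ) (w : ℂ) : ℂ :=
  2 * (((E w - dbarMat ν w) * adj (H w) (E w)).trace
    + ((V w + comm (ν w) (Φ w)) * adj (H w) (V w)).trace)

/-- The contribution of `D` to the squared `L²`-norm of `(η̇, φ̇, ν̇)` at `(∂̄, φ, h)`. -/
def normSq (Φ H E V ν : ℂ → Matrix ι ι ℂ) (D : Set ℂ) : ℂ :=
  2 * ∫ w in D, density Φ H E V ν w

end HiggsBundles

section Model

/-- The modified Bessel function `K₀` on `(0, ∞)`. -/
def besselK0 (x : ℝ) : ℝ := ∫ s in Set.Ioi (0 : ℝ), Real.exp (-x * Real.cosh s)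

/-- `u` is the function `u_t` of `r = |z|`. -/
structure IsModelFunction (t : ℝ) (u : ℝ → ℝ) : Prop where
  smooth : ContDiffOn ℝ 2 u (Set.Ioi 0)
  ode : ∀ r, 0 < r →
    deriv (deriv u) r + 1 / r * deriv u r - 8 * t ^ 2 * r * Real.sinh (2 * u r) = 0
  at_top : u ~[atTop] fun r => 1 / Real.pi * besselK0 (8 * t / 3 * r ^ (3 / 2 : ℝ))
  at_zero : u ~[𝓝[>] 0] fun r => -(1 / 2) * Real.log r

/-- A smooth cutoff function of the radius, equal to one near the origin. -/
structure IsCutoff (χ : ℝ → ℝ) : Prop where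
  smooth : ContDiff ℝ ∞ χ
  nonneg : ∀ r, 0 ≤ χ r
  le_one : ∀ r, χ r ≤ 1
  eq_one : ∃ r₀, 0 < r₀ ∧ ∀ r, 0 ≤ r → r ≤ r₀ → χ r = 1

/-- Indices of a frame with `ℓ` blocks of size two followed by `m` blocks of size one. -/
abbrev BlockIdx (ℓ m : ℕ) : Type := (Fin 2 × Fin ℓ) ⊕ Fin m

/-- The block diagonal matrix with 2×2 blocks `A j` and scalar entries `c k`. -/
def blockMat {ℓ m : ℕ} (A : Fin ℓ → Matrix (Fin 2) (Fin 2) ℂ) (c : Fin m → ℂ) :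
    Matrix (BlockIdx ℓ m) (BlockIdx ℓ m) ℂ :=
  Matrix.fromBlocks (Matrix.blockDiagonal A) 0 0 (Matrix.diagonal c)

/-- The functions in the local normal form of a Higgs field: local coordinates `z j` (as functions of
`w`), and the `dw`-coefficients of the one-forms `lamHat j` and `lam k`. -/
structure LocalModel (ℓ m : ℕ) where
  z : Fin ℓ → ℂ → ℂ
  lamHat : Fin ℓ → ℂ → ℂ
  lam : Fin m → ℂ → ℂ

namespace LocalModel

variable {ℓ m : ℕ} (M : LocalModel ℓ m)

/-- The normal form of `φ`, with `dz_j = z_j' dw`. -/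
def higgs (w : ℂ) : Matrix (BlockIdx ℓ m) (BlockIdx ℓ m) ℂ :=
  blockMat
    (fun j => !![M.lamHat j w, M.z j w * deriv (M.z j) w; deriv (M.z j) w, M.lamHat j w])
    (fun k => M.lam k w)

/-- The normal form of `h_∞`. -/
def hInf (w : ℂ) : Matrix (BlockIdx ℓ m) (BlockIdx ℓ m) ℂ :=
  blockMat
    (fun j => !![((‖M.z j w‖ ^ (-(1 / 2) : ℝ) : ℝ) : ℂ), 0; 0, ((‖M.z j w‖ ^ (1 / 2 : ℝ) : ℝ) : ℂ)])
    (fun _ => 1)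

/-- The approximate metric `h_t^app` for the cutoff `χ`, with `u = u_t`. -/
def hApp (χ u : ℝ → ℝ) (w : ℂ) : Matrix (BlockIdx ℓ m) (BlockIdx ℓ m) ℂ :=
  blockMat
    (fun j =>
      !![((‖M.z j w‖ ^ (-(1 / 2) : ℝ) * Real.exp (-(u ‖M.z j w‖ * χ ‖M.z j w‖)) : ℝ) : ℂ), 0;
        0, ((‖M.z j w‖ ^ (1 / 2 : ℝ) * Real.exp (u ‖M.z j w‖ * χ ‖M.z j w‖) : ℝ) : ℂ)])
    (fun _ => 1)

end LocalModel

/-- On the disk `|w| < R`, the columns of `g` form a holomorphic frame in which `Φ dw` and `H` have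
the normal form `M`; the disk contains no branch point except possibly its centre. -/
structure IsAdaptedFrame {n ℓ m : ℕ} (U : Set ℂ) (Φ H : ℂ → Matrix (Fin n) (Fin n) ℂ) (R : ℝ)
    (M : LocalModel ℓ m) (g : ℂ → Matrix (Fin n) (BlockIdx ℓ m) ℂ)
    (ginv : ℂ → Matrix (BlockIdx ℓ m) (Fin n) ℂ) : Prop where
  subset : Metric.ball 0 R ⊆ U
  unbranched : ∀ w ∈ Metric.ball (0 : ℂ) R, w ≠ 0 → (Φ w).discr ≠ 0
  z_hol : ∀ j, DifferentiableOn ℂ (M.z j) (Metric.ball 0 R)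
  z_inj : ∀ j, Set.InjOn (M.z j) (Metric.ball 0 R)
  z_zero : ∀ j, M.z j 0 = 0
  lamHat_hol : ∀ j, DifferentiableOn ℂ (M.lamHat j) (Metric.ball 0 R)
  lam_hol : ∀ k, DifferentiableOn ℂ (M.lam k) (Metric.ball 0 R)
  g_hol : HolMatOn g (Metric.ball 0 R)
  ginv_hol : HolMatOn ginv (Metric.ball 0 R)
  mul_inv : ∀ w ∈ Metric.ball (0 : ℂ) R, g w * ginv w = 1
  inv_mul : ∀ w ∈ Metric.ball (0 : ℂ) R, ginv w * g w = 1
  higgs_eq : ∀ w ∈ Metric.ball (0 : ℂ) R, ginv w * Φ w * g w = M.higgs w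
  metric_eq : ∀ w ∈ Metric.ball (0 : ℂ) R, w ≠ 0 → (g w)ᴴ * H w * g w = M.hInf w

/-- The functions in the normal form of a deformation: `P j`, and the `dw`-coefficients of the
one-forms `lamHatDot j` and `lamDot k`. -/
structure DeformationData (ℓ m : ℕ) where
  lamHatDot : Fin ℓ → ℂ → ℂ
  P : Fin ℓ → ℂ → ℂ
  lamDot : Fin m → ℂ → ℂ

namespace DeformationData

variable {ℓ m : ℕ} (d : DeformationData ℓ m)

structure HolOn (S : Set ℂ) : Prop where
  lamHatDot : ∀ j, DifferentiableOn ℂ (d.lamHatDot j) S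
  P : ∀ j, DifferentiableOn ℂ (d.P j) S
  lamDot : ∀ k, DifferentiableOn ℂ (d.lamDot k) S

structure EqOn (d' : DeformationData ℓ m) (S : Set ℂ) : Prop where
  lamHatDot : ∀ j, Set.EqOn (d.lamHatDot j) (d'.lamHatDot j) S
  P : ∀ j, Set.EqOn (d.P j) (d'.P j) S
  lamDot : ∀ k, Set.EqOn (d.lamDot k) (d'.lamDot k) S

/-- The normal form of `φ̇`. -/
def phiDot (M : LocalModel ℓ m) (w : ℂ) : Matrix (BlockIdx ℓ m) (BlockIdx ℓ m) ℂ :=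
  blockMat
    (fun j => !![d.lamHatDot j w, d.P j w * deriv (M.z j) w; 0, d.lamHatDot j w])
    (fun k => d.lamDot k w)

/-- The normal form of `ν̇_∞`. -/
def nuInf (M : LocalModel ℓ m) (w : ℂ) : Matrix (BlockIdx ℓ m) (BlockIdx ℓ m) ℂ :=
  blockMat (fun j => (-(d.P j w / (4 * M.z j w))) • !![1, 0; 0, -1]) (fun _ => 0)

end DeformationData

/-- `ν` is the metric variation `ν̇_t^app` on `D`, associated with the deformation
`(0, t φ̇)` of `(∂̄, t φ, h_t^app)`: on the open set `Ω`, which contains the region where the cutoff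
does not vanish, it is smooth and solves the Coulomb equation for `h_t^app`, and on `D \ Ω`, where
`h_t^app = h_∞`, it agrees with `ν̇_∞`. The origin is left out of the equation only because
the formula for `h_t^app` is not evaluated there; `ν` is smooth across it. -/
structure IsAppVariation {ℓ m : ℕ} (M : LocalModel ℓ m) (d : DeformationData ℓ m) (χ u : ℝ → ℝ)
    (t : ℝ) (D Ω : Set ℂ) (ν : ℂ → Matrix (BlockIdx ℓ m) (BlockIdx ℓ m) ℂ) : Prop where
  cont : ∀ a b, ContinuousOn (fun w => ν w a b) D
  smooth : SmoothMatOn ν Ω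
  coulomb : ∀ w ∈ Ω, w ≠ 0 →
    CoulombEq (fun x => (t : ℂ) • M.higgs x) (M.hApp χ u) 0 (fun x => (t : ℂ) • d.phiDot M x) ν w
  eq_inf : ∀ w ∈ D \ Ω, ν w = d.nuInf M w

end Model

end HiggsLocal

end

/-! Existence of the frame. Put w = s². As the spectral curve is smooth and eigenvalues are at most
double, a simple eigenvalue of Φ(0) continues holomorphically in w, and a double one becomes a
holomorphic function L(s) with L'(0) ≠ 0 whose two sheets are L(s) and L(-s)
(`exists_double_root_germ`). Counting zeros of the discriminant in s shows that there are ℓ pairs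
(`IsSpectralGerm.eq_of_order`). Write L = λ̂(s²) + s κ(s²); the coordinate z = w k² is chosen so
that √z z' = s κ (`exists_coordinate`). Normality makes the eigenlines orthogonal for h_∞. Flatness
makes the logarithm of the norm of a holomorphic eigenvector harmonic off the branch point, and the
prescribed growth leaves a bounded function once p log|s| is subtracted. So the squared norm is
|s|^p |e^f|² with f holomorphic (`IsSpectralGerm.exists_gram_eq`). An eigenvector rescaled to
squared norm 2|z|^{1/2} has the form e₂ + √z e₁, by splitting into even and odd parts in s, and e₁,
e₂ span the block. Independence at p itself holds because Φ(0) acts there through Jordan blocks, and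
the kernel of an intertwiner, if nonzero, contains an eigenvector.

Normal form of a deformation. The equation ∂̄γ = -η̇ is solved with the Cauchy kernel on a smaller
disk (`exists_dwbar_eq`), after which φ̇ is holomorphic. Smoothness of the spectral curve separates
the spectra of different blocks, so the off-diagonal blocks of φ̇ are removed by an explicit
Sylvester solution (`comm_sylvesterSol`); within a block the image of ad φ is computed by hand.
Uniqueness holds because the trace of a block and the functional X₀₁ + z X₁₀ vanish on that image.
The model ν̇_∞ is holomorphic off p and makes φ̇ + [ν̇, φ] commute with φ^†. A competing variation
differs from it, up to gauge, by some μ that is holomorphic off p, bounded, and satisfies [φ^†, [μ,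
φ]] = 0. Positivity of the metric gives [μ, φ] = 0, so after removal of the singularity μ can be
absorbed into the gauge transformation (`exists_gauge_to_nuInf`).

Comparison of norms. In each block only half the difference n of the diagonal entries of ν̇ matters,
and the Coulomb equation becomes a scalar equation for n with the profile f = χ u_t. Choose a
holomorphic with 2 z a' + a z' = P z'. Then n₀ = -P/(4z) - a |z| f'(|z|)/(2z) solves the scalar
equation up to the error with which f solves the sinh-Gordon equation. That error is supported where
|z| is bounded below, and it is exponentially small there: u_t is compared with the rescaled u₁,
which is controlled by K₀ (`expSmall_modelFunction`), and its derivatives follow from the equation.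
Near p, n₀ is bounded since r u_t' + 1/2 = O(r). The difference n - n₀ vanishes outside Ω and
satisfies an equation ∂∂̄κ = Aκ + S with A > 0, so the maximum principle makes it exponentially
small (`IsBlockData.expSmall_deviation`). Finally, the difference of the two densities equals ∂G
plus a multiple of n - n₀, where G vanishes outside Ω and is mild enough at p for Stokes' theorem.
Hence the integral is exponentially small, and the factor t² is absorbed by lowering the rate. -/

noncomputable section

namespace HiggsLocal

/-! ### Wirtinger calculus -/

/-- The real linear map `v ↦ a v + b v̄`. -/
def wirtingerCLM (a b : ℂ) : ℂ →L[ℝ] ℂ :=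
  a • (ContinuousLinearMap.id ℝ ℂ) + b • (Complex.conjCLE : ℂ →L[ℝ] ℂ)

@[simp] lemma wirtingerCLM_apply (a b v : ℂ) :
    wirtingerCLM a b v = a * v + b * (starRingEnd ℂ) v := by
  simp [wirtingerCLM]

/-- `f` is real differentiable at `w` with `∂f = a` and `∂̄f = b`. -/
def HasWirtinger (f : ℂ → ℂ) (a b w : ℂ) : Prop := HasFDerivAt f (wirtingerCLM a b) w

lemma eq_wirtingerCLM (T : ℂ →L[ℝ] ℂ) :
    T = wirtingerCLM ((1 / 2) * (T 1 - Complex.I * T Complex.I))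
      ((1 / 2) * (T 1 + Complex.I * T Complex.I)) := by
  ext v
  have hv : v = v.re • (1 : ℂ) + v.im • Complex.I := by
    simp [Complex.re_add_im]
  have h1 : T v = v.re * T 1 + v.im * T Complex.I := by
    conv_lhs => rw [hv]
    rw [map_add, map_smul, map_smul, Complex.real_smul, Complex.real_smul]
  rw [h1, wirtingerCLM_apply]
  have h2 : (starRingEnd ℂ) v = v.re - v.im * Complex.I := by
    apply Complex.ext <;> simp
  rw [h2]
  conv_rhs => rw [show v = (v.re : ℂ) + v.im * Complex.I from (Complex.re_add_im v).symm]
  simp only [Complex.add_re, Complex.ofReal_re, Complex.mul_re, Complex.I_re, Complex.ofReal_im,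
    Complex.I_im, Complex.add_im, Complex.mul_im]
  ring_nf
  rw [Complex.I_sq]
  ring

namespace HasWirtinger

variable {f g : ℂ → ℂ} {a b a' b' w : ℂ}

lemma of_hasFDerivAt {T : ℂ →L[ℝ] ℂ} (h : HasFDerivAt f T w)
    (hT : ∀ v, T v = a * v + b * (starRingEnd ℂ) v) : HasWirtinger f a b w := by
  have : T = wirtingerCLM a b := ContinuousLinearMap.ext fun v => by simpa using hT v
  rw [this] at h
  exact h

lemma dw_eq (h : HasWirtinger f a b w) : dw f w = a := by
  rw [dw, h.fderiv]
  simp only [wirtingerCLM_apply, map_one, Complex.conj_I]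
  linear_combination (-a / 2 + b / 2) * Complex.I_sq

lemma dwbar_eq (h : HasWirtinger f a b w) : dwbar f w = b := by
  rw [dwbar, h.fderiv]
  simp only [wirtingerCLM_apply, map_one, Complex.conj_I]
  linear_combination (a / 2 - b / 2) * Complex.I_sq

lemma differentiableAt (h : HasWirtinger f a b w) : DifferentiableAt ℝ f w :=
  HasFDerivAt.differentiableAt h

lemma of_differentiableAt (h : DifferentiableAt ℝ f w) :
    HasWirtinger f (dw f w) (dwbar f w) w := by
  have := h.hasFDerivAt
  rw [eq_wirtingerCLM (fderiv ℝ f w)] at this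
  exact this

lemma of_eq (h : HasWirtinger f a b w) (ha : a = a') (hb : b = b') : HasWirtinger f a' b' w :=
  ha ▸ hb ▸ h

lemma of_hasDerivAt (h : HasDerivAt f a w) : HasWirtinger f a 0 w := by
  refine of_hasFDerivAt (h.hasFDerivAt.restrictScalars ℝ) fun v => ?_
  simp [mul_comm]

lemma hasDerivAt (h : HasWirtinger f a 0 w) : HasDerivAt f a w := by
  rw [hasDerivAt_iff_hasFDerivAt]
  have : HasFDerivAt f ((ContinuousLinearMap.toSpanSingleton ℂ a).restrictScalars ℝ) w := by
    have hT : wirtingerCLM a 0 =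
        (ContinuousLinearMap.toSpanSingleton ℂ a).restrictScalars ℝ :=
      ContinuousLinearMap.ext fun v => by simp [mul_comm]
    exact hT ▸ h
  exact hasFDerivAt_of_restrictScalars ℝ this rfl

lemma congr_of_eventuallyEq (h : HasWirtinger f a b w) (hfg : g =ᶠ[𝓝 w] f) :
    HasWirtinger g a b w :=
  HasFDerivAt.congr_of_eventuallyEq h hfg

lemma unique (h : HasWirtinger f a b w) (h' : HasWirtinger f a' b' w) : a = a' ∧ b = b' :=
  ⟨h.dw_eq.symm.trans h'.dw_eq, h.dwbar_eq.symm.trans h'.dwbar_eq⟩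

lemma const (c : ℂ) : HasWirtinger (fun _ => c) 0 0 w := of_hasDerivAt (hasDerivAt_const w c)

lemma add (h : HasWirtinger f a b w) (h' : HasWirtinger g a' b' w) :
    HasWirtinger (fun x => f x + g x) (a + a') (b + b') w := by
  refine of_hasFDerivAt (HasFDerivAt.add h h') fun v => ?_
  simp; ring

lemma sub (h : HasWirtinger f a b w) (h' : HasWirtinger g a' b' w) :
    HasWirtinger (fun x => f x - g x) (a - a') (b - b') w := by
  refine of_hasFDerivAt (HasFDerivAt.sub h h') fun v => ?_
  simp; ring

lemma mul (h : HasWirtinger f a b w) (h' : HasWirtinger g a' b' w) :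
    HasWirtinger (fun x => f x * g x) (a * g w + f w * a') (b * g w + f w * b') w := by
  refine of_hasFDerivAt (HasFDerivAt.mul h h') fun v => ?_
  simp; ring

lemma const_mul (c : ℂ) (h : HasWirtinger f a b w) :
    HasWirtinger (fun x => c * f x) (c * a) (c * b) w := by
  simpa using (const c).mul h

lemma conj (h : HasWirtinger f a b w) :
    HasWirtinger (fun x => (starRingEnd ℂ) (f x)) ((starRingEnd ℂ) b) ((starRingEnd ℂ) a) w := by
  refine of_hasFDerivAt ((Complex.conjCLE : ℂ →L[ℝ] ℂ).hasFDerivAt.comp w h) fun v => ?_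
  simp; ring

/-- Composition with a holomorphic function on the right. -/
lemma comp_hol {φ : ℂ → ℂ} {φ' : ℂ} (h : HasWirtinger f a b (φ w)) (hφ : HasDerivAt φ φ' w) :
    HasWirtinger (fun x => f (φ x)) (a * φ') (b * (starRingEnd ℂ) φ') w := by
  have h1 := of_hasDerivAt hφ
  unfold HasWirtinger at h1 h
  refine of_hasFDerivAt (h.comp w h1) fun v => ?_
  simp; ring

/-- Composition of a real function with a real valued one. -/
lemma real_comp {F : ℝ → ℝ} {F' : ℝ} {ρ : ℂ → ℝ} (hF : HasDerivAt F F' (ρ w))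
    (h : HasWirtinger (fun x => (ρ x : ℂ)) a b w) :
    HasWirtinger (fun x => (F (ρ x) : ℂ)) (F' * a) (F' * b) w := by
  have h1 : HasFDerivAt ρ (Complex.reCLM ∘L wirtingerCLM a b) w := by
    have := Complex.reCLM.hasFDerivAt.comp w h
    simpa [Function.comp_def] using! this
  -- The derivative of a real-valued function takes real values, by uniqueness of the derivative.
  have hreal : ∀ v, ((Complex.reCLM (wirtingerCLM a b v) : ℝ) : ℂ) = wirtingerCLM a b v := by
    have h2 := Complex.ofRealCLM.hasFDerivAt.comp w h1
    have h3 := HasFDerivAt.unique h2 h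
    intro v
    exact congrArg (fun T : ℂ →L[ℝ] ℂ => T v) h3
  have h4 := Complex.ofRealCLM.hasFDerivAt.comp w (hF.hasFDerivAt.comp w h1)
  refine of_hasFDerivAt h4 fun v => ?_
  have := hreal v
  simp only [wirtingerCLM_apply] at this
  simp only [wirtingerCLM_apply, ContinuousLinearMap.comp_apply,
    ContinuousLinearMap.toSpanSingleton_apply, smul_eq_mul, Complex.ofRealCLM_apply,
    Complex.ofReal_mul, this]
  ring

/-- The derivatives of `|z|` for a nonvanishing holomorphic function `z`. -/
lemma norm_hol {z : ℂ → ℂ} {z' : ℂ} (hz : HasDerivAt z z' w) (h0 : z w ≠ 0) :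
    HasWirtinger (fun x => ((‖z x‖ : ℝ) : ℂ)) (‖z w‖ * z' / (2 * z w))
      ((starRingEnd ℂ) (‖z w‖ * z' / (2 * z w))) w := by
  -- |z| is the square root of z z̄, and z z̄ is differentiated by the product rule.
  have h1 := (of_hasDerivAt hz).mul (of_hasDerivAt hz).conj
  have h2 : HasWirtinger (fun x => ((Complex.normSq (z x) : ℝ) : ℂ)) (z' * (starRingEnd ℂ) (z w))
      (z w * (starRingEnd ℂ) z') w := by
    refine (h1.congr_of_eventuallyEq (Eventually.of_forall fun x => ?_)).of_eq ?_ ?_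
    · exact (Complex.mul_conj (z x)).symm
    · simp
    · simp
  have hpos : Complex.normSq (z w) ≠ 0 := by simpa using h0
  have h3 := real_comp (ρ := fun x => Complex.normSq (z x)) (Real.hasDerivAt_sqrt hpos) h2
  have hn : ∀ x, Real.sqrt (Complex.normSq x) = ‖x‖ := fun x => rfl
  simp only [hn] at h3
  have hne : (‖z w‖ : ℂ) ≠ 0 := by simpa using h0
  have hsq : (‖z w‖ : ℂ) * ‖z w‖ = z w * (starRingEnd ℂ) (z w) := by
    rw [Complex.mul_conj, Complex.normSq_eq_norm_sq]; push_cast; ring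
  have hc : (starRingEnd ℂ) (z w) ≠ 0 := by simpa using h0
  refine h3.of_eq ?_ ?_
  · push_cast
    field_simp
    linear_combination -z' * hsq
  · simp only [map_div₀, map_mul, Complex.conj_ofReal, map_ofNat]
    push_cast
    field_simp
    linear_combination -(starRingEnd ℂ) z' * hsq

end HasWirtinger

lemma dw_congr {f g : ℂ → ℂ} {w : ℂ} (h : f =ᶠ[𝓝 w] g) : dw f w = dw g w := by
  simp only [dw, h.fderiv_eq]

lemma dwbar_congr {f g : ℂ → ℂ} {w : ℂ} (h : f =ᶠ[𝓝 w] g) : dwbar f w = dwbar g w := by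
  simp only [dwbar, h.fderiv_eq]

lemma dwbar_of_differentiableAt {f : ℂ → ℂ} {w : ℂ} (h : DifferentiableAt ℂ f w) :
    dwbar f w = 0 :=
  (HasWirtinger.of_hasDerivAt h.hasDerivAt).dwbar_eq

lemma differentiableAt_complex_of_dwbar {f : ℂ → ℂ} {w : ℂ} (h : DifferentiableAt ℝ f w)
    (h0 : dwbar f w = 0) : DifferentiableAt ℂ f w := by
  have := HasWirtinger.of_differentiableAt h
  rw [h0] at this
  exact this.hasDerivAt.differentiableAt

@[simp] lemma dw_zero (w : ℂ) : dw (fun _ => 0) w = 0 := (HasWirtinger.const 0).dw_eq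

/-! ### The inhomogeneous Cauchy-Riemann equation -/

/-- In polar coordinates the area element contributes a factor r, which cancels the singularity. -/
lemma integrableOn_inv_norm (R : ℝ) :
    IntegrableOn (fun w : ℂ => ‖w‖⁻¹) (Metric.ball 0 R) := by
  have h := (integrable_fun_norm_addHaar (volume : Measure ℂ)
    (f := (Set.Iio R).indicator (fun r : ℝ => r⁻¹))).2 ?_
  · have h2 := h.integrableOn (s := Metric.ball (0 : ℂ) R)
    refine h2.congr_fun (fun w hw => ?_) measurableSet_ball
    have : ‖w‖ < R := by simpa using hw
    simp [Set.indicator, this]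
  · simp only [Complex.finrank_real_complex, Nat.add_one_sub_one, pow_one, smul_eq_mul]
    have h1 : IntegrableOn (fun _ : ℝ => (1 : ℝ)) (Set.Ioo 0 R) := by simp
    rw [← integrable_indicator_iff measurableSet_Ioi]
    rw [← integrable_indicator_iff measurableSet_Ioo] at h1
    refine h1.congr (Eventually.of_forall fun r => ?_)
    by_cases hr : 0 < r
    · by_cases hR : r < R <;> simp [Set.indicator, hr, hR, hr.ne']
    · simp [Set.indicator, hr]

lemma locallyIntegrable_inv : LocallyIntegrable (fun w : ℂ => w⁻¹) := by
  intro x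
  refine ⟨Metric.ball 0 (‖x‖ + 1), Metric.isOpen_ball.mem_nhds (by simp), ?_⟩
  refine (integrableOn_inv_norm (‖x‖ + 1)).mono' ?_ ?_
  · exact (measurable_id.inv).aestronglyMeasurable
  · exact Eventually.of_forall fun w => by simp

lemma hasDerivAt_polar_radius (r θ : ℝ) :
    HasDerivAt (fun r : ℝ => (r : ℂ) * Complex.exp (θ * Complex.I))
      (Complex.exp (θ * Complex.I)) r := by
  simpa using (Complex.ofRealCLM.hasDerivAt (x := r)).mul_const (Complex.exp (θ * Complex.I))

lemma hasDerivAt_polar_angle (r θ : ℝ) :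
    HasDerivAt (fun θ : ℝ => (r : ℂ) * Complex.exp (θ * Complex.I))
      (r * (Complex.I * Complex.exp (θ * Complex.I))) θ := by
  have h1 : HasDerivAt (fun θ : ℝ => (θ : ℂ) * Complex.I) Complex.I θ := by
    simpa using (Complex.ofRealCLM.hasDerivAt (x := θ)).mul_const Complex.I
  have := (h1.cexp).const_mul (r : ℂ)
  simpa [mul_comm, mul_left_comm] using this

/-- The Cauchy kernel is a fundamental solution of `∂̄`. -/
lemma integral_inv_mul_dwbar {g : ℂ → ℂ} (hg : ContDiff ℝ 1 g) (hc : HasCompactSupport g) :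
    ∫ ζ : ℂ, ζ⁻¹ * dwbar g ζ = -Real.pi * g 0 := by
  have hD : Continuous (fderiv ℝ g) := hg.continuous_fderiv one_ne_zero
  obtain ⟨B, hB⟩ : ∃ B : ℝ, 0 < B ∧ ∀ ζ : ℂ, B ≤ ‖ζ‖ → g ζ = 0 ∧ fderiv ℝ g ζ = 0 := by
    obtain ⟨C, hC⟩ := hc.isCompact.isBounded.exists_norm_le
    refine ⟨max C 0 + 1, by positivity, fun ζ hζ => ?_⟩
    have hn : ζ ∉ tsupport g := fun h => by
      have := hC ζ h
      have := le_max_left C 0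
      linarith
    refine ⟨image_eq_zero_of_notMem_tsupport hn, ?_⟩
    exact image_eq_zero_of_notMem_tsupport (fun h => hn (tsupport_fderiv_subset ℝ h))
  set p : ℝ → ℝ → ℂ := fun r θ => (r : ℂ) * Complex.exp (θ * Complex.I) with hp
  have hpc : Continuous fun x : ℝ × ℝ => p x.1 x.2 := by
    simp only [hp]; fun_prop
  -- A is the radial derivative and C is 1/r times the angular derivative. In polar coordinates r
  -- ζ⁻¹ ∂̄g = (A + iC)/2. Integrating A along rays gives -g(0), and integrating C around circles
  -- gives zero.
  set A : ℝ × ℝ → ℂ := fun x => fderiv ℝ g (p x.1 x.2) (Complex.exp (x.2 * Complex.I)) with hA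
  set C : ℝ × ℝ → ℂ :=
    fun x => fderiv ℝ g (p x.1 x.2) (Complex.I * Complex.exp (x.2 * Complex.I)) with hC
  have hAc : Continuous A := (hD.comp hpc).clm_apply (by fun_prop)
  have hCc : Continuous C := (hD.comp hpc).clm_apply (by fun_prop)
  have hnorm : ∀ r θ : ℝ, 0 ≤ r → ‖p r θ‖ = r := fun r θ hr => by
    simp [hp, Complex.norm_exp_ofReal_mul_I, abs_of_nonneg hr]
  have key : ∀ F : ℝ × ℝ → ℂ, Continuous F → (∀ r θ, B ≤ r → F (r, θ) = 0) →
      IntegrableOn F (Set.Ioi (0 : ℝ) ×ˢ Set.Ioo (-Real.pi) Real.pi) := by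
    intro F hF hF0
    have h1 : IntegrableOn F (Set.Icc (0 : ℝ) B ×ˢ Set.Icc (-Real.pi) Real.pi) :=
      hF.continuousOn.integrableOn_compact (isCompact_Icc.prod isCompact_Icc)
    have h2 : IntegrableOn F (Set.Ioi B ×ˢ Set.Ioo (-Real.pi) Real.pi) := by
      refine (integrableOn_zero (s := Set.Ioi B ×ˢ Set.Ioo (-Real.pi) Real.pi)).congr_fun
        (fun x hx => ?_) (measurableSet_Ioi.prod measurableSet_Ioo)
      exact (hF0 x.1 x.2 (le_of_lt hx.1)).symm
    refine (h1.union h2).mono_set ?_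
    rintro ⟨r, θ⟩ ⟨hr, hθ⟩
    rcases le_or_gt r B with h | h
    · exact Or.inl ⟨⟨le_of_lt hr, h⟩, ⟨hθ.1.le, hθ.2.le⟩⟩
    · exact Or.inr ⟨h, hθ⟩
  have hA0 : ∀ r θ : ℝ, B ≤ r → A (r, θ) = 0 := fun r θ hr => by
    simp only [hA]
    rw [(hB.2 _ (by rw [hnorm r θ (hB.1.le.trans hr)]; exact hr)).2]; rfl
  have hC0 : ∀ r θ : ℝ, B ≤ r → C (r, θ) = 0 := fun r θ hr => by
    simp only [hC]
    rw [(hB.2 _ (by rw [hnorm r θ (hB.1.le.trans hr)]; exact hr)).2]; rfl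
  have hAi := key A hAc hA0
  have hCi := key C hCc hC0
  have hAint : ∫ x in Set.Ioi (0 : ℝ) ×ˢ Set.Ioo (-Real.pi) Real.pi, A x =
      -(2 * Real.pi) * g 0 := by
    rw [Measure.volume_eq_prod] at hAi ⊢
    rw [← setIntegral_prod_swap, setIntegral_prod (fun x => A x.swap) hAi.swap]
    have h1 : ∀ θ : ℝ, ∫ r in Set.Ioi (0 : ℝ), A (r, θ) = -g 0 := by
      intro θ
      have hd : ∀ r ∈ Set.Ici (0 : ℝ), HasDerivAt (fun r => g (p r θ)) (A (r, θ)) r := by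
        intro r _
        have := ((hg.differentiable one_ne_zero) (p r θ)).hasFDerivAt.comp_hasDerivAt r
          (hasDerivAt_polar_radius r θ)
        exact this
      have hi : IntegrableOn (fun r => A (r, θ)) (Set.Ioi 0) := by
        have h1 : IntegrableOn (fun r => A (r, θ)) (Set.Icc 0 B) :=
          (hAc.comp (by fun_prop)).continuousOn.integrableOn_compact isCompact_Icc
        have h2 : IntegrableOn (fun r => A (r, θ)) (Set.Ioi B) :=
          (integrableOn_zero (s := Set.Ioi B)).congr_fun
            (fun r hr => (hA0 r θ (le_of_lt hr)).symm) measurableSet_Ioi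
        refine (h1.union h2).mono_set fun r hr => ?_
        rcases le_or_gt r B with h | h
        · exact Or.inl ⟨le_of_lt hr, h⟩
        · exact Or.inr h
      have ht : Tendsto (fun r => g (p r θ)) atTop (𝓝 0) := by
        refine tendsto_const_nhds.congr' ?_
        filter_upwards [eventually_ge_atTop B] with r hr
        exact ((hB.2 _ (by rw [hnorm r θ (hB.1.le.trans hr)]; exact hr)).1).symm
      have := integral_Ioi_of_hasDerivAt_of_tendsto' hd hi ht
      rw [this]; simp [hp]
    simp only [Prod.swap_prod_mk, h1]
    rw [setIntegral_const, Real.volume_real_Ioo_of_le (by linarith [Real.pi_pos]),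
      Complex.real_smul]
    push_cast
    ring
  have hCint : ∫ x in Set.Ioi (0 : ℝ) ×ˢ Set.Ioo (-Real.pi) Real.pi, C x = 0 := by
    rw [Measure.volume_eq_prod] at hCi ⊢
    rw [setIntegral_prod _ hCi]
    rw [setIntegral_congr_fun (g := fun _ => (0 : ℂ)) measurableSet_Ioi, integral_zero]
    intro r hr
    have hr0 : (r : ℂ) ≠ 0 := by simpa using (ne_of_gt hr)
    have hd : ∀ θ ∈ Set.uIcc (-Real.pi) Real.pi,
        HasDerivAt (fun θ => (r : ℂ)⁻¹ * g (p r θ)) (C (r, θ)) θ := by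
      intro θ _
      have := (((hg.differentiable one_ne_zero) (p r θ)).hasFDerivAt.comp_hasDerivAt θ
          (hasDerivAt_polar_angle r θ)).const_mul (r : ℂ)⁻¹
      convert! this using 1
      simp only [hC]
      have hs : ∀ v : ℂ, fderiv ℝ g (p r θ) (r * v) = r * fderiv ℝ g (p r θ) v := fun v => by
        rw [← Complex.real_smul, map_smul, Complex.real_smul]
      rw [hs]
      field_simp
    have hi : IntervalIntegrable (fun θ => C (r, θ)) volume (-Real.pi) Real.pi :=
      (hCc.comp (by fun_prop)).intervalIntegrable _ _
    have := intervalIntegral.integral_eq_sub_of_hasDerivAt hd hi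
    rw [intervalIntegral.integral_of_le (by linarith [Real.pi_pos]),
      integral_Ioc_eq_integral_Ioo] at this
    simp only
    rw [this]
    simp [hp, Complex.exp_neg, Complex.exp_pi_mul_I]
  rw [← Complex.integral_comp_polarCoord_symm]
  have hfun : ∀ x ∈ Set.Ioi (0 : ℝ) ×ˢ Set.Ioo (-Real.pi) Real.pi,
      x.1 • ((Complex.polarCoord.symm x)⁻¹ * dwbar g (Complex.polarCoord.symm x)) =
      (1 / 2 : ℂ) * A x + (Complex.I / 2) * C x := by
    rintro ⟨r, θ⟩ ⟨hr, hθ⟩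
    have hr0 : (r : ℂ) ≠ 0 := by simpa using (ne_of_gt hr)
    have hpp : Complex.polarCoord.symm (r, θ) = p r θ := by
      rw [Complex.polarCoord_symm_apply]
      simp only [hp, Complex.exp_mul_I, Complex.ofReal_cos, Complex.ofReal_sin]
    simp only [hpp, hA, hC]
    have hw := HasWirtinger.of_differentiableAt ((hg.differentiable one_ne_zero) (p r θ))
    rw [HasWirtinger] at hw
    rw [hw.fderiv]
    simp only [wirtingerCLM_apply, map_mul, Complex.conj_I]
    have he : (starRingEnd ℂ) (Complex.exp (θ * Complex.I)) = (Complex.exp (θ * Complex.I))⁻¹ := by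
      rw [← Complex.exp_conj, ← Complex.exp_neg]; simp
    rw [he, Complex.real_smul]
    simp only [hp]
    have hen : Complex.exp (θ * Complex.I) ≠ 0 := Complex.exp_ne_zero _
    field_simp
    ring_nf
    simp only [Complex.I_sq]
    ring
  rw [polarCoord_target, setIntegral_congr_fun (measurableSet_Ioi.prod measurableSet_Ioo) hfun,
    integral_add (hAi.const_mul _) (hCi.const_mul _), integral_const_mul, integral_const_mul,
    hAint, hCint]
  ring

-- The solution is the convolution with 1/(πζ). The derivative falls on f, and the reflection ζ ↦ w
-- - ζ reduces the claim to `integral_inv_mul_dwbar`; it produces a sign that cancels the one in -π.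
open scoped Convolution in
lemma exists_dwbar_eq_of_hasCompactSupport {f : ℂ → ℂ} (hf : ContDiff ℝ ∞ f)
    (hc : HasCompactSupport f) : ∃ u : ℂ → ℂ, ContDiff ℝ ∞ u ∧ ∀ w, dwbar u w = f w := by
  set k : ℂ → ℂ := fun ζ => (Real.pi : ℂ)⁻¹ * ζ⁻¹ with hk
  have hki : LocallyIntegrable k := by
    have := (locallyIntegrable_inv).smul (Real.pi : ℂ)⁻¹
    exact this
  set M := ContinuousLinearMap.mul ℝ ℂ
  refine ⟨k ⋆[M, volume] f, hc.contDiff_convolution_right M hki hf, fun w => ?_⟩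
  have h1 := hc.hasFDerivAt_convolution_right M hki (hf.of_le (by norm_num)) w
  have hD : Continuous (fderiv ℝ f) := hf.continuous_fderiv (by norm_num)
  have hDc : HasCompactSupport (fderiv ℝ f) := hc.fderiv ℝ
  have hcv : ConvolutionExistsAt k (fderiv ℝ f) w (M.precompR ℂ) volume :=
    hDc.convolutionExists_right (M.precompR ℂ) hki hD w
  have happ : ∀ v : ℂ, ((k ⋆[M.precompR ℂ, volume] fderiv ℝ f) w) v =
      ∫ ζ, k ζ * fderiv ℝ f (w - ζ) v := by
    intro v
    rw [convolution_def, ContinuousLinearMap.integral_apply hcv.integrable]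
    rfl
  have hint : ∀ v : ℂ, Integrable fun ζ => k ζ * fderiv ℝ f (w - ζ) v := fun v =>
    (hcv.integrable.apply_continuousLinearMap v)
  rw [dwbar, h1.fderiv, happ, happ, ← integral_const_mul, ← integral_add (hint _)
    ((hint _).const_mul _), ← integral_const_mul]
  set g : ℂ → ℂ := fun ζ => f (w - ζ) with hg
  have hgd : ContDiff ℝ 1 g := (hf.of_le (by norm_num)).comp (by fun_prop)
  have hgc : HasCompactSupport g := hc.comp_homeomorph (Homeomorph.subLeft w)
  have hgw : ∀ ζ, dwbar g ζ = -dwbar f (w - ζ) := by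
    intro ζ
    have hfd := HasWirtinger.of_differentiableAt ((hf.differentiable (by norm_num)) (w - ζ))
    have := hfd.comp_hol (φ := fun ζ => w - ζ) ((hasDerivAt_id ζ).const_sub w)
    simpa using this.dwbar_eq
  have hfin := integral_inv_mul_dwbar hgd hgc
  have hpi : (Real.pi : ℂ) ≠ 0 := by exact_mod_cast Real.pi_ne_zero
  have : ∀ ζ, 1 / 2 * (k ζ * fderiv ℝ f (w - ζ) 1 +
      Complex.I * (k ζ * fderiv ℝ f (w - ζ) Complex.I)) =
      -(Real.pi : ℂ)⁻¹ * (ζ⁻¹ * dwbar g ζ) := by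
    intro ζ
    rw [hgw, dwbar]
    simp only [hk]
    ring
  simp only [this]
  rw [integral_const_mul, hfin]
  simp only [hg, sub_zero]
  field_simp

/-- The `∂̄`-equation with smooth right-hand side is solvable on smaller disks. -/
theorem exists_dwbar_eq {f : ℂ → ℂ} {R ρ : ℝ} (hρ : 0 < ρ) (hρR : ρ < R)
    (hf : ContDiffOn ℝ ∞ f (Metric.ball 0 R)) :
    ∃ u : ℂ → ℂ, ContDiff ℝ ∞ u ∧ ∀ w ∈ Metric.ball (0 : ℂ) ρ, dwbar u w = f w := by
  obtain ⟨σ, hσ1, hσ2⟩ := exists_between hρR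
  -- The cutoff is one on the small disk and is supported strictly inside the disk of radius R, so
  -- its product with f extends by zero to a smooth function on the plane.
  let η : ContDiffBump (0 : ℂ) := ⟨ρ, σ, hρ, hσ1⟩
  set F : ℂ → ℂ := fun w => ((η w : ℝ) : ℂ) * f w with hF
  have hsupp : tsupport F ⊆ Metric.closedBall 0 σ := by
    have : Function.support F ⊆ Metric.ball 0 σ := by
      intro w hw
      have h1 : η w ≠ 0 := fun h => hw (by simp [hF, h])
      rw [← η.support_eq]
      exact h1
    exact (closure_mono this).trans Metric.closure_ball_subset_closedBall
  have hFs : ContDiff ℝ ∞ F := by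
    refine contDiff_iff_contDiffAt.2 fun w => ?_
    by_cases hw : w ∈ Metric.ball (0 : ℂ) R
    · have h1 : ContDiffAt ℝ ∞ f w := hf.contDiffAt (Metric.isOpen_ball.mem_nhds hw)
      exact (Complex.ofRealCLM.contDiff.contDiffAt.comp w η.contDiffAt).mul h1
    · have h1 : w ∉ tsupport F := fun h => hw (by
        have := hsupp h
        simp only [Metric.mem_closedBall, Metric.mem_ball] at this ⊢
        linarith)
      exact contDiffAt_const.congr_of_eventuallyEq
        (notMem_tsupport_iff_eventuallyEq.1 h1)
  have hFc : HasCompactSupport F :=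
    (isCompact_closedBall (0 : ℂ) σ).of_isClosed_subset (isClosed_tsupport F) hsupp
  obtain ⟨u, hu, hu2⟩ := exists_dwbar_eq_of_hasCompactSupport hFs hFc
  refine ⟨u, hu, fun w hw => ?_⟩
  rw [hu2 w]
  have : η w = 1 := η.one_of_mem_closedBall (Metric.ball_subset_closedBall hw)
  simp [hF, this]

/-! ### Commutators, adjoints and block diagonal matrices -/

section General

variable {ι : Type*} [Fintype ι]

lemma comm_apply (A B : Matrix ι ι ℂ) (a b : ι) :
    comm A B a b = ∑ c, (A a c * B c b - B a c * A c b) := by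
  simp [comm, Matrix.mul_apply]

lemma comm_add (A B C : Matrix ι ι ℂ) : comm A (B + C) = comm A B + comm A C := by
  simp only [comm]; noncomm_ring

lemma comm_sub (A B C : Matrix ι ι ℂ) : comm A (B - C) = comm A B - comm A C := by
  simp only [comm]; noncomm_ring

lemma comm_neg (A B : Matrix ι ι ℂ) : comm A (-B) = -comm A B := by
  simp only [comm]; noncomm_ring

lemma comm_swap (A B : Matrix ι ι ℂ) : comm A B = -comm B A := by
  simp only [comm]; noncomm_ring

lemma comm_zero (A : Matrix ι ι ℂ) : comm A 0 = 0 := by simp [comm]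

lemma HasWirtinger.sum {κ : Type*} {s : Finset κ} {f : κ → ℂ → ℂ} {a b : κ → ℂ} {w : ℂ}
    (h : ∀ i ∈ s, HasWirtinger (f i) (a i) (b i) w) :
    HasWirtinger (fun x => ∑ i ∈ s, f i x) (∑ i ∈ s, a i) (∑ i ∈ s, b i) w := by
  classical
  induction s using Finset.induction_on with
  | empty => simpa using HasWirtinger.const 0
  | insert i s hi ih =>
    simp only [Finset.sum_insert hi]
    exact (h i (by simp)).add (ih fun k hk => h k (by simp [hk]))

/-- `∂̄[Φ, γ] = [Φ, ∂̄γ]` for holomorphic `Φ`. -/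
lemma dbarMat_comm {Φ γ : ℂ → Matrix ι ι ℂ} {w : ℂ}
    (hΦ : ∀ a b, DifferentiableAt ℂ (fun x => Φ x a b) w)
    (hγ : ∀ a b, DifferentiableAt ℝ (fun x => γ x a b) w) :
    dbarMat (fun x => comm (Φ x) (γ x)) w = comm (Φ w) (dbarMat γ w) := by
  ext a b
  simp only [dbarMat, Matrix.of_apply, comm_apply]
  have h : ∀ c ∈ Finset.univ, HasWirtinger (fun x => Φ x a c * γ x c b - γ x a c * Φ x c b)
      (dw (fun x => Φ x a c * γ x c b - γ x a c * Φ x c b) w) (Φ w a c * dwbar (fun x => γ x c b) w - dwbar (fun x => γ x a c) w * Φ w c b) w := by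
    intro c _
    have h1 := HasWirtinger.of_hasDerivAt (hΦ a c).hasDerivAt
    have h2 := HasWirtinger.of_hasDerivAt (hΦ c b).hasDerivAt
    have h3 := HasWirtinger.of_differentiableAt (hγ c b)
    have h4 := HasWirtinger.of_differentiableAt (hγ a c)
    have h5 := (h1.mul h3).sub (h4.mul h2)
    exact h5.of_eq h5.dw_eq.symm (by ring)
  exact (HasWirtinger.sum h).dwbar_eq

lemma HolMatOn.comm {A B : ℂ → Matrix ι ι ℂ} {S : Set ℂ} (hA : HolMatOn A S)
    (hB : HolMatOn B S) : HolMatOn (fun w => comm (A w) (B w)) S := by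
  intro a b
  simp only [comm_apply]
  exact DifferentiableOn.fun_sum fun c _ => ((hA a c).mul (hB c b)).sub ((hB a c).mul (hA c b))

lemma HolMatOn.smoothMatOn {ι : Type*} {A : ℂ → Matrix ι ι ℂ} {S : Set ℂ} (hS : IsOpen S)
    (hA : HolMatOn A S) : SmoothMatOn A S := fun a b =>
  ((hA a b).contDiffOn hS).restrict_scalars ℝ

lemma SmoothMatOn.comm {A B : ℂ → Matrix ι ι ℂ} {S : Set ℂ} (hA : SmoothMatOn A S)
    (hB : SmoothMatOn B S) : SmoothMatOn (fun w => comm (A w) (B w)) S := by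
  intro a b
  simp only [comm_apply]
  exact ContDiffOn.sum fun c _ => ((hA a c).mul (hB c b)).sub ((hB a c).mul (hA c b))

lemma SmoothMatOn.differentiableAt {ι : Type*} {A : ℂ → Matrix ι ι ℂ} {S : Set ℂ} (hS : IsOpen S)
    (hA : SmoothMatOn A S) {w : ℂ} (hw : w ∈ S) (a b : ι) :
    DifferentiableAt ℝ (fun x => A x a b) w :=
  ((hA a b).contDiffAt (hS.mem_nhds hw)).differentiableAt (by norm_num)

variable [DecidableEq ι]

lemma inv_diagonal_of_ne_zero {D : ι → ℂ} (hD : ∀ a, D a ≠ 0) :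
    (Matrix.diagonal D)⁻¹ = Matrix.diagonal fun a => (D a)⁻¹ := by
  refine Matrix.inv_eq_left_inv ?_
  rw [Matrix.diagonal_mul_diagonal]
  simp [hD]

lemma adj_diagonal_apply {D : ι → ℂ} (hD : ∀ a, D a ≠ 0) (B : Matrix ι ι ℂ) (a b : ι) :
    adj (Matrix.diagonal D) B a b = (D a)⁻¹ * (starRingEnd ℂ) (B b a) * D b := by
  rw [adj, inv_diagonal_of_ne_zero hD, Matrix.mul_diagonal, Matrix.diagonal_mul]
  rfl

/-- For a positive diagonal metric and a normal endomorphism `Φ`, an endomorphism of the form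
`[μ, Φ]` that commutes with the adjoint of `Φ` vanishes. -/
lemma comm_eq_zero_of_comm_adj {D : ι → ℝ} (hD : ∀ a, 0 < D a) {Φ μ : Matrix ι ι ℂ}
    (h : comm (adj (Matrix.diagonal fun a => (D a : ℂ)) Φ) (comm μ Φ) = 0) : comm μ Φ = 0 := by
  set H : Matrix ι ι ℂ := Matrix.diagonal fun a => (D a : ℂ)
  have hD' : ∀ a, (D a : ℂ) ≠ 0 := fun a => by exact_mod_cast (hD a).ne'
  have hHi : H⁻¹ * H = 1 := by
    rw [inv_diagonal_of_ne_zero hD', Matrix.diagonal_mul_diagonal]; simp [hD']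
  have hHi' : H * H⁻¹ = 1 := by
    rw [inv_diagonal_of_ne_zero hD', Matrix.diagonal_mul_diagonal]; simp [hD']
  set B := comm μ Φ with hB
  set Ψ := adj H Φ with hΨ
  -- For B = [μ, Φ] the adjoint is [Φ^†, μ^†]. Then tr(B B^†) = tr([B, Φ^†] μ^†) plus the trace of a
  -- commutator, and both vanish. As tr(B B^†) is a positive combination of the squared entries, B =
  -- 0.
  have hadj : adj H B = comm Ψ (adj H μ) := by
    simp only [hB, hΨ, comm, adj, Matrix.conjTranspose_sub, Matrix.conjTranspose_mul]
    calc H⁻¹ * (Φᴴ * μᴴ - μᴴ * Φᴴ) * H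
        = H⁻¹ * Φᴴ * (1) * μᴴ * H - H⁻¹ * μᴴ * (1) * Φᴴ * H := by
          simp only [mul_one]; noncomm_ring
      _ = _ := by rw [← hHi']; noncomm_ring
  have htr : (B * adj H B).trace = 0 := by
    rw [hadj]
    have h1 : B * comm Ψ (adj H μ) = comm B Ψ * adj H μ + comm Ψ (B * adj H μ) := by
      simp only [comm]; noncomm_ring
    rw [h1, comm_swap B Ψ, h, neg_zero, zero_mul, zero_add, comm, Matrix.trace_sub,
      Matrix.trace_mul_comm, sub_self]
  have hsum : (B * adj H B).trace =
      ((∑ a, ∑ b, (D a * (D b)⁻¹) * ‖B a b‖ ^ 2 : ℝ) : ℂ) := by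
    simp only [Matrix.trace, Matrix.diag_apply, Matrix.mul_apply]
    push_cast
    refine Finset.sum_congr rfl fun a _ => Finset.sum_congr rfl fun b _ => ?_
    rw [adj_diagonal_apply hD']
    rw [← Complex.ofReal_pow, ← Complex.normSq_eq_norm_sq, ← Complex.mul_conj]
    ring
  rw [hsum] at htr
  have htr' : (∑ a, ∑ b, (D a * (D b)⁻¹) * ‖B a b‖ ^ 2 : ℝ) = 0 := by exact_mod_cast htr
  have hnn : ∀ a b, 0 ≤ (D a * (D b)⁻¹) * ‖B a b‖ ^ 2 := fun a b => by
    have := hD a; have := hD b; positivity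
  ext a b
  have h1 := (Finset.sum_eq_zero_iff_of_nonneg (fun a _ =>
    Finset.sum_nonneg fun b _ => hnn a b)).1 htr' a (Finset.mem_univ _)
  have h2 := (Finset.sum_eq_zero_iff_of_nonneg (fun b _ => hnn a b)).1 h1 b (Finset.mem_univ _)
  have h3 : D a * (D b)⁻¹ ≠ 0 := by
    have := hD a; have := hD b; positivity
  have h4 := (mul_eq_zero.1 h2).resolve_left h3
  simpa using h4

end General

section Blocks

variable {ℓ m : ℕ}

@[simp] lemma blockMat_inl_inl (A : Fin ℓ → Matrix (Fin 2) (Fin 2) ℂ) (c : Fin m → ℂ)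
    (x y : Fin 2 × Fin ℓ) :
    blockMat A c (Sum.inl x) (Sum.inl y) = if x.2 = y.2 then A x.2 x.1 y.1 else 0 := by
  simp [blockMat, Matrix.blockDiagonal_apply]

@[simp] lemma blockMat_inl_inr (A : Fin ℓ → Matrix (Fin 2) (Fin 2) ℂ) (c : Fin m → ℂ)
    (x : Fin 2 × Fin ℓ) (k : Fin m) : blockMat A c (Sum.inl x) (Sum.inr k) = 0 := by
  simp [blockMat]

@[simp] lemma blockMat_inr_inl (A : Fin ℓ → Matrix (Fin 2) (Fin 2) ℂ) (c : Fin m → ℂ)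
    (x : Fin 2 × Fin ℓ) (k : Fin m) : blockMat A c (Sum.inr k) (Sum.inl x) = 0 := by
  simp [blockMat]

@[simp] lemma blockMat_inr_inr (A : Fin ℓ → Matrix (Fin 2) (Fin 2) ℂ) (c : Fin m → ℂ)
    (k k' : Fin m) : blockMat A c (Sum.inr k) (Sum.inr k') = if k = k' then c k else 0 := by
  simp [blockMat, Matrix.diagonal_apply]

lemma blockMat_mul (A A' : Fin ℓ → Matrix (Fin 2) (Fin 2) ℂ) (c c' : Fin m → ℂ) :
    blockMat A c * blockMat A' c' = blockMat (fun j => A j * A' j) (fun k => c k * c' k) := by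
  simp only [blockMat, Matrix.fromBlocks_multiply, Matrix.mul_zero, add_zero, Matrix.zero_mul,
    zero_add, Matrix.diagonal_mul_diagonal, ← Matrix.blockDiagonal_mul]

lemma blockMat_sub (A A' : Fin ℓ → Matrix (Fin 2) (Fin 2) ℂ) (c c' : Fin m → ℂ) :
    blockMat A c - blockMat A' c' = blockMat (fun j => A j - A' j) (fun k => c k - c' k) := by
  ext a b
  rcases a with x | k <;> rcases b with y | k' <;> simp [Matrix.sub_apply]
  · split_ifs <;> simp
  · split_ifs <;> simp

lemma blockMat_add (A A' : Fin ℓ → Matrix (Fin 2) (Fin 2) ℂ) (c c' : Fin m → ℂ) :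
    blockMat A c + blockMat A' c' = blockMat (fun j => A j + A' j) (fun k => c k + c' k) := by
  ext a b
  rcases a with x | k <;> rcases b with y | k' <;> simp [Matrix.add_apply]
  · split_ifs <;> simp
  · split_ifs <;> simp

lemma blockMat_zero : blockMat (fun _ : Fin ℓ => 0) (fun _ : Fin m => (0 : ℂ)) = 0 := by
  ext a b
  rcases a with x | k <;> rcases b with y | k' <;> simp

lemma comm_blockMat (A A' : Fin ℓ → Matrix (Fin 2) (Fin 2) ℂ) (c c' : Fin m → ℂ) :
    comm (blockMat A c) (blockMat A' c') = blockMat (fun j => comm (A j) (A' j)) (fun _ => 0) := by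
  simp only [comm, blockMat_mul, blockMat_sub]
  congr 1
  ext k; ring

/-- The diagonal of a metric with `2 × 2` blocks `diag(x j, y j)`, completed by ones. -/
def metricDiag (x y : Fin ℓ → ℝ) : BlockIdx ℓ m → ℝ :=
  Sum.elim (fun p => if p.1 = 0 then x p.2 else y p.2) (fun _ => 1)

lemma metricDiag_pos {x y : Fin ℓ → ℝ} (hx : ∀ j, 0 < x j) (hy : ∀ j, 0 < y j)
    (a : BlockIdx ℓ m) : 0 < metricDiag x y a := by
  rcases a with ⟨i, j⟩ | k
  · fin_cases i
    · simpa [metricDiag] using hx j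
    · simpa [metricDiag] using hy j
  · simp [metricDiag]

lemma blockMat_diag (x y : Fin ℓ → ℝ) :
    blockMat (fun j => !![(x j : ℂ), 0; 0, (y j : ℂ)]) (fun _ : Fin m => 1) =
      Matrix.diagonal fun a => ((metricDiag x y a : ℝ) : ℂ) := by
  ext a b
  rcases a with ⟨i, j⟩ | k <;> rcases b with ⟨i', j'⟩ | k'
  · by_cases hj : j = j'
    · subst hj
      fin_cases i <;> fin_cases i' <;> simp [metricDiag]
    · simp [hj]
  · simp
  · simp
  · by_cases hk : k = k' <;> simp [hk, metricDiag]

/-- The adjoint of a block diagonal endomorphism for a diagonal metric. -/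
lemma adj_diag_blockMat {x y : Fin ℓ → ℝ} (hx : ∀ j, 0 < x j) (hy : ∀ j, 0 < y j)
    (A : Fin ℓ → Matrix (Fin 2) (Fin 2) ℂ) (c : Fin m → ℂ) :
    adj (Matrix.diagonal fun a => ((metricDiag x y a : ℝ) : ℂ)) (blockMat A c) =
      blockMat (fun j => !![(starRingEnd ℂ) (A j 0 0), (y j / x j : ℝ) * (starRingEnd ℂ) (A j 1 0);
        (x j / y j : ℝ) * (starRingEnd ℂ) (A j 0 1), (starRingEnd ℂ) (A j 1 1)])
        (fun k => (starRingEnd ℂ) (c k)) := by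
  have hD : ∀ a : BlockIdx ℓ m, ((metricDiag x y a : ℝ) : ℂ) ≠ 0 := fun a => by
    exact_mod_cast (metricDiag_pos hx hy a).ne'
  ext a b
  rw [adj_diagonal_apply hD]
  rcases a with ⟨i, j⟩ | k <;> rcases b with ⟨i', j'⟩ | k'
  · by_cases hj : j = j'
    · subst hj
      have h1 : ((x j : ℝ) : ℂ) ≠ 0 := by exact_mod_cast (hx j).ne'
      have h2 : ((y j : ℝ) : ℂ) ≠ 0 := by exact_mod_cast (hy j).ne'
      fin_cases i <;> fin_cases i' <;> simp [metricDiag] <;> field_simp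
    · simp [hj, Ne.symm hj]
  · simp
  · simp
  · by_cases hk : k = k'
    · subst hk; simp [metricDiag]
    · simp [hk, Ne.symm hk]

end Blocks

/-! ### Block Sylvester equations -/

section Sylvester

variable {ι κ : Type*} [Fintype ι] (β : ι → κ)

/-- Multiplication of the entries of a matrix by a function of the blocks. -/
def blockScale (g : κ → κ → ℂ) (X : Matrix ι ι ℂ) : Matrix ι ι ℂ :=
  Matrix.of fun a b => g (β a) (β b) * X a b

@[simp] lemma blockScale_apply (g : κ → κ → ℂ) (X : Matrix ι ι ℂ) (a b : ι) :
    blockScale β g X a b = g (β a) (β b) * X a b := rfl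

/-- A block diagonal N acts on each block of X separately, so scalars depending only on the block
pass through. -/
lemma comm_blockScale {N : Matrix ι ι ℂ} (hN : ∀ a b, β a ≠ β b → N a b = 0)
    (g : κ → κ → ℂ) (X : Matrix ι ι ℂ) :
    comm N (blockScale β g X) = blockScale β g (comm N X) := by
  ext a b
  simp only [comm_apply, blockScale_apply, Finset.mul_sum]
  refine Finset.sum_congr rfl fun c _ => ?_
  have h1 : N a c * (g (β c) (β b) * X c b) = g (β a) (β b) * (N a c * X c b) := by
    by_cases h : β a = β c
    · rw [h]; ring
    · rw [hN a c h]; ring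
  have h2 : g (β a) (β c) * X a c * N c b = g (β a) (β b) * (X a c * N c b) := by
    by_cases h : β c = β b
    · rw [h]; ring
    · rw [hN c b h]; ring
  rw [h1, h2]; ring

variable [DecidableEq ι]

/-- On the block (x, y), left and right multiplication by N commute and have squares α_x and α_y.
Their difference T = ad N is therefore a root of T⁴ - 2(α_x + α_y)T² + (α_x - α_y)². -/
lemma comm_four {N : Matrix ι ι ℂ} {α : κ → ℂ} (hNN : N * N = Matrix.diagonal fun a => α (β a))
    (X : Matrix ι ι ℂ) (a b : ι) :
    comm N (comm N (comm N (comm N X))) a b =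
      2 * (α (β a) + α (β b)) * comm N (comm N X) a b - (α (β a) - α (β b)) ^ 2 * X a b := by
  set D : Matrix ι ι ℂ := Matrix.diagonal fun a => α (β a)
  have h2 : ∀ Y : Matrix ι ι ℂ, comm N (comm N Y) = D * Y + Y * D - N * Y * N - N * Y * N := by
    intro Y
    rw [← hNN]; simp only [comm]; noncomm_ring
  have hND : N * D = D * N := by rw [← hNN]; noncomm_ring
  have hS : N * (N * X * N) * N = D * X * D := by rw [← hNN]; noncomm_ring
  have e : ∀ Y : Matrix ι ι ℂ, (D * Y) a b = α (β a) * Y a b ∧ (Y * D) a b = Y a b * α (β b) :=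
    fun Y => ⟨by simp [D, Matrix.diagonal_mul], by simp [D, Matrix.mul_diagonal]⟩
  have h3 : N * (D * X + X * D - N * X * N - N * X * N) * N =
      D * (N * X * N) + (N * X * N) * D - D * X * D - D * X * D := by
    have h4 : (N * D) * X * N = D * (N * X * N) := by rw [hND]; noncomm_ring
    have h5 : N * X * (D * N) = (N * X * N) * D := by rw [← hND]; noncomm_ring
    rw [← h4, ← h5, ← hS]; noncomm_ring
  rw [h2 (comm N (comm N X)), h2 X, h3]
  simp only [Matrix.sub_apply, Matrix.add_apply, (e _).1, (e _).2]
  ring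

/-- The solution of the equation `[c + N, X] = C` between blocks, up to the factor `f`. -/
def sylvesterSol (c α : κ → ℂ) (N : Matrix ι ι ℂ) (f : κ → κ → ℂ) (C : Matrix ι ι ℂ) :
    Matrix ι ι ℂ :=
  blockScale β (fun x y => f x y *
      ((c x - c y) ^ 3 - 2 * (α x + α y) * (c x - c y))) C +
    blockScale β (fun x y => f x y * (2 * (α x + α y) - (c x - c y) ^ 2)) (comm N C) +
    blockScale β (fun x y => f x y * (c x - c y)) (comm N (comm N C)) +
    blockScale β (fun x y => -f x y) (comm N (comm N (comm N C)))

/-- With δ = c_x - c_y the operator is δ + T, where T = ad N has the annihilating quartic q of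
`comm_four`. Dividing q(-δ) - q(T) by δ + T gives the cubic in T used for the solution. The scalar
q(-δ) is the product of the four differences of c_x ± √α_x and c_y ± √α_y. -/
lemma comm_sylvesterSol (c α : κ → ℂ) {N : Matrix ι ι ℂ} (hN : ∀ a b, β a ≠ β b → N a b = 0)
    (hNN : N * N = Matrix.diagonal fun a => α (β a)) (f : κ → κ → ℂ) (C : Matrix ι ι ℂ)
    (a b : ι) :
    comm (Matrix.diagonal (fun a => c (β a)) + N) (sylvesterSol β c α N f C) a b =
      f (β a) (β b) * (((c (β a) - c (β b)) ^ 2 - (α (β a) + α (β b))) ^ 2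
        - 4 * α (β a) * α (β b)) * C a b := by
  set X := sylvesterSol β c α N f C with hX
  have h1 : comm (Matrix.diagonal (fun a => c (β a)) + N) X a b =
      (c (β a) - c (β b)) * X a b + comm N X a b := by
    have : comm (Matrix.diagonal (fun a => c (β a)) + N) X =
        Matrix.diagonal (fun a => c (β a)) * X - X * Matrix.diagonal (fun a => c (β a)) +
          comm N X := by simp only [comm]; noncomm_ring
    rw [this]
    simp only [Matrix.add_apply, Matrix.sub_apply, Matrix.diagonal_mul, Matrix.mul_diagonal]
    ring
  rw [h1, hX, sylvesterSol, comm_add, comm_add, comm_add, comm_blockScale β hN,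
    comm_blockScale β hN, comm_blockScale β hN, comm_blockScale β hN]
  simp only [Matrix.add_apply, blockScale_apply, comm_four β hNN]
  ring

end Sylvester

/-! ### The normal form of the Higgs field -/

namespace LocalModel

variable {ℓ m : ℕ} (M : LocalModel ℓ m)

/-- The block of an index. -/
def blockOf : BlockIdx ℓ m → Fin ℓ ⊕ Fin m := Sum.map Prod.snd id

/-- The centres of the eigenvalues of the blocks. -/
def center (w : ℂ) : Fin ℓ ⊕ Fin m → ℂ := Sum.elim (fun j => M.lamHat j w) (fun k => M.lam k w)

/-- The squares of the differences between eigenvalue and centre. -/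
def spread (w : ℂ) : Fin ℓ ⊕ Fin m → ℂ :=
  Sum.elim (fun j => M.z j w * deriv (M.z j) w ^ 2) (fun _ => 0)

/-- The block off-diagonal part of the Higgs field. -/
def offDiag (w : ℂ) : Matrix (BlockIdx ℓ m) (BlockIdx ℓ m) ℂ :=
  blockMat (fun j => !![0, M.z j w * deriv (M.z j) w; deriv (M.z j) w, 0]) (fun _ => 0)

lemma higgs_eq_add (w : ℂ) :
    M.higgs w = Matrix.diagonal (fun a => M.center w (blockOf a)) + M.offDiag w := by
  ext a b
  rcases a with ⟨i, j⟩ | k <;> rcases b with ⟨i', j'⟩ | k'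
  · by_cases hj : j = j'
    · subst hj
      fin_cases i <;> fin_cases i' <;> simp [higgs, offDiag, center, blockOf]
    · simp [hj, higgs, offDiag]
  · simp [higgs, offDiag]
  · simp [higgs, offDiag]
  · by_cases hk : k = k' <;> simp [hk, higgs, offDiag, center, blockOf]

lemma offDiag_apply_of_ne (w : ℂ) (a b : BlockIdx ℓ m) (h : blockOf a ≠ blockOf b) :
    M.offDiag w a b = 0 := by
  rcases a with ⟨i, j⟩ | k <;> rcases b with ⟨i', j'⟩ | k' <;> simp [offDiag, blockOf] at h ⊢
  intro h'; exact absurd h' h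

lemma offDiag_mul_offDiag (w : ℂ) :
    M.offDiag w * M.offDiag w = Matrix.diagonal fun a => M.spread w (blockOf a) := by
  rw [offDiag, blockMat_mul]
  ext a b
  rcases a with ⟨i, j⟩ | k <;> rcases b with ⟨i', j'⟩ | k'
  · by_cases hj : j = j'
    · subst hj
      fin_cases i <;> fin_cases i' <;>
        simp [spread, blockOf, Matrix.mul_apply, Fin.sum_univ_two] <;> ring
    · simp [hj]
  · simp
  · simp
  · by_cases hk : k = k' <;> simp [hk, spread, blockOf]

/-- The characteristic polynomial of a block. -/
def factor (w lam : ℂ) : Fin ℓ ⊕ Fin m → ℂ :=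
  Sum.elim (fun j => (lam - M.lamHat j w) ^ 2 - M.z j w * deriv (M.z j) w ^ 2)
    (fun k => lam - M.lam k w)

lemma det_sub_higgs (w lam : ℂ) :
    (Matrix.scalar (BlockIdx ℓ m) lam - M.higgs w).det = ∏ b, M.factor w lam b := by
  have : Matrix.scalar (BlockIdx ℓ m) lam - M.higgs w =
      blockMat (fun j => !![lam - M.lamHat j w, -(M.z j w * deriv (M.z j) w);
        -deriv (M.z j) w, lam - M.lamHat j w]) (fun k => lam - M.lam k w) := by
    ext a b
    rcases a with ⟨i, j⟩ | k <;> rcases b with ⟨i', j'⟩ | k'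
    · by_cases hj : j = j'
      · subst hj
        fin_cases i <;> fin_cases i' <;> simp [higgs]
      · simp [hj, higgs]
    · simp [higgs]
    · simp [higgs]
    · by_cases hk : k = k' <;> simp [hk, higgs]
  rw [this, blockMat, Matrix.det_fromBlocks_zero₂₁, Matrix.det_blockDiagonal, Matrix.det_diagonal,
    Fintype.prod_sum_type]
  congr 1
  refine Finset.prod_congr rfl fun j _ => ?_
  rw [Matrix.det_fin_two]
  simp [factor]; ring

end LocalModel

lemma charpoly_eval_conj {ι κ : Type*} [Fintype ι] [DecidableEq ι] [Fintype κ] [DecidableEq κ]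
    {A : Matrix ι ι ℂ} {B : Matrix κ κ ℂ} {g : Matrix ι κ ℂ} {ginv : Matrix κ ι ℂ}
    (h1 : g * ginv = 1) (h2 : ginv * g = 1) (hB : ginv * A * g = B) (lam : ℂ) :
    A.charpoly.eval lam = (Matrix.scalar κ lam - B).det := by
  rw [Matrix.eval_charpoly]
  have : Matrix.scalar κ lam - B = ginv * (Matrix.scalar ι lam - A) * g := by
    rw [Matrix.mul_sub, Matrix.sub_mul, hB, Matrix.scalar_apply, Matrix.scalar_apply,
      ← Matrix.smul_one_eq_diagonal, ← Matrix.smul_one_eq_diagonal, Matrix.mul_smul,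
      Matrix.smul_mul, Matrix.mul_one, h2]
  rw [this, Matrix.det_conj_of_mul_eq_one h2 h1]

/-- If at a common zero of the factors the derivative cannot see any of them, a product has
derivative zero. -/
lemma hasDerivAt_prod_zero {κ : Type*} [Fintype κ] [DecidableEq κ] {f : κ → ℂ → ℂ} {f' : κ → ℂ}
    {x : ℂ} (hf : ∀ i, HasDerivAt (f i) (f' i) x)
    (h : ∀ i, f' i = 0 ∨ ∃ k, k ≠ i ∧ f k x = 0) :
    HasDerivAt (fun y => ∏ i, f i y) 0 x := by
  have h1 := HasDerivAt.fun_finsetProd (u := Finset.univ) (fun i _ => hf i)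
  refine h1.congr_deriv ?_
  refine Finset.sum_eq_zero fun i _ => ?_
  rcases h i with h0 | ⟨k, hk, h0⟩
  · simp [h0]
  · rw [Finset.prod_eq_zero (Finset.mem_erase.2 ⟨hk, Finset.mem_univ k⟩) h0, zero_smul]

/-! ### Regularity of the spectral curve, read in an adapted frame -/

section Frame

variable {n ℓ m : ℕ} {U : Set ℂ} {Φ H : ℂ → Matrix (Fin n) (Fin n) ℂ} {R : ℝ}
  {M : LocalModel ℓ m} {g : ℂ → Matrix (Fin n) (BlockIdx ℓ m) ℂ}
  {ginv : ℂ → Matrix (BlockIdx ℓ m) (Fin n) ℂ}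

lemma IsAdaptedFrame.charpoly_eval (hF : IsAdaptedFrame U Φ H R M g ginv) {w : ℂ}
    (hw : w ∈ Metric.ball (0 : ℂ) R) (lam : ℂ) :
    (Φ w).charpoly.eval lam = ∏ b, M.factor w lam b := by
  rw [charpoly_eval_conj (hF.mul_inv w hw) (hF.inv_mul w hw) (hF.higgs_eq w hw),
    M.det_sub_higgs]

lemma IsAdaptedFrame.z_differentiableAt (hF : IsAdaptedFrame U Φ H R M g ginv) {w : ℂ}
    (hw : w ∈ Metric.ball (0 : ℂ) R) (j : Fin ℓ) : DifferentiableAt ℂ (M.z j) w :=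
  (hF.z_hol j).differentiableAt (Metric.isOpen_ball.mem_nhds hw)

lemma IsAdaptedFrame.deriv_z_hol (hF : IsAdaptedFrame U Φ H R M g ginv) (j : Fin ℓ) :
    DifferentiableOn ℂ (deriv (M.z j)) (Metric.ball 0 R) :=
  (hF.z_hol j).deriv Metric.isOpen_ball

lemma IsAdaptedFrame.z_ne_zero (hF : IsAdaptedFrame U Φ H R M g ginv) {w : ℂ}
    (hw : w ∈ Metric.ball (0 : ℂ) R) (h0 : w ≠ 0) (j : Fin ℓ) : M.z j w ≠ 0 := by
  intro h
  have hR : 0 < R := Metric.pos_of_mem_ball hw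
  exact h0 (hF.z_inj j hw (Metric.mem_ball_self hR) (h.trans (hF.z_zero j).symm))

/-- On a smooth spectral curve, the derivatives of the factors of the characteristic polynomial
cannot all be hidden. -/
lemma IsAdaptedFrame.factor_regular (hF : IsAdaptedFrame U Φ H R M g ginv)
    (hs : SpectralCurveSmooth U Φ) {w : ℂ} (hw : w ∈ Metric.ball (0 : ℂ) R) {lam : ℂ}
    {b : Fin ℓ ⊕ Fin m} (hb : M.factor w lam b = 0)
    (h : (∃ b', b' ≠ b ∧ M.factor w lam b' = 0) ∨
      (∃ j, b = Sum.inl j ∧ deriv (M.z j) w = 0)) : False := by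
  classical
  have hz := fun j => (hF.z_differentiableAt hw j).hasDerivAt
  have hz' := fun j => ((hF.deriv_z_hol j).differentiableAt
    (Metric.isOpen_ball.mem_nhds hw)).hasDerivAt
  have hlh := fun j => ((hF.lamHat_hol j).differentiableAt
    (Metric.isOpen_ball.mem_nhds hw)).hasDerivAt
  have hl := fun k => ((hF.lam_hol k).differentiableAt
    (Metric.isOpen_ball.mem_nhds hw)).hasDerivAt
  have hd1 : ∃ f' : Fin ℓ ⊕ Fin m → ℂ,
      (∀ i, HasDerivAt (fun x => M.factor x lam i) (f' i) w) ∧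
      (∀ j, M.factor w lam (Sum.inl j) = 0 → deriv (M.z j) w = 0 → f' (Sum.inl j) = 0) := by
    refine ⟨Sum.elim (fun j => 2 * (lam - M.lamHat j w) * -deriv (M.lamHat j) w -
        (deriv (M.z j) w * deriv (M.z j) w ^ 2 +
          M.z j w * (2 * deriv (M.z j) w * deriv (deriv (M.z j)) w)))
      (fun k => -deriv (M.lam k) w), ?_, ?_⟩
    · rintro (j | k)
      · refine ((((hlh j).const_sub lam).pow 2).sub ((hz j).mul ((hz' j).pow 2))).congr_deriv ?_
        simp
      · exact (hl k).const_sub lam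
    · intro j h1 h2
      simp only [LocalModel.factor, Sum.elim_inl, h2] at h1
      have h3 : lam - M.lamHat j w = 0 := by simpa using h1
      simp [h2, h3]
  have hd2 : ∃ f' : Fin ℓ ⊕ Fin m → ℂ,
      (∀ i, HasDerivAt (fun x => M.factor w x i) (f' i) lam) ∧
      (∀ j, M.factor w lam (Sum.inl j) = 0 → deriv (M.z j) w = 0 → f' (Sum.inl j) = 0) := by
    refine ⟨Sum.elim (fun j => 2 * (lam - M.lamHat j w)) (fun k => 1), ?_, ?_⟩
    · rintro (j | k)
      · refine ((((hasDerivAt_id lam).sub_const (M.lamHat j w)).pow 2).sub_const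
          (M.z j w * deriv (M.z j) w ^ 2)).congr_deriv ?_
        simp
      · exact (hasDerivAt_id lam).sub_const (M.lam k w)
    · intro j h1 h2
      simp only [LocalModel.factor, Sum.elim_inl, h2] at h1
      have h3 : lam - M.lamHat j w = 0 := by simpa using h1
      simp [h3]
  -- In the product rule for either partial derivative, every term not differentiating factor b
  -- contains that vanishing factor. The remaining term dies because a second factor vanishes, or
  -- because z_j' = 0 makes factor b equal to a square to first order.
  have hall : ∀ f' : Fin ℓ ⊕ Fin m → ℂ,
      (∀ j, M.factor w lam (Sum.inl j) = 0 → deriv (M.z j) w = 0 → f' (Sum.inl j) = 0) →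
      ∀ i, f' i = 0 ∨ ∃ k, k ≠ i ∧ M.factor w lam k = 0 := by
    intro f' hf' i
    by_cases hi : i = b
    · subst hi
      rcases h with ⟨b', h1, h2⟩ | ⟨j, rfl, h2⟩
      · exact Or.inr ⟨b', h1, h2⟩
      · exact Or.inl (hf' j hb h2)
    · exact Or.inr ⟨b, fun h => hi h.symm, hb⟩
  obtain ⟨f₁, h1, h1'⟩ := hd1
  obtain ⟨f₂, h2, h2'⟩ := hd2
  have e1 := hasDerivAt_prod_zero h1 (hall f₁ h1')
  have e2 := hasDerivAt_prod_zero h2 (hall f₂ h2')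
  have hzero : (Φ w).charpoly.eval lam = 0 := by
    rw [hF.charpoly_eval hw]
    exact Finset.prod_eq_zero (Finset.mem_univ b) hb
  rcases hs w (hF.subset hw) lam hzero with h3 | h3
  · apply h3
    rw [← Polynomial.deriv]
    have : (fun x => (Φ w).charpoly.eval x) = fun x => ∏ i, M.factor w x i :=
      funext fun x => hF.charpoly_eval hw x
    rw [this]
    exact e2.deriv
  · apply h3
    have : (fun x => (Φ x).charpoly.eval lam) =ᶠ[𝓝 w] fun x => ∏ i, M.factor x lam i := by
      filter_upwards [Metric.isOpen_ball.mem_nhds hw] with x hx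
      exact hF.charpoly_eval hx lam
    rw [this.deriv_eq]
    exact e1.deriv

/-- A zero of z_j' would make the point of the spectral curve with eigenvalue λ̂_j singular. -/
lemma IsAdaptedFrame.deriv_z_ne_zero (hF : IsAdaptedFrame U Φ H R M g ginv)
    (hs : SpectralCurveSmooth U Φ) {w : ℂ} (hw : w ∈ Metric.ball (0 : ℂ) R) (j : Fin ℓ) :
    deriv (M.z j) w ≠ 0 := by
  intro h
  refine hF.factor_regular hs hw (lam := M.lamHat j w) (b := Sum.inl j) ?_ (Or.inr ⟨j, rfl, h⟩)
  simp [LocalModel.factor, h]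

/-- The eigenvalues of different blocks are different. -/
lemma IsAdaptedFrame.resultant_ne_zero (hF : IsAdaptedFrame U Φ H R M g ginv)
    (hs : SpectralCurveSmooth U Φ) {w : ℂ} (hw : w ∈ Metric.ball (0 : ℂ) R)
    {b b' : Fin ℓ ⊕ Fin m} (hbb : b ≠ b') :
    ((M.center w b - M.center w b') ^ 2 - (M.spread w b + M.spread w b')) ^ 2
        - 4 * M.spread w b * M.spread w b' ≠ 0 := by
  intro h
  obtain ⟨x, hx⟩ := IsAlgClosed.exists_eq_mul_self (M.spread w b)
  obtain ⟨y, hy⟩ := IsAlgClosed.exists_eq_mul_self (M.spread w b')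
  have hfac : ∀ (b : Fin ℓ ⊕ Fin m) (x : ℂ), M.spread w b = x * x →
      M.factor w (M.center w b + x) b = 0 := by
    rintro (j | k) x hx
    · simp only [LocalModel.spread, LocalModel.factor, LocalModel.center, Sum.elim_inl] at hx ⊢
      rw [hx]; ring
    · simp only [LocalModel.spread, LocalModel.factor, LocalModel.center, Sum.elim_inr] at hx ⊢
      have : x = 0 := by simpa using hx.symm
      rw [this]; ring
  have hmain : ∀ x y : ℂ, M.spread w b = x * x → M.spread w b' = y * y →
      M.center w b + x = M.center w b' + y → False := by
    intro x y hx hy hxy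
    refine hF.factor_regular hs hw (hfac b x hx) (Or.inl ⟨b', hbb.symm, ?_⟩)
    rw [hxy]
    exact hfac b' y hy
  -- The expression is the product of the differences of the eigenvalues center ± √spread of the two
  -- blocks. A vanishing factor is a common eigenvalue, which smoothness excludes.
  have hp : (M.center w b - M.center w b' + x - y) * (M.center w b - M.center w b' + x + y) *
      ((M.center w b - M.center w b' - x - y) * (M.center w b - M.center w b' - x + y)) = 0 := by
    rw [hx, hy] at h
    linear_combination h
  have hx' : M.spread w b = (-x) * (-x) := by rw [hx]; ring
  have hy' : M.spread w b' = (-y) * (-y) := by rw [hy]; ring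
  rcases mul_eq_zero.1 hp with h1 | h1 <;> rcases mul_eq_zero.1 h1 with h2 | h2
  · exact hmain x y hx hy (by linear_combination h2)
  · exact hmain x (-y) hx hy' (by linear_combination h2)
  · exact hmain (-x) y hx' hy (by linear_combination h2)
  · exact hmain (-x) (-y) hx' hy' (by linear_combination h2)

end Frame

section DiagBlock

variable {ℓ m : ℕ}

/-- The `2 × 2` diagonal block `j` of an endomorphism. -/
def diagBlock (X : Matrix (BlockIdx ℓ m) (BlockIdx ℓ m) ℂ) (j : Fin ℓ) :
    Matrix (Fin 2) (Fin 2) ℂ :=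
  Matrix.of fun i i' => X (Sum.inl (i, j)) (Sum.inl (i', j))

lemma blockMat_mul_apply_inl (A : Fin ℓ → Matrix (Fin 2) (Fin 2) ℂ) (c : Fin m → ℂ)
    (X : Matrix (BlockIdx ℓ m) (BlockIdx ℓ m) ℂ) (i : Fin 2) (j : Fin ℓ) (b : BlockIdx ℓ m) :
    (blockMat A c * X) (Sum.inl (i, j)) b = ∑ i', A j i i' * X (Sum.inl (i', j)) b := by
  simp [Matrix.mul_apply, Fintype.sum_sum_type, Fintype.sum_prod_type]

lemma mul_blockMat_apply_inl (A : Fin ℓ → Matrix (Fin 2) (Fin 2) ℂ) (c : Fin m → ℂ)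
    (X : Matrix (BlockIdx ℓ m) (BlockIdx ℓ m) ℂ) (i : Fin 2) (j : Fin ℓ) (a : BlockIdx ℓ m) :
    (X * blockMat A c) a (Sum.inl (i, j)) = ∑ i', X a (Sum.inl (i', j)) * A j i' i := by
  simp [Matrix.mul_apply, Fintype.sum_sum_type, Fintype.sum_prod_type]

lemma diagBlock_comm_blockMat (A : Fin ℓ → Matrix (Fin 2) (Fin 2) ℂ) (c : Fin m → ℂ)
    (X : Matrix (BlockIdx ℓ m) (BlockIdx ℓ m) ℂ) (j : Fin ℓ) :
    diagBlock (comm (blockMat A c) X) j = comm (A j) (diagBlock X j) := by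
  ext i i'
  simp only [diagBlock, Matrix.of_apply, comm, Matrix.sub_apply, blockMat_mul_apply_inl,
    mul_blockMat_apply_inl]
  simp [Matrix.mul_apply]

lemma comm_blockMat_apply_inr (A : Fin ℓ → Matrix (Fin 2) (Fin 2) ℂ) (c : Fin m → ℂ)
    (X : Matrix (BlockIdx ℓ m) (BlockIdx ℓ m) ℂ) (k : Fin m) :
    comm (blockMat A c) X (Sum.inr k) (Sum.inr k) = 0 := by
  simp [comm, Matrix.mul_apply, Fintype.sum_sum_type, Fintype.sum_prod_type, mul_comm]

lemma diagBlock_blockMat (A : Fin ℓ → Matrix (Fin 2) (Fin 2) ℂ) (c : Fin m → ℂ) (j : Fin ℓ) :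
    diagBlock (blockMat A c) j = A j := by
  ext i i'; simp [diagBlock]

lemma diagBlock_sub (X Y : Matrix (BlockIdx ℓ m) (BlockIdx ℓ m) ℂ) (j : Fin ℓ) :
    diagBlock (X - Y) j = diagBlock X j - diagBlock Y j := rfl

lemma HolMatOn.blockMat {A : Fin ℓ → ℂ → Matrix (Fin 2) (Fin 2) ℂ} {c : Fin m → ℂ → ℂ}
    {S : Set ℂ} (hA : ∀ j, HolMatOn (A j) S) (hc : ∀ k, DifferentiableOn ℂ (c k) S) :
    HolMatOn (fun w => blockMat (fun j => A j w) (fun k => c k w)) S := by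
  rintro (⟨i, j⟩ | k) (⟨i', j'⟩ | k')
  · by_cases hj : j = j'
    · simpa [hj] using hA j' i i'
    · simpa [hj] using differentiableOn_const (0 : ℂ)
  · simpa using differentiableOn_const (0 : ℂ)
  · simpa using differentiableOn_const (0 : ℂ)
  · by_cases hk : k = k'
    · simpa [hk] using hc k'
    · simpa [hk] using differentiableOn_const (0 : ℂ)

lemma holMatOn_fin_two {a b c d : ℂ → ℂ} {S : Set ℂ} (ha : DifferentiableOn ℂ a S)
    (hb : DifferentiableOn ℂ b S) (hc : DifferentiableOn ℂ c S) (hd : DifferentiableOn ℂ d S) :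
    HolMatOn (fun w => !![a w, b w; c w, d w]) S := by
  intro i i'
  fin_cases i <;> fin_cases i' <;> simpa

lemma HolMatOn.add {ι κ : Type*} {A B : ℂ → Matrix ι κ ℂ} {S : Set ℂ} (hA : HolMatOn A S)
    (hB : HolMatOn B S) : HolMatOn (fun w => A w + B w) S :=
  fun a b => (hA a b).add (hB a b)

lemma HolMatOn.sub {ι κ : Type*} {A B : ℂ → Matrix ι κ ℂ} {S : Set ℂ} (hA : HolMatOn A S)
    (hB : HolMatOn B S) : HolMatOn (fun w => A w - B w) S :=
  fun a b => (hA a b).sub (hB a b)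

lemma HolMatOn.mono {ι κ : Type*} {A : ℂ → Matrix ι κ ℂ} {S T : Set ℂ} (hA : HolMatOn A S)
    (h : T ⊆ S) : HolMatOn A T := fun a b => (hA a b).mono h

lemma HolMatOn.blockScale {ι κ : Type*} [Fintype ι] {β : ι → κ} {g : ℂ → κ → κ → ℂ}
    {X : ℂ → Matrix ι ι ℂ} {S : Set ℂ} (hg : ∀ x y, DifferentiableOn ℂ (fun w => g w x y) S)
    (hX : HolMatOn X S) : HolMatOn (fun w => blockScale β (g w) (X w)) S :=
  fun a b => (hg (β a) (β b)).mul (hX a b)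

end DiagBlock

/-! ### Normal form of a deformation: existence and uniqueness -/

section Frame

variable {n ℓ m : ℕ} {U : Set ℂ} {Φ H : ℂ → Matrix (Fin n) (Fin n) ℂ} {R : ℝ}
  {M : LocalModel ℓ m} {g : ℂ → Matrix (Fin n) (BlockIdx ℓ m) ℂ}
  {ginv : ℂ → Matrix (BlockIdx ℓ m) (Fin n) ℂ}

lemma IsAdaptedFrame.higgs_hol (hF : IsAdaptedFrame U Φ H R M g ginv) :
    HolMatOn M.higgs (Metric.ball 0 R) :=
  HolMatOn.blockMat (A := fun j w => !![M.lamHat j w, M.z j w * deriv (M.z j) w;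
      deriv (M.z j) w, M.lamHat j w])
    (fun j => holMatOn_fin_two (hF.lamHat_hol j) ((hF.z_hol j).mul (hF.deriv_z_hol j))
      (hF.deriv_z_hol j) (hF.lamHat_hol j)) hF.lam_hol

lemma IsAdaptedFrame.offDiag_hol (hF : IsAdaptedFrame U Φ H R M g ginv) :
    HolMatOn M.offDiag (Metric.ball 0 R) :=
  HolMatOn.blockMat (A := fun j w => !![0, M.z j w * deriv (M.z j) w; deriv (M.z j) w, 0])
    (c := fun _ _ => 0)
    (fun j => holMatOn_fin_two (differentiableOn_const 0) ((hF.z_hol j).mul (hF.deriv_z_hol j))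
      (hF.deriv_z_hol j) (differentiableOn_const 0)) (fun _ => differentiableOn_const 0)

lemma IsAdaptedFrame.center_hol (hF : IsAdaptedFrame U Φ H R M g ginv) (b : Fin ℓ ⊕ Fin m) :
    DifferentiableOn ℂ (fun w => M.center w b) (Metric.ball 0 R) := by
  rcases b with j | k
  · exact hF.lamHat_hol j
  · exact hF.lam_hol k

lemma IsAdaptedFrame.spread_hol (hF : IsAdaptedFrame U Φ H R M g ginv) (b : Fin ℓ ⊕ Fin m) :
    DifferentiableOn ℂ (fun w => M.spread w b) (Metric.ball 0 R) := by
  rcases b with j | k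
  · exact (hF.z_hol j).mul ((hF.deriv_z_hol j).pow 2)
  · exact differentiableOn_const 0

/-- A holomorphic endomorphism can be brought to normal form by a holomorphic gauge
transformation. -/
theorem IsAdaptedFrame.exists_normalForm (hF : IsAdaptedFrame U Φ H R M g ginv)
    (hs : SpectralCurveSmooth U Φ) {S : Set ℂ} (hS : S ⊆ Metric.ball 0 R)
    {V : ℂ → Matrix (BlockIdx ℓ m) (BlockIdx ℓ m) ℂ} (hV : HolMatOn V S) :
    ∃ d : DeformationData ℓ m, d.HolOn S ∧ ∃ γ, HolMatOn γ S ∧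
      ∀ w ∈ S, d.phiDot M w = V w + comm (M.higgs w) (γ w) := by
  classical
  have hz' : ∀ j, ∀ w ∈ S, deriv (M.z j) w ≠ 0 := fun j w hw => hF.deriv_z_ne_zero hs (hS hw) j
  have hz'2 : ∀ j, ∀ w ∈ S, 2 * deriv (M.z j) w ≠ 0 := fun j w hw =>
    mul_ne_zero two_ne_zero (hz' j w hw)
  have hdz := fun j => (hF.deriv_z_hol j).mono hS
  have hdz2 : ∀ j, DifferentiableOn ℂ (fun w => 2 * deriv (M.z j) w) S :=
    fun j => (hdz j).const_mul 2
  -- The inverse resultant off the diagonal blocks and zero on them, so that X removes exactly the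
  -- part of V between different blocks.
  let f : ℂ → Fin ℓ ⊕ Fin m → Fin ℓ ⊕ Fin m → ℂ := fun w x y => if x = y then 0 else
    (((M.center w x - M.center w y) ^ 2 - (M.spread w x + M.spread w y)) ^ 2
        - 4 * M.spread w x * M.spread w y)⁻¹
  have hc := fun b => (hF.center_hol b).mono hS
  have hsp := fun b => (hF.spread_hol b).mono hS
  have hoff := hF.offDiag_hol.mono hS
  have hf : ∀ x y, DifferentiableOn ℂ (fun w => f w x y) S := by
    intro x y
    by_cases hxy : x = y
    · simpa [f, hxy] using differentiableOn_const (0 : ℂ)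
    · simp only [f, hxy, if_false]
      refine DifferentiableOn.inv ?_ fun w hw => hF.resultant_ne_zero hs (hS hw) hxy
      exact (((((hc x).sub (hc y)).pow 2).sub ((hsp x).add (hsp y))).pow 2).sub
        (((hsp x).const_mul 4).mul (hsp y))
  let X : ℂ → Matrix (BlockIdx ℓ m) (BlockIdx ℓ m) ℂ := fun w =>
    sylvesterSol LocalModel.blockOf (M.center w) (M.spread w) (M.offDiag w) (f w) (V w)
  have hX : HolMatOn X S := by
    have h1 := hoff.comm hV
    have h2 := hoff.comm h1
    have h3 := hoff.comm h2
    have hd : ∀ x y, DifferentiableOn ℂ (fun w => M.center w x - M.center w y) S :=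
      fun x y => (hc x).sub (hc y)
    have hσ : ∀ x y, DifferentiableOn ℂ (fun w => 2 * (M.spread w x + M.spread w y)) S :=
      fun x y => ((hsp x).add (hsp y)).const_mul 2
    exact (((HolMatOn.blockScale (fun x y => (hf x y).mul (((hd x y).pow 3).sub
      ((hσ x y).mul (hd x y)))) hV).add
      (HolMatOn.blockScale (fun x y => (hf x y).mul ((hσ x y).sub ((hd x y).pow 2))) h1)).add
      (HolMatOn.blockScale (fun x y => (hf x y).mul (hd x y)) h2)).add
      (HolMatOn.blockScale (fun x y => (hf x y).neg) h3)
  have hXc : ∀ w ∈ S, ∀ a b, comm (M.higgs w) (X w) a b =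
      if LocalModel.blockOf a = LocalModel.blockOf b then 0 else V w a b := by
    intro w hw a b
    rw [M.higgs_eq_add, comm_sylvesterSol LocalModel.blockOf _ _ (M.offDiag_apply_of_ne w)
      (M.offDiag_mul_offDiag w)]
    by_cases hab : (LocalModel.blockOf a : Fin ℓ ⊕ Fin m) = LocalModel.blockOf b
    · simp [f, hab]
    · have := hF.resultant_ne_zero hs (hS hw) hab
      simp only [f, hab, if_false]
      rw [inv_mul_cancel₀ this, one_mul]
  -- Inside a block, the diagonal entries of Y cancel the lower left entry of V and move it,
  -- multiplied by z_j, to the upper right. The off-diagonal entry of Y cancels the traceless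
  -- diagonal part of V.
  let Y : ℂ → Matrix (BlockIdx ℓ m) (BlockIdx ℓ m) ℂ := fun w => blockMat (fun j =>
    !![-(diagBlock (V w) j 1 0) / (2 * deriv (M.z j) w),
        (diagBlock (V w) j 0 0 - diagBlock (V w) j 1 1) / (2 * deriv (M.z j) w);
      0, diagBlock (V w) j 1 0 / (2 * deriv (M.z j) w)]) (fun _ => 0)
  have hVd : ∀ j i i', DifferentiableOn ℂ (fun w => diagBlock (V w) j i i') S :=
    fun j i i' => hV _ _
  have hY : HolMatOn Y S := by
    refine HolMatOn.blockMat (A := fun j w =>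
      !![-(diagBlock (V w) j 1 0) / (2 * deriv (M.z j) w),
        (diagBlock (V w) j 0 0 - diagBlock (V w) j 1 1) / (2 * deriv (M.z j) w);
      0, diagBlock (V w) j 1 0 / (2 * deriv (M.z j) w)]) (c := fun _ _ => 0) (fun j => ?_)
      (fun _ => differentiableOn_const 0)
    exact holMatOn_fin_two ((hVd j 1 0).neg.div (hdz2 j) (hz'2 j))
      (((hVd j 0 0).sub (hVd j 1 1)).div (hdz2 j) (hz'2 j)) (differentiableOn_const 0)
      ((hVd j 1 0).div (hdz2 j) (hz'2 j))
  refine ⟨⟨fun j w => (diagBlock (V w) j 0 0 + diagBlock (V w) j 1 1) / 2,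
    fun j w => (diagBlock (V w) j 0 1 + M.z j w * diagBlock (V w) j 1 0) / deriv (M.z j) w,
    fun k w => V w (Sum.inr k) (Sum.inr k)⟩, ⟨?_, ?_, ?_⟩, fun w => Y w - X w, hY.sub hX, ?_⟩
  · exact fun j => ((hVd j 0 0).add (hVd j 1 1)).div_const 2
  · exact fun j => ((hVd j 0 1).add (((hF.z_hol j).mono hS).mul (hVd j 1 0))).div (hdz j) (hz' j)
  · exact fun k => hV _ _
  · intro w hw
    rw [comm_sub]
    have hYc : comm (M.higgs w) (Y w) = _ := comm_blockMat _ _ _ _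
    rw [hYc]
    ext a b
    rw [Matrix.add_apply, Matrix.sub_apply, hXc w hw]
    rcases a with ⟨i, j⟩ | k <;> rcases b with ⟨i', j'⟩ | k'
    · by_cases hj : j = j'
      · subst hj
        have h0 := hz' j w hw
        fin_cases i <;> fin_cases i' <;>
          simp [DeformationData.phiDot, LocalModel.blockOf, comm, Matrix.mul_apply,
            Fin.sum_univ_two, diagBlock] <;> field_simp <;> ring
      · simp [DeformationData.phiDot, LocalModel.blockOf, hj]
    · simp [DeformationData.phiDot, LocalModel.blockOf]
    · simp [DeformationData.phiDot, LocalModel.blockOf]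
    · by_cases hk : k = k'
      · subst hk; simp [DeformationData.phiDot, LocalModel.blockOf]
      · simp [DeformationData.phiDot, LocalModel.blockOf, hk]

/-- Every deformation has a representative in normal form on smaller disks. -/
theorem IsAdaptedFrame.exists_gauge_normalForm (hF : IsAdaptedFrame U Φ H R M g ginv)
    (hs : SpectralCurveSmooth U Φ) {E V : ℂ → Matrix (BlockIdx ℓ m) (BlockIdx ℓ m) ℂ}
    (hEV : IsDeformation M.higgs (Metric.ball 0 R) E V) {σ : ℝ} (hσ : 0 < σ) (hσR : σ < R) :
    ∃ d : DeformationData ℓ m, d.HolOn (Metric.ball 0 σ) ∧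
      ∃ γ, IsGauge M.higgs (Metric.ball 0 σ) γ E V 0 (d.phiDot M) := by
  have hsub : Metric.ball (0 : ℂ) σ ⊆ Metric.ball 0 R := Metric.ball_subset_ball hσR.le
  choose u hu hu2 using fun a b => exists_dwbar_eq hσ hσR (hEV.smooth_eta a b).neg
  set γ₀ : ℂ → Matrix (BlockIdx ℓ m) (BlockIdx ℓ m) ℂ := fun w => Matrix.of fun a b => u a b w
  have hγ₀ : ∀ a b w, DifferentiableAt ℝ (fun x => γ₀ x a b) w := fun a b w =>
    (hu a b).differentiable (by norm_num) w
  have hdγ₀ : ∀ w ∈ Metric.ball (0 : ℂ) σ, dbarMat γ₀ w = -E w := fun w hw => by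
    ext a b; exact hu2 a b w hw
  -- Once η̇ is gauged away, the deformation equation says that the new φ̇ is holomorphic.
  have hV1 : HolMatOn (fun w => V w + comm (M.higgs w) (γ₀ w)) (Metric.ball 0 σ) := by
    intro a b w hw
    have hΦd : ∀ a b, DifferentiableAt ℂ (fun x => M.higgs x a b) w := fun a b =>
      (hF.higgs_hol a b).differentiableAt (Metric.isOpen_ball.mem_nhds (hsub hw))
    have hVd := hEV.smooth_phi.differentiableAt Metric.isOpen_ball (hsub hw) a b
    have hcd : DifferentiableAt ℝ (fun x => comm (M.higgs x) (γ₀ x) a b) w := by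
      have h1 : SmoothMatOn γ₀ (Metric.ball 0 R) := fun a b => (hu a b).contDiffOn
      exact ((hF.higgs_hol.smoothMatOn Metric.isOpen_ball).comm h1).differentiableAt
        Metric.isOpen_ball (hsub hw) a b
    refine (differentiableAt_complex_of_dwbar (hVd.add hcd) ?_).differentiableWithinAt
    have h1 := (HasWirtinger.of_differentiableAt hVd).add (HasWirtinger.of_differentiableAt hcd)
    have h2 := h1.dwbar_eq
    refine h2.trans ?_
    have h3 : dwbar (fun x => comm (M.higgs x) (γ₀ x) a b) w =
        comm (M.higgs w) (dbarMat γ₀ w) a b :=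
      congrFun (congrFun (dbarMat_comm hΦd (fun a b => hγ₀ a b w)) a) b
    have h4 := congrFun (congrFun (hEV.eq w (hsub hw)) a) b
    rw [h3, hdγ₀ w hw, comm_neg, comm_swap, neg_neg]
    exact h4
  obtain ⟨d, hd, γ₁, hγ₁, heq⟩ := hF.exists_normalForm hs hsub hV1
  refine ⟨d, hd, fun w => γ₀ w + γ₁ w, ⟨?_, ?_, ?_⟩⟩
  · exact fun a b => (hu a b).contDiffOn.add (hγ₁.smoothMatOn Metric.isOpen_ball a b)
  · intro w hw
    ext a b
    have h1 := (HasWirtinger.of_differentiableAt (hγ₀ a b w)).add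
      (HasWirtinger.of_hasDerivAt ((hγ₁ a b).differentiableAt
        (Metric.isOpen_ball.mem_nhds hw)).hasDerivAt)
    have h2 := congrFun (congrFun (hdγ₀ w hw) a) b
    have h3 := h1.dwbar_eq
    simp only [dbarMat, Matrix.of_apply, Matrix.neg_apply, Matrix.sub_apply, Pi.zero_apply,
      Matrix.zero_apply, Matrix.add_apply] at h2 h3 ⊢
    rw [h3, h2]; ring
  · intro w hw
    rw [heq w hw, comm_add]; abel

/-- The normal form of a deformation is unique. -/
theorem IsAdaptedFrame.normalForm_unique (hF : IsAdaptedFrame U Φ H R M g ginv)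
    (hs : SpectralCurveSmooth U Φ) {S : Set ℂ} (hS : S ⊆ Metric.ball 0 R)
    {E V γ γ' : ℂ → Matrix (BlockIdx ℓ m) (BlockIdx ℓ m) ℂ} {d d' : DeformationData ℓ m}
    (h : IsGauge M.higgs S γ E V 0 (d.phiDot M)) (h' : IsGauge M.higgs S γ' E V 0 (d'.phiDot M)) :
    d'.EqOn d S := by
  have key : ∀ w ∈ S, d'.phiDot M w - d.phiDot M w = comm (M.higgs w) (γ' w - γ w) := by
    intro w hw
    rw [comm_sub, ← h.phi w hw, ← h'.phi w hw]; abel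
  have hblock : ∀ w ∈ S, ∀ j, !![d'.lamHatDot j w, d'.P j w * deriv (M.z j) w;
        0, d'.lamHatDot j w] - !![d.lamHatDot j w, d.P j w * deriv (M.z j) w; 0, d.lamHatDot j w]
      = comm !![M.lamHat j w, M.z j w * deriv (M.z j) w; deriv (M.z j) w, M.lamHat j w]
        (diagBlock (γ' w - γ w) j) := by
    intro w hw j
    have := congrArg (fun X => diagBlock X j) (key w hw)
    simp only [LocalModel.higgs, diagBlock_comm_blockMat, diagBlock_sub,
      DeformationData.phiDot, diagBlock_blockMat] at this
    exact this
  -- Three functionals annihilate [φ, ·] and detect the three kinds of data: the trace of a block,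
  -- the combination X₀₁ + z_j X₁₀ within a block, and the entry of a block of size one.
  refine ⟨fun j w hw => ?_, fun j w hw => ?_, fun k w hw => ?_⟩
  · have h1 := congrArg Matrix.trace (hblock w hw j)
    rw [comm, Matrix.trace_sub (_ * _), Matrix.trace_mul_comm, sub_self] at h1
    simp [Matrix.trace, Fin.sum_univ_two] at h1
    linear_combination h1
  · have h0 := hF.deriv_z_ne_zero hs (hS hw) j
    have h1 := congrFun (congrFun (hblock w hw j) 0) 1
    have h2 := congrFun (congrFun (hblock w hw j) 1) 0
    rw [comm_apply, Fin.sum_univ_two] at h1 h2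
    simp at h1 h2
    refine mul_right_cancel₀ h0 ?_
    linear_combination h1 + M.z j w * h2
  · have h1 := congrFun (congrFun (key w hw) (Sum.inr k)) (Sum.inr k)
    rw [LocalModel.higgs, comm_blockMat_apply_inr] at h1
    simp [DeformationData.phiDot] at h1
    linear_combination h1

end Frame

/-! ### The variation of the limiting metric -/

section Frame

variable {n ℓ m : ℕ} {U : Set ℂ} {Φ H : ℂ → Matrix (Fin n) (Fin n) ℂ} {R : ℝ}
  {M : LocalModel ℓ m} {g : ℂ → Matrix (Fin n) (BlockIdx ℓ m) ℂ}
  {ginv : ℂ → Matrix (BlockIdx ℓ m) (Fin n) ℂ}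

lemma LocalModel.hInf_eq_diagonal (M : LocalModel ℓ m) (w : ℂ) :
    M.hInf w = Matrix.diagonal fun a => ((metricDiag (fun j => ‖M.z j w‖ ^ (-(1 / 2) : ℝ))
      (fun j => ‖M.z j w‖ ^ (1 / 2 : ℝ)) a : ℝ) : ℂ) :=
  blockMat_diag _ _

lemma rpow_half_div_neg_half {r : ℝ} (hr : 0 < r) :
    r ^ (1 / 2 : ℝ) / r ^ (-(1 / 2) : ℝ) = r := by
  rw [← Real.rpow_sub hr]; norm_num

lemma rpow_neg_half_div_half {r : ℝ} (hr : 0 < r) :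
    r ^ (-(1 / 2) : ℝ) / r ^ (1 / 2 : ℝ) = r⁻¹ := by
  rw [← Real.rpow_sub hr, ← Real.rpow_neg_one]; norm_num

lemma LocalModel.adj_hInf_blockMat (M : LocalModel ℓ m) {w : ℂ} (hz : ∀ j, M.z j w ≠ 0)
    (A : Fin ℓ → Matrix (Fin 2) (Fin 2) ℂ) (c : Fin m → ℂ) :
    adj (M.hInf w) (blockMat A c) =
      blockMat (fun j => !![(starRingEnd ℂ) (A j 0 0), ‖M.z j w‖ * (starRingEnd ℂ) (A j 1 0);
        (‖M.z j w‖ : ℂ)⁻¹ * (starRingEnd ℂ) (A j 0 1), (starRingEnd ℂ) (A j 1 1)])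
        (fun k => (starRingEnd ℂ) (c k)) := by
  have hp : ∀ j, 0 < ‖M.z j w‖ := fun j => norm_pos_iff.2 (hz j)
  rw [M.hInf_eq_diagonal, adj_diag_blockMat (fun j => Real.rpow_pos_of_pos (hp j) _)
    (fun j => Real.rpow_pos_of_pos (hp j) _)]
  congr 1
  ext j
  rw [rpow_half_div_neg_half (hp j), rpow_neg_half_div_half (hp j), Complex.ofReal_inv]

lemma norm_mul_norm_eq (x : ℂ) : (‖x‖ : ℂ) * ‖x‖ = x * (starRingEnd ℂ) x := by
  rw [Complex.mul_conj, Complex.normSq_eq_norm_sq]; push_cast; ring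

lemma covD_zero {ι : Type*} [Fintype ι] [DecidableEq ι] (H : ℂ → Matrix ι ι ℂ) (w : ℂ) :
    covD H 0 w = 0 := by
  ext a b
  simp [covD, dMat, comm_zero]

lemma covD_congr {ι : Type*} [Fintype ι] [DecidableEq ι] {H A B : ℂ → Matrix ι ι ℂ} {w : ℂ}
    (h : A =ᶠ[𝓝 w] B) : covD H A w = covD H B w := by
  have h1 : dMat A w = dMat B w := by
    ext a b
    exact dw_congr (h.mono fun x hx => congrFun (congrFun hx a) b)
  rw [covD, covD, h1, h.self_of_nhds]

lemma nuInf_hol (hF : IsAdaptedFrame U Φ H R M g ginv) {d : DeformationData ℓ m} {S : Set ℂ}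
    (hS : S ⊆ Metric.ball 0 R \ {0}) (hd : d.HolOn S) : HolMatOn (d.nuInf M) S := by
  have hz : ∀ j, DifferentiableOn ℂ (fun w => -(d.P j w / (4 * M.z j w))) S := fun j =>
    ((hd.P j).div (((hF.z_hol j).mono (hS.trans Set.sdiff_subset)).const_mul 4) fun w hw =>
      mul_ne_zero (by norm_num) (hF.z_ne_zero (hS hw).1 (hS hw).2 j)).neg
  refine HolMatOn.blockMat (A := fun j w => (-(d.P j w / (4 * M.z j w))) • !![1, 0; 0, -1])
    (c := fun _ _ => 0) (fun j => ?_) (fun _ => differentiableOn_const 0)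
  intro i i'
  simp only [Matrix.smul_apply, smul_eq_mul]
  exact (hz j).mul_const _

/-- In the limit, the deformed Higgs field commutes with the adjoint of the Higgs field. -/
lemma comm_adj_phiDot_add (M : LocalModel ℓ m) (d : DeformationData ℓ m) {w : ℂ}
    (hz : ∀ j, M.z j w ≠ 0) :
    comm (adj (M.hInf w) (M.higgs w)) (d.phiDot M w + comm (d.nuInf M w) (M.higgs w)) = 0 := by
  rw [LocalModel.higgs, M.adj_hInf_blockMat hz, DeformationData.nuInf, comm_blockMat,
    DeformationData.phiDot, blockMat_add, comm_blockMat, ← blockMat_zero]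
  congr 1
  ext j i i'
  have h0 := hz j
  have hn : (‖M.z j w‖ : ℂ) ≠ 0 := by simpa using h0
  have h2 := norm_mul_norm_eq (M.z j w)
  have hc : (starRingEnd ℂ) (M.z j w) ≠ 0 := by simpa using h0
  rw [comm_apply, Fin.sum_univ_two]
  fin_cases i <;> fin_cases i' <;>
    simp [comm, Matrix.mul_apply, Fin.sum_univ_two] <;> field_simp <;> try ring1
  · linear_combination 2 * d.P j w * (starRingEnd ℂ) (deriv (M.z j) w) * deriv (M.z j) w * h2
  · linear_combination -2 * d.P j w * (starRingEnd ℂ) (deriv (M.z j) w) * deriv (M.z j) w * h2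

lemma adj_smul {ι : Type*} [Fintype ι] [DecidableEq ι] (H B : Matrix ι ι ℂ) (t : ℂ) :
    adj H (t • B) = (starRingEnd ℂ) t • adj H B := by
  simp [adj, Matrix.conjTranspose_smul]

lemma comm_smul_smul {ι : Type*} [Fintype ι] (A B : Matrix ι ι ℂ) (s t : ℂ) :
    comm (s • A) (t • B) = (s * t) • comm A B := by
  simp [comm, smul_smul, smul_sub, mul_comm]

theorem decoupled_nuInf (M : LocalModel ℓ m) (d : DeformationData ℓ m) {w : ℂ}
    (hz : ∀ j, M.z j w ≠ 0) : DecoupledEq M.higgs M.hInf (d.phiDot M) (d.nuInf M) w := by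
  rw [DecoupledEq, LocalModel.higgs, M.adj_hInf_blockMat hz, DeformationData.nuInf,
    DeformationData.phiDot, M.adj_hInf_blockMat hz, M.adj_hInf_blockMat hz, blockMat_add,
    comm_blockMat, comm_blockMat, comm_blockMat, comm_blockMat, blockMat_add, blockMat_add,
    ← blockMat_zero]
  congr 1
  swap
  · ext k; simp
  ext j i i'
  have h4 : (starRingEnd ℂ) (4 : ℂ) = 4 := map_ofNat _ 4
  have h0 := hz j
  have hn : (‖M.z j w‖ : ℂ) ≠ 0 := by simpa using h0
  have h2 := norm_mul_norm_eq (M.z j w)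
  have hc : (starRingEnd ℂ) (M.z j w) ≠ 0 := by simpa using h0
  fin_cases i <;> fin_cases i' <;>
    simp [comm, Matrix.mul_apply, Fin.sum_univ_two] <;> field_simp <;> try ring1
  · rw [h4]
    linear_combination -(8 * M.z j w * (starRingEnd ℂ) (d.P j w) * deriv (M.z j) w *
      (starRingEnd ℂ) (deriv (M.z j) w) + 8 * (starRingEnd ℂ) (M.z j w) * d.P j w *
      deriv (M.z j) w * (starRingEnd ℂ) (deriv (M.z j) w)) * h2
  · rw [h4]
    linear_combination (8 * M.z j w * (starRingEnd ℂ) (d.P j w) * deriv (M.z j) w *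
      (starRingEnd ℂ) (deriv (M.z j) w) + 8 * (starRingEnd ℂ) (M.z j w) * d.P j w *
      deriv (M.z j) w * (starRingEnd ℂ) (deriv (M.z j) w)) * h2

/-- Off the origin the model variation is holomorphic, so the second-order term drops and the
Coulomb equation reduces to `comm_adj_phiDot_add`. Scaling φ and φ̇ by t multiplies the remaining
expressions by t². -/
theorem isLimitingVariation_nuInf (hF : IsAdaptedFrame U Φ H R M g ginv)
    {d : DeformationData ℓ m} {ρ : ℝ} (hρ : ρ ≤ R) (hd : d.HolOn (Metric.ball 0 ρ)) (t : ℝ) :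
    IsLimitingVariation (fun w => (t : ℂ) • M.higgs w) M.hInf (Metric.ball 0 ρ \ {0}) 0
      (fun w => (t : ℂ) • d.phiDot M w) (d.nuInf M) := by
  have hsub : Metric.ball (0 : ℂ) ρ \ {0} ⊆ Metric.ball 0 R \ {0} :=
    Set.sdiff_subset_sdiff_left (Metric.ball_subset_ball hρ)
  have hopen : IsOpen (Metric.ball (0 : ℂ) ρ \ {0}) := Metric.isOpen_ball.sdiff isClosed_singleton
  have hd' : d.HolOn (Metric.ball 0 ρ \ {0}) := ⟨fun j => (hd.lamHatDot j).mono Set.sdiff_subset,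
    fun j => (hd.P j).mono Set.sdiff_subset, fun j => (hd.lamDot j).mono Set.sdiff_subset⟩
  have hν := nuInf_hol hF hsub hd'
  refine ⟨hν.smoothMatOn hopen, fun w hw => ?_, fun w hw => ?_⟩
  · have hz : ∀ j, M.z j w ≠ 0 := fun j => hF.z_ne_zero (hsub hw).1 (hsub hw).2 j
    have h0 : dbarMat (d.nuInf M) =ᶠ[𝓝 w] 0 := by
      filter_upwards [hopen.mem_nhds hw] with x hx
      ext a b
      exact dwbar_of_differentiableAt ((hν a b).differentiableAt (hopen.mem_nhds hx))
    rw [CoulombEq, covD_congr h0, covD_zero, sub_zero, zero_add, adj_smul]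
    have h1 : (t : ℂ) • d.phiDot M w + comm (d.nuInf M w) ((t : ℂ) • M.higgs w) =
        (t : ℂ) • (d.phiDot M w + comm (d.nuInf M w) (M.higgs w)) := by
      have := comm_smul_smul (d.nuInf M w) (M.higgs w) 1 t
      rw [one_smul, one_mul] at this
      rw [this, smul_add]
    rw [h1, comm_smul_smul, comm_adj_phiDot_add M d hz, smul_zero]
  · have hz : ∀ j, M.z j w ≠ 0 := fun j => hF.z_ne_zero (hsub hw).1 (hsub hw).2 j
    have h1 := decoupled_nuInf M d hz
    rw [DecoupledEq] at h1 ⊢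
    have h2 : comm (adj (M.hInf w) ((t : ℂ) • M.higgs w))
        (d.nuInf M w + adj (M.hInf w) (d.nuInf M w)) = (t : ℂ) • comm (adj (M.hInf w) (M.higgs w))
        (d.nuInf M w + adj (M.hInf w) (d.nuInf M w)) := by
      have := comm_smul_smul (adj (M.hInf w) (M.higgs w))
        (d.nuInf M w + adj (M.hInf w) (d.nuInf M w)) t 1
      rw [one_smul, mul_one] at this
      rw [adj_smul, Complex.conj_ofReal, this]
    rw [h2]
    simp only [adj_smul, Complex.conj_ofReal, comm_smul_smul]
    rw [← smul_add, ← smul_add, h1, smul_zero]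

/-- A variation of the limiting metric that differs from the model by a bounded amount is
taken to the model by a smooth gauge transformation. -/
theorem exists_gauge_to_nuInf (hF : IsAdaptedFrame U Φ H R M g ginv)
    {d : DeformationData ℓ m} {ρ : ℝ} (hρ0 : 0 < ρ) (hρ : ρ ≤ R)
    (hd : d.HolOn (Metric.ball 0 ρ))
    {E V γ₁ ν : ℂ → Matrix (BlockIdx ℓ m) (BlockIdx ℓ m) ℂ}
    (hγ₁ : IsGauge M.higgs (Metric.ball 0 ρ) γ₁ E V 0 (d.phiDot M))
    (hν : IsLimitingVariation M.higgs M.hInf (Metric.ball 0 ρ \ {0}) E V ν)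
    (hνE : ∀ w ∈ Metric.ball (0 : ℂ) ρ \ {0}, dbarMat ν w = E w)
    (hb : ∃ C : ℝ, ∀ᶠ w in 𝓝[≠] 0, ∀ a b, ‖(ν w - d.nuInf M w) a b‖ ≤ C) :
    ∃ γ, IsGauge M.higgs (Metric.ball 0 ρ) γ E V 0 (d.phiDot M) ∧
      ∀ w ∈ Metric.ball (0 : ℂ) ρ \ {0}, ν w + γ w = d.nuInf M w := by
  have hsub : Metric.ball (0 : ℂ) ρ \ {0} ⊆ Metric.ball 0 R \ {0} :=
    Set.sdiff_subset_sdiff_left (Metric.ball_subset_ball hρ)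
  have hopen : IsOpen (Metric.ball (0 : ℂ) ρ \ {0}) := Metric.isOpen_ball.sdiff isClosed_singleton
  have hd' : d.HolOn (Metric.ball 0 ρ \ {0}) := ⟨fun j => (hd.lamHatDot j).mono Set.sdiff_subset,
    fun j => (hd.P j).mono Set.sdiff_subset, fun j => (hd.lamDot j).mono Set.sdiff_subset⟩
  have hνinf := nuInf_hol hF hsub hd'
  have h0mem : Metric.ball (0 : ℂ) ρ ∈ 𝓝 0 := Metric.isOpen_ball.mem_nhds (Metric.mem_ball_self hρ0)
  -- μ is the error left by γ₁. It is holomorphic off 0 because ∂̄ν = η̇ = -∂̄γ₁. The difference of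
  -- the Coulomb equations for ν and for the model gives [φ^†, [μ, φ]] = 0, hence [μ, φ] = 0.
  -- Subtracting μ from γ₁ thus changes neither η̇ nor φ̇.
  set μ : ℂ → Matrix (BlockIdx ℓ m) (BlockIdx ℓ m) ℂ := fun w => ν w + γ₁ w - d.nuInf M w with hμ
  have hμhol : HolMatOn μ (Metric.ball 0 ρ \ {0}) := by
    intro a b w hw
    have h1 := hν.smooth.differentiableAt hopen hw a b
    have h2 := hγ₁.smooth.differentiableAt Metric.isOpen_ball hw.1 a b
    have h3 := (hνinf a b).differentiableAt (hopen.mem_nhds hw)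
    have h4 := ((HasWirtinger.of_differentiableAt h1).add (HasWirtinger.of_differentiableAt h2)).sub
      (HasWirtinger.of_hasDerivAt h3.hasDerivAt)
    refine (differentiableAt_complex_of_dwbar h4.differentiableAt ?_).differentiableWithinAt
    refine h4.dwbar_eq.trans ?_
    have h5 := congrFun (congrFun (hνE w hw) a) b
    have h6 := congrFun (congrFun (hγ₁.eta w hw.1) a) b
    simp only [dbarMat, Matrix.of_apply, Matrix.sub_apply, Pi.zero_apply,
      Matrix.zero_apply] at h5 h6
    rw [h5, ← h6]; ring
  have hμcomm : ∀ w ∈ Metric.ball (0 : ℂ) ρ \ {0}, comm (M.higgs w) (μ w) = 0 := by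
    intro w hw
    have hz : ∀ j, M.z j w ≠ 0 := fun j => hF.z_ne_zero (hsub hw).1 (hsub hw).2 j
    have hp : ∀ j, 0 < ‖M.z j w‖ := fun j => norm_pos_iff.2 (hz j)
    have h1 := hν.coulomb w hw
    have h2 : dbarMat ν =ᶠ[𝓝 w] E := by
      filter_upwards [hopen.mem_nhds hw] with x hx using hνE x hx
    rw [CoulombEq, covD_congr h2, sub_self, zero_add] at h1
    have h3 := comm_adj_phiDot_add M d hz
    have h4 : comm (μ w) (M.higgs w) = (V w + comm (ν w) (M.higgs w)) -
        (d.phiDot M w + comm (d.nuInf M w) (M.higgs w)) := by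
      have h5 := hγ₁.phi w hw.1
      have h6 : comm (μ w) (M.higgs w) = comm (ν w) (M.higgs w) - comm (M.higgs w) (γ₁ w)
          - comm (d.nuInf M w) (M.higgs w) := by
        simp only [hμ, comm]; noncomm_ring
      rw [h6, ← h5]; abel
    have h7 : comm (adj (M.hInf w) (M.higgs w)) (comm (μ w) (M.higgs w)) = 0 := by
      rw [h4, comm_sub, h1, h3, sub_self]
    rw [M.hInf_eq_diagonal] at h7
    have h8 := comm_eq_zero_of_comm_adj (metricDiag_pos (fun j => Real.rpow_pos_of_pos (hp j) _)
      (fun j => Real.rpow_pos_of_pos (hp j) _)) h7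
    rw [comm_swap, h8, neg_zero]
  -- Boundedness of ν - ν_∞ and continuity of γ₁ make the singularity of μ removable. This is what
  -- keeps the corrected gauge transformation smooth at 0.
  have hext : ∀ a b, ∃ f : ℂ → ℂ, DifferentiableOn ℂ f (Metric.ball 0 ρ) ∧
      ∀ w ∈ Metric.ball (0 : ℂ) ρ \ {0}, f w = μ w a b := by
    intro a b
    obtain ⟨C, hC⟩ := hb
    have hγc : ContinuousAt (fun w => γ₁ w a b) 0 :=
      (hγ₁.smooth.differentiableAt Metric.isOpen_ball (Metric.mem_ball_self hρ0) a b).continuousAt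
    have hbd : IsBoundedUnder (· ≤ ·) (𝓝[≠] (0 : ℂ)) fun w => ‖μ w a b - μ 0 a b‖ := by
      have h1 : ∀ᶠ w in 𝓝[≠] (0 : ℂ), ‖γ₁ w a b‖ ≤ ‖γ₁ 0 a b‖ + 1 := by
        refine nhdsWithin_le_nhds ?_
        exact (hγc.norm.eventually (ge_mem_nhds (by linarith : ‖γ₁ 0 a b‖ < ‖γ₁ 0 a b‖ + 1)))
      refine ⟨C + (‖γ₁ 0 a b‖ + 1) + ‖μ 0 a b‖, ?_⟩
      rw [eventually_map]
      filter_upwards [h1, hC] with w hw1 hw2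
      have h3 : μ w a b = (ν w - d.nuInf M w) a b + γ₁ w a b := by
        simp only [hμ, Matrix.add_apply, Matrix.sub_apply]; ring
      calc ‖μ w a b - μ 0 a b‖ ≤ ‖μ w a b‖ + ‖μ 0 a b‖ := norm_sub_le _ _
        _ ≤ (‖(ν w - d.nuInf M w) a b‖ + ‖γ₁ w a b‖) + ‖μ 0 a b‖ := by
            rw [h3]; gcongr; exact norm_add_le _ _
        _ ≤ _ := by gcongr; exact hw2 a b
    refine ⟨_, Complex.differentiableOn_update_limUnder_of_isLittleO h0mem (hμhol a b)
      hbd.isLittleO_sub_self_inv, fun w hw => ?_⟩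
    rw [Function.update_of_ne hw.2]
  choose f hf hfeq using hext
  set μ' : ℂ → Matrix (BlockIdx ℓ m) (BlockIdx ℓ m) ℂ := fun w => Matrix.of fun a b => f a b w
  have hμ'eq : ∀ w ∈ Metric.ball (0 : ℂ) ρ \ {0}, μ' w = μ w := fun w hw => by
    ext a b; exact hfeq a b w hw
  have hμ'hol : HolMatOn μ' (Metric.ball 0 ρ) := hf
  have hcomm' : ∀ w ∈ Metric.ball (0 : ℂ) ρ, comm (M.higgs w) (μ' w) = 0 := by
    intro w hw
    by_cases hw0 : w = 0
    · subst hw0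
      ext a b
      have hc : ContinuousAt (fun w => comm (M.higgs w) (μ' w) a b) 0 :=
        ((((hF.higgs_hol.mono (Metric.ball_subset_ball hρ)).comm hμ'hol) a b).differentiableAt
          h0mem).continuousAt
      have h1 : Tendsto (fun w => comm (M.higgs w) (μ' w) a b) (𝓝[≠] 0) (𝓝 0) := by
        refine tendsto_const_nhds.congr' ?_
        filter_upwards [self_mem_nhdsWithin, nhdsWithin_le_nhds h0mem] with x hx hx2
        rw [hμ'eq x ⟨hx2, hx⟩, hμcomm x ⟨hx2, hx⟩]; rfl
      exact tendsto_nhds_unique (hc.tendsto.mono_left nhdsWithin_le_nhds) h1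
    · rw [hμ'eq w ⟨hw, hw0⟩, hμcomm w ⟨hw, hw0⟩]
  refine ⟨fun w => γ₁ w - μ' w, ⟨?_, ?_, ?_⟩, ?_⟩
  · exact fun a b => (hγ₁.smooth a b).sub (hμ'hol.smoothMatOn Metric.isOpen_ball a b)
  · intro w hw
    rw [hγ₁.eta w hw]
    ext a b
    have h1 := hγ₁.smooth.differentiableAt Metric.isOpen_ball hw a b
    have h2 := (hμ'hol a b).differentiableAt (Metric.isOpen_ball.mem_nhds hw)
    have h3 := ((HasWirtinger.of_differentiableAt h1).sub
      (HasWirtinger.of_hasDerivAt h2.hasDerivAt)).dwbar_eq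
    simp only [dbarMat, Matrix.of_apply, Matrix.sub_apply] at h3 ⊢
    rw [h3, sub_zero]
  · intro w hw
    rw [hγ₁.phi w hw, comm_sub, hcomm' w hw, sub_zero]
  · intro w hw
    simp only [hμ'eq w hw, hμ]
    abel

end Frame

/-! ### The model function -/

/-- A critical point with positive second derivative is a local minimum. If it were also a local
maximum, g would be locally constant and its second derivative would vanish. -/
lemma not_isLocalMax_of_deriv_deriv_pos {g : ℝ → ℝ} {x : ℝ} (hc : ContinuousAt g x)
    (hd : 0 < deriv (deriv g) x) : ¬ IsLocalMax g x := by
  intro h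
  have h1 := isLocalMin_of_deriv_deriv_pos hd h.deriv_eq_zero hc
  have h2 : g =ᶠ[𝓝 x] fun _ => g x := by
    filter_upwards [h, h1] with y hy1 hy2 using le_antisymm hy1 hy2
  have h3 : deriv g =ᶠ[𝓝 x] fun _ => (0 : ℝ) := by
    have := h2.deriv
    filter_upwards [this] with y hy
    rw [hy]; simp
  rw [h3.deriv_eq] at hd
  simp at hd

lemma hasDerivAt_two_of_contDiffOn {u : ℝ → ℝ} (hu : ContDiffOn ℝ 2 u (Set.Ioi 0)) {r : ℝ}
    (hr : 0 < r) : HasDerivAt u (deriv u r) r ∧ HasDerivAt (deriv u) (deriv (deriv u) r) r := by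
  have h2 : ContDiffAt ℝ 2 u r := hu.contDiffAt (isOpen_Ioi.mem_nhds hr)
  refine ⟨(h2.differentiableAt (by norm_num)).hasDerivAt, ?_⟩
  have h3 : ContDiffOn ℝ 1 (deriv u) (Set.Ioi 0) :=
    hu.deriv_of_isOpen isOpen_Ioi (by norm_num)
  exact ((h3.contDiffAt (isOpen_Ioi.mem_nhds hr)).differentiableAt (by norm_num)).hasDerivAt

/-- Comparison principle for the radial sinh-Gordon equation. -/
lemma radial_sinhGordon_le {t : ℝ} (ht : 0 < t) {v₁ v₂ : ℝ → ℝ}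
    (h₁ : ContDiffOn ℝ 2 v₁ (Set.Ioi 0)) (h₂ : ContDiffOn ℝ 2 v₂ (Set.Ioi 0))
    (ode₁ : ∀ r, 0 < r →
      deriv (deriv v₁) r + 1 / r * deriv v₁ r - 8 * t ^ 2 * r * Real.sinh (2 * v₁ r) = 0)
    (ode₂ : ∀ r, 0 < r →
      deriv (deriv v₂) r + 1 / r * deriv v₂ r - 8 * t ^ 2 * r * Real.sinh (2 * v₂ r) = 0)
    (h0 : ∀ ε > 0, ∀ᶠ r in 𝓝[>] (0 : ℝ), v₁ r - v₂ r ≤ ε * -Real.log r)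
    (hinf : ∀ ε > 0, ∀ᶠ r in atTop, v₁ r - v₂ r ≤ ε) {r : ℝ} (hr : 0 < r) : v₁ r ≤ v₂ r := by
  by_contra hcon
  push Not at hcon
  set η := v₁ r - v₂ r with hη
  have hη0 : 0 < η := by simp only [hη]; linarith
  obtain ⟨B, hBr, hB⟩ : ∃ B, r < B ∧ v₁ B - v₂ B ≤ η / 4 := by
    obtain ⟨B, hB1, hB2⟩ := ((eventually_gt_atTop r).and (hinf (η / 4) (by positivity))).exists
    exact ⟨B, hB1, hB2⟩
  have hB0 : 0 < B := hr.trans hBr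
  have hlog : 0 < Real.log B - Real.log r := by
    have := Real.log_lt_log hr hBr
    linarith
  set ε := η / 4 / (Real.log B - Real.log r) with hε
  have hε0 : 0 < ε := by positivity
  have hεl : ε * (Real.log B - Real.log r) = η / 4 := by
    rw [hε]; field_simp
  -- The logarithmic term is annihilated by v'' + v'/r and tends to -∞ at 0. There it beats v₁ - v₂,
  -- which is bounded by half as large a multiple of -log. The value of ε makes the cost at r equal
  -- to η/4, so g is at least 3η/4 at r and at most η/4 at both ends; its maximum is interior, and
  -- the equation gives g'' > 0 there.
  set g : ℝ → ℝ := fun x => v₁ x - v₂ x + ε * (Real.log x - Real.log B) with hg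
  obtain ⟨b, hb0, hbr, hgb⟩ : ∃ b, 0 < b ∧ b < r ∧ g b ≤ η / 4 := by
    have hl : ∀ᶠ x in 𝓝[>] (0 : ℝ), Real.log x ≤ 2 / ε * (η / 4 + ε * Real.log B) :=
      Real.tendsto_log_nhdsGT_zero.eventually (eventually_le_atBot _)
    have hlt : ∀ᶠ x in 𝓝[>] (0 : ℝ), x < r :=
      nhdsWithin_le_nhds (Iio_mem_nhds hr)
    have hpos : ∀ᶠ x in 𝓝[>] (0 : ℝ), 0 < x := self_mem_nhdsWithin
    obtain ⟨b, ⟨hb1, hb2⟩, hb3, hb4⟩ :=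
      ((hl.and hlt).and (hpos.and (h0 (ε / 2) (by positivity)))).exists
    refine ⟨b, hb3, hb2, ?_⟩
    have h5 : ε / 2 * Real.log b ≤ η / 4 + ε * Real.log B := by
      calc ε / 2 * Real.log b ≤ ε / 2 * (2 / ε * (η / 4 + ε * Real.log B)) := by gcongr
        _ = _ := by field_simp
    simp only [hg]
    linarith
  have hcont : ContinuousOn g (Set.Icc b B) := by
    have hs : Set.Icc b B ⊆ Set.Ioi 0 := fun x hx => hb0.trans_le hx.1
    refine ((h₁.continuousOn.mono hs).sub (h₂.continuousOn.mono hs)).add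
      (continuousOn_const.mul ((Real.continuousOn_log.mono fun x hx => ?_).sub continuousOn_const))
    exact (hs hx).ne'
  obtain ⟨x, hx, hmax⟩ := isCompact_Icc.exists_isMaxOn
    (Set.nonempty_Icc.2 (hbr.trans hBr).le) hcont
  have hgr : 3 * η / 4 ≤ g r := by
    simp only [hg]; rw [← hη]; linarith
  have hgx : 3 * η / 4 ≤ g x := hgr.trans (hmax ⟨hbr.le, hBr.le⟩)
  have hxb : b < x := lt_of_le_of_ne hx.1 fun h => by rw [← h] at hgx; linarith
  have hgB : g B = v₁ B - v₂ B := by simp [hg]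
  have hxB : x < B := lt_of_le_of_ne hx.2 fun h => by rw [h, hgB] at hgx; linarith
  have hx0 : 0 < x := hb0.trans hxb
  have hloc : IsLocalMax g x := hmax.isLocalMax (Icc_mem_nhds hxb hxB)
  have hd1 : ∀ y, 0 < y → HasDerivAt g (deriv v₁ y - deriv v₂ y + ε * y⁻¹) y := by
    intro y hy
    exact ((hasDerivAt_two_of_contDiffOn h₁ hy).1.sub (hasDerivAt_two_of_contDiffOn h₂ hy).1).add
      (((Real.hasDerivAt_log hy.ne').sub_const _).const_mul ε)
  have hd1' : deriv g =ᶠ[𝓝 x] fun y => deriv v₁ y - deriv v₂ y + ε * y⁻¹ := by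
    filter_upwards [isOpen_Ioi.mem_nhds hx0] with y hy using (hd1 y hy).deriv
  have hd2 : HasDerivAt (fun y => deriv v₁ y - deriv v₂ y + ε * y⁻¹)
      (deriv (deriv v₁) x - deriv (deriv v₂) x + ε * (-(x ^ 2)⁻¹)) x :=
    ((hasDerivAt_two_of_contDiffOn h₁ hx0).2.sub (hasDerivAt_two_of_contDiffOn h₂ hx0).2).add
      ((hasDerivAt_inv hx0.ne').const_mul ε)
  have hz : deriv v₁ x - deriv v₂ x + ε * x⁻¹ = 0 := by
    rw [← (hd1 x hx0).deriv]; exact hloc.deriv_eq_zero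
  have hvx : v₂ x < v₁ x := by
    have h5 : Real.log x ≤ Real.log B := Real.log_le_log hx0 hxB.le
    have h6 : ε * (Real.log x - Real.log B) ≤ 0 :=
      mul_nonpos_of_nonneg_of_nonpos hε0.le (by linarith)
    simp only [hg] at hgx
    linarith
  have hsinh : Real.sinh (2 * v₂ x) < Real.sinh (2 * v₁ x) := Real.sinh_lt_sinh.2 (by linarith)
  refine not_isLocalMax_of_deriv_deriv_pos (hd1 x hx0).continuousAt ?_ hloc
  rw [hd1'.deriv_eq, hd2.deriv]
  have e1 := ode₁ x hx0
  have e2 := ode₂ x hx0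
  have h8 : 0 < 8 * t ^ 2 * x * (Real.sinh (2 * v₁ x) - Real.sinh (2 * v₂ x)) := by
    have : 0 < Real.sinh (2 * v₁ x) - Real.sinh (2 * v₂ x) := by linarith
    positivity
  have h9 : deriv (deriv v₁) x - deriv (deriv v₂) x + ε * (-(x ^ 2)⁻¹) =
      8 * t ^ 2 * x * (Real.sinh (2 * v₁ x) - Real.sinh (2 * v₂ x)) := by
    have h10 : 1 / x * (deriv v₁ x - deriv v₂ x + ε * x⁻¹) = 0 := by rw [hz]; ring
    have h11 : ε * (-(x ^ 2)⁻¹) = -(1 / x * (ε * x⁻¹)) := by field_simp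
    rw [h11]
    linarith
  rw [h9]; exact h8

/-- From cosh s ≥ 1 and cosh s ≥ s one gets x cosh s ≥ (x - 1) + s, and the integral of e^{-s} is
one. -/
lemma besselK0_le {x : ℝ} (hx : 1 ≤ x) : besselK0 x ≤ Real.exp (1 - x) := by
  have hi : IntegrableOn (fun s : ℝ => Real.exp (1 - x) * Real.exp (-s)) (Set.Ioi 0) :=
    (integrableOn_exp_neg_Ioi 0).const_mul _
  have h1 : besselK0 x ≤ ∫ s in Set.Ioi (0 : ℝ), Real.exp (1 - x) * Real.exp (-s) := by
    refine integral_mono_of_nonneg (Eventually.of_forall fun s => (Real.exp_pos _).le) hi ?_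
    filter_upwards [self_mem_ae_restrict measurableSet_Ioi] with s hs
    rw [← Real.exp_add]
    refine Real.exp_le_exp.2 ?_
    have h2 : 1 ≤ Real.cosh s := Real.one_le_cosh s
    have h3 : s ≤ Real.cosh s := by
      rw [Real.cosh_eq]
      have := Real.quadratic_le_exp_of_nonneg (le_of_lt hs)
      have := Real.exp_pos (-s)
      nlinarith [sq_nonneg (s - 1)]
    nlinarith
  refine h1.trans ?_
  rw [integral_const_mul, integral_exp_neg_Ioi_zero, mul_one]

namespace IsModelFunction

variable {t : ℝ} {u : ℝ → ℝ}

lemma eventually_log_bounds (h : IsModelFunction t u) {ε : ℝ} (hε : 0 < ε) :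
    ∀ᶠ r in 𝓝[>] (0 : ℝ), (1 / 2 - ε) * -Real.log r ≤ u r ∧ u r ≤ (1 / 2 + ε) * -Real.log r := by
  have h1 := h.at_zero.isLittleO.def (show 0 < 2 * ε by positivity)
  have hlt : ∀ᶠ x in 𝓝[>] (0 : ℝ), x < 1 := nhdsWithin_le_nhds (Iio_mem_nhds one_pos)
  have hpos : ∀ᶠ x in 𝓝[>] (0 : ℝ), 0 < x := self_mem_nhdsWithin
  filter_upwards [h1, hlt, hpos] with r hr1 hr2 hr3
  have hl : Real.log r < 0 := Real.log_neg hr3 hr2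
  simp only [Pi.sub_apply, Real.norm_eq_abs] at hr1
  rw [abs_of_pos (show 0 < -(1 / 2) * Real.log r by linarith), abs_le] at hr1
  constructor <;> linarith [hr1.1, hr1.2]

lemma tendsto_zero (h : IsModelFunction t u) (ht : 0 < t) : Tendsto u atTop (𝓝 0) := by
  have hx : Tendsto (fun r : ℝ => 8 * t / 3 * r ^ (3 / 2 : ℝ)) atTop atTop :=
    (tendsto_rpow_atTop (by norm_num)).const_mul_atTop (by positivity)
  have hK : Tendsto (fun r : ℝ => 1 / Real.pi * besselK0 (8 * t / 3 * r ^ (3 / 2 : ℝ))) atTop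
      (𝓝 0) := by
    have h0 : Tendsto besselK0 atTop (𝓝 0) := by
      have h2 : Tendsto (fun x : ℝ => Real.exp (1 - x)) atTop (𝓝 0) :=
        Real.tendsto_exp_atBot.comp (tendsto_const_nhds.add_atBot tendsto_neg_atTop_atBot)
      refine squeeze_zero' (Eventually.of_forall fun x => ?_) ?_ h2
      · exact integral_nonneg fun s => (Real.exp_pos _).le
      · filter_upwards [eventually_ge_atTop 1] with x hx using besselK0_le hx
    simpa using (h0.comp hx).const_mul (1 / Real.pi)
  exact h.at_top.symm.tendsto_nhds hK

/-- Comparison with the zero solution: u is positive near 0 by its logarithmic growth and tends to 0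
at infinity. -/
lemma nonneg (h : IsModelFunction t u) (ht : 0 < t) {r : ℝ} (hr : 0 < r) : 0 ≤ u r := by
  refine radial_sinhGordon_le ht (v₁ := fun _ => 0) contDiffOn_const h.smooth (by simp) h.ode ?_ ?_
    hr
  · intro ε hε
    have hlt : ∀ᶠ x in 𝓝[>] (0 : ℝ), x < 1 := nhdsWithin_le_nhds (Iio_mem_nhds one_pos)
    have hpos : ∀ᶠ x in 𝓝[>] (0 : ℝ), 0 < x := self_mem_nhdsWithin
    filter_upwards [h.eventually_log_bounds (show (0 : ℝ) < 1 / 4 by norm_num), hlt, hpos] with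
      r hr1 hr2 hr3
    have hl : Real.log r < 0 := Real.log_neg hr3 hr2
    have : 0 ≤ ε * -Real.log r := by
      have : 0 < -Real.log r := by linarith
      positivity
    linarith [hr1.1]
  · intro ε hε
    filter_upwards [(h.tendsto_zero ht).eventually (lt_mem_nhds (show -ε < 0 by linarith))] with
      r hr
    linarith

/-- Comparison with the rescaled model function for `t = 1`. -/
lemma le_rescale (h : IsModelFunction t u) (ht : 0 < t) {u₁ : ℝ → ℝ}
    (h₁ : IsModelFunction 1 u₁) {r : ℝ} (hr : 0 < r) : u r ≤ u₁ (t ^ (2 / 3 : ℝ) * r) := by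
  set s := t ^ (2 / 3 : ℝ) with hs
  have hs0 : 0 < s := Real.rpow_pos_of_pos ht _
  -- This relation makes u₁(s r) a solution of the equation with parameter t: two factors of s come
  -- from the derivatives and one from the coefficient r.
  have hs3 : s ^ 3 = t ^ 2 := by
    rw [hs, ← Real.rpow_natCast, ← Real.rpow_mul ht.le, ← Real.rpow_natCast]; norm_num
  have hmap : ∀ x : ℝ, 0 < x → 0 < s * x := fun x hx => by positivity
  have hd1 : ∀ x, 0 < x → HasDerivAt (fun r => u₁ (s * r)) (deriv u₁ (s * x) * s) x := by
    intro x hx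
    have := (hasDerivAt_two_of_contDiffOn h₁.smooth (hmap x hx)).1.comp x ((hasDerivAt_id x).const_mul s)
    simpa using! this
  have hd2 : ∀ x, 0 < x → deriv (deriv (fun r => u₁ (s * r))) x =
      deriv (deriv u₁) (s * x) * s * s := by
    intro x hx
    have h1 : deriv (fun r => u₁ (s * r)) =ᶠ[𝓝 x] fun x => deriv u₁ (s * x) * s := by
      filter_upwards [isOpen_Ioi.mem_nhds hx] with y hy using (hd1 y hy).deriv
    rw [h1.deriv_eq]
    have := ((hasDerivAt_two_of_contDiffOn h₁.smooth (hmap x hx)).2.comp x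
      ((hasDerivAt_id x).const_mul s)).mul_const s
    simpa using! this.deriv
  refine radial_sinhGordon_le ht (v₂ := fun r => u₁ (s * r)) h.smooth ?_ h.ode ?_ ?_ ?_ hr
  · exact h₁.smooth.comp (by fun_prop) fun x hx => hmap x hx
  · intro x hx
    rw [hd2 x hx, (hd1 x hx).deriv]
    have := h₁.ode (s * x) (hmap x hx)
    have e : deriv (deriv u₁) (s * x) = 8 * (s * x) * Real.sinh (2 * u₁ (s * x)) -
        1 / (s * x) * deriv u₁ (s * x) := by linarith
    rw [e, ← hs3]
    field_simp
    ring
  · intro ε hε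
    have hmapt : Tendsto (fun r => s * r) (𝓝[>] (0 : ℝ)) (𝓝[>] 0) := by
      refine tendsto_nhdsWithin_iff.2 ⟨?_, ?_⟩
      · have : Tendsto (fun r => s * r) (𝓝 (0 : ℝ)) (𝓝 (s * 0)) := (continuous_const_mul s).tendsto 0
        rw [mul_zero] at this
        exact this.mono_left nhdsWithin_le_nhds
      · filter_upwards [self_mem_nhdsWithin] with x hx using hmap x hx
    have hl : ∀ᶠ x in 𝓝[>] (0 : ℝ), Real.log x ≤ -(4 * |Real.log s| / ε) :=
      Real.tendsto_log_nhdsGT_zero.eventually (eventually_le_atBot _)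
    have hpos : ∀ᶠ x in 𝓝[>] (0 : ℝ), 0 < x := self_mem_nhdsWithin
    set δ := min (ε / 4) (1 / 4) with hδ
    have hδ0 : 0 < δ := by positivity
    have hδ1 : δ ≤ ε / 4 := min_le_left _ _
    have hδ2 : δ ≤ 1 / 4 := min_le_right _ _
    filter_upwards [h.eventually_log_bounds hδ0, hmapt.eventually (h₁.eventually_log_bounds hδ0),
      hl, hpos] with x hx1 hx2 hx3 hx4
    have h5 := hx1.2
    have h6 := hx2.1
    rw [Real.log_mul hs0.ne' hx4.ne'] at h6
    have h7 : 4 * |Real.log s| ≤ ε * -Real.log x := by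
      have : 4 * |Real.log s| / ε ≤ -Real.log x := by linarith
      calc 4 * |Real.log s| = ε * (4 * |Real.log s| / ε) := by field_simp
        _ ≤ _ := by gcongr
    have h8 : (1 / 2 - δ) * Real.log s ≤ |Real.log s| := by
      have := le_abs_self (Real.log s)
      have := abs_nonneg (Real.log s)
      nlinarith
    have h9 : 0 ≤ -Real.log x := by
      have : 0 ≤ 4 * |Real.log s| / ε := by positivity
      linarith
    nlinarith
  · intro ε hε
    have hmapt : Tendsto (fun r => s * r) atTop atTop := tendsto_id.const_mul_atTop hs0
    filter_upwards [(h.tendsto_zero ht).eventually (gt_mem_nhds hε), eventually_gt_atTop 0] with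
      x hx hx0
    have := h₁.nonneg one_pos (hmap x hx0)
    linarith

/-- The equation reads (r u')' = 8 t² r² sinh(2u) ≥ 0, so r u' is increasing. A positive value c of
it would force u to grow at least like c log r, against decay at infinity. -/
lemma deriv_nonpos (h : IsModelFunction t u) (ht : 0 < t) {r : ℝ} (hr : 0 < r) :
    deriv u r ≤ 0 ∧ ∀ x, 0 < x → x ≤ r → x * deriv u x ≤ r * deriv u r := by
  have hd : ∀ x, 0 < x → HasDerivAt (fun x => x * deriv u x)
      (8 * t ^ 2 * x ^ 2 * Real.sinh (2 * u x)) x := by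
    intro x hx
    refine ((hasDerivAt_id x).mul (hasDerivAt_two_of_contDiffOn h.smooth hx).2).congr_deriv ?_
    have := h.ode x hx
    have e : deriv (deriv u) x = 8 * t ^ 2 * x * Real.sinh (2 * u x) - 1 / x * deriv u x := by
      linarith
    rw [e]
    simp only [id]
    field_simp
    ring
  have hmono : MonotoneOn (fun x => x * deriv u x) (Set.Ioi 0) := by
    refine monotoneOn_of_deriv_nonneg (convex_Ioi 0)
      (fun x hx => (hd x hx).continuousAt.continuousWithinAt)
      (fun x hx => ((hd x (by simpa using hx)).differentiableAt).differentiableWithinAt) ?_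
    intro x hx
    have hx0 : 0 < x := by simpa using hx
    rw [(hd x hx0).deriv]
    have : 0 ≤ Real.sinh (2 * u x) := Real.sinh_nonneg_iff.2 (by linarith [h.nonneg ht hx0])
    positivity
  refine ⟨?_, fun x hx hxr => hmono hx hr hxr⟩
  by_contra hcon
  push Not at hcon
  set c := r * deriv u r with hc
  have hc0 : 0 < c := mul_pos hr hcon
  have hmono2 : MonotoneOn (fun x => u x - c * Real.log x) (Set.Ici r) := by
    have hd2 : ∀ x, 0 < x → HasDerivAt (fun x => u x - c * Real.log x)
        (deriv u x - c * x⁻¹) x := fun x hx =>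
      (hasDerivAt_two_of_contDiffOn h.smooth hx).1.sub ((Real.hasDerivAt_log hx.ne').const_mul c)
    refine monotoneOn_of_deriv_nonneg (convex_Ici r)
      (fun x hx => (hd2 x (hr.trans_le hx)).continuousAt.continuousWithinAt)
      (fun x hx => ?_) ?_
    · have hx' : r < x := by simpa using hx
      exact ((hd2 x (hr.trans hx')).differentiableAt).differentiableWithinAt
    · intro x hx
      have hx' : r < x := by simpa using hx
      have hx0 := hr.trans hx'
      rw [(hd2 x hx0).deriv]
      have h1 : c ≤ x * deriv u x := hmono hr hx0 hx'.le
      have h2 : c * x⁻¹ ≤ deriv u x := by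
        rw [← div_eq_mul_inv, div_le_iff₀ hx0]; linarith
      linarith
  have hlog : ∀ᶠ x in atTop, Real.log x ≥ (1 - (u r - c * Real.log r)) / c :=
    Real.tendsto_log_atTop.eventually (eventually_ge_atTop _)
  obtain ⟨x, ⟨hx1, hx2⟩, hx3⟩ := ((hlog.and (eventually_ge_atTop r)).and
    ((h.tendsto_zero ht).eventually (gt_mem_nhds one_pos))).exists
  have h3 := hmono2 (Set.self_mem_Ici) hx2 hx2
  simp only at h3
  have h4 : 1 - (u r - c * Real.log r) ≤ c * Real.log x := by
    rw [ge_iff_le, div_le_iff₀ hc0] at hx1; linarith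
  linarith

/-- As r u' is increasing and u' ≤ 0, the value of u' at any point of [r/2, r] is at most u'(r). The
mean value theorem on that interval and u(r) ≥ 0 give the bound. -/
lemma abs_deriv_le (h : IsModelFunction t u) (ht : 0 < t) {r : ℝ} (hr : 0 < r) :
    |deriv u r| ≤ 2 * u (r / 2) / r := by
  have hlt : r / 2 < r := by linarith
  have hr2 : 0 < r / 2 := by linarith
  obtain ⟨ξ, hξ, hξ2⟩ := exists_deriv_eq_slope u hlt
    (fun x hx => (hasDerivAt_two_of_contDiffOn h.smooth (hr2.trans_le hx.1)).1.continuousAt.continuousWithinAt)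
    (fun x hx => (hasDerivAt_two_of_contDiffOn h.smooth (hr2.trans hx.1)).1.differentiableAt.differentiableWithinAt)
  have hξ0 : 0 < ξ := hr2.trans hξ.1
  have h1 := (h.deriv_nonpos ht hr).2 ξ hξ0 hξ.2.le
  have h2 := (h.deriv_nonpos ht hr).1
  have h3 := h.nonneg ht hr
  have h5 : u r - u (r / 2) = deriv u ξ * (r / 2) := by
    rw [hξ2]; field_simp; ring
  rw [abs_of_nonpos h2, le_div_iff₀ hr]
  have h6 : deriv u ξ ≤ deriv u r := by
    by_contra hcon
    push Not at hcon
    have h7 : ξ * deriv u r ≤ ξ * deriv u ξ := by gcongr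
    have h8 : r * deriv u r ≤ ξ * deriv u r := mul_le_mul_of_nonpos_right hξ.2.le h2
    have h9 : ξ * deriv u r < ξ * deriv u ξ := by gcongr
    linarith
  nlinarith

lemma hasDerivAt_mul_deriv (h : IsModelFunction t u) {x : ℝ} (hx : 0 < x) :
    HasDerivAt (fun x => x * deriv u x) (8 * t ^ 2 * x ^ 2 * Real.sinh (2 * u x)) x := by
  refine ((hasDerivAt_id x).mul (hasDerivAt_two_of_contDiffOn h.smooth hx).2).congr_deriv ?_
  have := h.ode x hx
  have e : deriv (deriv u) x = 8 * t ^ 2 * x * Real.sinh (2 * u x) - 1 / x * deriv u x := by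
    linarith
  rw [e]
  simp only [id]
  field_simp
  ring

/-- The function v - c log is increasing on [x, r]. It turns a bound on the logarithmic derivative
into logarithmic growth at 0, to be confronted with the prescribed asymptotics. -/
lemma le_mul_log_of_le_mul_deriv {v v' : ℝ → ℝ} {c r : ℝ} (hr : 0 < r)
    (hv : ∀ x, 0 < x → HasDerivAt v (v' x) x) (hc : ∀ x, 0 < x → x ≤ r → c ≤ x * v' x) {x : ℝ}
    (hx : 0 < x) (hxr : x ≤ r) : v x ≤ c * Real.log x + (v r - c * Real.log r) := by
  have hd : ∀ x, 0 < x → HasDerivAt (fun x => v x - c * Real.log x) (v' x - c * x⁻¹) x :=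
    fun x hx => (hv x hx).sub ((Real.hasDerivAt_log hx.ne').const_mul c)
  have hmono : MonotoneOn (fun x => v x - c * Real.log x) (Set.Icc x r) := by
    refine monotoneOn_of_deriv_nonneg (convex_Icc x r)
      (fun y hy => (hd y (hx.trans_le hy.1)).continuousAt.continuousWithinAt) (fun y hy => ?_) ?_
    · rw [interior_Icc] at hy
      exact (hd y (hx.trans hy.1)).differentiableAt.differentiableWithinAt
    · intro y hy
      rw [interior_Icc] at hy
      have hy0 := hx.trans hy.1
      rw [(hd y hy0).deriv, sub_nonneg, ← div_eq_mul_inv, div_le_iff₀ hy0]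
      linarith [hc y hy0 hy.2.le]
  have := hmono ⟨le_rfl, hxr⟩ ⟨hxr, le_rfl⟩ hxr
  simp only at this
  linarith

/-- The behaviour of the logarithmic derivative at the origin. -/
lemma exists_mul_deriv_add_half_le (h : IsModelFunction t u) (ht : 0 < t) :
    ∃ δ > 0, ∃ C : ℝ, ∀ r, 0 < r → r < δ → |r * deriv u r + 1 / 2| ≤ C * r := by
  obtain ⟨δ, hδ0, hδ⟩ : ∃ δ > 0, ∀ r, 0 < r → r < δ → r < 1 ∧ u r ≤ 3 / 4 * -Real.log r := by
    have h1 := h.eventually_log_bounds (show (0 : ℝ) < 1 / 4 by norm_num)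
    have hlt : ∀ᶠ x in 𝓝[>] (0 : ℝ), x < 1 := nhdsWithin_le_nhds (Iio_mem_nhds one_pos)
    obtain ⟨δ, hδ, hsub⟩ := mem_nhdsGT_iff_exists_Ioo_subset.1 (h1.and hlt)
    refine ⟨δ, hδ, fun r h0 h1 => ?_⟩
    obtain ⟨⟨_, h3⟩, h4⟩ := hsub ⟨h0, h1⟩
    exact ⟨h4, by norm_num at h3 ⊢; linarith⟩
  refine ⟨δ, hδ0, 4 * t ^ 2, fun r hr hrδ => ?_⟩
  have hlog : ∀ K : ℝ, ∀ᶠ x in 𝓝[>] (0 : ℝ), Real.log x < K := fun K =>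
    Real.tendsto_log_nhdsGT_zero.eventually (eventually_lt_atBot _)
  have hpos : ∀ᶠ x in 𝓝[>] (0 : ℝ), 0 < x := self_mem_nhdsWithin
  have hltr : ∀ᶠ x in 𝓝[>] (0 : ℝ), x < r := nhdsWithin_le_nhds (Iio_mem_nhds hr)
  have hd1 := fun x hx => (hasDerivAt_two_of_contDiffOn h.smooth (r := x) hx).1
  -- If r u' = -1/2 - η at one radius, monotonicity gives x u' ≤ -1/2 - η at all smaller radii. Then
  -- u grows at least like (1/2 + η)(-log x), faster than its asymptotics allow.
  have hlow : 0 ≤ r * deriv u r + 1 / 2 := by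
    by_contra hcon
    set η := -(r * deriv u r + 1 / 2) with hη
    have hη0 : 0 < η := by linarith
    have hb := fun x hx hxr => le_mul_log_of_le_mul_deriv (v := fun x => -u x)
      (c := 1 / 2 + η) (x := x) hr (fun x hx => (hd1 x hx).neg) (fun x hx hxr => by
        have := (h.deriv_nonpos ht hr).2 x hx hxr
        linarith) hx hxr
    set K := -u r - (1 / 2 + η) * Real.log r
    obtain ⟨x, ⟨hx1, hx2⟩, hx3, hx4⟩ := (((hlog (-(2 * |K| / η))).and hpos).and
      (hltr.and (h.eventually_log_bounds (half_pos hη0)))).exists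
    have h1 := hb x hx2 hx3.le
    have h2 : 2 * |K| < η * -Real.log x := by
      have : 2 * |K| / η < -Real.log x := by linarith
      rw [div_lt_iff₀ hη0] at this; linarith
    have h3 := le_abs_self K
    have h4 := hx4.2
    nlinarith
  -- Near 0 the bound u ≤ -(3/4) log y gives y² sinh(2u) ≤ 1/2, hence (r u')' ≤ 4t². Thus 4t² x - x
  -- u' is increasing, and an excess η over the claimed bound would make u grow more slowly than
  -- (1/2)(-log x).
  have hup : r * deriv u r + 1 / 2 ≤ 4 * t ^ 2 * r := by
    by_contra hcon
    set η := r * deriv u r + 1 / 2 - 4 * t ^ 2 * r with hη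
    have hη0 : 0 < η := by linarith
    have hanti : MonotoneOn (fun x => 4 * t ^ 2 * x - x * deriv u x) (Set.Ioo 0 δ) := by
      have hd : ∀ x, 0 < x → HasDerivAt (fun x => 4 * t ^ 2 * x - x * deriv u x)
          (4 * t ^ 2 - 8 * t ^ 2 * x ^ 2 * Real.sinh (2 * u x)) x := fun x hx => by
        have := ((hasDerivAt_id x).const_mul (4 * t ^ 2)).sub (h.hasDerivAt_mul_deriv hx)
        simpa using! this
      refine monotoneOn_of_deriv_nonneg (convex_Ioo 0 δ)
        (fun y hy => (hd y hy.1).continuousAt.continuousWithinAt)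
        (fun y hy => ?_) ?_
      · rw [interior_Ioo] at hy
        exact (hd y hy.1).differentiableAt.differentiableWithinAt
      · intro y hy
        rw [interior_Ioo] at hy
        obtain ⟨hy0, hyδ⟩ := hy
        obtain ⟨hy1, hy2⟩ := hδ y hy0 hyδ
        rw [(hd y hy0).deriv]
        have h1 : Real.sinh (2 * u y) ≤ Real.exp (-(3 / 2) * Real.log y) / 2 := by
          rw [Real.sinh_eq]
          have := Real.exp_pos (-(2 * u y))
          have : Real.exp (2 * u y) ≤ Real.exp (-(3 / 2) * Real.log y) :=
            Real.exp_le_exp.2 (by linarith)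
          linarith
        have h2 : y ^ 2 * Real.exp (-(3 / 2) * Real.log y) ≤ 1 := by
          have : y ^ 2 = Real.exp (2 * Real.log y) := by
            rw [two_mul, Real.exp_add, Real.exp_log hy0]; ring
          rw [this, ← Real.exp_add, Real.exp_le_one_iff]
          linarith [Real.log_neg hy0 hy1]
        have h3 : y ^ 2 * Real.sinh (2 * u y) ≤ 1 / 2 := by
          have := mul_le_mul_of_nonneg_left h1 (sq_nonneg y)
          linarith
        have h4 := mul_le_mul_of_nonneg_left h3 (show 0 ≤ 8 * t ^ 2 by positivity)
        linarith
    have hb := fun x hx hxr => le_mul_log_of_le_mul_deriv (c := -(1 / 2) + η) (x := x) hr hd1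
      (fun x hx hxr => by
        have := hanti ⟨hx, hxr.trans_lt hrδ⟩ ⟨hr, hrδ⟩ hxr
        simp only at this
        have : 0 ≤ 4 * t ^ 2 * x := by positivity
        linarith) hx hxr
    set K := u r - (-(1 / 2) + η) * Real.log r
    obtain ⟨x, ⟨hx1, hx2⟩, hx3, hx4⟩ := (((hlog (-(2 * |K| / η))).and hpos).and
      (hltr.and (h.eventually_log_bounds (half_pos hη0)))).exists
    have h1 := hb x hx2 hx3.le
    have h2 : 2 * |K| < η * -Real.log x := by
      have : 2 * |K| / η < -Real.log x := by linarith
      rw [div_lt_iff₀ hη0] at this; linarith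
    have h3 := le_abs_self K
    have h4 := hx4.1
    nlinarith
  rw [abs_of_nonneg hlow]
  exact hup

/-- Bootstrapping: the equation expresses u'' through u and u', so each order of smoothness yields
the next. -/
lemma contDiffOn (h : IsModelFunction t u) : ContDiffOn ℝ ∞ u (Set.Ioi 0) := by
  refine contDiffOn_infty.2 fun n => ?_
  induction n with
  | zero => exact h.smooth.of_le (by norm_num)
  | succ n ih =>
    rcases Nat.eq_zero_or_pos n with rfl | hn
    · exact h.smooth.of_le (by norm_num)
    obtain ⟨k, rfl⟩ : ∃ k, n = k + 1 := ⟨n - 1, by omega⟩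
    have hd : ContDiffOn ℝ k (deriv u) (Set.Ioi 0) :=
      ih.deriv_of_isOpen isOpen_Ioi (by norm_cast)
    have hd2 : ContDiffOn ℝ k (deriv (deriv u)) (Set.Ioi 0) := by
      have : ContDiffOn ℝ k (fun r => 8 * t ^ 2 * r * Real.sinh (2 * u r) - 1 / r * deriv u r)
          (Set.Ioi 0) := by
        have hk : ContDiffOn ℝ k u (Set.Ioi 0) := ih.of_le (by norm_cast; omega)
        refine ((contDiffOn_const.mul contDiffOn_id).mul
          (Real.contDiff_sinh.comp_contDiffOn (contDiffOn_const.mul hk))).sub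
          ((contDiffOn_const.div contDiffOn_id fun x hx => (ne_of_gt hx)).mul hd)
      refine this.congr fun r hr => ?_
      have := h.ode r hr
      linarith
    have hd1 : ContDiffOn ℝ (k + 1) (deriv u) (Set.Ioi 0) :=
      (contDiffOn_succ_iff_deriv_of_isOpen isOpen_Ioi).2
        ⟨fun x hx => (hasDerivAt_two_of_contDiffOn h.smooth hx).2.differentiableAt.differentiableWithinAt,
          by simp, hd2⟩
    have := (contDiffOn_succ_iff_deriv_of_isOpen (n := k + 1) (f := u) isOpen_Ioi).2
        ⟨fun x hx => (hasDerivAt_two_of_contDiffOn h.smooth hx).1.differentiableAt.differentiableWithinAt,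
          by simp, hd1⟩
    exact_mod_cast this

end IsModelFunction

/-! ### Uniform exponential decay -/

/-- `f t x` decays exponentially as `t → ∞`, uniformly for `x ∈ S`. -/
def ExpSmall {X E : Type*} [Norm E] (S : Set X) (f : ℝ → X → E) : Prop :=
  ∃ c : ℝ, 0 < c ∧
    (fun p : ℝ × X => f p.1 p.2) =O[atTop ×ˢ 𝓟 S] fun p => Real.exp (-c * p.1)

/-- `f t x` is bounded for large `t`, uniformly for `x ∈ S`. -/
def EvBounded {X E : Type*} [Norm E] (S : Set X) (f : ℝ → X → E) : Prop :=
  (fun p : ℝ × X => f p.1 p.2) =O[atTop ×ˢ 𝓟 S] fun _ => (1 : ℝ)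

namespace ExpSmall

variable {X : Type*} {S : Set X}

lemma of_le {E F : Type*} [Norm E] [SeminormedAddCommGroup F] {f : ℝ → X → E} {g : ℝ → X → F} (hg : ExpSmall S g)
    (T : ℝ) (h : ∀ t, T ≤ t → ∀ x ∈ S, ‖f t x‖ ≤ ‖g t x‖) : ExpSmall S f := by
  obtain ⟨c, hc, hO⟩ := hg
  refine ⟨c, hc, IsBigO.trans (IsBigO.of_bound 1 ?_) hO⟩
  have h1 : ∀ᶠ p : ℝ × X in atTop ×ˢ 𝓟 S, T ≤ p.1 :=
    tendsto_fst.eventually (eventually_ge_atTop T)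
  have h2 : ∀ᶠ p : ℝ × X in atTop ×ˢ 𝓟 S, p.2 ∈ S :=
    tendsto_snd.eventually (mem_principal_self S)
  filter_upwards [h1, h2] with p hp1 hp2
  simpa using h p.1 hp1 p.2 hp2

lemma of_exp {E : Type*} [Norm E] {f : ℝ → X → E} {c C : ℝ} (hc : 0 < c) (T : ℝ)
    (h : ∀ t, T ≤ t → ∀ x ∈ S, ‖f t x‖ ≤ C * Real.exp (-c * t)) : ExpSmall S f := by
  refine ⟨c, hc, IsBigO.of_bound C ?_⟩
  have h1 : ∀ᶠ p : ℝ × X in atTop ×ˢ 𝓟 S, T ≤ p.1 :=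
    tendsto_fst.eventually (eventually_ge_atTop T)
  have h2 : ∀ᶠ p : ℝ × X in atTop ×ˢ 𝓟 S, p.2 ∈ S :=
    tendsto_snd.eventually (mem_principal_self S)
  filter_upwards [h1, h2] with p hp1 hp2
  rw [Real.norm_of_nonneg (Real.exp_pos _).le]
  exact h p.1 hp1 p.2 hp2

lemma exists_bound {E : Type*} [Norm E] {f : ℝ → X → E} (h : ExpSmall S f) :
    ∃ c > 0, ∃ C > 0, ∃ T > 0, ∀ t, T ≤ t → ∀ x ∈ S, ‖f t x‖ ≤ C * Real.exp (-c * t) := by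
  obtain ⟨c, hc, hO⟩ := h
  obtain ⟨C, hC, hb⟩ := hO.exists_pos
  have := hb.bound
  rw [eventually_prod_principal_iff] at this
  obtain ⟨T, hT⟩ := eventually_atTop.1 this
  refine ⟨c, hc, C, hC, max T 1, by positivity, fun t ht x hx => ?_⟩
  have := hT t ((le_max_left _ _).trans ht) x hx
  rwa [Real.norm_of_nonneg (Real.exp_pos _).le] at this

variable {E : Type*} [NormedRing E] {f g : ℝ → X → E}

lemma add (hf : ExpSmall S f) (hg : ExpSmall S g) : ExpSmall S fun t x => f t x + g t x := by
  obtain ⟨c, hc, C, hC, T, hT, hf⟩ := hf.exists_bound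
  obtain ⟨c', hc', C', hC', T', hT', hg⟩ := hg.exists_bound
  refine of_exp (c := min c c') (C := C + C') (by positivity) (max T T') fun t ht x hx => ?_
  have ht0 : 0 ≤ t := hT.le.trans ((le_max_left _ _).trans ht)
  have h1 : Real.exp (-c * t) ≤ Real.exp (-min c c' * t) :=
    Real.exp_le_exp.2 (by nlinarith [min_le_left c c'])
  have h2 : Real.exp (-c' * t) ≤ Real.exp (-min c c' * t) :=
    Real.exp_le_exp.2 (by nlinarith [min_le_right c c'])
  calc ‖f t x + g t x‖ ≤ ‖f t x‖ + ‖g t x‖ := norm_add_le _ _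
    _ ≤ C * Real.exp (-c * t) + C' * Real.exp (-c' * t) :=
      add_le_add (hf t ((le_max_left _ _).trans ht) x hx) (hg t ((le_max_right _ _).trans ht) x hx)
    _ ≤ _ := by rw [add_mul]; gcongr

lemma neg (hf : ExpSmall S f) : ExpSmall S fun t x => -f t x :=
  hf.of_le 0 fun t _ x _ => (norm_neg (f t x)).le

lemma sub (hf : ExpSmall S f) (hg : ExpSmall S g) : ExpSmall S fun t x => f t x - g t x := by
  simpa only [sub_eq_add_neg] using hf.add hg.neg

lemma bounded_mul (hg : EvBounded S g) (hf : ExpSmall S f) : ExpSmall S fun t x => g t x * f t x := by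
  obtain ⟨c, hc, hO⟩ := hf
  exact ⟨c, hc, by simpa using! IsBigO.mul hg hO⟩

lemma mul_bounded (hf : ExpSmall S f) (hg : EvBounded S g) : ExpSmall S fun t x => f t x * g t x := by
  obtain ⟨c, hc, hO⟩ := hf
  exact ⟨c, hc, by simpa using! IsBigO.mul hO hg⟩

lemma tendsto (hf : ExpSmall S f) :
    Tendsto (fun p : ℝ × X => f p.1 p.2) (atTop ×ˢ 𝓟 S) (𝓝 0) := by
  obtain ⟨c, hc, hO⟩ := hf
  refine hO.trans_tendsto ?_
  refine Tendsto.comp (g := fun t : ℝ => Real.exp (-c * t)) ?_ tendsto_fst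
  refine Real.tendsto_exp_atBot.comp ?_
  exact tendsto_id.const_mul_atTop_of_neg (by linarith)

/-- Half of the rate pays for the polynomial factor: t² ≤ (8/c²) e^{ct/2}. -/
lemma sq_mul {f : ℝ → X → ℝ} (hf : ExpSmall S f) : ExpSmall S fun t x => t ^ 2 * f t x := by
  obtain ⟨c, hc, C, hC, T, hT, hf⟩ := hf.exists_bound
  refine of_exp (c := c / 2) (C := 8 / c ^ 2 * C) (by positivity) T fun t ht x hx => ?_
  have ht0 : 0 < t := hT.trans_le ht
  have h1 : t ^ 2 ≤ 8 / c ^ 2 * Real.exp (c / 2 * t) := by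
    have := Real.quadratic_le_exp_of_nonneg (show 0 ≤ c / 2 * t by positivity)
    have h2 : (c / 2 * t) ^ 2 / 2 ≤ Real.exp (c / 2 * t) := by nlinarith
    calc t ^ 2 = 8 / c ^ 2 * ((c / 2 * t) ^ 2 / 2) := by field_simp; ring
      _ ≤ _ := by gcongr
  rw [norm_mul, Real.norm_of_nonneg (sq_nonneg t)]
  calc t ^ 2 * ‖f t x‖ ≤ (8 / c ^ 2 * Real.exp (c / 2 * t)) * (C * Real.exp (-c * t)) := by
        gcongr; exact hf t ht x hx
    _ = 8 / c ^ 2 * C * (Real.exp (c / 2 * t) * Real.exp (-c * t)) := by ring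
    _ = _ := by rw [← Real.exp_add]; congr 2; ring

/-- The argument tends to 0 uniformly, and sinh x = O(x) at 0. -/
lemma sinh {f : ℝ → X → ℝ} (hf : ExpSmall S f) : ExpSmall S fun t x => Real.sinh (f t x) := by
  have h1 : Real.sinh =O[𝓝 0] fun x : ℝ => x := by
    have := (Real.hasDerivAt_sinh 0).differentiableAt.isBigO_sub
    simpa using! this
  have h2 := h1.comp_tendsto hf.tendsto
  obtain ⟨c, hc, hO⟩ := hf
  exact ⟨c, hc, h2.trans hO⟩

lemma cosh {f : ℝ → X → ℝ} (hf : ExpSmall S f) : EvBounded S fun t x => Real.cosh (f t x) := by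
  have : Tendsto (fun p : ℝ × X => Real.cosh (f p.1 p.2)) (atTop ×ˢ 𝓟 S) (𝓝 (Real.cosh 0)) :=
    (Real.continuous_cosh.tendsto 0).comp hf.tendsto
  exact this.isBigO_one ℝ

lemma evBounded_of_bound {E : Type*} [Norm E] {g : ℝ → X → E} (C : ℝ)
    (h : ∀ t, ∀ x ∈ S, ‖g t x‖ ≤ C) : EvBounded S g := by
  refine IsBigO.of_bound C ?_
  rw [eventually_prod_principal_iff]
  exact Eventually.of_forall fun t x hx => by simpa using h t x hx

end ExpSmall

/-- Since u_t(r) ≤ u₁(t^{2/3} r) and (t^{2/3})^{3/2} = t, the bound u₁(x) ≤ exp(1 - (8/3) x^{3/2})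
for large x becomes exponential decay in t, at a rate fixed by the smallest radius. -/
lemma expSmall_modelFunction {u : ℝ → ℝ → ℝ} (hu : ∀ t, 0 < t → IsModelFunction t (u t)) {r₁ : ℝ}
    (hr₁ : 0 < r₁) :
    ExpSmall (Set.Ici r₁) u := by
  have h₁ := hu 1 one_pos
  obtain ⟨X, hX⟩ : ∃ X : ℝ, ∀ x, X ≤ x → u 1 x ≤ Real.exp (1 - 8 / 3 * x ^ (3 / 2 : ℝ)) := by
    have h2 := h₁.at_top.isLittleO.def (show (0 : ℝ) < 1 by norm_num)
    have hx : Tendsto (fun r : ℝ => 8 * 1 / 3 * r ^ (3 / 2 : ℝ)) atTop atTop :=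
      (tendsto_rpow_atTop (by norm_num)).const_mul_atTop (by norm_num)
    obtain ⟨X, hX⟩ := eventually_atTop.1 (h2.and (hx.eventually_ge_atTop 1))
    refine ⟨X, fun x hx => ?_⟩
    obtain ⟨h3, h4⟩ := hX x hx
    have h5 := besselK0_le h4
    set K := besselK0 (8 * 1 / 3 * x ^ (3 / 2 : ℝ))
    have hK : 0 ≤ K := integral_nonneg fun s => (Real.exp_pos _).le
    have hpi : 1 / Real.pi ≤ 1 / 2 := by
      have := Real.two_le_pi
      gcongr
    simp only [Pi.sub_apply, Real.norm_eq_abs, one_mul] at h3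
    rw [abs_of_nonneg (show 0 ≤ 1 / Real.pi * K by positivity), abs_le] at h3
    have h6 : 1 / Real.pi * K ≤ 1 / 2 * K := by gcongr
    rw [show (8 : ℝ) * 1 / 3 = 8 / 3 by norm_num] at h5
    have h7 : u 1 x - 1 / Real.pi * K ≤ 1 / Real.pi * K := h3.2
    linarith
  have hlim : Tendsto (fun t : ℝ => t ^ (2 / 3 : ℝ) * r₁) atTop atTop :=
    (tendsto_rpow_atTop (by norm_num)).atTop_mul_const hr₁
  obtain ⟨T, hT⟩ := eventually_atTop.1 ((hlim.eventually_ge_atTop X).and (eventually_gt_atTop 0))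
  refine ExpSmall.of_exp (c := 8 / 3 * r₁ ^ (3 / 2 : ℝ)) (C := Real.exp 1) (by positivity) T
    fun t ht r hr => ?_
  obtain ⟨hT1, hT0⟩ := hT t ht
  have hr : r₁ ≤ r := hr
  have hr0 : 0 < r := hr₁.trans_le hr
  have hs : 0 < t ^ (2 / 3 : ℝ) := by positivity
  have hm : t ^ (2 / 3 : ℝ) * r₁ ≤ t ^ (2 / 3 : ℝ) * r := by gcongr
  rw [Real.norm_of_nonneg ((hu t hT0).nonneg hT0 hr0)]
  refine ((hu t hT0).le_rescale hT0 h₁ hr0).trans ((hX _ (hT1.trans hm)).trans ?_)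
  rw [← Real.exp_add, Real.exp_le_exp, Real.mul_rpow hs.le hr0.le, ← Real.rpow_mul hT0.le]
  norm_num
  have : r₁ ^ (3 / 2 : ℝ) ≤ r ^ (3 / 2 : ℝ) := by gcongr
  have : t * r₁ ^ (3 / 2 : ℝ) ≤ t * r ^ (3 / 2 : ℝ) := by gcongr
  linarith

/-- The gradient bound involves u at half the radius, hence the decay is used from r₁/2 on. -/
lemma expSmall_deriv_modelFunction {u : ℝ → ℝ → ℝ} (hu : ∀ t, 0 < t → IsModelFunction t (u t))
    {r₁ : ℝ} (hr₁ : 0 < r₁) : ExpSmall (Set.Ici r₁) fun t => deriv (u t) := by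
  obtain ⟨c, hc, C, hC, T, hT, h⟩ := (expSmall_modelFunction hu (half_pos hr₁)).exists_bound
  refine ExpSmall.of_exp (c := c) (C := 2 / r₁ * C) hc T fun t ht r hr => ?_
  have hr : r₁ ≤ r := hr
  have hr0 : 0 < r := hr₁.trans_le hr
  have ht0 := hT.trans_le ht
  refine ((hu t ht0).abs_deriv_le ht0 hr0).trans ?_
  have h1 := (le_abs_self _).trans (h t ht (r / 2) (by simp only [Set.mem_Ici]; linarith))
  calc 2 * u t (r / 2) / r ≤ 2 * (C * Real.exp (-c * t)) / r₁ := by gcongr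
    _ = _ := by ring

/-! ### Holomorphic functions on disks -/

/-- A primitive L of f'/f exists on the disk, and f e^{-L} has derivative zero. -/
lemma exists_exp_eq_of_ne_zero {f : ℂ → ℂ} {R : ℝ} (hf : DifferentiableOn ℂ f (Metric.ball 0 R))
    (h0 : ∀ w ∈ Metric.ball (0 : ℂ) R, f w ≠ 0) :
    ∃ L : ℂ → ℂ, DifferentiableOn ℂ L (Metric.ball 0 R) ∧
      ∀ w ∈ Metric.ball (0 : ℂ) R, Complex.exp (L w) = f w := by
  rcases le_or_gt R 0 with hR | hR
  · exact ⟨0, by simp [Metric.ball_eq_empty.2 hR], by simp [Metric.ball_eq_empty.2 hR]⟩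
  have h1 : DifferentiableOn ℂ (fun w => deriv f w / f w) (Metric.ball 0 R) :=
    (hf.deriv Metric.isOpen_ball).div hf h0
  obtain ⟨L, hL⟩ := h1.isExactOn_ball
  obtain ⟨c, hc⟩ : ∃ c : ℂ, Complex.exp c = f 0 :=
    ⟨Complex.log (f 0), Complex.exp_log (h0 0 (Metric.mem_ball_self hR))⟩
  have hd : ∀ w ∈ Metric.ball (0 : ℂ) R,
      HasDerivAt (fun w => f w * Complex.exp (-L w)) 0 w := by
    intro w hw
    have h2 := (hf.differentiableAt (Metric.isOpen_ball.mem_nhds hw)).hasDerivAt.mul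
      (hL w hw).neg.cexp
    refine h2.congr_deriv ?_
    have := h0 w hw
    field_simp
    ring
  have hconst : ∀ w ∈ Metric.ball (0 : ℂ) R,
      f w * Complex.exp (-L w) = f 0 * Complex.exp (-L 0) := by
    intro w hw
    exact Metric.isOpen_ball.is_const_of_deriv_eq_zero (convex_ball 0 R).isPreconnected
      (fun x hx => (hd x hx).differentiableAt.differentiableWithinAt)
      (fun x hx => (hd x hx).deriv) hw (Metric.mem_ball_self hR)
  refine ⟨fun w => c + (L w - L 0), fun w hw => ?_, fun w hw => ?_⟩
  · exact ((hL w hw).sub_const _ |>.const_add _).differentiableAt.differentiableWithinAt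
  · have h3 := hconst w hw
    rw [Complex.exp_add, hc, Complex.exp_sub]
    rw [Complex.exp_neg, Complex.exp_neg] at h3
    have e1 := Complex.exp_ne_zero (L w)
    have e2 := Complex.exp_ne_zero (L 0)
    field_simp at h3 ⊢
    linear_combination -h3

lemma exists_pow_eq_of_ne_zero {f : ℂ → ℂ} {R : ℝ} (hf : DifferentiableOn ℂ f (Metric.ball 0 R))
    (h0 : ∀ w ∈ Metric.ball (0 : ℂ) R, f w ≠ 0) {p : ℕ} (hp : p ≠ 0) :
    ∃ k : ℂ → ℂ, DifferentiableOn ℂ k (Metric.ball 0 R) ∧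
      ∀ w ∈ Metric.ball (0 : ℂ) R, k w ≠ 0 ∧ k w ^ p = f w := by
  obtain ⟨L, hL, hLe⟩ := exists_exp_eq_of_ne_zero hf h0
  refine ⟨fun w => Complex.exp (L w / p), (hL.div_const _).cexp, fun w hw =>
    ⟨Complex.exp_ne_zero _, ?_⟩⟩
  rw [← Complex.exp_nat_mul, ← hLe w hw]
  congr 1
  field_simp

lemma cpow_half_sq (w : ℂ) : (w ^ (1 / 2 : ℂ)) ^ 2 = w := by
  have := Complex.cpow_nat_inv_pow w (n := 2) (by norm_num)
  rwa [Nat.cast_ofNat, inv_eq_one_div] at this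

lemma mem_ball_sq {r : ℝ} {s : ℂ} (hs : s ∈ Metric.ball (0 : ℂ) r) :
    s ^ 2 ∈ Metric.ball (0 : ℂ) (r ^ 2) := by
  rw [mem_ball_zero_iff] at hs ⊢
  rw [norm_pow]
  gcongr

/-- An even holomorphic function of `s` is a holomorphic function of `s²`. -/
lemma exists_comp_sq_of_even {g : ℂ → ℂ} {r : ℝ} (hr : 0 < r)
    (hg : DifferentiableOn ℂ g (Metric.ball 0 r))
    (heven : ∀ s ∈ Metric.ball (0 : ℂ) r, g (-s) = g s) :
    ∃ h : ℂ → ℂ, DifferentiableOn ℂ h (Metric.ball 0 (r ^ 2)) ∧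
      ∀ s ∈ Metric.ball (0 : ℂ) r, h (s ^ 2) = g s := by
  have hsqrt := cpow_half_sq
  have hnorm : ∀ w : ℂ, ‖w ^ (1 / 2 : ℂ)‖ ^ 2 = ‖w‖ := fun w => by
    rw [← norm_pow, hsqrt]
  have hmem : ∀ w ∈ Metric.ball (0 : ℂ) (r ^ 2), w ^ (1 / 2 : ℂ) ∈ Metric.ball (0 : ℂ) r := by
    intro w hw
    rw [mem_ball_zero_iff] at hw ⊢
    rw [← hnorm] at hw
    exact lt_of_pow_lt_pow_left₀ 2 hr.le hw
  set h : ℂ → ℂ := fun w => g (w ^ (1 / 2 : ℂ)) with hh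
  have hkey : ∀ s ∈ Metric.ball (0 : ℂ) r, h (s ^ 2) = g s := by
    intro s hs
    have h1 : ((s ^ 2) ^ (1 / 2 : ℂ)) ^ 2 = s ^ 2 := hsqrt _
    rcases sq_eq_sq_iff_eq_or_eq_neg.1 h1 with h2 | h2
    · simp only [hh, h2]
    · simp only [hh, h2, heven s hs]
  refine ⟨h, ?_, hkey⟩
  have hoff : ∀ w ∈ Metric.ball (0 : ℂ) (r ^ 2), w ≠ 0 → DifferentiableAt ℂ h w := by
    intro w hw hw0
    set s := w ^ (1 / 2 : ℂ) with hs
    have hs2 : s ^ 2 = w := hsqrt w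
    have hsb := hmem w hw
    -- The principal root jumps along the negative axis. b is a branch holomorphic near w through
    -- the same value s, and evenness of g makes h independent of the branch.
    set b : ℂ → ℂ := fun x => s * (x / w) ^ (1 / 2 : ℂ) with hb
    have hbd : DifferentiableAt ℂ b w := by
      refine DifferentiableAt.const_mul (DifferentiableAt.cpow_const ?_ ?_) s
      · fun_prop
      · rw [div_self hw0]; simp
    have hbw : b w = s := by simp [hb, div_self hw0]
    have hb2 : ∀ x, b x ^ 2 = x := fun x => by
      simp only [hb, mul_pow, hs2, hsqrt]
      field_simp
    have hbmem : ∀ᶠ x in 𝓝 w, b x ∈ Metric.ball (0 : ℂ) r :=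
      hbd.continuousAt.eventually (Metric.isOpen_ball.mem_nhds (by rw [hbw]; exact hsb))
    have heq : h =ᶠ[𝓝 w] fun x => g (b x) := by
      filter_upwards [hbmem] with x hx
      rw [← hkey _ hx, hb2]
    refine DifferentiableAt.congr_of_eventuallyEq ?_ heq
    refine DifferentiableAt.comp w ?_ hbd
    rw [hbw]
    exact hg.differentiableAt (Metric.isOpen_ball.mem_nhds hsb)
  have hnhds : Metric.ball (0 : ℂ) (r ^ 2) ∈ 𝓝 (0 : ℂ) := Metric.ball_mem_nhds _ (by positivity)
  refine (Complex.differentiableOn_compl_singleton_and_continuousAt_iff hnhds).1 ⟨?_, ?_⟩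
  · exact fun w hw => (hoff w hw.1 hw.2).differentiableWithinAt
  · have h1 : ContinuousAt g 0 :=
      (hg.differentiableAt (Metric.ball_mem_nhds 0 hr)).continuousAt
    have h2 : Tendsto (fun w : ℂ => w ^ (1 / 2 : ℂ)) (𝓝 0) (𝓝 0) := by
      rw [tendsto_zero_iff_norm_tendsto_zero]
      have h3 : ∀ w : ℂ, ‖w ^ (1 / 2 : ℂ)‖ = Real.sqrt ‖w‖ := fun w => by
        rw [← hnorm w, Real.sqrt_sq (norm_nonneg _)]
      simp only [h3]
      have : Tendsto (fun w : ℂ => Real.sqrt ‖w‖) (𝓝 0) (𝓝 (Real.sqrt ‖(0 : ℂ)‖)) :=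
        (Real.continuous_sqrt.comp continuous_norm).tendsto 0
      simpa using this
    have h4 : h 0 = g 0 := by
      have := hkey 0 (Metric.mem_ball_self hr)
      simpa using this
    unfold ContinuousAt
    rw [h4]
    exact h1.tendsto.comp h2

/-- Even and odd parts of a holomorphic function of `s`, as functions of `s²`. -/
lemma exists_even_odd {f : ℂ → ℂ} {r : ℝ} (hr : 0 < r)
    (hf : DifferentiableOn ℂ f (Metric.ball 0 r)) :
    ∃ f₀ f₁ : ℂ → ℂ, DifferentiableOn ℂ f₀ (Metric.ball 0 (r ^ 2)) ∧
      DifferentiableOn ℂ f₁ (Metric.ball 0 (r ^ 2)) ∧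
      ∀ s ∈ Metric.ball (0 : ℂ) r, f s = f₀ (s ^ 2) + s * f₁ (s ^ 2) := by
  have hneg : DifferentiableOn ℂ (fun s => f (-s)) (Metric.ball 0 r) :=
    hf.comp (differentiableOn_neg _) fun s hs => by simpa using hs
  obtain ⟨f₀, hf₀, h₀⟩ := exists_comp_sq_of_even (g := fun s => (f s + f (-s)) / 2) hr
    ((hf.add hneg).div_const 2) fun s _ => by simp only [neg_neg]; ring
  set o : ℂ → ℂ := fun s => (f s - f (-s)) / 2 with ho
  have hodd : ∀ s, o (-s) = -o s := fun s => by simp only [ho, neg_neg]; ring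
  have ho0 : o 0 = 0 := by simp [ho]
  have hod : DifferentiableOn ℂ o (Metric.ball 0 r) := (hf.sub hneg).div_const 2
  have hds : DifferentiableOn ℂ (dslope o 0) (Metric.ball 0 r) :=
    (Complex.differentiableOn_dslope (Metric.ball_mem_nhds 0 hr)).2 hod
  have hmul : ∀ s, s * dslope o 0 s = o s := fun s => by
    have := sub_smul_dslope o 0 s
    simpa [ho0] using this
  obtain ⟨f₁, hf₁, h₁⟩ := exists_comp_sq_of_even (g := dslope o 0) hr hds fun s _ => by
    rcases eq_or_ne s 0 with rfl | hs
    · simp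
    · have e1 := hmul s
      have e2 := hmul (-s)
      rw [hodd, ← e1] at e2
      have : s * (dslope o 0 (-s) - dslope o 0 s) = 0 := by linear_combination -e2
      exact sub_eq_zero.1 ((mul_eq_zero.1 this).resolve_left hs)
  refine ⟨f₀, f₁, hf₀, hf₁, fun s hs => ?_⟩
  rw [h₀ s hs, h₁ s hs, hmul]
  simp only [ho]; ring

/-- With w = s² the equation says that s b(s²) is a primitive of 2 f(s²) in s. So b is read off from
the odd part of any primitive. -/
lemma exists_mul_deriv_add_half_mul_eq {f : ℂ → ℂ} {R : ℝ} (hR : 0 < R)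
    (hf : DifferentiableOn ℂ f (Metric.ball 0 R)) :
    ∃ b : ℂ → ℂ, DifferentiableOn ℂ b (Metric.ball 0 R) ∧
      ∀ w ∈ Metric.ball (0 : ℂ) R, w * deriv b w + 1 / 2 * b w = f w := by
  set r := Real.sqrt R with hr
  have hr0 : 0 < r := Real.sqrt_pos.2 hR
  have hr2 : r ^ 2 = R := Real.sq_sqrt hR.le
  have h1 : DifferentiableOn ℂ (fun s => 2 * f (s ^ 2)) (Metric.ball 0 r) := by
    refine DifferentiableOn.const_mul (hf.comp (by fun_prop) fun s hs => ?_) 2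
    rw [← hr2]; exact mem_ball_sq hs
  obtain ⟨G, hG⟩ := h1.isExactOn_ball
  have hGd : DifferentiableOn ℂ G (Metric.ball 0 r) := fun s hs =>
    (hG s hs).differentiableAt.differentiableWithinAt
  obtain ⟨G₀, b, hG₀, hb, hGb⟩ := exists_even_odd hr0 hGd
  rw [hr2] at hG₀ hb
  refine ⟨b, hb, ?_⟩
  have hder : ∀ s ∈ Metric.ball (0 : ℂ) r,
      2 * s * deriv G₀ (s ^ 2) + b (s ^ 2) + 2 * s ^ 2 * deriv b (s ^ 2) = 2 * f (s ^ 2) := by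
    intro s hs
    have hs2 : s ^ 2 ∈ Metric.ball (0 : ℂ) R := by rw [← hr2]; exact mem_ball_sq hs
    have hsq : HasDerivAt (fun s : ℂ => s ^ 2) (2 * s) s := by simpa using hasDerivAt_pow 2 s
    have d0 := (hG₀.differentiableAt (Metric.isOpen_ball.mem_nhds hs2)).hasDerivAt.comp s hsq
    have d1 := (hasDerivAt_id s).mul
      ((hb.differentiableAt (Metric.isOpen_ball.mem_nhds hs2)).hasDerivAt.comp s hsq)
    have d2 : HasDerivAt G (deriv G₀ (s ^ 2) * (2 * s) + (1 * b (s ^ 2) +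
        s * (deriv b (s ^ 2) * (2 * s)))) s := by
      refine (d0.add d1).congr_of_eventuallyEq ?_
      filter_upwards [Metric.isOpen_ball.mem_nhds hs] with x hx using hGb x hx
    have := d2.unique (hG s hs)
    linear_combination this
  intro w hw
  set s := w ^ (1 / 2 : ℂ) with hs
  have hs2 : s ^ 2 = w := cpow_half_sq w
  have hsb : s ∈ Metric.ball (0 : ℂ) r := by
    rw [mem_ball_zero_iff] at hw ⊢
    rw [← hs2, norm_pow, ← hr2] at hw
    exact lt_of_pow_lt_pow_left₀ 2 hr0.le hw
  have e1 := hder s hsb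
  have e2 := hder (-s) (by simpa using hsb)
  rw [neg_sq, hs2] at e2
  rw [hs2] at e1
  linear_combination e1 / 4 + e2 / 4

/-- The solution G of the previous equation with right-hand side w f vanishes at 0. Writing G = w b
turns w G' + G/2 into w (w b' + 3b/2), and w is cancelled, at the origin by continuity. -/
lemma exists_mul_deriv_add_three_halves_mul_eq {f : ℂ → ℂ} {R : ℝ} (hR : 0 < R)
    (hf : DifferentiableOn ℂ f (Metric.ball 0 R)) :
    ∃ b : ℂ → ℂ, DifferentiableOn ℂ b (Metric.ball 0 R) ∧
      ∀ w ∈ Metric.ball (0 : ℂ) R, w * deriv b w + 3 / 2 * b w = f w := by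
  obtain ⟨G, hG, hGe⟩ := exists_mul_deriv_add_half_mul_eq hR (f := fun w => w * f w)
    (differentiableOn_id.mul hf)
  have h0 : G 0 = 0 := by simpa using hGe 0 (Metric.mem_ball_self hR)
  set b := dslope G 0 with hb
  have hbd : DifferentiableOn ℂ b (Metric.ball 0 R) :=
    (Complex.differentiableOn_dslope (Metric.ball_mem_nhds 0 hR)).2 hG
  have hmul : ∀ s, G s = s * b s := fun s => by
    have := sub_smul_dslope G 0 s
    simpa [h0] using this.symm
  have hoff : ∀ w ∈ Metric.ball (0 : ℂ) R, w ≠ 0 → w * deriv b w + 3 / 2 * b w = f w := by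
    intro w hw hw0
    have hd : HasDerivAt G (1 * b w + w * deriv b w) w := by
      have := (hasDerivAt_id w).mul
        (hbd.differentiableAt (Metric.isOpen_ball.mem_nhds hw)).hasDerivAt
      exact this.congr_of_eventuallyEq (Eventually.of_forall hmul)
    have h1 := hGe w hw
    rw [hd.deriv, hmul] at h1
    have : w * (w * deriv b w + 3 / 2 * b w - f w) = 0 := by linear_combination h1
    exact sub_eq_zero.1 ((mul_eq_zero.1 this).resolve_left hw0)
  refine ⟨b, hbd, fun w hw => ?_⟩
  rcases eq_or_ne w 0 with rfl | hw0
  · have hnh : Metric.ball (0 : ℂ) R ∈ 𝓝 (0 : ℂ) := Metric.isOpen_ball.mem_nhds hw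
    have hc1 : ContinuousAt (fun w => w * deriv b w + 3 / 2 * b w) 0 :=
      (continuousAt_id.mul ((hbd.deriv Metric.isOpen_ball).differentiableAt hnh).continuousAt).add
        (continuousAt_const.mul (hbd.differentiableAt hnh).continuousAt)
    have hc2 : ContinuousAt f 0 := (hf.differentiableAt hnh).continuousAt
    have heq : (fun w => w * deriv b w + 3 / 2 * b w) =ᶠ[𝓝[≠] 0] f := by
      filter_upwards [nhdsWithin_le_nhds hnh, self_mem_nhdsWithin] with w hw hw0
        using hoff w hw hw0
    exact tendsto_nhds_unique
      ((hc1.tendsto.mono_left nhdsWithin_le_nhds).congr' heq)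
      (hc2.tendsto.mono_left nhdsWithin_le_nhds)
  · exact hoff w hw hw0

/-! ### Maximum principle with an isolated singularity -/

open InnerProductSpace in
lemma dw_dwbar_eq_laplacian {f : ℂ → ℂ} {w : ℂ} (hf : ContDiffAt ℝ 2 f w) :
    dw (dwbar f) w = 1 / 4 * Laplacian.laplacian f w := by
  have hd : DifferentiableAt ℝ (fderiv ℝ f) w :=
    (hf.fderiv_right (m := 1) (by norm_num)).differentiableAt (by norm_num)
  have h1 : ∀ v, HasFDerivAt (fun x => fderiv ℝ f x v) ((fderiv ℝ (fderiv ℝ f) w).flip v) w :=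
    fun v => by
      have := hd.hasFDerivAt.clm_apply (hasFDerivAt_const v w)
      refine this.congr_fderiv ?_
      ext u; simp
  have h2 : HasFDerivAt (dwbar f) ((1 / 2 : ℂ) • ((fderiv ℝ (fderiv ℝ f) w).flip 1 +
      Complex.I • (fderiv ℝ (fderiv ℝ f) w).flip Complex.I)) w :=
    ((h1 1).add ((h1 Complex.I).const_mul Complex.I)).const_mul (1 / 2 : ℂ)
  have hsymm := (hf.isSymmSndFDerivAt (by simp)).eq 1 Complex.I
  rw [dw, h2.fderiv, laplacian_eq_iteratedFDeriv_complexPlane]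
  simp only [iteratedFDeriv_two_apply, _root_.smul_apply,
    _root_.add_apply, ContinuousLinearMap.flip_apply, smul_eq_mul,
    Matrix.cons_val_zero, Matrix.cons_val_one]
  rw [hsymm]
  linear_combination (-(1 / 4) * (fderiv ℝ (fderiv ℝ f) w) Complex.I Complex.I) * Complex.I_sq

open InnerProductSpace in
lemma laplacian_nonpos_of_isLocalMax {f : ℂ → ℝ} {w : ℂ} (hf : ContDiffAt ℝ 2 f w)
    (hmax : IsLocalMax f w) : Laplacian.laplacian f w ≤ 0 := by
  have key : ∀ v : ℂ, fderiv ℝ (fderiv ℝ f) w v v ≤ 0 := by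
    intro v
    by_contra hcon
    push Not at hcon
    set l : ℝ → ℂ := fun s => w + s • v with hl
    have hl0 : l 0 = w := by simp [hl]
    have hld : ∀ s, HasDerivAt l v s := fun s => by
      have := ((hasDerivAt_id s).smul_const v).const_add w
      rw [one_smul] at this
      exact this
    have hlc : Tendsto l (𝓝 0) (𝓝 w) := by
      have := (hld 0).continuousAt.tendsto
      rwa [hl0] at this
    have hev : ∀ᶠ x in 𝓝 w, DifferentiableAt ℝ f x := by
      filter_upwards [hf.eventually (by simp)] with x hx using hx.differentiableAt (by norm_num)
    have h1 : deriv (fun s => f (l s)) =ᶠ[𝓝 0] fun s => fderiv ℝ f (l s) v := by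
      filter_upwards [hlc.eventually hev] with s hs
      exact (hs.hasFDerivAt.comp_hasDerivAt s (hld s)).deriv
    have hd : DifferentiableAt ℝ (fderiv ℝ f) w :=
      (hf.fderiv_right (m := 1) (by norm_num)).differentiableAt (by norm_num)
    have h2 : HasDerivAt (fun s => fderiv ℝ f (l s) v) (fderiv ℝ (fderiv ℝ f) w v v) 0 := by
      have h3 : HasFDerivAt (fderiv ℝ f) (fderiv ℝ (fderiv ℝ f) w) (l 0) := by
        rw [hl0]; exact hd.hasFDerivAt
      have := (h3.comp_hasDerivAt 0 (hld 0)).clm_apply (hasDerivAt_const 0 v)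
      simpa using! this
    have hc : ContinuousAt (fun s => f (l s)) 0 := by
      have : ContinuousAt f (l 0) := by rw [hl0]; exact hf.continuousAt
      exact this.comp (hld 0).continuousAt
    refine not_isLocalMax_of_deriv_deriv_pos hc (by rw [h1.deriv_eq, h2.deriv]; exact hcon) ?_
    have := hlc.eventually hmax
    filter_upwards [this] with s hs
    rw [hl0]; exact hs
  rw [laplacian_eq_iteratedFDeriv_complexPlane]
  simp only [iteratedFDeriv_two_apply, Matrix.cons_val_zero, Matrix.cons_val_one]
  linarith [key 1, key Complex.I]

open InnerProductSpace in
/-- Maximum principle on a bounded open set punctured at the origin. -/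
lemma le_of_laplacian_pos {Ω : Set ℂ} (hΩ : IsOpen Ω) (hbd : Bornology.IsBounded Ω) {f : ℂ → ℝ}
    {M B : ℝ} (hc : ContinuousOn f (closure Ω \ {0}))
    (h2 : ∀ w ∈ Ω, w ≠ 0 → ContDiffAt ℝ 2 f w) (hB : ∀ᶠ w in 𝓝[≠] (0 : ℂ), f w ≤ B)
    (hfr : ∀ w ∈ frontier Ω, w ≠ 0 → f w ≤ M)
    (hpos : ∀ w ∈ Ω, w ≠ 0 → M < f w → 0 < Laplacian.laplacian f w) {w : ℂ} (hw : w ∈ Ω)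
    (hw0 : w ≠ 0) : f w ≤ M := by
  by_contra hcon
  push Not at hcon
  obtain ⟨R, hR0, hR⟩ : ∃ R > 0, ∀ x ∈ closure Ω, ‖x‖ ≤ R := by
    obtain ⟨R, hR⟩ := hbd.closure.exists_norm_le
    exact ⟨max R 1, by positivity, fun x hx => (hR x hx).trans (le_max_left _ _)⟩
  have hlogw : Real.log ‖w‖ ≤ Real.log R :=
    Real.log_le_log (norm_pos_iff.2 hw0) (hR w (subset_closure hw))
  set ε := (f w - M) / (2 * (Real.log R - Real.log ‖w‖ + 1)) with hε
  have hden : 0 < 2 * (Real.log R - Real.log ‖w‖ + 1) := by linarith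
  have hε0 : 0 < ε := div_pos (by linarith) hden
  -- The added term is harmonic, nonpositive on the closure of Ω and tends to -∞ at 0. So g has the
  -- Laplacian of f and cannot exceed M near the puncture, while ε is small enough to keep g(w) > M.
  -- The maximum of g is then an interior point off 0, where the Laplacian of f is positive: a
  -- contradiction.
  set g : ℂ → ℝ := fun x => f x + ε * (Real.log ‖x‖ - Real.log R) with hg
  have hgw : M < g w := by
    have h5 : ε * (2 * (Real.log R - Real.log ‖w‖ + 1)) = f w - M := div_mul_cancel₀ _ hden.ne'
    simp only [hg]
    nlinarith
  have hgf : ∀ x ∈ closure Ω, x ≠ 0 → g x ≤ f x := by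
    intro x hx hx0
    have : Real.log ‖x‖ ≤ Real.log R := Real.log_le_log (norm_pos_iff.2 hx0) (hR x hx)
    have : ε * (Real.log ‖x‖ - Real.log R) ≤ 0 :=
      mul_nonpos_of_nonneg_of_nonpos hε0.le (by linarith)
    simp only [hg]; linarith
  obtain ⟨δ, hδ0, hδw, hδ⟩ : ∃ δ > 0, δ < ‖w‖ ∧ ∀ x, x ≠ 0 → ‖x‖ ≤ δ → g x ≤ M := by
    have hl : Tendsto (fun x : ℂ => Real.log ‖x‖) (𝓝[≠] 0) atBot :=
      Real.tendsto_log_nhdsGT_zero.comp tendsto_norm_nhdsNE_zero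
    have hl2 := hl.eventually (eventually_le_atBot (Real.log R + (M - B) / ε))
    have := eventually_nhdsWithin_iff.1 (hB.and hl2)
    obtain ⟨δ, hδ0, hδ⟩ := Metric.eventually_nhds_iff.1 this
    refine ⟨min (δ / 2) (‖w‖ / 2), lt_min (by positivity) (half_pos (norm_pos_iff.2 hw0)),
      (min_le_right _ _).trans_lt (half_lt_self (norm_pos_iff.2 hw0)), fun x hx0 hx => ?_⟩
    have hxδ : dist x 0 < δ := by
      rw [dist_zero_right]
      exact (hx.trans (min_le_left _ _)).trans_lt (by linarith)
    obtain ⟨h6, h7⟩ := hδ hxδ hx0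
    have h8 : ε * (Real.log ‖x‖ - Real.log R) ≤ ε * ((M - B) / ε) := by
      gcongr; linarith
    rw [mul_div_cancel₀ _ hε0.ne'] at h8
    simp only [hg]; linarith
  set K := closure Ω \ Metric.ball 0 δ with hK
  have hKc : IsCompact K := hbd.isCompact_closure.diff Metric.isOpen_ball
  have hK0 : ∀ x ∈ K, x ≠ 0 := fun x hx h => hx.2 (h ▸ Metric.mem_ball_self hδ0)
  have hwK : w ∈ K := ⟨subset_closure hw, by simp [hδw.le]⟩
  have hgc : ContinuousOn g K := by
    refine (hc.mono fun x hx => ⟨hx.1, hK0 x hx⟩).add (continuousOn_const.mul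
      (ContinuousOn.sub (ContinuousOn.log continuous_norm.continuousOn fun x hx => ?_)
        continuousOn_const))
    exact norm_ne_zero_iff.2 (hK0 x hx)
  obtain ⟨x, hxK, hxmax⟩ := hKc.exists_isMaxOn ⟨w, hwK⟩ hgc
  have hgx : M < g x := hgw.trans_le (hxmax hwK)
  have hx0 := hK0 x hxK
  have hxΩ : x ∈ Ω := by
    by_contra hxn
    have : x ∈ frontier Ω := ⟨hxK.1, by rwa [hΩ.interior_eq]⟩
    linarith [hfr x this hx0, hgf x hxK.1 hx0]
  have hxδ : δ < ‖x‖ := by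
    by_contra hn
    push Not at hn
    linarith [hδ x hx0 hn]
  have hloc : IsLocalMax g x := by
    refine hxmax.isLocalMax ?_
    have h9 : Ω ∩ (Metric.closedBall 0 δ)ᶜ ∈ 𝓝 x :=
      (hΩ.inter Metric.isClosed_closedBall.isOpen_compl).mem_nhds ⟨hxΩ, by simpa using hxδ⟩
    filter_upwards [h9] with y hy
    refine ⟨subset_closure hy.1, fun hyb => hy.2 (Metric.ball_subset_closedBall hyb)⟩
  have hharm : HarmonicAt (fun x : ℂ => Real.log ‖x‖) x :=
    (analyticAt_id (𝕜 := ℂ) (z := x)).harmonicAt_log_norm hx0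
  have hharm2 : HarmonicAt (fun y : ℂ => ε * (Real.log ‖y‖ - Real.log R)) x :=
    HarmonicAt.const_smul (c := ε) (hharm.sub (harmonicAt_const (Real.log R)))
  have hlap : Laplacian.laplacian g x = Laplacian.laplacian f x := by
    have h10 := (h2 x hxΩ hx0).laplacian_add hharm2.1
    rw [hharm2.2.eq_of_nhds] at h10
    simpa using! h10
  have h11 := laplacian_nonpos_of_isLocalMax (f := g) ((h2 x hxΩ hx0).add hharm2.1) hloc
  rw [hlap] at h11
  have h12 := hpos x hxΩ hx0 (hgx.trans_le (hgf x hxK.1 hx0))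
  linarith

open InnerProductSpace in
/-- A priori bound for complex solutions of `∂∂̄κ = a κ + S` with an isolated singularity. -/
lemma norm_le_of_dw_dwbar {Ω : Set ℂ} (hΩ : IsOpen Ω) (hbd : Bornology.IsBounded Ω)
    {κ : ℂ → ℂ} {a : ℂ → ℝ} {S : ℂ → ℂ} {m B : ℝ} (hc : ContinuousOn κ (closure Ω \ {0}))
    (h2 : ∀ w ∈ Ω, w ≠ 0 → ContDiffAt ℝ 2 κ w) (hB : ∀ᶠ w in 𝓝[≠] (0 : ℂ), ‖κ w‖ ≤ B)
    (hfr : ∀ w ∈ frontier Ω, w ≠ 0 → κ w = 0) (hm : 0 ≤ m)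
    (heq : ∀ w ∈ Ω, w ≠ 0 → dw (dwbar κ) w = a w * κ w + S w)
    (ha : ∀ w ∈ Ω, w ≠ 0 → 0 < a w) (hS : ∀ w ∈ Ω, w ≠ 0 → ‖S w‖ ≤ m * a w) {w : ℂ} (hw : w ∈ Ω)
    (hw0 : w ≠ 0) : ‖κ w‖ ≤ m := by
  -- A rotation makes κ(w) real and nonnegative, so the real maximum principle applies to Re(θκ).
  -- Where this exceeds m, its Laplacian is at least 4a(Re(θκ) - m) > 0.
  obtain ⟨θ, hθ, hθκ⟩ : ∃ θ : ℂ, ‖θ‖ = 1 ∧ (θ * κ w).re = ‖κ w‖ := by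
    rcases eq_or_ne (κ w) 0 with h | h
    · exact ⟨1, by simp, by simp [h]⟩
    · refine ⟨(starRingEnd ℂ) (κ w) / ‖κ w‖, ?_, ?_⟩
      · rw [norm_div, RCLike.norm_conj, Complex.norm_real, norm_norm,
          div_self (norm_ne_zero_iff.2 h)]
      · have h3 : (‖κ w‖ : ℂ) ≠ 0 := by exact_mod_cast norm_ne_zero_iff.2 h
        have : (starRingEnd ℂ) (κ w) / ‖κ w‖ * κ w = (‖κ w‖ : ℂ) := by
          rw [div_mul_eq_mul_div, Complex.conj_mul']
          field_simp
        rw [this, Complex.ofReal_re]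
  set l : ℂ →L[ℝ] ℝ := Complex.reCLM ∘L (θ • ContinuousLinearMap.id ℝ ℂ) with hl
  have hlapp : ∀ x, l x = (θ * x).re := fun x => by simp [hl]
  have hle : ∀ x, l x ≤ ‖x‖ := fun x => by
    rw [hlapp]
    refine (Complex.re_le_norm _).trans ?_
    rw [norm_mul, hθ, one_mul]
  have hlow : ∀ x, -‖x‖ ≤ l x := fun x => by
    rw [hlapp]
    have := (abs_le.1 (Complex.abs_re_le_norm (θ * x))).1
    rwa [norm_mul, hθ, one_mul] at this
  have := le_of_laplacian_pos hΩ hbd (f := l ∘ κ) (M := m) (B := B)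
    (l.continuous.comp_continuousOn hc) (fun x hx hx0 => l.contDiff.contDiffAt.comp x (h2 x hx hx0))
    (hB.mono fun x hx => (hle _).trans hx)
    (fun x hx hx0 => by simp [hfr x hx hx0, hm]) ?_ hw hw0
  · rw [Function.comp_apply, hlapp, hθκ] at this
    exact this
  · intro x hx hx0 hmx
    rw [(h2 x hx hx0).laplacian_CLM_comp_left]
    have h4 := dw_dwbar_eq_laplacian (h2 x hx hx0)
    rw [heq x hx hx0] at h4
    have h5 : Laplacian.laplacian κ x = (4 * a x) • κ x + (4 : ℝ) • S x := by
      simp only [Complex.real_smul]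
      push_cast
      linear_combination -4 * h4
    rw [Function.comp_apply, h5, map_add, map_smul, map_smul]
    simp only [smul_eq_mul, Function.comp_apply] at hmx ⊢
    have h6 := hlow (S x)
    have h7 := hS x hx hx0
    have h8 := ha x hx hx0
    nlinarith

/-! ### Integrals of functions with an isolated singularity -/

lemma integrableOn_of_isBigO_inv_norm {K : Set ℂ} (hK : IsCompact K) {f : ℂ → ℂ}
    (hc : ContinuousOn f (K \ {0})) (hO : f =O[𝓝[≠] 0] fun w => ‖w‖⁻¹) : IntegrableOn f K := by
  obtain ⟨C, hC⟩ := hO.bound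
  obtain ⟨δ, hδ0, hδ⟩ := Metric.eventually_nhds_iff.1 (eventually_nhdsWithin_iff.1 hC)
  have h1 : IntegrableOn f (K \ Metric.ball 0 δ) := by
    refine ContinuousOn.integrableOn_compact (hK.diff Metric.isOpen_ball) (hc.mono fun x hx => ?_)
    exact ⟨hx.1, fun h => hx.2 (by rw [h]; exact Metric.mem_ball_self hδ0)⟩
  have hm : MeasurableSet ((K ∩ Metric.ball 0 δ) \ {0}) :=
    (hK.measurableSet.inter measurableSet_ball).diff (measurableSet_singleton 0)
  have h2 : IntegrableOn f ((K ∩ Metric.ball 0 δ) \ {0}) := by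
    have h3 : IntegrableOn (fun w : ℂ => C * ‖w‖⁻¹) ((K ∩ Metric.ball 0 δ) \ {0}) :=
      IntegrableOn.mono_set (t := Metric.ball 0 δ) (Integrable.const_mul (integrableOn_inv_norm δ) C)
        fun x hx => hx.1.2
    refine Integrable.mono' h3
      ((hc.mono fun x hx => ⟨hx.1.1, hx.2⟩).aestronglyMeasurable hm) ?_
    filter_upwards [self_mem_ae_restrict hm] with x hx
    have := hδ hx.1.2 hx.2
    simpa using this
  have h4 : IntegrableOn f ({0} : Set ℂ) := by
    rw [IntegrableOn, Measure.restrict_singleton]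
    simp
  refine ((h1.union h2).union h4).mono_set fun x hx => ?_
  by_cases hx0 : x = 0
  · exact Or.inr hx0
  · by_cases hxb : x ∈ Metric.ball (0 : ℂ) δ
    · exact Or.inl (Or.inr ⟨⟨hx, hxb⟩, hx0⟩)
    · exact Or.inl (Or.inl ⟨hx, hxb⟩)

/-- By Fubini it suffices to integrate along horizontal lines. All but one of them miss the origin,
and there F is differentiable with compact support. -/
lemma integral_fderiv_one_eq_zero {F : ℂ → ℂ} (hd : ∀ w, w ≠ 0 → DifferentiableAt ℝ F w)
    (hcs : HasCompactSupport F) (hi : Integrable fun w => fderiv ℝ F w 1) :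
    ∫ w, fderiv ℝ F w 1 = 0 := by
  set e := Complex.measurableEquivRealProd.symm with he
  have hvp : MeasurePreserving e := Complex.volume_preserving_equiv_real_prod.symm
  have heapp : ∀ x y : ℝ, e (x, y) = (x : ℂ) + y * Complex.I := fun x y => by
    apply Complex.ext <;> simp [he, Complex.measurableEquivRealProd]
  rw [← hvp.integral_comp e.measurableEmbedding]
  have hi2 : Integrable (fun p => fderiv ℝ F (e p) 1) (volume.prod volume) :=
    (hvp.integrable_comp_emb e.measurableEmbedding).2 hi
  obtain ⟨R, hR⟩ := hcs.isCompact.isBounded.subset_closedBall 0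
  change ∫ p, fderiv ℝ F (e p) 1 ∂(volume.prod volume) = 0
  rw [integral_prod_symm _ hi2]
  refine integral_eq_zero_of_ae ?_
  have hne : ∀ᵐ y : ℝ, y ≠ 0 := by
    simp [ae_iff, measure_singleton]
  filter_upwards [hne, hi2.prod_left_ae] with y hy hiy
  have hder : ∀ x : ℝ, HasDerivAt (fun x : ℝ => F (e (x, y))) (fderiv ℝ F (e (x, y)) 1) x := by
    intro x
    have h0 : e (x, y) ≠ 0 := by
      rw [heapp]
      intro h
      have := congrArg Complex.im h
      simp at this
      exact hy this
    have h1 : HasDerivAt (fun x : ℝ => e (x, y)) 1 x := by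
      simp only [heapp]
      exact (Complex.ofRealCLM.hasDerivAt.add_const _)
    exact (hd _ h0).hasFDerivAt.comp_hasDerivAt x h1
  have hint : Integrable (fun x : ℝ => F (e (x, y))) := by
    have hcont : Continuous (fun x : ℝ => F (e (x, y))) :=
      continuous_iff_continuousAt.2 fun x => (hder x).continuousAt
    refine hcont.integrable_of_hasCompactSupport
      (HasCompactSupport.intro (isCompact_Icc (a := -R) (b := R)) fun x hx => ?_)
    by_contra hcon
    have h3 := hR (subset_tsupport F hcon)
    rw [mem_closedBall_zero_iff] at h3
    have h4 : |x| ≤ R := by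
      have := (Complex.abs_re_le_norm (e (x, y))).trans h3
      rw [heapp] at this
      simpa using this
    exact hx ⟨(abs_le.1 h4).1, (abs_le.1 h4).2⟩
  exact integral_eq_zero_of_hasDerivAt_of_integrable hder hiy hint

lemma integral_fderiv_I_eq_zero {F : ℂ → ℂ} (hd : ∀ w, w ≠ 0 → DifferentiableAt ℝ F w)
    (hcs : HasCompactSupport F) (hi : Integrable fun w => fderiv ℝ F w Complex.I) :
    ∫ w, fderiv ℝ F w Complex.I = 0 := by
  set e := Complex.measurableEquivRealProd.symm with he
  have hvp : MeasurePreserving e := Complex.volume_preserving_equiv_real_prod.symm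
  have heapp : ∀ x y : ℝ, e (x, y) = (x : ℂ) + y * Complex.I := fun x y => by
    apply Complex.ext <;> simp [he, Complex.measurableEquivRealProd]
  rw [← hvp.integral_comp e.measurableEmbedding]
  have hi2 : Integrable (fun p => fderiv ℝ F (e p) Complex.I) (volume.prod volume) :=
    (hvp.integrable_comp_emb e.measurableEmbedding).2 hi
  obtain ⟨R, hR⟩ := hcs.isCompact.isBounded.subset_closedBall 0
  change ∫ p, fderiv ℝ F (e p) Complex.I ∂(volume.prod volume) = 0
  rw [integral_prod _ hi2]
  refine integral_eq_zero_of_ae ?_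
  have hne : ∀ᵐ x : ℝ, x ≠ 0 := by
    simp [ae_iff, measure_singleton]
  filter_upwards [hne, hi2.prod_right_ae] with x hx hiy
  have hder : ∀ y : ℝ, HasDerivAt (fun y : ℝ => F (e (x, y)))
      (fderiv ℝ F (e (x, y)) Complex.I) y := by
    intro y
    have h0 : e (x, y) ≠ 0 := by
      rw [heapp]
      intro h
      have := congrArg Complex.re h
      simp at this
      exact hx this
    have h1 : HasDerivAt (fun y : ℝ => e (x, y)) Complex.I y := by
      simp only [heapp]
      have := (Complex.ofRealCLM.hasDerivAt (x := y)).mul_const Complex.I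
      have := this.const_add (x : ℂ)
      simpa using! this
    exact (hd _ h0).hasFDerivAt.comp_hasDerivAt y h1
  have hint : Integrable (fun y : ℝ => F (e (x, y))) := by
    have hcont : Continuous (fun y : ℝ => F (e (x, y))) :=
      continuous_iff_continuousAt.2 fun y => (hder y).continuousAt
    refine hcont.integrable_of_hasCompactSupport
      (HasCompactSupport.intro (isCompact_Icc (a := -R) (b := R)) fun y hy => ?_)
    by_contra hcon
    have h3 := hR (subset_tsupport F hcon)
    rw [mem_closedBall_zero_iff] at h3
    have h4 : |y| ≤ R := by
      have := (Complex.abs_im_le_norm (e (x, y))).trans h3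
      rw [heapp] at this
      simpa using this
    exact hy ⟨(abs_le.1 h4).1, (abs_le.1 h4).2⟩
  exact integral_eq_zero_of_hasDerivAt_of_integrable hder hiy hint

/-- Stokes' theorem for a compactly supported function with an isolated singularity. -/
lemma integral_dw_eq_zero {F : ℂ → ℂ} (hd : ContDiffOn ℝ 1 F {0}ᶜ) (hcs : HasCompactSupport F)
    (h1 : dw F =O[𝓝[≠] 0] fun w => ‖w‖⁻¹) (h2 : dwbar F =O[𝓝[≠] 0] fun w => ‖w‖⁻¹) :
    Integrable (dw F) ∧ ∫ w, dw F w = 0 := by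
  have hfd : ContinuousOn (fderiv ℝ F) {0}ᶜ :=
    hd.continuousOn_fderiv_of_isOpen isOpen_compl_singleton le_rfl
  have hfc : ∀ v, ContinuousOn (fun w => fderiv ℝ F w v) {0}ᶜ := fun v =>
    hfd.clm_apply continuousOn_const
  set K := tsupport F with hK
  have hint : ∀ v, ((fun w => fderiv ℝ F w v) =O[𝓝[≠] 0]
      fun w => ‖w‖⁻¹) → Integrable fun w => fderiv ℝ F w v := by
    intro v hO
    refine (integrableOn_iff_integrable_of_support_subset (s := K) ?_).1
      (integrableOn_of_isBigO_inv_norm hcs.isCompact ((hfc v).mono fun x hx => hx.2) hO)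
    intro w hw
    refine support_fderiv_subset ℝ (f := F) (fun h => hw ?_)
    simp only [h]; rfl
  have e1 : ∀ w, fderiv ℝ F w 1 = dw F w + dwbar F w := fun w => by
    simp only [dw, dwbar]; ring
  have e2 : ∀ w, fderiv ℝ F w Complex.I = Complex.I * (dw F w - dwbar F w) := fun w => by
    simp only [dw, dwbar]
    linear_combination (fderiv ℝ F w Complex.I) * Complex.I_sq
  have i1 := hint 1 (by simp only [e1]; exact h1.add h2)
  have i2 := hint Complex.I (by
    simp only [e2]
    exact (h1.sub h2).const_mul_left _)
  have hd' : ∀ w, w ≠ 0 → DifferentiableAt ℝ F w := fun w hw =>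
    (hd.contDiffAt (isOpen_compl_singleton.mem_nhds hw)).differentiableAt (by norm_num)
  refine ⟨(i1.sub (i2.const_mul Complex.I)).const_mul (1 / 2), ?_⟩
  simp only [dw]
  rw [integral_const_mul, integral_sub i1 (i2.const_mul _), integral_const_mul,
    integral_fderiv_one_eq_zero hd' hcs i1, integral_fderiv_I_eq_zero hd' hcs i2]
  simp

/-! ### The cut off profile -/

lemma evBounded_of_continuousOn {K : Set ℝ} (hK : IsCompact K) {g : ℝ → ℝ} (hg : ContinuousOn g K) :
    EvBounded K fun _ => g := by
  obtain ⟨C, hC⟩ := hK.exists_bound_of_continuousOn hg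
  exact ExpSmall.evBounded_of_bound C fun _ => hC

lemma ExpSmall.mono {X E : Type*} [Norm E] {S S' : Set X} {f : ℝ → X → E} (h : ExpSmall S f)
    (hS : S' ⊆ S) : ExpSmall S' f := by
  obtain ⟨c, hc, hO⟩ := h
  exact ⟨c, hc, hO.mono (Filter.prod_mono le_rfl (principal_mono.2 hS))⟩

lemma ExpSmall.congr {X E : Type*} [SeminormedAddCommGroup E] {S : Set X} {f g : ℝ → X → E}
    (h : ExpSmall S f)
    (hfg : ∀ t, 0 < t → ∀ x ∈ S, g t x = f t x) : ExpSmall S g :=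
  h.of_le 1 fun t ht x hx => by rw [hfg t (by linarith) x hx]

/-- The first three derivatives of `u_t` decay exponentially away from the origin. -/
lemma expSmall_derivs_modelFunction {u : ℝ → ℝ → ℝ} (hu : ∀ t, 0 < t → IsModelFunction t (u t))
    {r₁ r₂ : ℝ} (hr₁ : 0 < r₁) :
    ExpSmall (Set.Icc r₁ r₂) (fun t => deriv (deriv (u t))) ∧
      ExpSmall (Set.Icc r₁ r₂) (fun t => deriv (deriv (deriv (u t)))) := by
  have hsub : Set.Icc r₁ r₂ ⊆ Set.Ici r₁ := fun x hx => hx.1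
  have hpos : ∀ x ∈ Set.Icc r₁ r₂, 0 < x := fun x hx => hr₁.trans_le hx.1
  have h0 := (expSmall_modelFunction hu hr₁).mono hsub
  have h1 := (expSmall_deriv_modelFunction hu hr₁).mono hsub
  have bdd : ∀ g : ℝ → ℝ, ContinuousOn g (Set.Icc r₁ r₂) → EvBounded (Set.Icc r₁ r₂) fun _ => g :=
    fun g => evBounded_of_continuousOn isCompact_Icc
  have hinv : ContinuousOn (fun r : ℝ => 1 / r) (Set.Icc r₁ r₂) :=
    continuousOn_const.div continuousOn_id fun x hx => (hpos x hx).ne'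
  have h2u : ExpSmall (Set.Icc r₁ r₂) fun t r => 2 * u t r :=
    ExpSmall.bounded_mul (bdd (fun _ => 2) continuousOn_const) h0
  -- The equation expresses the second derivative through u and u', and its derivative gives the
  -- third. The factors t² are absorbed by exponential decay.
  have ode : ∀ t, 0 < t → ∀ r, 0 < r →
      deriv (deriv (u t)) r = 8 * r * (t ^ 2 * Real.sinh (2 * u t r)) - 1 / r * deriv (u t) r := by
    intro t ht r hr
    have := (hu t ht).ode r hr
    linarith
  have h2 : ExpSmall (Set.Icc r₁ r₂) (fun t => deriv (deriv (u t))) := by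
    refine ExpSmall.congr ?_ fun t ht r hr => ode t ht r (hpos r hr)
    exact (ExpSmall.bounded_mul (bdd (fun r => 8 * r) (by fun_prop)) h2u.sinh.sq_mul).sub
      (ExpSmall.bounded_mul (bdd _ hinv) h1)
  refine ⟨h2, ?_⟩
  have h3 : ExpSmall (Set.Icc r₁ r₂) fun t r => (8 : ℝ) * (t ^ 2 * Real.sinh (2 * u t r)) +
      8 * r * (t ^ 2 * (Real.cosh (2 * u t r) * (2 * deriv (u t) r))) -
      (1 / r * deriv (deriv (u t)) r - 1 / r * (1 / r * deriv (u t) r)) := by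
    refine ((ExpSmall.bounded_mul (bdd _ continuousOn_const) h2u.sinh.sq_mul).add
      (ExpSmall.bounded_mul (bdd (fun r => 8 * r) (by fun_prop))
        (ExpSmall.sq_mul (ExpSmall.bounded_mul h2u.cosh
          (ExpSmall.bounded_mul (bdd (fun _ => 2) continuousOn_const) h1))))).sub
      ((ExpSmall.bounded_mul (bdd _ hinv) h2).sub
      (ExpSmall.bounded_mul (bdd _ hinv) (ExpSmall.bounded_mul (bdd _ hinv) h1)))
  refine ExpSmall.congr h3 fun t ht r hr => ?_
  have hr0 := hpos r hr
  have heq : deriv (deriv (u t)) =ᶠ[𝓝 r] fun r =>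
      8 * r * (t ^ 2 * Real.sinh (2 * u t r)) - 1 / r * deriv (u t) r := by
    filter_upwards [isOpen_Ioi.mem_nhds hr0] with x hx using ode t ht x hx
  obtain ⟨d1, d2⟩ := hasDerivAt_two_of_contDiffOn (hu t ht).smooth hr0
  rw [heq.deriv_eq]
  have hd := (((hasDerivAt_id r).const_mul 8).mul
    (((d1.const_mul 2).sinh).const_mul (t ^ 2))).sub
    (((hasDerivAt_const r (1 : ℝ)).div (hasDerivAt_id r) hr0.ne').mul d2)
  refine hd.deriv.trans ?_
  simp only [id, Pi.div_apply]
  field_simp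
  ring

/-- The cut off profile `χ u`. -/
def profile (χ u : ℝ → ℝ) (r : ℝ) : ℝ := u r * χ r

lemma profile_contDiffOn {t : ℝ} {χ u : ℝ → ℝ} (hχ : IsCutoff χ) (hu : IsModelFunction t u) :
    ContDiffOn ℝ ∞ (profile χ u) (Set.Ioi 0) :=
  hu.contDiffOn.mul hχ.smooth.contDiffOn

/-- `(f'' + f'/r)/4`, so that `∂∂̄ f(|z|) = |z'|² Ψ(|z|)`. -/
def radialLap (f : ℝ → ℝ) (r : ℝ) : ℝ := (deriv (deriv f) r + 1 / r * deriv f r) / 4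

/-- The error with which the profile solves the radial sinh-Gordon equation. -/
def profileError (t : ℝ) (χ u : ℝ → ℝ) (r : ℝ) : ℝ :=
  radialLap (profile χ u) r - 2 * t ^ 2 * r * Real.sinh (2 * profile χ u r)

lemma radialLap_contDiffOn {f : ℝ → ℝ} (hf : ContDiffOn ℝ ∞ f (Set.Ioi 0)) :
    ContDiffOn ℝ ∞ (radialLap f) (Set.Ioi 0) := by
  have h1 : ContDiffOn ℝ ∞ (deriv f) (Set.Ioi 0) := hf.deriv_of_isOpen isOpen_Ioi (by norm_cast)
  have h2 : ContDiffOn ℝ ∞ (deriv (deriv f)) (Set.Ioi 0) :=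
    h1.deriv_of_isOpen isOpen_Ioi (by norm_cast)
  exact (h2.add ((contDiffOn_const.div contDiffOn_id fun x hx => (ne_of_gt hx)).mul h1)).div_const 4

lemma differentiableAt_of_contDiffOn_Ioi {f : ℝ → ℝ} (hf : ContDiffOn ℝ ∞ f (Set.Ioi 0)) {r : ℝ}
    (hr : 0 < r) : DifferentiableAt ℝ f r :=
  (hf.contDiffAt (isOpen_Ioi.mem_nhds hr)).differentiableAt (by norm_num)

/-- Where χ = 1 the profile is u_t itself. The error of the cut-off profile therefore lives away
from the branch point. -/
lemma profileError_eq_zero {t : ℝ} {χ u : ℝ → ℝ} (hu : IsModelFunction t u)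
    {r₀ : ℝ} (hχ : ∀ r, 0 ≤ r → r ≤ r₀ → χ r = 1) {r : ℝ} (hr : 0 < r) (hr0 : r < r₀) :
    profileError t χ u r = 0 := by
  have h1 : profile χ u =ᶠ[𝓝 r] u := by
    filter_upwards [Ioo_mem_nhds hr hr0] with x hx
    simp [profile, hχ x hx.1.le hx.2.le]
  rw [profileError, radialLap, h1.deriv.deriv_eq, h1.deriv_eq, h1.eq_of_nhds]
  have := hu.ode r hr
  linarith

/-- Every term of the Leibniz expansions contains u_t, one of its derivatives, or the sinh of 2χu_t,
all exponentially small on an annulus. The derivative of the error is included because it enters the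
source term of the deviation equation. -/
lemma expSmall_profileError {χ : ℝ → ℝ} {u : ℝ → ℝ → ℝ} (hχ : IsCutoff χ)
    (hu : ∀ t, 0 < t → IsModelFunction t (u t)) {r₁ r₂ : ℝ} (hr₁ : 0 < r₁) :
    ExpSmall (Set.Icc r₁ r₂) (fun t => profileError t χ (u t)) ∧
      ExpSmall (Set.Icc r₁ r₂) (fun t => deriv (profileError t χ (u t))) := by
  set K := Set.Icc r₁ r₂ with hK
  have hsub : K ⊆ Set.Ici r₁ := fun x hx => hx.1
  have hpos : ∀ x ∈ K, 0 < x := fun x hx => hr₁.trans_le hx.1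
  have h0 := (expSmall_modelFunction hu hr₁).mono hsub
  have h1 := (expSmall_deriv_modelFunction hu hr₁).mono hsub
  obtain ⟨h2, h3⟩ := expSmall_derivs_modelFunction hu (r₁ := r₁) (r₂ := r₂) hr₁
  have bdd : ∀ g : ℝ → ℝ, ContinuousOn g K → EvBounded K fun _ => g :=
    fun g => evBounded_of_continuousOn isCompact_Icc
  have hinv : ContinuousOn (fun r : ℝ => 1 / r) K :=
    continuousOn_const.div continuousOn_id fun x hx => (hpos x hx).ne'
  have hc1 : ContDiff ℝ ∞ (deriv χ) := ContDiff.deriv' hχ.smooth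
  have hc2 : ContDiff ℝ ∞ (deriv (deriv χ)) := ContDiff.deriv' hc1
  have hc3 : ContDiff ℝ ∞ (deriv (deriv (deriv χ))) := ContDiff.deriv' hc2
  have b0 := bdd χ hχ.smooth.continuous.continuousOn
  have b1 := bdd _ hc1.continuous.continuousOn
  have b2 := bdd _ hc2.continuous.continuousOn
  have b3 := bdd _ hc3.continuous.continuousOn
  have e0 : ∀ r, HasDerivAt χ (deriv χ r) r := fun r =>
    (hχ.smooth.differentiable (by norm_num) r).hasDerivAt
  have e1 : ∀ r, HasDerivAt (deriv χ) (deriv (deriv χ) r) r := fun r =>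
    (hc1.differentiable (by norm_num) r).hasDerivAt
  have e2 : ∀ r, HasDerivAt (deriv (deriv χ)) (deriv (deriv (deriv χ)) r) r := fun r =>
    (hc2.differentiable (by norm_num) r).hasDerivAt
  have hud : ∀ t, 0 < t → ∀ r, 0 < r → HasDerivAt (u t) (deriv (u t) r) r ∧
      HasDerivAt (deriv (u t)) (deriv (deriv (u t)) r) r ∧
      HasDerivAt (deriv (deriv (u t))) (deriv (deriv (deriv (u t))) r) r := by
    intro t ht r hr
    obtain ⟨d1, d2⟩ := hasDerivAt_two_of_contDiffOn (hu t ht).smooth hr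
    have c1 : ContDiffOn ℝ ∞ (deriv (u t)) (Set.Ioi 0) :=
      (hu t ht).contDiffOn.deriv_of_isOpen isOpen_Ioi (by norm_cast)
    have c2 : ContDiffOn ℝ ∞ (deriv (deriv (u t))) (Set.Ioi 0) :=
      c1.deriv_of_isOpen isOpen_Ioi (by norm_cast)
    exact ⟨d1, d2, (differentiableAt_of_contDiffOn_Ioi c2 hr).hasDerivAt⟩
  have f1 : ∀ t, 0 < t → ∀ r, 0 < r → deriv (profile χ (u t)) r =
      deriv (u t) r * χ r + u t r * deriv χ r := fun t ht r hr =>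
    ((hud t ht r hr).1.mul (e0 r)).deriv
  have f2 : ∀ t, 0 < t → ∀ r, 0 < r → deriv (deriv (profile χ (u t))) r =
      deriv (deriv (u t)) r * χ r + deriv (u t) r * deriv χ r +
        (deriv (u t) r * deriv χ r + u t r * deriv (deriv χ) r) := by
    intro t ht r hr
    have : deriv (profile χ (u t)) =ᶠ[𝓝 r] fun r => deriv (u t) r * χ r + u t r * deriv χ r := by
      filter_upwards [isOpen_Ioi.mem_nhds hr] with x hx using f1 t ht x hx
    rw [this.deriv_eq]
    exact (((hud t ht r hr).2.1.mul (e0 r)).add ((hud t ht r hr).1.mul (e1 r))).deriv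
  have f3 : ∀ t, 0 < t → ∀ r, 0 < r → deriv (deriv (deriv (profile χ (u t)))) r =
      deriv (deriv (deriv (u t))) r * χ r + deriv (deriv (u t)) r * deriv χ r +
        (deriv (deriv (u t)) r * deriv χ r + deriv (u t) r * deriv (deriv χ) r) +
        (deriv (deriv (u t)) r * deriv χ r + deriv (u t) r * deriv (deriv χ) r +
          (deriv (u t) r * deriv (deriv χ) r + u t r * deriv (deriv (deriv χ)) r)) := by
    intro t ht r hr
    have : deriv (deriv (profile χ (u t))) =ᶠ[𝓝 r] fun r =>
        deriv (deriv (u t)) r * χ r + deriv (u t) r * deriv χ r +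
        (deriv (u t) r * deriv χ r + u t r * deriv (deriv χ) r) := by
      filter_upwards [isOpen_Ioi.mem_nhds hr] with x hx using f2 t ht x hx
    rw [this.deriv_eq]
    obtain ⟨d1, d2, d3⟩ := hud t ht r hr
    exact (((d3.mul (e0 r)).add (d2.mul (e1 r))).add
      ((d2.mul (e1 r)).add (d1.mul (e2 r)))).deriv
  have g0 : ExpSmall K fun t => profile χ (u t) := h0.mul_bounded b0
  have g1 : ExpSmall K fun t => deriv (profile χ (u t)) :=
    ExpSmall.congr ((h1.mul_bounded b0).add (h0.mul_bounded b1)) fun t ht r hr =>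
      f1 t ht r (hpos r hr)
  have g2 : ExpSmall K fun t => deriv (deriv (profile χ (u t))) :=
    ExpSmall.congr (((h2.mul_bounded b0).add (h1.mul_bounded b1)).add
      ((h1.mul_bounded b1).add (h0.mul_bounded b2))) fun t ht r hr => f2 t ht r (hpos r hr)
  have g3 : ExpSmall K fun t => deriv (deriv (deriv (profile χ (u t)))) :=
    ExpSmall.congr ((((h3.mul_bounded b0).add (h2.mul_bounded b1)).add
      ((h2.mul_bounded b1).add (h1.mul_bounded b2))).add (((h2.mul_bounded b1).add
      (h1.mul_bounded b2)).add ((h1.mul_bounded b2).add (h0.mul_bounded b3))))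
      fun t ht r hr => f3 t ht r (hpos r hr)
  have g00 : ExpSmall K fun t r => 2 * profile χ (u t) r :=
    ExpSmall.bounded_mul (bdd (fun _ => 2) continuousOn_const) g0
  have b4 : EvBounded K fun _ _ => (1 / 4 : ℝ) := bdd _ continuousOn_const
  constructor
  · have := ((g2.add (ExpSmall.bounded_mul (bdd _ hinv) g1)).mul_bounded b4).sub
      (ExpSmall.bounded_mul (bdd (fun r => 2 * r) (by fun_prop)) g00.sinh.sq_mul)
    refine this.congr fun t ht r hr => ?_
    simp only [profileError, radialLap]
    ring
  · have := ((g3.add ((ExpSmall.bounded_mul (bdd _ hinv) g2).sub (ExpSmall.bounded_mul (bdd _ hinv)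
      (ExpSmall.bounded_mul (bdd _ hinv) g1)))).mul_bounded b4).sub
      ((ExpSmall.bounded_mul (bdd (fun _ => 2) (by fun_prop)) g00.sinh.sq_mul).add
      (ExpSmall.bounded_mul (bdd (fun r => 4 * r) (by fun_prop))
        (ExpSmall.sq_mul (ExpSmall.bounded_mul g00.cosh g1))))
    refine this.congr fun t ht r hr => ?_
    have hr0 := hpos r hr
    have c0 := profile_contDiffOn hχ (hu t ht)
    have c1 : ContDiffOn ℝ ∞ (deriv (profile χ (u t))) (Set.Ioi 0) :=
      c0.deriv_of_isOpen isOpen_Ioi (by norm_cast)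
    have c2 : ContDiffOn ℝ ∞ (deriv (deriv (profile χ (u t)))) (Set.Ioi 0) :=
      c1.deriv_of_isOpen isOpen_Ioi (by norm_cast)
    have d0 := (differentiableAt_of_contDiffOn_Ioi c0 hr0).hasDerivAt
    have d1 := (differentiableAt_of_contDiffOn_Ioi c1 hr0).hasDerivAt
    have d2 := (differentiableAt_of_contDiffOn_Ioi c2 hr0).hasDerivAt
    have hd := ((d2.add (((hasDerivAt_const r (1 : ℝ)).div (hasDerivAt_id r) hr0.ne').mul
      d1)).div_const 4).sub (((hasDerivAt_id r).const_mul (2 * t ^ 2)).mul ((d0.const_mul 2).sinh))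
    refine hd.deriv.trans ?_
    simp only [id, Pi.div_apply]
    field_simp
    ring

/-! ### The scalar problem in one block -/

/-- A centred coordinate `z` on the disk of radius `σ`, a function `P`, and a solution `a` of
`2 z a' + a z' = P z'`. -/
structure IsBlockData (σ : ℝ) (z P a : ℂ → ℂ) : Prop where
  pos : 0 < σ
  z_hol : DifferentiableOn ℂ z (Metric.ball 0 σ)
  z_zero : z 0 = 0
  z_ne : ∀ w ∈ Metric.ball (0 : ℂ) σ, w ≠ 0 → z w ≠ 0
  dz_ne : ∀ w ∈ Metric.ball (0 : ℂ) σ, deriv z w ≠ 0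
  P_hol : DifferentiableOn ℂ P (Metric.ball 0 σ)
  a_hol : DifferentiableOn ℂ a (Metric.ball 0 σ)
  a_eq : ∀ w ∈ Metric.ball (0 : ℂ) σ, 2 * z w * deriv a w + a w * deriv z w = P w * deriv z w

/-- The equation for a says d(√z a) = P dz/(2√z), the variation of the eigenvalue form √z dz. With z
= w k² and a = b/k it becomes w b' + b/2 = P z'/(2k), which has a holomorphic solution. -/
lemma exists_isBlockData {σ : ℝ} (hσ : 0 < σ) {z P : ℂ → ℂ}
    (hz : DifferentiableOn ℂ z (Metric.ball 0 σ)) (hz0 : z 0 = 0)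
    (hzne : ∀ w ∈ Metric.ball (0 : ℂ) σ, w ≠ 0 → z w ≠ 0)
    (hdz : ∀ w ∈ Metric.ball (0 : ℂ) σ, deriv z w ≠ 0)
    (hP : DifferentiableOn ℂ P (Metric.ball 0 σ)) : ∃ a, IsBlockData σ z P a := by
  have hmem0 : (0 : ℂ) ∈ Metric.ball (0 : ℂ) σ := Metric.mem_ball_self hσ
  have hnh : ∀ w ∈ Metric.ball (0 : ℂ) σ, Metric.ball (0 : ℂ) σ ∈ 𝓝 w := fun w hw =>
    Metric.isOpen_ball.mem_nhds hw
  set q := dslope z 0 with hq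
  have hqd : DifferentiableOn ℂ q (Metric.ball 0 σ) :=
    (Complex.differentiableOn_dslope (hnh 0 hmem0)).2 hz
  have hmul : ∀ s, z s = s * q s := fun s => by
    have := sub_smul_dslope z 0 s
    simpa [hz0] using this.symm
  have hq0 : ∀ w ∈ Metric.ball (0 : ℂ) σ, q w ≠ 0 := by
    intro w hw
    rcases eq_or_ne w 0 with rfl | hw0
    · rw [hq, dslope_same]; exact hdz 0 hw
    · intro h
      exact hzne w hw hw0 (by rw [hmul, h, mul_zero])
  obtain ⟨k, hk, hke⟩ := exists_pow_eq_of_ne_zero hqd hq0 (p := 2) (by norm_num)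
  have hdzd := hz.deriv Metric.isOpen_ball
  obtain ⟨b, hb, hbe⟩ := exists_mul_deriv_add_half_mul_eq hσ
    (f := fun w => P w * deriv z w / (2 * k w))
    ((hP.mul hdzd).div (hk.const_mul 2) fun w hw => mul_ne_zero two_ne_zero (hke w hw).1)
  refine ⟨fun w => b w / k w, hσ, hz, hz0, hzne, hdz, hP,
    hb.div hk fun w hw => (hke w hw).1, fun w hw => ?_⟩
  have hkw := (hke w hw).1
  have dk := (hk.differentiableAt (hnh w hw)).hasDerivAt
  have db := (hb.differentiableAt (hnh w hw)).hasDerivAt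
  have dz : HasDerivAt z (1 * k w ^ 2 + w * (2 * k w * deriv k w)) w := by
    have h1 : HasDerivAt (fun w => w * k w ^ 2) (1 * k w ^ 2 + w * (2 * k w * deriv k w)) w := by
      have := (hasDerivAt_id w).mul (dk.pow 2)
      simpa using! this
    refine h1.congr_of_eventuallyEq ?_
    filter_upwards [hnh w hw] with x hx
    rw [hmul, (hke x hx).2]
  have hbe' := hbe w hw
  have dd : deriv (fun w => b w / k w) w = (deriv b w * k w - b w * deriv k w) / k w ^ 2 :=
    (db.div dk hkw).deriv
  rw [dd, hmul, ← (hke w hw).2]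
  have e2 : P w * deriv z w = 2 * k w * (w * deriv b w + 1 / 2 * b w) := by
    rw [hbe']; field_simp
  rw [e2, dz.deriv]
  field_simp
  ring

namespace IsBlockData

variable {σ : ℝ} {z P a : ℂ → ℂ} (h : IsBlockData σ z P a)
include h

lemma hasDerivAt_z {w : ℂ} (hw : w ∈ Metric.ball (0 : ℂ) σ) : HasDerivAt z (deriv z w) w :=
  (h.z_hol.differentiableAt (Metric.isOpen_ball.mem_nhds hw)).hasDerivAt

lemma hasDerivAt_a {w : ℂ} (hw : w ∈ Metric.ball (0 : ℂ) σ) : HasDerivAt a (deriv a w) w :=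
  (h.a_hol.differentiableAt (Metric.isOpen_ball.mem_nhds hw)).hasDerivAt

lemma dz_hol : DifferentiableOn ℂ (deriv z) (Metric.ball 0 σ) := h.z_hol.deriv Metric.isOpen_ball

lemma contDiffAt_hol {f : ℂ → ℂ} (hf : DifferentiableOn ℂ f (Metric.ball 0 σ)) {w : ℂ}
    (hw : w ∈ Metric.ball (0 : ℂ) σ) {n : WithTop ℕ∞} : ContDiffAt ℝ n f w :=
  ((hf.contDiffOn Metric.isOpen_ball).contDiffAt
    (Metric.isOpen_ball.mem_nhds hw)).restrict_scalars ℝ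

lemma contDiffAt_div_z {f : ℂ → ℂ} (hf : DifferentiableOn ℂ f (Metric.ball 0 σ)) {w c : ℂ}
    (hw : w ∈ Metric.ball (0 : ℂ) σ) (hw0 : w ≠ 0) (hc : c ≠ 0) {n : WithTop ℕ∞} :
    ContDiffAt ℝ n (fun x => f x / (c * z x)) w := by
  have hnh := Metric.isOpen_ball.mem_nhds hw
  exact (((hf.contDiffOn Metric.isOpen_ball).contDiffAt hnh).div
    (contDiffAt_const.mul ((h.z_hol.contDiffOn Metric.isOpen_ball).contDiffAt hnh))
    (mul_ne_zero hc (h.z_ne w hw hw0))).restrict_scalars ℝ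

lemma contDiffAt_radial {f : ℝ → ℝ} (hf : ContDiffOn ℝ ∞ f (Set.Ioi 0)) {w : ℂ}
    (hw : w ∈ Metric.ball (0 : ℂ) σ) (hw0 : w ≠ 0) :
    ContDiffAt ℝ ∞ (fun x => ((f ‖z x‖ : ℝ) : ℂ)) w := by
  have h1 : ContDiffAt ℝ ∞ (fun x => ‖z x‖) w :=
    (h.contDiffAt_hol h.z_hol hw).norm ℝ (h.z_ne w hw hw0)
  have h2 : ContDiffAt ℝ ∞ f ‖z w‖ :=
    hf.contDiffAt (isOpen_Ioi.mem_nhds (norm_pos_iff.2 (h.z_ne w hw hw0)))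
  exact Complex.ofRealCLM.contDiff.contDiffAt.comp w (h2.comp w h1)

lemma tendsto_norm_z : Tendsto (fun w => ‖z w‖) (𝓝[≠] 0) (𝓝[>] 0) := by
  have hnh : Metric.ball (0 : ℂ) σ ∈ 𝓝 (0 : ℂ) := Metric.ball_mem_nhds 0 h.pos
  refine tendsto_nhdsWithin_iff.2 ⟨?_, ?_⟩
  · have h1 : ContinuousAt (fun w => ‖z w‖) 0 := (h.z_hol.differentiableAt hnh).continuousAt.norm
    have := h1.tendsto
    simp only [h.z_zero, norm_zero] at this
    exact this.mono_left nhdsWithin_le_nhds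
  · filter_upwards [nhdsWithin_le_nhds hnh, self_mem_nhdsWithin] with w hw hw0
    exact norm_pos_iff.2 (h.z_ne w hw hw0)

lemma inv_norm_z_isBigO : (fun w => ‖z w‖⁻¹) =O[𝓝[≠] 0] fun w => ‖w‖⁻¹ := by
  have hmem0 : (0 : ℂ) ∈ Metric.ball (0 : ℂ) σ := Metric.mem_ball_self h.pos
  have h1 := (h.hasDerivAt_z hmem0).hasFDerivAt
  have h2 : Tendsto (fun w => z w / w) (𝓝[≠] 0) (𝓝 (deriv z 0)) := by
    have := (h.hasDerivAt_z hmem0).tendsto_slope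
    refine this.congr' ?_
    filter_upwards [self_mem_nhdsWithin] with w hw
    simp [slope_def_field, h.z_zero]
  have h3 := (h2.inv₀ (h.dz_ne 0 hmem0)).isBigO_one ℝ
  have h4 : (fun w : ℂ => ‖w‖⁻¹) =O[𝓝[≠] 0] fun w => ‖w‖⁻¹ := isBigO_refl _ _
  have h5 := h3.norm_left.mul h4
  simp only [one_mul] at h5
  refine h5.congr' ?_ EventuallyEq.rfl
  filter_upwards [self_mem_nhdsWithin] with w hw
  have : ‖w‖ ≠ 0 := norm_ne_zero_iff.2 hw
  rw [norm_inv, norm_div]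
  field_simp

lemma isBigO_one_of_hol {f : ℂ → ℂ} (hf : DifferentiableOn ℂ f (Metric.ball 0 σ)) :
    f =O[𝓝[≠] 0] fun _ => (1 : ℝ) :=
  ((hf.differentiableAt (Metric.ball_mem_nhds 0 h.pos)).continuousAt.tendsto.isBigO_one ℝ).mono
    nhdsWithin_le_nhds

lemma hasWirtinger_norm {w : ℂ} (hw : w ∈ Metric.ball (0 : ℂ) σ) (hw0 : w ≠ 0) :
    HasWirtinger (fun x => ((‖z x‖ : ℝ) : ℂ)) (‖z w‖ * deriv z w / (2 * z w))
      ((starRingEnd ℂ) (‖z w‖ * deriv z w / (2 * z w))) w :=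
  HasWirtinger.norm_hol (h.hasDerivAt_z hw) (h.z_ne w hw hw0)

lemma norm_mul_conj_eq {w : ℂ} (hw : w ∈ Metric.ball (0 : ℂ) σ) (hw0 : w ≠ 0) :
    (starRingEnd ℂ) (‖z w‖ * deriv z w / (2 * z w)) =
      (starRingEnd ℂ) (deriv z w) * z w / (2 * ‖z w‖) := by
  have hz := h.z_ne w hw hw0
  have hzc : (starRingEnd ℂ) (z w) ≠ 0 := by simpa using hz
  have hn : (‖z w‖ : ℂ) ≠ 0 := by exact_mod_cast norm_ne_zero_iff.2 hz
  have e := Complex.mul_conj' (z w)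
  rw [map_div₀, map_mul, map_mul, Complex.conj_ofReal, map_ofNat, div_eq_div_iff (by simp [hz])
    (by simp [hz])]
  linear_combination (-2) * (starRingEnd ℂ) (deriv z w) * e

/-- `∂̄(a f'(|z|)|z|/(2z)) = a z̄' Ψ(|z|)` with `Ψ` the radial Laplacian of `f`. -/
lemma hasWirtinger_correction {f : ℝ → ℝ} (hf : ContDiffOn ℝ ∞ f (Set.Ioi 0)) {w : ℂ}
    (hw : w ∈ Metric.ball (0 : ℂ) σ) (hw0 : w ≠ 0) :
    dwbar (fun x => a x / (2 * z x) * ((‖z x‖ * deriv f ‖z x‖ : ℝ) : ℂ)) w =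
      (starRingEnd ℂ) (deriv z w) * a w * (radialLap f ‖z w‖ : ℝ) := by
  have hz := h.z_ne w hw hw0
  have hr : 0 < ‖z w‖ := norm_pos_iff.2 hz
  have hf1 : ContDiffOn ℝ ∞ (deriv f) (Set.Ioi 0) := hf.deriv_of_isOpen isOpen_Ioi (by norm_cast)
  have hG : HasDerivAt (fun r => r * deriv f r) (1 * deriv f ‖z w‖ +
      ‖z w‖ * deriv (deriv f) ‖z w‖) ‖z w‖ :=
    (hasDerivAt_id _).mul (differentiableAt_of_contDiffOn_Ioi hf1 hr).hasDerivAt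
  have h1 := HasWirtinger.real_comp (ρ := fun x => ‖z x‖) hG (h.hasWirtinger_norm hw hw0)
  have h2 : HasDerivAt (fun x => a x / (2 * z x)) (deriv (fun x => a x / (2 * z x)) w) w :=
    (((h.hasDerivAt_a hw).div ((h.hasDerivAt_z hw).const_mul 2)
      (mul_ne_zero two_ne_zero hz)).differentiableAt).hasDerivAt
  have h3 := (HasWirtinger.of_hasDerivAt h2).mul h1
  rw [h3.dwbar_eq, h.norm_mul_conj_eq hw hw0, radialLap]
  have hn : (‖z w‖ : ℂ) ≠ 0 := by exact_mod_cast norm_ne_zero_iff.2 hz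
  push_cast
  field_simp
  ring

/-- The factor conj(z') is antiholomorphic, so ∂ acts only on a and on the radial function. The ∂̄
component is not needed and stays unevaluated. -/
lemma dw_dwbar_correction {f : ℝ → ℝ} (hf : ContDiffOn ℝ ∞ f (Set.Ioi 0)) {w : ℂ}
    (hw : w ∈ Metric.ball (0 : ℂ) σ) (hw0 : w ≠ 0) :
    HasWirtinger (dwbar (fun x => a x / (2 * z x) * ((‖z x‖ * deriv f ‖z x‖ : ℝ) : ℂ)))
      ((starRingEnd ℂ) (deriv z w) * (deriv a w * (radialLap f ‖z w‖ : ℝ) +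
        a w * (deriv (radialLap f) ‖z w‖ : ℝ) * (‖z w‖ * deriv z w / (2 * z w))))
      (dwbar (dwbar (fun x => a x / (2 * z x) * ((‖z x‖ * deriv f ‖z x‖ : ℝ) : ℂ))) w) w := by
  have hz := h.z_ne w hw hw0
  have hr : 0 < ‖z w‖ := norm_pos_iff.2 hz
  have hΨ := (differentiableAt_of_contDiffOn_Ioi (radialLap_contDiffOn hf) hr).hasDerivAt
  have h1 := HasWirtinger.real_comp (ρ := fun x => ‖z x‖) hΨ (h.hasWirtinger_norm hw hw0)
  have hdz := ((h.dz_hol.differentiableAt (Metric.isOpen_ball.mem_nhds hw)).hasDerivAt)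
  have h2 := ((HasWirtinger.of_hasDerivAt hdz).conj.mul
    (HasWirtinger.of_hasDerivAt (h.hasDerivAt_a hw))).mul h1
  have h3 : dwbar (fun x => a x / (2 * z x) * ((‖z x‖ * deriv f ‖z x‖ : ℝ) : ℂ)) =ᶠ[𝓝 w]
      fun x => (starRingEnd ℂ) (deriv z x) * a x * (radialLap f ‖z x‖ : ℝ) := by
    filter_upwards [(Metric.isOpen_ball.sdiff isClosed_singleton).mem_nhds
      (show w ∈ Metric.ball 0 σ \ {0} from ⟨hw, hw0⟩)] with x hx
    exact h.hasWirtinger_correction hf hx.1 hx.2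
  have h4 := h2.congr_of_eventuallyEq h3
  refine h4.of_eq ?_ h4.dwbar_eq.symm
  simp only [map_zero]
  ring

end IsBlockData

/-! ### Exponential decay of the scalar problem -/

lemma IsModelFunction.mul_deriv_isBigO {t : ℝ} {u χ : ℝ → ℝ} (hu : IsModelFunction t u)
    (ht : 0 < t) (hχ : IsCutoff χ) :
    (fun r => (r * deriv (profile χ u) r + 1 / 2) / r) =O[𝓝[>] 0] fun _ => (1 : ℝ) := by
  obtain ⟨δ, hδ, C, hC⟩ := hu.exists_mul_deriv_add_half_le ht
  obtain ⟨r₀, hr₀, hχ1⟩ := hχ.eq_one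
  refine IsBigO.of_bound C ?_
  filter_upwards [Ioo_mem_nhdsGT (lt_min hδ hr₀)] with r hr
  have hr0 : 0 < r := hr.1
  have h1 : profile χ u =ᶠ[𝓝 r] u := by
    filter_upwards [Ioo_mem_nhds hr.1 (hr.2.trans_le (min_le_right _ _))] with x hx
    simp [profile, hχ1 x hx.1.le hx.2.le]
  rw [h1.deriv_eq, norm_one, mul_one, norm_div, Real.norm_eq_abs, Real.norm_of_nonneg hr0.le,
    div_le_iff₀ hr0]
  exact hC r hr0 (hr.2.trans_le (min_le_left _ _))

lemma profile_nonneg {t : ℝ} {u χ : ℝ → ℝ} (hu : IsModelFunction t u)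
    (ht : 0 < t) (hχ : IsCutoff χ) {r : ℝ} (hr : 0 < r) : 0 ≤ profile χ u r :=
  mul_nonneg (hu.nonneg ht hr) (hχ.nonneg r)

/-- `r⁻¹ (exp (-2 f) - 1)`. -/
def expDefect (f : ℝ → ℝ) (r : ℝ) : ℝ := r⁻¹ * (Real.exp (-2 * f r) - 1)

lemma expDefect_hasDerivAt {f : ℝ → ℝ} {r : ℝ} (hr : r ≠ 0) (hf : DifferentiableAt ℝ f r) :
    HasDerivAt (expDefect f) (-(r ^ 2)⁻¹ * (Real.exp (-2 * f r) - 1) +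
      r⁻¹ * (Real.exp (-2 * f r) * (-2 * deriv f r))) r :=
  (hasDerivAt_inv hr).mul (((hf.hasDerivAt.const_mul (-2)).exp).sub_const 1)

/-- The data of the scalar Coulomb problem in one block: `n` solves the equation on `Ω`, and
`n = -P / (4 z)` on the rest of the disk of radius `ρ`. -/
structure IsScalarSolution (ρ : ℝ) (z P : ℂ → ℂ) (f : ℝ → ℝ) (t : ℝ) (Ω : Set ℂ) (n : ℂ → ℂ) :
    Prop where
  cont : ContinuousOn n (Metric.ball 0 ρ)
  smooth : ContDiffOn ℝ ∞ n Ω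
  eq : ∀ w ∈ Ω, w ≠ 0 → dw (dwbar n) w = t ^ 2 * ‖z w‖ * ((starRingEnd ℂ) (deriv z w) * deriv z w) *
    (4 * n w * (Real.cosh (2 * f ‖z w‖) : ℝ) + (Real.exp (-2 * f ‖z w‖) : ℝ) * (P w / z w))
  eq_inf : ∀ w ∈ Metric.ball (0 : ℂ) ρ \ Ω, n w = -(P w / (4 * z w))

/-- The integrand `P̄z̄'/|z| e^{-2f} (P z' + 2 n z z')`. -/
def blockDensity (z P : ℂ → ℂ) (f : ℝ → ℝ) (n : ℂ → ℂ) (w : ℂ) : ℂ :=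
  (starRingEnd ℂ) (P w * deriv z w) / ‖z w‖ * (Real.exp (-2 * f ‖z w‖) : ℝ) *
    (P w * deriv z w + 2 * n w * z w * deriv z w)

/-- The difference of `n` and its expected value. -/
def deviation (z P a : ℂ → ℂ) (f : ℝ → ℝ) (n : ℂ → ℂ) (w : ℂ) : ℂ :=
  n w + P w / (4 * z w) + a w / (2 * z w) * ((‖z w‖ * deriv f ‖z w‖ : ℝ) : ℂ)

/-- A primitive for the leading part of the difference of the densities. -/
def densityPrimitive (z P a : ℂ → ℂ) (f : ℝ → ℝ) (w : ℂ) : ℂ :=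
  (starRingEnd ℂ) (P w * deriv z w) * (a w * z w) * (expDefect f ‖z w‖ : ℝ)

namespace IsBlockData

variable {σ : ℝ} {z P a : ℂ → ℂ} (h : IsBlockData σ z P a)
include h

lemma deviation_contDiffAt {f : ℝ → ℝ} (hf : ContDiffOn ℝ ∞ f (Set.Ioi 0)) {n : ℂ → ℂ} {w : ℂ}
    (hw : w ∈ Metric.ball (0 : ℂ) σ) (hw0 : w ≠ 0) (hn : ContDiffAt ℝ 2 n w) :
    ContDiffAt ℝ 2 (deviation z P a f n) w := by
  have hz := h.z_ne w hw hw0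
  have hf1 : ContDiffOn ℝ ∞ (fun r => r * deriv f r) (Set.Ioi 0) :=
    contDiffOn_id.mul (hf.deriv_of_isOpen isOpen_Ioi (by norm_cast))
  have h1 := (h.contDiffAt_radial hf1 hw hw0).of_le (show (2 : WithTop ℕ∞) ≤ ∞ by norm_cast)
  exact (hn.add (h.contDiffAt_div_z h.P_hol hw hw0 (by norm_num))).add
    ((h.contDiffAt_div_z h.a_hol hw hw0 (by norm_num)).mul h1)

/-- Inserting P = a + 2 z a'/z' combines the polar terms into a multiple of r f' + 1/2. Since this
is O(r) for the profile, the pole at the branch point disappears and the deviation is bounded there.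
-/
lemma deviation_eq {f : ℝ → ℝ} {n : ℂ → ℂ} {w : ℂ}
    (hw : w ∈ Metric.ball (0 : ℂ) σ) (hw0 : w ≠ 0) :
    deviation z P a f n w = n w + deriv a w / (2 * deriv z w) +
      a w / 2 * (‖z w‖ / z w) * (((‖z w‖ * deriv f ‖z w‖ + 1 / 2) / ‖z w‖ : ℝ) : ℂ) := by
  have hz := h.z_ne w hw hw0
  have hn : (‖z w‖ : ℂ) ≠ 0 := by exact_mod_cast norm_ne_zero_iff.2 hz
  have hd := h.dz_ne w hw
  have e := h.a_eq w hw
  have hP : P w = (2 * z w * deriv a w + a w * deriv z w) / deriv z w := by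
    rw [e]; field_simp
  rw [deviation, hP]
  push_cast
  field_simp
  ring

lemma deviation_isBigO {t : ℝ} (ht : 0 < t) {χ u : ℝ → ℝ} (hu : IsModelFunction t u)
    (hχ : IsCutoff χ) {n : ℂ → ℂ} (hn : ContinuousAt n 0) :
    deviation z P a (profile χ u) n =O[𝓝[≠] 0] fun _ => (1 : ℝ) := by
  have h1 := (hu.mul_deriv_isBigO ht hχ).comp_tendsto h.tendsto_norm_z
  have h2 : n =O[𝓝[≠] 0] fun _ => (1 : ℝ) := (hn.tendsto.isBigO_one ℝ).mono nhdsWithin_le_nhds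
  have h3 : (fun w => deriv a w / (2 * deriv z w)) =O[𝓝[≠] 0] fun _ => (1 : ℝ) :=
    h.isBigO_one_of_hol ((h.a_hol.deriv Metric.isOpen_ball).div (h.dz_hol.const_mul 2)
      fun w hw => mul_ne_zero two_ne_zero (h.dz_ne w hw))
  have h4 : (fun w => a w / 2) =O[𝓝[≠] 0] fun _ => (1 : ℝ) :=
    h.isBigO_one_of_hol (h.a_hol.div_const 2)
  have h5 : (fun w => (‖z w‖ / z w : ℂ)) =O[𝓝[≠] 0] fun _ => (1 : ℝ) := by
    refine IsBigO.of_bound 1 (Eventually.of_forall fun w => ?_)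
    rw [norm_div, Complex.norm_real, norm_norm, norm_one, mul_one]
    exact div_self_le_one _
  have h6 : (fun w => (((‖z w‖ * deriv (profile χ u) ‖z w‖ + 1 / 2) / ‖z w‖ : ℝ) : ℂ)) =O[𝓝[≠] 0]
      fun _ => (1 : ℝ) := by
    refine IsBigO.trans (IsBigO.of_bound 1 (Eventually.of_forall fun w => ?_)) h1
    rw [one_mul, Complex.norm_real]
    rfl
  have h8 := (h4.mul h5).mul h6
  simp only [mul_one] at h8
  have h7 := (h2.add h3).add h8
  refine h7.congr' ?_ EventuallyEq.rfl
  filter_upwards [nhdsWithin_le_nhds (Metric.ball_mem_nhds 0 h.pos), self_mem_nhdsWithin] with w hw hw0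
  exact (h.deviation_eq hw hw0).symm

/-- The equation for the deviation. -/
lemma dw_dwbar_deviation {ρ t : ℝ} {χ u : ℝ → ℝ} (hu : IsModelFunction t u)
    (hχ : IsCutoff χ) {Ω : Set ℂ} (hΩ : IsOpen Ω) (hΩσ : Ω ⊆ Metric.ball 0 σ) {n : ℂ → ℂ}
    (hn : IsScalarSolution ρ z P (profile χ u) t Ω n) {w : ℂ} (hw : w ∈ Ω) (hw0 : w ≠ 0) :
    dw (dwbar (deviation z P a (profile χ u) n)) w =
      ((4 * t ^ 2 * ‖z w‖ * ‖deriv z w‖ ^ 2 * Real.cosh (2 * profile χ u ‖z w‖) : ℝ) : ℂ) *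
        deviation z P a (profile χ u) n w +
      (starRingEnd ℂ) (deriv z w) * (deriv a w * (profileError t χ u ‖z w‖ : ℝ) +
        a w * (deriv (profileError t χ u) ‖z w‖ : ℝ) * (‖z w‖ * deriv z w / (2 * z w))) := by
  set f := profile χ u with hf
  have hfs : ContDiffOn ℝ ∞ f (Set.Ioi 0) := profile_contDiffOn hχ hu
  have hopen : IsOpen (Ω \ {0}) := hΩ.sdiff isClosed_singleton
  have hmem : w ∈ Ω \ {0} := ⟨hw, hw0⟩
  have hns : ∀ x ∈ Ω, DifferentiableAt ℝ n x := fun x hx =>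
    (hn.smooth.contDiffAt (hΩ.mem_nhds hx)).differentiableAt (by norm_num)
  have hnb : DifferentiableAt ℝ (dwbar n) w := by
    have h1 : ContDiffAt ℝ 1 (fderiv ℝ n) w :=
      (hn.smooth.contDiffAt (hΩ.mem_nhds hw)).fderiv_right (by norm_cast)
    have h2 := h1.differentiableAt (by norm_num)
    exact ((h2.clm_apply (differentiableAt_const _)).add
      ((h2.clm_apply (differentiableAt_const _)).const_mul Complex.I)).const_mul _
  have hf1 : ContDiffOn ℝ ∞ (fun r => r * deriv f r) (Set.Ioi 0) :=
    contDiffOn_id.mul (hfs.deriv_of_isOpen isOpen_Ioi (by norm_cast))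
  -- The term P/(4z) is holomorphic off 0 and is killed by ∂̄.
  have hbar : dwbar (deviation z P a f n) =ᶠ[𝓝 w] fun x => dwbar n x +
      dwbar (fun x => a x / (2 * z x) * ((‖z x‖ * deriv f ‖z x‖ : ℝ) : ℂ)) x := by
    filter_upwards [hopen.mem_nhds hmem] with x hx
    have hxσ := hΩσ hx.1
    have hz := h.z_ne x hxσ hx.2
    have d1 := HasWirtinger.of_differentiableAt (hns x hx.1)
    have d2 : DifferentiableAt ℂ (fun x => P x / (4 * z x)) x :=
      (h.P_hol.differentiableAt (Metric.isOpen_ball.mem_nhds hxσ)).div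
        ((h.hasDerivAt_z hxσ).differentiableAt.const_mul 4) (by simpa using hz)
    have d3 : DifferentiableAt ℝ
        (fun x => a x / (2 * z x) * ((‖z x‖ * deriv f ‖z x‖ : ℝ) : ℂ)) x :=
      ((h.contDiffAt_div_z h.a_hol hxσ hx.2 (by norm_num)).mul
        (h.contDiffAt_radial hf1 hxσ hx.2)).differentiableAt (by norm_num)
    have d4 := (d1.add (HasWirtinger.of_hasDerivAt d2.hasDerivAt)).add
      (HasWirtinger.of_differentiableAt d3)
    have := d4.dwbar_eq
    rw [add_zero] at this
    exact this
  rw [dw_congr hbar, ((HasWirtinger.of_differentiableAt hnb).add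
    (h.dw_dwbar_correction hfs (hΩσ hw) hw0)).dw_eq, hn.eq w hw hw0]
  have hwσ := hΩσ hw
  have hz := h.z_ne w hwσ hw0
  have hr : 0 < ‖z w‖ := norm_pos_iff.2 hz
  have hd := h.dz_ne w hwσ
  have hd0 := (differentiableAt_of_contDiffOn_Ioi hfs hr).hasDerivAt
  -- The cosh term of this derivative cancels the part of the zeroth-order coefficient times
  -- deviation that contains a f'. The sinh terms match through e^{-2f} = cosh 2f - sinh 2f and the
  -- equation for a.
  have hE : deriv (profileError t χ u) ‖z w‖ = deriv (radialLap f) ‖z w‖ -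
      (2 * t ^ 2 * Real.sinh (2 * f ‖z w‖) + 2 * t ^ 2 * ‖z w‖ *
        (Real.cosh (2 * f ‖z w‖) * (2 * deriv f ‖z w‖))) := by
    have hd1 := (differentiableAt_of_contDiffOn_Ioi (radialLap_contDiffOn hfs) hr).hasDerivAt
    have hd2 := hd1.sub (((hasDerivAt_id _).const_mul (2 * t ^ 2)).mul ((hd0.const_mul 2).sinh))
    refine hd2.deriv.trans ?_
    simp only [id]
    ring
  have hexp : Real.exp (-2 * f ‖z w‖) = Real.cosh (2 * f ‖z w‖) - Real.sinh (2 * f ‖z w‖) := by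
    rw [Real.cosh_sub_sinh]; ring_nf
  have hdz2 : ((‖deriv z w‖ ^ 2 : ℝ) : ℂ) = (starRingEnd ℂ) (deriv z w) * deriv z w := by
    rw [Complex.conj_mul']; push_cast; rfl
  have hP : P w = (2 * z w * deriv a w + a w * deriv z w) / deriv z w := by
    rw [h.a_eq w hwσ]; field_simp
  rw [hE, hexp, deviation, profileError, ← hf, hP]
  simp only [Complex.ofReal_mul, Complex.ofReal_sub, Complex.ofReal_add] at hdz2 ⊢
  rw [hdz2]
  set c : ℂ := ((Real.cosh (2 * f ‖z w‖) : ℝ) : ℂ)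
  set s : ℂ := ((Real.sinh (2 * f ‖z w‖) : ℝ) : ℂ)
  set Dz := (starRingEnd ℂ) (deriv z w)
  push_cast
  field_simp
  ring

lemma densityPrimitive_hasWirtinger {f : ℝ → ℝ} (hf : ContDiffOn ℝ ∞ f (Set.Ioi 0)) {w : ℂ}
    (hw : w ∈ Metric.ball (0 : ℂ) σ) (hw0 : w ≠ 0) :
    HasWirtinger (densityPrimitive z P a f)
      ((starRingEnd ℂ) (P w * deriv z w) * ((deriv a w * z w + a w * deriv z w) *
        (expDefect f ‖z w‖ : ℝ) + a w * (deriv (expDefect f) ‖z w‖ : ℝ) * (‖z w‖ * deriv z w / 2)))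
      ((starRingEnd ℂ) (deriv (fun x => P x * deriv z x) w) * (a w * z w) *
        (expDefect f ‖z w‖ : ℝ) + (starRingEnd ℂ) (P w * deriv z w) * (a w * z w) *
        ((deriv (expDefect f) ‖z w‖ : ℝ) * ((starRingEnd ℂ) (deriv z w) * z w / (2 * ‖z w‖)))) w := by
  have hz := h.z_ne w hw hw0
  have hr : 0 < ‖z w‖ := norm_pos_iff.2 hz
  have d1 := ((h.P_hol.mul h.dz_hol).differentiableAt (Metric.isOpen_ball.mem_nhds hw)).hasDerivAt
  have d2 := (h.hasDerivAt_a hw).mul (h.hasDerivAt_z hw)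
  have d3 := (expDefect_hasDerivAt hr.ne' (differentiableAt_of_contDiffOn_Ioi hf hr)).differentiableAt.hasDerivAt
  have d4 := HasWirtinger.real_comp (ρ := fun x => ‖z x‖) d3 (h.hasWirtinger_norm hw hw0)
  have d5 := ((HasWirtinger.of_hasDerivAt d1).conj.mul (HasWirtinger.of_hasDerivAt d2)).mul d4
  refine d5.of_eq ?_ ?_
  · simp only [map_zero, Pi.mul_apply]
    field_simp
    ring
  · rw [h.norm_mul_conj_eq hw hw0]
    simp only [Pi.mul_apply, mul_zero, add_zero]
    rfl

/-- The difference of the densities is exact up to the deviation. -/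
lemma blockDensity_sub {f : ℝ → ℝ} (hf : ContDiffOn ℝ ∞ f (Set.Ioi 0)) {n : ℂ → ℂ} {w : ℂ}
    (hw : w ∈ Metric.ball (0 : ℂ) σ) (hw0 : w ≠ 0) :
    blockDensity z P f n w - blockDensity z P 0 (fun x => -(P x / (4 * z x))) w =
      dw (densityPrimitive z P a f) w + 2 * ((starRingEnd ℂ) (P w * deriv z w)) *
        (z w / ‖z w‖) * deriv z w * (Real.exp (-2 * f ‖z w‖) : ℝ) * deviation z P a f n w := by
  have hz := h.z_ne w hw hw0
  have hr : 0 < ‖z w‖ := norm_pos_iff.2 hz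
  have hn : (‖z w‖ : ℂ) ≠ 0 := by exact_mod_cast hr.ne'
  have hd := h.dz_ne w hw
  rw [(h.densityPrimitive_hasWirtinger hf hw hw0).dw_eq,
    (expDefect_hasDerivAt hr.ne' (differentiableAt_of_contDiffOn_Ioi hf hr)).deriv]
  have hP : P w = (2 * z w * deriv a w + a w * deriv z w) / deriv z w := by
    rw [h.a_eq w hw]; field_simp
  simp only [blockDensity, deviation, expDefect, Pi.zero_apply, mul_zero, Real.exp_zero]
  set cP := (starRingEnd ℂ) (P w * deriv z w)
  rw [hP]
  push_cast
  set e := Complex.exp (-2 * (f ‖z w‖ : ℂ))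
  field_simp
  ring

end IsBlockData

namespace IsBlockData

variable {σ : ℝ} {z P a : ℂ → ℂ} (h : IsBlockData σ z P a)
include h

lemma blockDensity_continuousOn {f : ℝ → ℝ} (hf : ContDiffOn ℝ ∞ f (Set.Ioi 0)) {n : ℂ → ℂ}
    {K : Set ℂ} (hK : K ⊆ Metric.ball 0 σ) (hn : ContinuousOn n (K \ {0})) :
    ContinuousOn (blockDensity z P f n) (K \ {0}) := by
  have hs : K \ {0} ⊆ Metric.ball 0 σ := fun x hx => hK hx.1
  have hzc := h.z_hol.continuousOn.mono hs
  have hdc := h.dz_hol.continuousOn.mono hs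
  have hPc := h.P_hol.continuousOn.mono hs
  have hfc : ContinuousOn (fun w => f ‖z w‖) (K \ {0}) :=
    hf.continuousOn.comp hzc.norm fun x hx => norm_pos_iff.2 (h.z_ne x (hs hx) hx.2)
  refine ContinuousOn.mul (ContinuousOn.mul (ContinuousOn.div
    (Complex.continuous_conj.comp_continuousOn (hPc.mul hdc))
    (Complex.continuous_ofReal.comp_continuousOn hzc.norm) ?_)
    (Complex.continuous_ofReal.comp_continuousOn
      (Real.continuous_exp.comp_continuousOn (continuousOn_const.mul hfc))))
    ((hPc.mul hdc).add (((continuousOn_const.mul hn).mul hzc).mul hdc))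
  intro x hx
  simpa using h.z_ne x (hs hx) hx.2

lemma blockDensity_isBigO {f : ℝ → ℝ} (hf : ∀ r, 0 < r → 0 ≤ f r) {n : ℂ → ℂ}
    (hn : (fun w => n w * z w) =O[𝓝[≠] 0] fun _ => (1 : ℝ)) :
    blockDensity z P f n =O[𝓝[≠] 0] fun w => ‖w‖⁻¹ := by
  have hPd := h.isBigO_one_of_hol (h.P_hol.mul h.dz_hol)
  have h1 : (fun w => (starRingEnd ℂ) (P w * deriv z w)) =O[𝓝[≠] 0] fun _ => (1 : ℝ) := by
    refine IsBigO.trans (IsBigO.of_bound 1 (Eventually.of_forall fun w => ?_)) hPd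
    simp
  have h2 : (fun w => ((‖z w‖ : ℂ))⁻¹) =O[𝓝[≠] 0] fun w => ‖w‖⁻¹ := by
    refine IsBigO.trans (IsBigO.of_bound 1 (Eventually.of_forall fun w => ?_)) h.inv_norm_z_isBigO
    simp
  have h3 : (fun w => ((Real.exp (-2 * f ‖z w‖) : ℝ) : ℂ)) =O[𝓝[≠] 0] fun _ => (1 : ℝ) := by
    refine IsBigO.of_bound 1 ?_
    filter_upwards [h.tendsto_norm_z.eventually self_mem_nhdsWithin] with w hw
    rw [Complex.norm_real, Real.norm_of_nonneg (Real.exp_pos _).le, norm_one, mul_one,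
      Real.exp_le_one_iff]
    linarith [hf _ hw]
  have h4 := h.isBigO_one_of_hol h.dz_hol
  have h5 : (fun w => 2 * n w * z w * deriv z w) =O[𝓝[≠] 0] fun _ => (1 : ℝ) := by
    have := (hn.mul h4).const_mul_left (2 : ℂ)
    simp only [mul_one] at this
    refine this.congr_left fun w => by ring
  have h6 := ((h1.mul h2).mul h3).mul (hPd.add h5)
  simp only [one_mul, mul_one] at h6
  exact h6

lemma blockDensity_inf_integrableOn {ρ : ℝ} (hρσ : ρ < σ) :
    IntegrableOn (blockDensity z P 0 fun x => -(P x / (4 * z x))) (Metric.ball 0 ρ) := by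
  have hs : Metric.closedBall (0 : ℂ) ρ ⊆ Metric.ball 0 σ := Metric.closedBall_subset_ball hρσ
  refine IntegrableOn.mono_set (integrableOn_of_isBigO_inv_norm (isCompact_closedBall 0 ρ)
    (h.blockDensity_continuousOn contDiffOn_const hs ?_)
    (h.blockDensity_isBigO (fun r _ => le_rfl) ?_)) Metric.ball_subset_closedBall
  · have hs' : Metric.closedBall (0 : ℂ) ρ \ {0} ⊆ Metric.ball 0 σ := fun x hx => hs hx.1
    refine ((h.P_hol.continuousOn.mono hs').div
      (continuousOn_const.mul (h.z_hol.continuousOn.mono hs')) fun x hx => ?_).neg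
    simpa using h.z_ne x (hs' hx) hx.2
  · refine ((h.isBigO_one_of_hol h.P_hol).const_mul_left (-(1 / 4) : ℂ)).congr' ?_ EventuallyEq.rfl
    filter_upwards [nhdsWithin_le_nhds (Metric.ball_mem_nhds 0 h.pos), self_mem_nhdsWithin]
      with w hw hw0
    have := h.z_ne w hw hw0
    field_simp

/-- On the closure of Ω the density is O(1/|w|), because n is continuous at 0 and the profile is
nonnegative. Outside, it coincides with the limiting density. -/
lemma blockDensity_integrableOn {ρ t : ℝ} (ht : 0 < t) (hρσ : ρ < σ) {χ u : ℝ → ℝ}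
    (hu : IsModelFunction t u) (hχ : IsCutoff χ) {Ω : Set ℂ} (h0 : (0 : ℂ) ∈ Ω)
    (hcl : closure Ω ⊆ Metric.ball 0 ρ)
    (hχΩ : ∀ w ∈ Metric.ball (0 : ℂ) ρ, χ ‖z w‖ ≠ 0 → w ∈ Ω) {n : ℂ → ℂ}
    (hn : IsScalarSolution ρ z P (profile χ u) t Ω n) :
    IntegrableOn (blockDensity z P (profile χ u) n) (Metric.ball 0 ρ) := by
  have hsub : closure Ω ⊆ Metric.ball 0 σ := hcl.trans (Metric.ball_subset_ball hρσ.le)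
  have hK : IsCompact (closure Ω) :=
    (Metric.isBounded_ball.subset (subset_closure.trans hcl)).isCompact_closure
  have h0ρ : (0 : ℂ) ∈ Metric.ball (0 : ℂ) ρ := hcl (subset_closure h0)
  have hnc : ContinuousAt n 0 := hn.cont.continuousAt (Metric.isOpen_ball.mem_nhds h0ρ)
  have h1 : IntegrableOn (blockDensity z P (profile χ u) n) (closure Ω) := by
    refine integrableOn_of_isBigO_inv_norm hK
      (h.blockDensity_continuousOn (profile_contDiffOn hχ hu) hsub
        (hn.cont.mono fun x hx => hcl hx.1))
      (h.blockDensity_isBigO (fun r hr => profile_nonneg hu ht hχ hr) ?_)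
    have := ((hnc.tendsto.isBigO_one ℝ).mono nhdsWithin_le_nhds).mul
      (h.isBigO_one_of_hol h.z_hol)
    simpa only [mul_one] using this
  have h2 : IntegrableOn (blockDensity z P (profile χ u) n) (Metric.ball 0 ρ \ closure Ω) := by
    have hm : MeasurableSet (Metric.ball (0 : ℂ) ρ \ closure Ω) :=
      measurableSet_ball.diff isClosed_closure.measurableSet
    refine IntegrableOn.congr_fun ((h.blockDensity_inf_integrableOn hρσ).mono_set Set.sdiff_subset)
      (fun w hw => ?_) hm
    have hwΩ : w ∉ Ω := fun hh => hw.2 (subset_closure hh)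
    have hχ0 : χ ‖z w‖ = 0 := by
      by_contra hh
      exact hwΩ (hχΩ w hw.1 hh)
    simp only [blockDensity, profile, hχ0, mul_zero, hn.eq_inf w ⟨hw.1, hwΩ⟩, Pi.zero_apply]
  refine (h1.union h2).mono_set fun x hx => ?_
  by_cases hxc : x ∈ closure Ω
  · exact Or.inl hxc
  · exact Or.inr ⟨hx, hxc⟩

/-- The deviation vanishes outside `Ω`. -/
lemma deviation_eq_zero {ρ t : ℝ} (hρσ : ρ < σ) {χ u : ℝ → ℝ}
    (hu : IsModelFunction t u) (hχ : IsCutoff χ) {Ω : Set ℂ} (h0 : (0 : ℂ) ∈ Ω)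
    (hχΩ : ∀ w ∈ Metric.ball (0 : ℂ) ρ, χ ‖z w‖ ≠ 0 → w ∈ Ω) {n : ℂ → ℂ}
    (hn : IsScalarSolution ρ z P (profile χ u) t Ω n) {w : ℂ} (hw : w ∈ Metric.ball (0 : ℂ) ρ)
    (hwΩ : w ∉ Ω) : deviation z P a (profile χ u) n w = 0 := by
  have hw0 : w ≠ 0 := fun hh => hwΩ (hh ▸ h0)
  have hwσ := Metric.ball_subset_ball hρσ.le hw
  have hr : 0 < ‖z w‖ := norm_pos_iff.2 (h.z_ne w hwσ hw0)
  have hχ0 : χ ‖z w‖ = 0 := by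
    by_contra hh
    exact hwΩ (hχΩ w hw hh)
  -- A zero of the nonnegative cutoff is a minimum, so the derivative vanishes there as well. Hence
  -- the correction term f' vanishes outside Ω, not only f.
  have hχ1 : deriv χ ‖z w‖ = 0 :=
    IsLocalMin.deriv_eq_zero (Eventually.of_forall fun r => by rw [hχ0]; exact hχ.nonneg r)
  have hd : deriv (profile χ u) ‖z w‖ = 0 := by
    have h1 := (hasDerivAt_two_of_contDiffOn hu.smooth hr).1
    have h2 := (hχ.smooth.differentiable (by norm_num) ‖z w‖).hasDerivAt
    rw [show profile χ u = fun r => u r * χ r from rfl]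
    refine (h1.mul h2).deriv.trans ?_
    simp [hχ0, hχ1]
  rw [deviation, hd, hn.eq_inf w ⟨hw, hwΩ⟩]
  simp

lemma densityPrimitive_eq_zero {ρ : ℝ} {χ u : ℝ → ℝ} {Ω : Set ℂ}
    (hχΩ : ∀ w ∈ Metric.ball (0 : ℂ) ρ, χ ‖z w‖ ≠ 0 → w ∈ Ω) {w : ℂ}
    (hw : w ∈ Metric.ball (0 : ℂ) ρ) (hwΩ : w ∉ Ω) :
    densityPrimitive z P a (profile χ u) w = 0 := by
  have hχ0 : χ ‖z w‖ = 0 := by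
    by_contra hh
    exact hwΩ (hχΩ w hw hh)
  simp [densityPrimitive, expDefect, profile, hχ0]

/-- The profile is nonnegative, so e^{-2f} lies in (0, 1], and r f' is bounded near 0. These bounds
make the first derivatives of the primitive O(1/|w|), as Stokes' theorem with an isolated
singularity requires. -/
lemma expDefect_isBigO {t : ℝ} (ht : 0 < t) {χ u : ℝ → ℝ}
    (hu : IsModelFunction t u) (hχ : IsCutoff χ) :
    ((fun w => ((expDefect (profile χ u) ‖z w‖ : ℝ) : ℂ)) =O[𝓝[≠] 0] fun w => ‖w‖⁻¹) ∧
    ((fun w => ((deriv (expDefect (profile χ u)) ‖z w‖ : ℝ) : ℂ) * ‖z w‖) =O[𝓝[≠] 0]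
      fun w => ‖w‖⁻¹) := by
  set f := profile χ u with hf
  have hb : ∀ r, 0 < r → |Real.exp (-2 * f r) - 1| ≤ 1 ∧ |Real.exp (-2 * f r)| ≤ 1 := by
    intro r hr
    have h1 : Real.exp (-2 * f r) ≤ 1 :=
      Real.exp_le_one_iff.2 (by linarith [profile_nonneg hu ht hχ hr])
    have h2 := Real.exp_pos (-2 * f r)
    constructor <;> rw [abs_le] <;> constructor <;> linarith
  have hB : (fun r => r * deriv f r) =O[𝓝[>] 0] fun _ => (1 : ℝ) := by
    have h1 := hu.mul_deriv_isBigO ht hχ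
    have h2 : (fun r : ℝ => r) =O[𝓝[>] 0] fun _ => (1 : ℝ) :=
      (continuousAt_id.tendsto.isBigO_one ℝ).mono nhdsWithin_le_nhds
    have h3 := (h1.mul h2).sub
      (isBigO_const_const (1 / 2 : ℝ) (one_ne_zero (α := ℝ)) (𝓝[>] (0 : ℝ)) |>.congr_right
        fun _ => (mul_one (1 : ℝ)).symm)
    simp only [mul_one] at h3
    refine h3.congr' ?_ EventuallyEq.rfl
    filter_upwards [self_mem_nhdsWithin] with r hr
    have : r ≠ 0 := ne_of_gt hr
    field_simp
    ring
  have hE : expDefect f =O[𝓝[>] 0] fun r => r⁻¹ := by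
    refine IsBigO.of_bound 1 ?_
    filter_upwards [self_mem_nhdsWithin] with r hr
    rw [expDefect, norm_mul, one_mul]
    exact mul_le_of_le_one_right (norm_nonneg _) (hb r hr).1
  have hE1 : (fun r => deriv (expDefect f) r * r) =O[𝓝[>] 0] fun r => r⁻¹ := by
    have e1 : (fun r => Real.exp (-2 * f r) - 1) =O[𝓝[>] 0] fun _ => (1 : ℝ) := by
      refine IsBigO.of_bound 1 ?_
      filter_upwards [self_mem_nhdsWithin] with r hr
      simpa using (hb r hr).1
    have e2 : (fun r => Real.exp (-2 * f r)) =O[𝓝[>] 0] fun _ => (1 : ℝ) := by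
      refine IsBigO.of_bound 1 ?_
      filter_upwards [self_mem_nhdsWithin] with r hr
      simpa using (hb r hr).2
    have e3 := (e2.mul hB).const_mul_left (-2 : ℝ)
    simp only [mul_one] at e3
    have e4 := (isBigO_refl (fun r : ℝ => r⁻¹) (𝓝[>] 0)).mul (e3.sub e1)
    simp only [mul_one] at e4
    refine e4.congr' ?_ EventuallyEq.rfl
    filter_upwards [self_mem_nhdsWithin] with r hr
    have hr0 : r ≠ 0 := ne_of_gt hr
    rw [(expDefect_hasDerivAt hr0
      (differentiableAt_of_contDiffOn_Ioi (profile_contDiffOn hχ hu) hr)).deriv]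
    field_simp
    ring
  constructor
  · refine IsBigO.trans (IsBigO.of_bound 1 (Eventually.of_forall fun w => ?_))
      ((hE.comp_tendsto h.tendsto_norm_z).trans h.inv_norm_z_isBigO)
    rw [one_mul, Complex.norm_real]; rfl
  · refine IsBigO.trans (IsBigO.of_bound 1 (Eventually.of_forall fun w => ?_))
      ((hE1.comp_tendsto h.tendsto_norm_z).trans h.inv_norm_z_isBigO)
    rw [one_mul, ← Complex.ofReal_mul, Complex.norm_real]; rfl

/-- The primitive vanishes wherever χ does, in particular outside Ω. Extended by zero it is C¹ off 0
with compact support, and its derivatives are O(1/|w|) at 0, so neither the boundary nor the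
puncture contributes. -/
lemma integral_dw_densityPrimitive {ρ t : ℝ} (ht : 0 < t) (hρσ : ρ < σ) {χ u : ℝ → ℝ}
    (hu : IsModelFunction t u) (hχ : IsCutoff χ) {Ω : Set ℂ} (h0 : (0 : ℂ) ∈ Ω)
    (hcl : closure Ω ⊆ Metric.ball 0 ρ)
    (hχΩ : ∀ w ∈ Metric.ball (0 : ℂ) ρ, χ ‖z w‖ ≠ 0 → w ∈ Ω) :
    IntegrableOn (dw (densityPrimitive z P a (profile χ u))) (Metric.ball 0 ρ) ∧
      ∫ w in Metric.ball 0 ρ, dw (densityPrimitive z P a (profile χ u)) w = 0 := by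
  set f := profile χ u with hf
  have hfs : ContDiffOn ℝ ∞ f (Set.Ioi 0) := profile_contDiffOn hχ hu
  set F := (Metric.ball (0 : ℂ) ρ).indicator (densityPrimitive z P a f) with hF
  have hK : IsCompact (closure Ω) :=
    (Metric.isBounded_ball.subset (subset_closure.trans hcl)).isCompact_closure
  have hFz : ∀ w, w ∉ Ω → F w = 0 := by
    intro w hw
    by_cases hwρ : w ∈ Metric.ball (0 : ℂ) ρ
    · rw [hF, Set.indicator_of_mem hwρ, h.densityPrimitive_eq_zero hχΩ hwρ hw]
    · rw [hF, Set.indicator_of_notMem hwρ]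
  have hFeq : ∀ w ∈ Metric.ball (0 : ℂ) ρ, F =ᶠ[𝓝 w] densityPrimitive z P a f := by
    intro w hw
    filter_upwards [Metric.isOpen_ball.mem_nhds hw] with x hx
    rw [hF, Set.indicator_of_mem hx]
  have hF0 : ∀ w, w ∉ closure Ω → F =ᶠ[𝓝 w] fun _ => 0 := by
    intro w hw
    filter_upwards [isClosed_closure.isOpen_compl.mem_nhds hw] with x hx
    exact hFz x fun hh => hx (subset_closure hh)
  have hsupp : HasCompactSupport F :=
    HasCompactSupport.intro hK fun w hw => hFz w fun hh => hw (subset_closure hh)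
  have hc1 : ContDiffOn ℝ 1 F {0}ᶜ := by
    intro w hw0
    refine ContDiffAt.contDiffWithinAt ?_
    by_cases hwc : w ∈ closure Ω
    · have hwσ := Metric.ball_subset_ball hρσ.le (hcl hwc)
      refine ContDiffAt.congr_of_eventuallyEq ?_ (hFeq w (hcl hwc))
      have hE : ContDiffOn ℝ ∞ (expDefect f) (Set.Ioi 0) :=
        (contDiffOn_inv ℝ |>.mono fun x hx => ne_of_gt hx).mul
          ((Real.contDiff_exp.comp_contDiffOn (contDiffOn_const.mul hfs)).sub contDiffOn_const)
      have hrad := (h.contDiffAt_radial hE hwσ hw0).of_le (show (1 : WithTop ℕ∞) ≤ ∞ by norm_cast)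
      exact ((Complex.conjCLE.contDiff.contDiffAt.comp w
        (h.contDiffAt_hol (h.P_hol.mul h.dz_hol) hwσ)).mul
        ((h.contDiffAt_hol h.a_hol hwσ).mul (h.contDiffAt_hol h.z_hol hwσ))).mul hrad
    · exact contDiffAt_const.congr_of_eventuallyEq (hF0 w hwc)
  have hρ0 : Metric.ball (0 : ℂ) ρ ∈ 𝓝 (0 : ℂ) := Metric.isOpen_ball.mem_nhds (hcl (subset_closure h0))
  obtain ⟨hE0, hE1⟩ := h.expDefect_isBigO ht hu hχ
  have bPd : (fun w => (starRingEnd ℂ) (P w * deriv z w)) =O[𝓝[≠] 0] fun _ => (1 : ℝ) := by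
    refine IsBigO.trans (IsBigO.of_bound 1 (Eventually.of_forall fun w => ?_))
      (h.isBigO_one_of_hol (h.P_hol.mul h.dz_hol))
    simp
  have bPd' : (fun w => (starRingEnd ℂ) (deriv (fun x => P x * deriv z x) w)) =O[𝓝[≠] 0]
      fun _ => (1 : ℝ) := by
    refine IsBigO.trans (IsBigO.of_bound 1 (Eventually.of_forall fun w => ?_))
      (h.isBigO_one_of_hol ((h.P_hol.mul h.dz_hol).deriv Metric.isOpen_ball))
    simp
    rfl
  have ba := h.isBigO_one_of_hol h.a_hol
  have hdw : dw F =O[𝓝[≠] 0] fun w => ‖w‖⁻¹ := by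
    have b1 := h.isBigO_one_of_hol (((h.a_hol.deriv Metric.isOpen_ball).mul h.z_hol).add
      (h.a_hol.mul h.dz_hol))
    have b2 := (b1.mul hE0)
    have b3 := (h.isBigO_one_of_hol ((h.a_hol.mul h.dz_hol).div_const 2)).mul hE1
    have b4 := bPd.mul (b2.add b3)
    simp only [one_mul] at b4
    refine b4.congr' ?_ EventuallyEq.rfl
    filter_upwards [nhdsWithin_le_nhds hρ0, self_mem_nhdsWithin] with w hw hw0
    rw [dw_congr (hFeq w hw), (h.densityPrimitive_hasWirtinger hfs
      (Metric.ball_subset_ball hρσ.le hw) hw0).dw_eq]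
    simp only [Pi.mul_apply, Pi.add_apply]
    ring
  have hdwb : dwbar F =O[𝓝[≠] 0] fun w => ‖w‖⁻¹ := by
    have bz := h.isBigO_one_of_hol h.z_hol
    have b1 := ((bPd'.mul (ba.mul bz)).mul hE0)
    have b5 : (fun w => (starRingEnd ℂ) (deriv z w) * (z w / ‖z w‖) ^ 2 / 2) =O[𝓝[≠] 0]
        fun _ => (1 : ℝ) := by
      refine IsBigO.trans (IsBigO.of_bound 1 (Eventually.of_forall fun w => ?_))
        (h.isBigO_one_of_hol h.dz_hol)
      have : ‖z w‖ / ‖z w‖ ≤ 1 := div_self_le_one _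
      have h2 : (‖z w‖ / ‖z w‖) ^ 2 ≤ 1 := pow_le_one₀ (by positivity) this
      simp only [norm_div, norm_mul, norm_pow, RCLike.norm_conj, Complex.norm_real, norm_norm,
        Complex.norm_ofNat]
      nlinarith [norm_nonneg (deriv z w)]
    have b6 := ((bPd.mul ba).mul b5).mul hE1
    simp only [one_mul] at b1 b6
    refine (b1.add b6).congr' ?_ EventuallyEq.rfl
    filter_upwards [nhdsWithin_le_nhds hρ0, self_mem_nhdsWithin] with w hw hw0
    have hwσ := Metric.ball_subset_ball hρσ.le hw
    rw [dwbar_congr (hFeq w hw), (h.densityPrimitive_hasWirtinger hfs hwσ hw0).dwbar_eq]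
    have hz := h.z_ne w hwσ hw0
    have hn : (‖z w‖ : ℂ) ≠ 0 := by exact_mod_cast norm_ne_zero_iff.2 hz
    rw [← hf]
    field_simp
  obtain ⟨hi, hint⟩ := integral_dw_eq_zero hc1 hsupp hdw hdwb
  have hEq : Set.EqOn (dw F) (dw (densityPrimitive z P a f)) (Metric.ball 0 ρ) :=
    fun w hw => dw_congr (hFeq w hw)
  refine ⟨(hi.integrableOn).congr_fun hEq measurableSet_ball, ?_⟩
  rw [← setIntegral_congr_fun measurableSet_ball hEq]
  refine (setIntegral_eq_integral_of_forall_compl_eq_zero fun w hw => ?_).trans hint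
  have : w ∉ closure Ω := fun hh => hw (hcl hh)
  rw [dw_congr (hF0 w this), dw_zero]

omit h in
lemma exists_norm_bound {f : ℂ → ℂ} {ρ : ℝ} (hf : DifferentiableOn ℂ f (Metric.ball 0 σ))
    (hρσ : ρ < σ) : ∃ C > 0, ∀ w ∈ Metric.closedBall (0 : ℂ) ρ, ‖f w‖ ≤ C := by
  obtain ⟨C, hC⟩ := (isCompact_closedBall (0 : ℂ) ρ).exists_bound_of_continuousOn
    (hf.continuousOn.mono (Metric.closedBall_subset_ball hρσ))
  exact ⟨max C 1, by positivity, fun w hw => (hC w hw).trans (le_max_left _ _)⟩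

/-- The deviation decays exponentially. -/
lemma expSmall_deviation {ρ : ℝ} (hρσ : ρ < σ) {χ : ℝ → ℝ} {u : ℝ → ℝ → ℝ}
    (hu : ∀ t, 0 < t → IsModelFunction t (u t)) (hχ : IsCutoff χ) {Ω : Set ℂ} (hΩ : IsOpen Ω)
    (h0 : (0 : ℂ) ∈ Ω) (hcl : closure Ω ⊆ Metric.ball 0 ρ)
    (hχΩ : ∀ w ∈ Metric.ball (0 : ℂ) ρ, χ ‖z w‖ ≠ 0 → w ∈ Ω) {n : ℝ → ℂ → ℂ}
    (hn : ∀ t, 0 < t → IsScalarSolution ρ z P (profile χ (u t)) t Ω (n t)) :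
    ExpSmall (Metric.ball (0 : ℂ) ρ \ {0}) fun t => deviation z P a (profile χ (u t)) (n t) := by
  obtain ⟨r₀, hr₀, hχ1⟩ := hχ.eq_one
  obtain ⟨r₂, hr₂, hzb⟩ := exists_norm_bound h.z_hol hρσ
  obtain ⟨Cz, hCz, hdzb⟩ := exists_norm_bound h.dz_hol hρσ
  obtain ⟨Ca, hCa, hab⟩ := exists_norm_bound h.a_hol hρσ
  obtain ⟨Cd, hCd, hdab⟩ := exists_norm_bound (h.a_hol.deriv Metric.isOpen_ball) hρσ
  obtain ⟨Ci, hCi, hib⟩ := exists_norm_bound (h.dz_hol.inv h.dz_ne) hρσ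
  obtain ⟨hE0, hE1⟩ := expSmall_profileError hχ hu (r₁ := r₀) (r₂ := r₂) hr₀
  obtain ⟨c, hc, C, hC, T, hT, hE⟩ := (ExpSmall.add
    (hE0.of_le (f := fun t r => ‖profileError t χ (u t) r‖) 0 fun t _ r _ => (norm_norm _).le)
    (hE1.of_le (f := fun t r => ‖deriv (profileError t χ (u t)) r‖) 0
      fun t _ r _ => (norm_norm _).le)).exists_bound
  have hclσ : closure Ω ⊆ Metric.ball 0 σ := hcl.trans (Metric.ball_subset_ball hρσ.le)
  -- A bounds the source term relative to the profile error and its derivative. L bounds the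
  -- zeroth-order coefficient from below for t ≥ T and |z| ≥ r₀, using that Ci bounds 1/z'. The
  -- maximum principle then yields A C/L times the exponential.
  set A := Cz * (Cd + Ca * Cz / 2) with hA
  have hA0 : 0 < A := by positivity
  set L := 4 * T ^ 2 * r₀ * (Ci⁻¹) ^ 2 with hL
  have hL0 : 0 < L := by positivity
  refine ExpSmall.of_exp (c := c) (C := A * C / L) hc T fun t ht w hw => ?_
  have ht0 : 0 < t := hT.trans_le ht
  by_cases hwΩ : w ∈ Ω
  swap
  · rw [h.deviation_eq_zero hρσ (hu t ht0) hχ h0 hχΩ (hn t ht0) hw.1 hwΩ, norm_zero]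
    positivity
  have hΩb : Bornology.IsBounded Ω := Metric.isBounded_ball.subset (subset_closure.trans hcl)
  have hfs := profile_contDiffOn hχ (hu t ht0)
  have hnc : ContinuousAt (n t) 0 :=
    (hn t ht0).cont.continuousAt (Metric.isOpen_ball.mem_nhds (hcl (subset_closure h0)))
  obtain ⟨B, hB⟩ := (h.deviation_isBigO ht0 (hu t ht0) hχ hnc).bound
  refine norm_le_of_dw_dwbar hΩ hΩb (κ := deviation z P a (profile χ (u t)) (n t))
    (a := fun w => 4 * t ^ 2 * ‖z w‖ * ‖deriv z w‖ ^ 2 * Real.cosh (2 * profile χ (u t) ‖z w‖))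
    (S := fun w => (starRingEnd ℂ) (deriv z w) * (deriv a w * (profileError t χ (u t) ‖z w‖ : ℝ) +
        a w * (deriv (profileError t χ (u t)) ‖z w‖ : ℝ) * (‖z w‖ * deriv z w / (2 * z w))))
    (B := B) ?_ ?_ ?_ ?_ (by positivity) ?_ ?_ ?_ hwΩ hw.2
  · intro x hx
    have hxσ := hclσ hx.1
    have hx0 : x ≠ 0 := hx.2
    have hf1 : ContDiffOn ℝ ∞ (fun r => r * deriv (profile χ (u t)) r) (Set.Ioi 0) :=
      contDiffOn_id.mul (hfs.deriv_of_isOpen isOpen_Ioi (by norm_cast))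
    have hnx : ContinuousAt (n t) x :=
      (hn t ht0).cont.continuousAt (Metric.isOpen_ball.mem_nhds (hcl hx.1))
    exact ((hnx.add (h.contDiffAt_div_z (n := 0) h.P_hol hxσ hx0 (by norm_num)).continuousAt).add
      ((h.contDiffAt_div_z (n := 0) h.a_hol hxσ hx0 (by norm_num)).continuousAt.mul
        (h.contDiffAt_radial hf1 hxσ hx0).continuousAt)).continuousWithinAt
  · intro x hx hx0
    exact h.deviation_contDiffAt hfs (hclσ (subset_closure hx)) hx0
      (((hn t ht0).smooth.contDiffAt (hΩ.mem_nhds hx)).of_le (by norm_cast))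
  · simpa using hB
  · intro x hx hx0
    refine h.deviation_eq_zero hρσ (hu t ht0) hχ h0 hχΩ (hn t ht0) (hcl hx.1) ?_
    have := hx.2
    rwa [hΩ.interior_eq] at this
  · intro x hx hx0
    exact h.dw_dwbar_deviation (hu t ht0) hχ hΩ (subset_closure.trans hclσ) (hn t ht0) hx hx0
  · intro x hx hx0
    have hxσ := hclσ (subset_closure hx)
    have h1 : 0 < ‖z x‖ := norm_pos_iff.2 (h.z_ne x hxσ hx0)
    have h2 : 0 < ‖deriv z x‖ := norm_pos_iff.2 (h.dz_ne x hxσ)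
    have h3 := Real.cosh_pos (2 * profile χ (u t) ‖z x‖)
    positivity
  · intro x hx hx0
    have hxρ := Metric.ball_subset_closedBall (hcl (subset_closure hx))
    have hxσ := hclσ (subset_closure hx)
    have h1 : 0 < ‖z x‖ := norm_pos_iff.2 (h.z_ne x hxσ hx0)
    -- Near the branch point, where the coefficient degenerates with |z|, the source is identically
    -- zero. A uniform bound on source over coefficient is only needed for |z| ≥ r₀.
    rcases lt_or_ge ‖z x‖ r₀ with hlt | hge
    · have e0 : profileError t χ (u t) =ᶠ[𝓝 ‖z x‖] fun _ => 0 := by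
        filter_upwards [Ioo_mem_nhds h1 hlt] with r hr
        exact profileError_eq_zero (hu t ht0) hχ1 hr.1 hr.2
      rw [e0.deriv_eq, e0.eq_of_nhds]
      have h3 := Real.cosh_pos (2 * profile χ (u t) ‖z x‖)
      simp only [deriv_const, Complex.ofReal_zero, mul_zero, zero_mul, add_zero, norm_zero]
      positivity
    · have hEb := hE t ht ‖z x‖ ⟨hge, hzb x hxρ⟩
      rw [Real.norm_of_nonneg (by positivity)] at hEb
      set e0 := ‖profileError t χ (u t) ‖z x‖‖
      set e1 := ‖deriv (profileError t χ (u t)) ‖z x‖‖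
      have he0 : 0 ≤ e0 := norm_nonneg _
      have he1 : 0 ≤ e1 := norm_nonneg _
      have hS1 : ‖(‖z x‖ : ℂ) * deriv z x / (2 * z x)‖ ≤ Cz / 2 := by
        rw [norm_div, norm_mul, norm_mul, Complex.norm_real, norm_norm, Complex.norm_ofNat]
        have := hdzb x hxρ
        rw [div_le_div_iff₀ (by positivity) (by norm_num)]
        nlinarith
      have hS : ‖(starRingEnd ℂ) (deriv z x) * (deriv a x * (profileError t χ (u t) ‖z x‖ : ℝ) +
          a x * (deriv (profileError t χ (u t)) ‖z x‖ : ℝ) * (‖z x‖ * deriv z x / (2 * z x)))‖ ≤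
          Cz * (Cd * e0 + Ca * e1 * (Cz / 2)) := by
        rw [norm_mul, RCLike.norm_conj]
        refine mul_le_mul (hdzb x hxρ) ((norm_add_le _ _).trans (add_le_add ?_ ?_))
          (norm_nonneg _) hCz.le
        · rw [norm_mul, Complex.norm_real]
          exact mul_le_mul_of_nonneg_right (hdab x hxρ) he0
        · rw [norm_mul, norm_mul, Complex.norm_real]
          exact mul_le_mul (mul_le_mul_of_nonneg_right (hab x hxρ) he1) hS1 (norm_nonneg _)
            (by positivity)
      have hS2 : Cz * (Cd * e0 + Ca * e1 * (Cz / 2)) ≤ A * (e0 + e1) := by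
        rw [hA, mul_assoc Cz]
        refine mul_le_mul_of_nonneg_left ?_ hCz.le
        have : 0 ≤ Cd * e1 := by positivity
        have : 0 ≤ Ca * Cz / 2 * e0 := by positivity
        linarith
      have hLa : L ≤ 4 * t ^ 2 * ‖z x‖ * ‖deriv z x‖ ^ 2 *
          Real.cosh (2 * profile χ (u t) ‖z x‖) := by
        have h2 : Ci⁻¹ ≤ ‖deriv z x‖ := by
          have := hib x hxρ
          simp only [Pi.inv_apply, norm_inv] at this
          rw [inv_le_comm₀ hCi (norm_pos_iff.2 (h.dz_ne x hxσ))]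
          exact this
        have h3 := Real.one_le_cosh (2 * profile χ (u t) ‖z x‖)
        calc L = L * 1 := (mul_one _).symm
          _ ≤ _ := by
            rw [hL]; gcongr
      calc _ ≤ A * (e0 + e1) := hS.trans hS2
        _ ≤ A * (C * Real.exp (-c * t)) := by gcongr
        _ = A * C / L * Real.exp (-c * t) * L := by field_simp
        _ ≤ _ := by gcongr

/-- The integrated difference of the densities decays exponentially. -/
lemma expSmall_integral {ρ : ℝ} (hρσ : ρ < σ) {χ : ℝ → ℝ} {u : ℝ → ℝ → ℝ}
    (hu : ∀ t, 0 < t → IsModelFunction t (u t)) (hχ : IsCutoff χ) {Ω : Set ℂ} (hΩ : IsOpen Ω)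
    (h0 : (0 : ℂ) ∈ Ω) (hcl : closure Ω ⊆ Metric.ball 0 ρ)
    (hχΩ : ∀ w ∈ Metric.ball (0 : ℂ) ρ, χ ‖z w‖ ≠ 0 → w ∈ Ω) {n : ℝ → ℂ → ℂ}
    (hn : ∀ t, 0 < t → IsScalarSolution ρ z P (profile χ (u t)) t Ω (n t)) :
    ExpSmall (Set.univ : Set Unit) fun t _ => ∫ w in Metric.ball 0 ρ,
      (blockDensity z P (profile χ (u t)) (n t) w -
        blockDensity z P 0 (fun x => -(P x / (4 * z x))) w) := by
  obtain ⟨c, hc, C, hC, T, hT, hdev⟩ :=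
    (h.expSmall_deviation hρσ hu hχ hΩ h0 hcl hχΩ hn).exists_bound
  obtain ⟨Cz, hCz, hdzb⟩ := exists_norm_bound h.dz_hol hρσ
  obtain ⟨CP, hCP, hPb⟩ := exists_norm_bound (h.P_hol.mul h.dz_hol) hρσ
  refine ExpSmall.of_exp (c := c) (C := 2 * CP * Cz * C * volume.real (Metric.ball (0 : ℂ) ρ)) hc T
    fun t ht _ _ => ?_
  have ht0 : 0 < t := hT.trans_le ht
  set f := profile χ (u t) with hf
  have hfs : ContDiffOn ℝ ∞ f (Set.Ioi 0) := profile_contDiffOn hχ (hu t ht0)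
  set r : ℂ → ℂ := fun w => 2 * ((starRingEnd ℂ) (P w * deriv z w)) *
        (z w / ‖z w‖) * deriv z w * (Real.exp (-2 * f ‖z w‖) : ℝ) * deviation z P a f (n t) w with hr
  have hae : ∀ᵐ w ∂(volume.restrict (Metric.ball (0 : ℂ) ρ)), w ∈ Metric.ball (0 : ℂ) ρ \ {0} := by
    have h1 : ∀ᵐ w ∂(volume.restrict (Metric.ball (0 : ℂ) ρ)), w ≠ 0 :=
      ae_restrict_of_ae (by simp [ae_iff, measure_singleton])
    filter_upwards [h1, self_mem_ae_restrict measurableSet_ball] with w hw1 hw2 using ⟨hw2, hw1⟩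
  obtain ⟨hi, hint⟩ := h.integral_dw_densityPrimitive ht0 hρσ (hu t ht0) hχ h0 hcl hχΩ
  have hi1 := h.blockDensity_integrableOn ht0 hρσ (hu t ht0) hχ h0 hcl hχΩ (hn t ht0)
  have hi2 := h.blockDensity_inf_integrableOn hρσ
  have hri : IntegrableOn r (Metric.ball 0 ρ) := by
    refine ((hi1.sub hi2).sub hi).congr ?_
    filter_upwards [hae] with w hw
    have := h.blockDensity_sub hfs (n := n t) (Metric.ball_subset_ball hρσ.le hw.1) hw.2
    simp only [Pi.sub_apply, hr]
    rw [this]; ring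
  have heq : ∫ w in Metric.ball 0 ρ, (blockDensity z P f (n t) w -
        blockDensity z P 0 (fun x => -(P x / (4 * z x))) w) = ∫ w in Metric.ball 0 ρ, r w := by
    have h1 : ∫ w in Metric.ball 0 ρ, (blockDensity z P f (n t) w -
        blockDensity z P 0 (fun x => -(P x / (4 * z x))) w) =
        ∫ w in Metric.ball 0 ρ, (dw (densityPrimitive z P a f) w + r w) := by
      refine integral_congr_ae ?_
      filter_upwards [hae] with w hw
      exact h.blockDensity_sub hfs (n := n t) (Metric.ball_subset_ball hρσ.le hw.1) hw.2
    rw [h1, integral_add hi hri, hint, zero_add]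
  rw [heq]
  have hb : ∀ᵐ w ∂(volume.restrict (Metric.ball (0 : ℂ) ρ)),
      ‖r w‖ ≤ 2 * CP * Cz * C * Real.exp (-c * t) := by
    filter_upwards [hae] with w hw
    have hwc := Metric.ball_subset_closedBall hw.1
    have h1 := hPb w hwc
    have h2 := hdzb w hwc
    have h3 := hdev t ht w hw
    have hz := h.z_ne w (Metric.ball_subset_ball hρσ.le hw.1) hw.2
    have h4 : ‖z w‖ / ‖z w‖ = 1 := div_self (norm_ne_zero_iff.2 hz)
    have h5 : Real.exp (-2 * f ‖z w‖) ≤ 1 := Real.exp_le_one_iff.2 (by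
      linarith [profile_nonneg (hu t ht0) ht0 hχ (norm_pos_iff.2 hz)])
    simp only [hr, norm_mul, norm_div, RCLike.norm_conj, Complex.norm_real, norm_norm,
      Complex.norm_ofNat, Real.norm_of_nonneg (Real.exp_pos _).le, h4, mul_one]
    simp only [Pi.mul_apply, norm_mul] at h1
    calc 2 * (‖P w‖ * ‖deriv z w‖) * ‖deriv z w‖ * Real.exp (-2 * f ‖z w‖) *
          ‖deviation z P a f (n t) w‖ ≤ 2 * CP * Cz * 1 * (C * Real.exp (-c * t)) := by gcongr
      _ = _ := by ring
  have hfin : volume (Metric.ball (0 : ℂ) ρ) < ⊤ := measure_ball_lt_top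
  refine (norm_setIntegral_le_of_norm_le_const_ae' (C := 2 * CP * Cz * C * Real.exp (-c * t)) hfin
    ?_).trans (le_of_eq (by ring))
  rw [ae_restrict_iff' measurableSet_ball] at hb
  exact hb

end IsBlockData

/-! ### Reduction of the approximate variation to the blocks -/

section Reduction

variable {ℓ m : ℕ}

lemma LocalModel.hApp_eq_diagonal (M : LocalModel ℓ m) (χ u : ℝ → ℝ) (w : ℂ) :
    M.hApp χ u w = Matrix.diagonal fun a => ((metricDiag
      (fun j => ‖M.z j w‖ ^ (-(1 / 2) : ℝ) * Real.exp (-(u ‖M.z j w‖ * χ ‖M.z j w‖)))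
      (fun j => ‖M.z j w‖ ^ (1 / 2 : ℝ) * Real.exp (u ‖M.z j w‖ * χ ‖M.z j w‖)) a : ℝ) : ℂ) :=
  blockMat_diag _ _

/-- The limiting metric is the case u = 0, so one density formula serves both norms. -/
lemma LocalModel.hApp_zero (M : LocalModel ℓ m) (χ : ℝ → ℝ) : M.hApp χ 0 = M.hInf := by
  funext w
  simp [LocalModel.hApp, LocalModel.hInf]

lemma LocalModel.adj_hApp_blockMat (M : LocalModel ℓ m) (χ u : ℝ → ℝ) {w : ℂ}
    (hz : ∀ j, M.z j w ≠ 0) (A : Fin ℓ → Matrix (Fin 2) (Fin 2) ℂ) (c : Fin m → ℂ) :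
    adj (M.hApp χ u w) (blockMat A c) =
      blockMat (fun j => !![(starRingEnd ℂ) (A j 0 0),
          ‖M.z j w‖ * (Real.exp (2 * profile χ u ‖M.z j w‖) : ℝ) * (starRingEnd ℂ) (A j 1 0);
        (‖M.z j w‖ : ℂ)⁻¹ * (Real.exp (-2 * profile χ u ‖M.z j w‖) : ℝ) * (starRingEnd ℂ) (A j 0 1),
          (starRingEnd ℂ) (A j 1 1)])
        (fun k => (starRingEnd ℂ) (c k)) := by
  have hp : ∀ j, 0 < ‖M.z j w‖ := fun j => norm_pos_iff.2 (hz j)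
  rw [M.hApp_eq_diagonal, adj_diag_blockMat
    (fun j => mul_pos (Real.rpow_pos_of_pos (hp j) _) (Real.exp_pos _))
    (fun j => mul_pos (Real.rpow_pos_of_pos (hp j) _) (Real.exp_pos _))]
  congr 1
  ext j
  rw [mul_div_mul_comm, mul_div_mul_comm, rpow_half_div_neg_half (hp j),
    rpow_neg_half_div_half (hp j), ← Real.exp_sub, ← Real.exp_sub]
  have e1 : u ‖M.z j w‖ * χ ‖M.z j w‖ - -(u ‖M.z j w‖ * χ ‖M.z j w‖) =
      2 * profile χ u ‖M.z j w‖ := by simp only [profile]; ring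
  have e2 : -(u ‖M.z j w‖ * χ ‖M.z j w‖) - u ‖M.z j w‖ * χ ‖M.z j w‖ =
      -2 * profile χ u ‖M.z j w‖ := by simp only [profile]; ring
  rw [e1, e2, Complex.ofReal_mul, Complex.ofReal_mul, Complex.ofReal_inv]

/-- Half the difference of the diagonal entries of the `j`-th block. -/
def halfDiff (ν : ℂ → Matrix (BlockIdx ℓ m) (BlockIdx ℓ m) ℂ) (j : Fin ℓ) (w : ℂ) : ℂ :=
  1 / 2 * (ν w (Sum.inl (0, j)) (Sum.inl (0, j)) - ν w (Sum.inl (1, j)) (Sum.inl (1, j)))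

lemma trace_mul_blockMat (X : Matrix (BlockIdx ℓ m) (BlockIdx ℓ m) ℂ)
    (A : Fin ℓ → Matrix (Fin 2) (Fin 2) ℂ) (c : Fin m → ℂ) :
    (X * blockMat A c).trace =
      ∑ j, (diagBlock X j * A j).trace + ∑ k, X (Sum.inr k) (Sum.inr k) * c k := by
  rw [Matrix.trace, Fintype.sum_sum_type, Fintype.sum_prod_type_right]
  congr 1
  · refine Finset.sum_congr rfl fun j _ => ?_
    rw [Matrix.trace]
    refine Finset.sum_congr rfl fun i _ => ?_
    simp only [Matrix.diag_apply, mul_blockMat_apply_inl]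
    simp [Matrix.mul_apply, diagBlock]
  · refine Finset.sum_congr rfl fun k _ => ?_
    simp [Matrix.mul_apply, Fintype.sum_sum_type, blockMat, Matrix.diagonal_apply]

lemma smul_phiDot_add_comm {ι : Type*} [Fintype ι] (V ν A : Matrix ι ι ℂ) (t : ℂ) :
    t • V + comm ν (t • A) = t • (V + comm ν A) := by
  have := comm_smul_smul ν A 1 t
  rw [one_smul, one_mul] at this
  rw [this, smul_add]

/-- φ̇^† is block diagonal and lower triangular in each 2×2 block. The trace therefore sees only the
diagonal and the upper right entry of each block of φ̇ + [ν̇, φ]. There ν̇ enters through half the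
difference of its diagonal entries, the block of [ν̇, φ] being traceless. -/
lemma density_hApp (M : LocalModel ℓ m) (d : DeformationData ℓ m) (χ u : ℝ → ℝ) (t : ℝ)
    (ν : ℂ → Matrix (BlockIdx ℓ m) (BlockIdx ℓ m) ℂ) {w : ℂ} (hz : ∀ j, M.z j w ≠ 0) :
    density (fun w => (t : ℂ) • M.higgs w) (M.hApp χ u) 0 (fun w => (t : ℂ) • d.phiDot M w) ν w =
      2 * t ^ 2 * (∑ j, (2 * (d.lamHatDot j w * (starRingEnd ℂ) (d.lamHatDot j w)) +
        blockDensity (M.z j) (d.P j) (profile χ u) (halfDiff ν j) w) +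
        ∑ k, d.lamDot k w * (starRingEnd ℂ) (d.lamDot k w)) := by
  have h0 : adj (M.hApp χ u w) 0 = 0 := by simp [adj]
  have e1 : ∀ j, diagBlock (d.phiDot M w + comm (ν w) (M.higgs w)) j =
      !![d.lamHatDot j w, d.P j w * deriv (M.z j) w; 0, d.lamHatDot j w] -
        comm !![M.lamHat j w, M.z j w * deriv (M.z j) w; deriv (M.z j) w, M.lamHat j w]
          (diagBlock (ν w) j) := by
    intro j
    rw [comm_swap, ← sub_eq_add_neg, diagBlock_sub, LocalModel.higgs, diagBlock_comm_blockMat,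
      DeformationData.phiDot, diagBlock_blockMat]
  have e2 : ∀ k, (d.phiDot M w + comm (ν w) (M.higgs w)) (Sum.inr k) (Sum.inr k) =
      d.lamDot k w := by
    intro k
    rw [comm_swap, ← sub_eq_add_neg, Matrix.sub_apply, LocalModel.higgs, comm_blockMat_apply_inr]
    simp [DeformationData.phiDot]
  rw [density, Pi.zero_apply, h0, mul_zero, Matrix.trace_zero, zero_add, smul_phiDot_add_comm,
    adj_smul, Complex.conj_ofReal, Matrix.smul_mul, Matrix.mul_smul, Matrix.trace_smul,
    Matrix.trace_smul]
  have e3 : adj (M.hApp χ u w) (d.phiDot M w) = blockMat _ _ := M.adj_hApp_blockMat χ u hz _ _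
  rw [e3, trace_mul_blockMat]
  simp only [e1, e2, smul_eq_mul]
  rw [← mul_assoc, ← mul_assoc]
  congr 1
  · ring
  congr 1
  refine Finset.sum_congr rfl fun j _ => ?_
  have hn : (‖M.z j w‖ : ℂ) ≠ 0 := by simpa using hz j
  simp [comm, Matrix.trace_fin_two, Matrix.mul_apply, Fin.sum_univ_two, diagBlock, halfDiff,
    blockDensity, Matrix.vecHead, Matrix.vecTail, -Complex.ofReal_exp]
  field_simp
  ring

lemma comm_diagonal_apply_self {ι : Type*} [Fintype ι] [DecidableEq ι] (D : ι → ℂ)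
    (X : Matrix ι ι ℂ) (a : ι) : comm (Matrix.diagonal D) X a a = 0 := by
  simp [comm, Matrix.diagonal_mul, Matrix.mul_diagonal, mul_comm]

/-- The connection form of a diagonal metric is diagonal, and a commutator with a diagonal matrix
has zero diagonal. -/
lemma covD_diagonal_apply_self {ι : Type*} [Fintype ι] [DecidableEq ι] (D : ℂ → ι → ℂ)
    {H : ℂ → Matrix ι ι ℂ} (hH : ∀ w, H w = Matrix.diagonal (D w)) {w : ℂ} (hD : ∀ a, D w a ≠ 0)
    (A : ℂ → Matrix ι ι ℂ) (a : ι) : covD H A w a a = dw (fun x => A x a a) w := by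
  have h1 : dMat H w = Matrix.diagonal fun a => dw (fun x => D x a) w := by
    ext a b
    by_cases hab : a = b
    · subst hab; simp [dMat, hH]
    · simp [dMat, hH, hab]
  rw [covD, h1, hH, inv_diagonal_of_ne_zero hD, Matrix.diagonal_mul_diagonal, Matrix.add_apply,
    comm_diagonal_apply_self, add_zero]
  rfl

/-- The diagonal part of the Coulomb equation in a block. -/
lemma CoulombEq.dw_dwbar_halfDiff {M : LocalModel ℓ m} {d : DeformationData ℓ m} {χ u : ℝ → ℝ}
    {t : ℝ} {ν : ℂ → Matrix (BlockIdx ℓ m) (BlockIdx ℓ m) ℂ} {Ω : Set ℂ} (hΩ : IsOpen Ω)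
    (hν : SmoothMatOn ν Ω) {w : ℂ} (hw : w ∈ Ω) (hz : ∀ j, M.z j w ≠ 0)
    (h : CoulombEq (fun x => (t : ℂ) • M.higgs x) (M.hApp χ u) 0
      (fun x => (t : ℂ) • d.phiDot M x) ν w) (j : Fin ℓ) :
    dw (dwbar (halfDiff ν j)) w = t ^ 2 * ‖M.z j w‖ *
      ((starRingEnd ℂ) (deriv (M.z j) w) * deriv (M.z j) w) *
      (4 * halfDiff ν j w * (Real.cosh (2 * profile χ u ‖M.z j w‖) : ℝ) +
        (Real.exp (-2 * profile χ u ‖M.z j w‖) : ℝ) * (d.P j w / M.z j w)) := by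
  have hp : ∀ j, 0 < ‖M.z j w‖ := fun j => norm_pos_iff.2 (hz j)
  have hdiff : ∀ a x, x ∈ Ω → DifferentiableAt ℝ (fun y => ν y a a) x := fun a x hx =>
    hν.differentiableAt hΩ hx a a
  have hdiff2 : ∀ a, DifferentiableAt ℝ (dwbar fun y => ν y a a) w := fun a => by
    have h1 : ContDiffAt ℝ 1 (fderiv ℝ fun y => ν y a a) w :=
      ((hν a a).contDiffAt (hΩ.mem_nhds hw)).fderiv_right (by norm_cast)
    have h2 := h1.differentiableAt (by norm_num)
    exact ((h2.clm_apply (differentiableAt_const _)).add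
      ((h2.clm_apply (differentiableAt_const _)).const_mul Complex.I)).const_mul _
  have hL : dw (dwbar (halfDiff ν j)) w = 1 / 2 *
      (dw (dwbar fun y => ν y (Sum.inl (0, j)) (Sum.inl (0, j))) w -
        dw (dwbar fun y => ν y (Sum.inl (1, j)) (Sum.inl (1, j))) w) := by
    have h1 : dwbar (halfDiff ν j) =ᶠ[𝓝 w] fun x => 1 / 2 *
        (dwbar (fun y => ν y (Sum.inl (0, j)) (Sum.inl (0, j))) x -
        dwbar (fun y => ν y (Sum.inl (1, j)) (Sum.inl (1, j))) x) := by
      filter_upwards [hΩ.mem_nhds hw] with x hx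
      exact ((HasWirtinger.of_differentiableAt (hdiff _ x hx)).sub
        (HasWirtinger.of_differentiableAt (hdiff _ x hx))).const_mul (1 / 2) |>.dwbar_eq
    rw [dw_congr h1]
    exact ((HasWirtinger.of_differentiableAt (hdiff2 _)).sub
      (HasWirtinger.of_differentiableAt (hdiff2 _))).const_mul (1 / 2) |>.dw_eq
  -- The diagonal entries of the equation carry no connection term. In their zeroth-order part, the
  -- 2×2 block involves ν only through the difference of its diagonal entries, which closes the
  -- scalar equation.
  have key : ∀ a, dw (dwbar fun y => ν y a a) w = -((t : ℂ) ^ 2 *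
      comm (adj (M.hApp χ u w) (M.higgs w)) (d.phiDot M w + comm (ν w) (M.higgs w)) a a) := by
    intro a
    have h1 := congrFun (congrFun h a) a
    rw [covD_zero, sub_zero, Matrix.add_apply, covD_diagonal_apply_self _
      (fun w => M.hApp_eq_diagonal χ u w) (fun a => by
        exact_mod_cast (metricDiag_pos
          (fun j => mul_pos (Real.rpow_pos_of_pos (hp j) _) (Real.exp_pos _))
          (fun j => mul_pos (Real.rpow_pos_of_pos (hp j) _) (Real.exp_pos _)) a).ne'),
      smul_phiDot_add_comm, adj_smul, comm_smul_smul, Complex.conj_ofReal] at h1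
    simp only [Matrix.smul_apply, smul_eq_mul, Matrix.zero_apply] at h1
    have h2 : dw (fun x => dbarMat ν x a a) w = dw (dwbar fun y => ν y a a) w := rfl
    rw [h2] at h1
    linear_combination h1
  have e1 : diagBlock (d.phiDot M w + comm (ν w) (M.higgs w)) j =
      !![d.lamHatDot j w, d.P j w * deriv (M.z j) w; 0, d.lamHatDot j w] -
        comm !![M.lamHat j w, M.z j w * deriv (M.z j) w; deriv (M.z j) w, M.lamHat j w]
          (diagBlock (ν w) j) := by
    rw [comm_swap, ← sub_eq_add_neg, diagBlock_sub, LocalModel.higgs, diagBlock_comm_blockMat,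
      DeformationData.phiDot, diagBlock_blockMat]
  have e2 : diagBlock (comm (adj (M.hApp χ u w) (M.higgs w))
      (d.phiDot M w + comm (ν w) (M.higgs w))) j = comm
      !![(starRingEnd ℂ) (M.lamHat j w), ‖M.z j w‖ *
          (Real.exp (2 * profile χ u ‖M.z j w‖) : ℝ) * (starRingEnd ℂ) (deriv (M.z j) w);
        (‖M.z j w‖ : ℂ)⁻¹ * (Real.exp (-2 * profile χ u ‖M.z j w‖) : ℝ) *
          (starRingEnd ℂ) (M.z j w * deriv (M.z j) w), (starRingEnd ℂ) (M.lamHat j w)]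
      (!![d.lamHatDot j w, d.P j w * deriv (M.z j) w; 0, d.lamHatDot j w] -
        comm !![M.lamHat j w, M.z j w * deriv (M.z j) w; deriv (M.z j) w, M.lamHat j w]
          (diagBlock (ν w) j)) := by
    rw [← e1]
    nth_rewrite 1 [LocalModel.higgs]
    rw [M.adj_hApp_blockMat χ u hz, diagBlock_comm_blockMat]
    simp
  have e3 := fun i => congrFun (congrFun e2 i) i
  rw [hL, key, key]
  have e4 := e3 0
  have e5 := e3 1
  simp only [diagBlock, Matrix.of_apply] at e4 e5
  rw [e4, e5]
  have hn : (‖M.z j w‖ : ℂ) ≠ 0 := by simpa using hz j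
  have h2 := norm_mul_norm_eq (M.z j w)
  have hc : (Real.cosh (2 * profile χ u ‖M.z j w‖) : ℂ) =
      (Real.exp (2 * profile χ u ‖M.z j w‖) + Real.exp (-2 * profile χ u ‖M.z j w‖)) / 2 := by
    rw [Real.cosh_eq, neg_mul]; push_cast; ring
  rw [hc]
  set E1 := (Real.exp (2 * profile χ u ‖M.z j w‖) : ℂ)
  set E2 := (Real.exp (-2 * profile χ u ‖M.z j w‖) : ℂ)
  have hzj := hz j
  simp only [comm, Matrix.sub_apply, Matrix.mul_apply, Fin.sum_univ_two, halfDiff, map_mul,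
    Matrix.of_apply, Matrix.cons_val_zero, Matrix.cons_val_one, Matrix.cons_val', Matrix.cons_val_fin_one]
  set a0 := ν w (Sum.inl (0, j)) (Sum.inl (0, j))
  set a1 := ν w (Sum.inl (1, j)) (Sum.inl (1, j))
  set D := deriv (M.z j) w
  set cD := (starRingEnd ℂ) D
  set cz := (starRingEnd ℂ) (M.z j w)
  field_simp
  linear_combination (-4 * (t : ℂ) ^ 2 * E2 * D * cD * (d.P j w + M.z j w * (a0 - a1))) * h2

end Reduction

/-! ### Exponential decay of the difference of the norms -/

section Frame

variable {n ℓ m : ℕ} {U : Set ℂ} {Φ H : ℂ → Matrix (Fin n) (Fin n) ℂ} {R : ℝ}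
  {M : LocalModel ℓ m} {g : ℂ → Matrix (Fin n) (BlockIdx ℓ m) ℂ}
  {ginv : ℂ → Matrix (BlockIdx ℓ m) (Fin n) ℂ}

lemma DeformationData.halfDiff_nuInf (d : DeformationData ℓ m) (M : LocalModel ℓ m) (j : Fin ℓ) :
    halfDiff (d.nuInf M) j = fun w => -(d.P j w / (4 * M.z j w)) := by
  funext w
  simp [halfDiff, DeformationData.nuInf]
  ring

lemma IsAppVariation.isScalarSolution (hF : IsAdaptedFrame U Φ H R M g ginv)
    {d : DeformationData ℓ m} {χ u : ℝ → ℝ} {t ρ : ℝ} {Ω : Set ℂ}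
    {ν : ℂ → Matrix (BlockIdx ℓ m) (BlockIdx ℓ m) ℂ} (hρR : ρ ≤ R) (hΩ : IsOpen Ω)
    (hcl : closure Ω ⊆ Metric.ball 0 ρ)
    (hν : IsAppVariation M d χ u t (Metric.ball 0 ρ) Ω ν) (j : Fin ℓ) :
    IsScalarSolution ρ (M.z j) (d.P j) (profile χ u) t Ω (halfDiff ν j) where
  cont := continuousOn_const.mul ((hν.cont _ _).sub (hν.cont _ _))
  smooth := contDiffOn_const.mul ((hν.smooth _ _).sub (hν.smooth _ _))
  eq w hw hw0 := by
    have hwR := Metric.ball_subset_ball hρR (hcl (subset_closure hw))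
    exact (hν.coulomb w hw hw0).dw_dwbar_halfDiff hΩ hν.smooth hw
      (fun j => hF.z_ne_zero hwR hw0 j) j
  eq_inf w hw := by
    have h1 := congrFun (d.halfDiff_nuInf M j) w
    rw [← h1, halfDiff, halfDiff, hν.eq_inf w hw]

/-- Comparison of the norms for the approximate and the limiting metric. -/
theorem expDecay_normSq_sub (hF : IsAdaptedFrame U Φ H R M g ginv) (hs : SpectralCurveSmooth U Φ)
    (hℓ : 0 < ℓ) {ρ σ : ℝ} (hρ : 0 < ρ) (hρσ : ρ < σ) (hσR : σ ≤ R) {d : DeformationData ℓ m}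
    (hd : d.HolOn (Metric.ball 0 σ)) {χ : ℝ → ℝ} {u : ℝ → ℝ → ℝ} {Ω : Set ℂ}
    {νapp : ℝ → ℂ → Matrix (BlockIdx ℓ m) (BlockIdx ℓ m) ℂ} (hχ : IsCutoff χ)
    (hu : ∀ t : ℝ, 0 < t → IsModelFunction t (u t)) (hΩ : IsOpen Ω)
    (hcl : closure Ω ⊆ Metric.ball 0 ρ)
    (hχΩ : ∀ j, ∀ w ∈ Metric.ball (0 : ℂ) ρ, χ ‖M.z j w‖ ≠ 0 → w ∈ Ω)
    (hν : ∀ t : ℝ, 0 < t → IsAppVariation M d χ (u t) t (Metric.ball 0 ρ) Ω (νapp t)) :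
    (∀ t : ℝ, 0 < t →
      IntegrableOn (density (fun w => (t : ℂ) • M.higgs w) (M.hApp χ (u t)) 0
        (fun w => (t : ℂ) • d.phiDot M w) (νapp t)) (Metric.ball 0 ρ) ∧
      IntegrableOn (density (fun w => (t : ℂ) • M.higgs w) M.hInf 0
        (fun w => (t : ℂ) • d.phiDot M w) (d.nuInf M)) (Metric.ball 0 ρ)) ∧
    ∃ c : ℝ, 0 < c ∧
      (fun t : ℝ => normSq (fun w => (t : ℂ) • M.higgs w) (M.hApp χ (u t)) 0
          (fun w => (t : ℂ) • d.phiDot M w) (νapp t) (Metric.ball 0 ρ)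
        - normSq (fun w => (t : ℂ) • M.higgs w) M.hInf 0
          (fun w => (t : ℂ) • d.phiDot M w) (d.nuInf M) (Metric.ball 0 ρ))
        =O[atTop] fun t : ℝ => Real.exp (-c * t) := by
  have hσ : 0 < σ := hρ.trans hρσ
  have hsub : Metric.ball (0 : ℂ) σ ⊆ Metric.ball 0 R := Metric.ball_subset_ball hσR
  -- The cutoff equals one at the branch point. Since ℓ > 0, there is a block whose cutoff forces
  -- the origin into Ω.
  have h0Ω : (0 : ℂ) ∈ Ω := by
    obtain ⟨r₀, hr₀, hχ1⟩ := hχ.eq_one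
    refine hχΩ ⟨0, hℓ⟩ 0 (Metric.mem_ball_self hρ) ?_
    rw [hF.z_zero, norm_zero, hχ1 0 le_rfl hr₀.le]
    exact one_ne_zero
  have hblock : ∀ j, ∃ a, IsBlockData σ (M.z j) (d.P j) a := fun j =>
    exists_isBlockData hσ ((hF.z_hol j).mono hsub) (hF.z_zero j)
      (fun w hw hw0 => hF.z_ne_zero (hsub hw) hw0 j)
      (fun w hw => hF.deriv_z_ne_zero hs (hsub hw) j) (hd.P j)
  choose a ha using hblock
  have hsol := fun j t ht => (hν t ht).isScalarSolution hF (hρσ.le.trans hσR) hΩ hcl j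
  -- The eigenvalue part of the density does not depend on the metric and cancels in the difference.
  set c : ℂ → ℂ := fun w => ∑ j, 2 * (d.lamHatDot j w * (starRingEnd ℂ) (d.lamHatDot j w)) +
    ∑ k, d.lamDot k w * (starRingEnd ℂ) (d.lamDot k w) with hc
  set A : ℝ → Fin ℓ → ℂ → ℂ := fun t j =>
    blockDensity (M.z j) (d.P j) (profile χ (u t)) (halfDiff (νapp t) j) with hA
  set B : Fin ℓ → ℂ → ℂ := fun j =>
    blockDensity (M.z j) (d.P j) 0 (fun x => -(d.P j x / (4 * M.z j x))) with hB
  have hci : IntegrableOn c (Metric.ball 0 ρ) := by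
    have hs' : Metric.closedBall (0 : ℂ) ρ ⊆ Metric.ball 0 σ := Metric.closedBall_subset_ball hρσ
    refine IntegrableOn.mono_set (ContinuousOn.integrableOn_compact (isCompact_closedBall 0 ρ) ?_)
      Metric.ball_subset_closedBall
    have hcj : ∀ {f : ℂ → ℂ}, DifferentiableOn ℂ f (Metric.ball 0 σ) →
        ContinuousOn (fun w => f w * (starRingEnd ℂ) (f w)) (Metric.closedBall 0 ρ) := fun hf =>
      (hf.continuousOn.mono hs').mul
        (Complex.continuous_conj.comp_continuousOn (hf.continuousOn.mono hs'))
    exact (continuousOn_finsetSum _ fun j _ => continuousOn_const.mul (hcj (hd.lamHatDot j))).add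
      (continuousOn_finsetSum _ fun k _ => hcj (hd.lamDot k))
  have hAi : ∀ t, 0 < t → ∀ j, IntegrableOn (A t j) (Metric.ball 0 ρ) := fun t ht j =>
    (ha j).blockDensity_integrableOn ht hρσ (hu t ht) hχ h0Ω hcl (hχΩ j) (hsol j t ht)
  have hBi : ∀ j, IntegrableOn (B j) (Metric.ball 0 ρ) := fun j =>
    (ha j).blockDensity_inf_integrableOn hρσ
  have hae : ∀ᵐ w ∂(volume.restrict (Metric.ball (0 : ℂ) ρ)), ∀ j, M.z j w ≠ 0 := by
    have h1 : ∀ᵐ w ∂(volume.restrict (Metric.ball (0 : ℂ) ρ)), w ≠ 0 :=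
      ae_restrict_of_ae (by simp [ae_iff, measure_singleton])
    filter_upwards [h1, self_mem_ae_restrict measurableSet_ball] with w hw1 hw2 j
    exact hF.z_ne_zero (hsub (Metric.ball_subset_ball hρσ.le hw2)) hw1 j
  have hD1 : ∀ t : ℝ, density (fun w => (t : ℂ) • M.higgs w) (M.hApp χ (u t)) 0
      (fun w => (t : ℂ) • d.phiDot M w) (νapp t) =ᵐ[volume.restrict (Metric.ball (0 : ℂ) ρ)]
      fun w => 2 * (t : ℂ) ^ 2 * (c w + ∑ j, A t j w) := by
    intro t
    filter_upwards [hae] with w hw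
    rw [density_hApp M d χ (u t) t (νapp t) hw, Finset.sum_add_distrib]
    simp only [hc, hA]; ring
  have hD2 : ∀ t : ℝ, density (fun w => (t : ℂ) • M.higgs w) M.hInf 0
      (fun w => (t : ℂ) • d.phiDot M w) (d.nuInf M) =ᵐ[volume.restrict (Metric.ball (0 : ℂ) ρ)]
      fun w => 2 * (t : ℂ) ^ 2 * (c w + ∑ j, B j w) := by
    intro t
    filter_upwards [hae] with w hw
    have hp0 : profile χ 0 = 0 := by funext r; simp [profile]
    rw [← M.hApp_zero χ, density_hApp M d χ 0 t (d.nuInf M) hw, Finset.sum_add_distrib]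
    simp only [hc, hB, hp0, d.halfDiff_nuInf M]; ring
  have hI1 : ∀ t : ℝ, 0 < t → IntegrableOn (fun w => 2 * (t : ℂ) ^ 2 * (c w + ∑ j, A t j w))
      (Metric.ball 0 ρ) := fun t ht =>
    Integrable.const_mul (Integrable.add hci (integrable_finsetSum _ fun j _ => hAi t ht j)) _
  have hI2 : ∀ t : ℝ, IntegrableOn (fun w => 2 * (t : ℂ) ^ 2 * (c w + ∑ j, B j w))
      (Metric.ball 0 ρ) := fun t =>
    Integrable.const_mul (Integrable.add hci (integrable_finsetSum _ fun j _ => hBi j)) _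
  refine ⟨fun t ht => ⟨(hI1 t ht).congr (hD1 t).symm, (hI2 t).congr (hD2 t).symm⟩, ?_⟩
  have hdiff : ∀ t : ℝ, 0 < t → normSq (fun w => (t : ℂ) • M.higgs w) (M.hApp χ (u t)) 0
          (fun w => (t : ℂ) • d.phiDot M w) (νapp t) (Metric.ball 0 ρ)
        - normSq (fun w => (t : ℂ) • M.higgs w) M.hInf 0
          (fun w => (t : ℂ) • d.phiDot M w) (d.nuInf M) (Metric.ball 0 ρ) =
      4 * (t : ℂ) ^ 2 * ∑ j, ∫ w in Metric.ball 0 ρ, (A t j w - B j w) := by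
    intro t ht
    have h1 : ∑ j, ∫ w in Metric.ball 0 ρ, (A t j w - B j w) =
        ∫ w in Metric.ball 0 ρ, ∑ j, (A t j w - B j w) :=
      (integral_finsetSum _ fun j _ => (hAi t ht j).sub (hBi j)).symm
    rw [normSq, normSq, integral_congr_ae (hD1 t), integral_congr_ae (hD2 t), ← mul_sub,
      ← integral_sub (hI1 t ht) (hI2 t), h1, ← integral_const_mul, ← integral_const_mul]
    refine integral_congr_ae (Eventually.of_forall fun w => ?_)
    simp only [Finset.sum_sub_distrib]
    ring
  have hsmall : ∀ s : Finset (Fin ℓ), ExpSmall (Set.univ : Set Unit) fun t _ =>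
      ∑ j ∈ s, ∫ w in Metric.ball 0 ρ, (A t j w - B j w) := by
    intro s
    induction s using Finset.induction_on with
    | empty =>
      refine ExpSmall.of_exp (c := 1) (C := 0) one_pos 0 fun t _ _ _ => ?_
      simp
    | insert j s hj ih =>
      simp only [Finset.sum_insert hj]
      exact ((ha j).expSmall_integral hρσ hu hχ hΩ h0Ω hcl (hχΩ j) (hsol j)).add ih
  obtain ⟨c', hc', C, hC, T, hT, hb⟩ := (ExpSmall.sq_mul ((hsmall Finset.univ).of_le
    (f := fun t _ => ‖∑ j, ∫ w in Metric.ball 0 ρ, (A t j w - B j w)‖) 0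
    fun t _ _ _ => (norm_norm _).le)).exists_bound
  refine ⟨c', hc', IsBigO.of_bound (4 * C) ?_⟩
  filter_upwards [eventually_ge_atTop T] with t ht
  rw [hdiff t (hT.trans_le ht), Real.norm_of_nonneg (Real.exp_pos _).le]
  have := hb t ht () (Set.mem_univ _)
  rw [norm_mul, norm_norm, Real.norm_of_nonneg (sq_nonneg t)] at this
  rw [norm_mul, norm_mul, norm_pow, Complex.norm_real, Complex.norm_ofNat, Real.norm_eq_abs, sq_abs]
  linarith

end Frame

/-! ### Bounded harmonic functions near a puncture -/

lemma HasWirtinger.hasDerivAt_comp_curve {ψ : ℂ → ℝ} {a : ℂ} {γ : ℝ → ℂ} {γ' : ℂ} {t : ℝ}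
    (h : HasWirtinger (fun x => (ψ x : ℂ)) a ((starRingEnd ℂ) a) (γ t))
    (hγ : HasDerivAt γ γ' t) : HasDerivAt (fun t => ψ (γ t)) (2 * (a * γ').re) t := by
  have h1 : HasDerivAt (fun t => (ψ (γ t) : ℂ)) (wirtingerCLM a ((starRingEnd ℂ) a) γ') t :=
    HasFDerivAt.comp_hasDerivAt t h hγ
  have h2 := Complex.reCLM.hasFDerivAt.comp_hasDerivAt t h1
  refine h2.congr_deriv ?_
  simp [wirtingerCLM_apply]
  ring

lemma HasWirtinger.two_mul_re {f : ℂ → ℂ} {c w : ℂ} (h : HasDerivAt f c w) :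
    HasWirtinger (fun x => ((2 * (f x).re : ℝ) : ℂ)) c ((starRingEnd ℂ) c) w := by
  have h1 := (HasWirtinger.of_hasDerivAt h).add (HasWirtinger.of_hasDerivAt h).conj
  refine (h1.congr_of_eventuallyEq (Eventually.of_forall fun x => ?_)).of_eq (by simp) (by simp)
  simp only [Complex.add_conj]

/-- Along a logarithmic spiral, a real function with `∂ψ = b / s` grows linearly. -/
lemma eq_add_mul_of_hasWirtinger_div {ψ : ℂ → ℝ} {b : ℂ} {r : ℝ}
    (h : ∀ s ∈ Metric.ball (0 : ℂ) r, s ≠ 0 →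
      HasWirtinger (fun x => (ψ x : ℂ)) (b / s) ((starRingEnd ℂ) (b / s)) s)
    {s₀ q : ℂ} (hs₀ : s₀ ∈ Metric.ball (0 : ℂ) r) (hs0 : s₀ ≠ 0) (hq : q.re ≤ 0) {t : ℝ}
    (ht : 0 ≤ t) : ψ (s₀ * Complex.exp (q * t)) = ψ s₀ + 2 * (b * q).re * t := by
  have hmem : ∀ t : ℝ, 0 ≤ t → s₀ * Complex.exp (q * t) ∈ Metric.ball (0 : ℂ) r := by
    intro t ht
    rw [mem_ball_zero_iff] at hs₀ ⊢
    refine lt_of_le_of_lt ?_ hs₀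
    rw [norm_mul, Complex.norm_exp]
    refine mul_le_of_le_one_right (norm_nonneg _) (Real.exp_le_one_iff.2 ?_)
    simpa using mul_nonpos_of_nonpos_of_nonneg hq ht
  have hder : ∀ t : ℝ, 0 ≤ t → HasDerivAt (fun t : ℝ => ψ (s₀ * Complex.exp (q * t)) -
      2 * (b * q).re * t) 0 t := by
    intro t ht
    have hne : s₀ * Complex.exp (q * t) ≠ 0 := mul_ne_zero hs0 (Complex.exp_ne_zero _)
    have h1 : HasDerivAt (fun t : ℝ => s₀ * Complex.exp (q * t))
        (s₀ * (Complex.exp (q * t) * q)) t := by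
      have h2 : HasDerivAt (fun t : ℝ => q * (t : ℂ)) q t := by
        simpa using (Complex.ofRealCLM.hasDerivAt (x := t)).const_mul q
      exact h2.cexp.const_mul s₀
    have h3 := HasWirtinger.hasDerivAt_comp_curve (γ := fun t : ℝ => s₀ * Complex.exp (q * t))
      (h _ (hmem t ht) hne) h1
    have h4 := h3.sub ((hasDerivAt_id t).const_mul (2 * (b * q).re))
    refine h4.congr_deriv ?_
    have : b / (s₀ * Complex.exp (q * t)) * (s₀ * (Complex.exp (q * t) * q)) = b * q := by
      field_simp
    rw [this]; ring
  have := (convex_Ici (0 : ℝ)).is_const_of_fderivWithin_eq_zero (𝕜 := ℝ)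
    (f := fun t : ℝ => ψ (s₀ * Complex.exp (q * t)) - 2 * (b * q).re * t)
    (fun t ht => (hder t ht).differentiableAt.differentiableWithinAt)
    (fun t ht => by
      have h5 := ((hder t ht).hasDerivWithinAt (s := Set.Ici 0)).hasFDerivWithinAt
      rw [h5.fderivWithin (uniqueDiffOn_Ici 0 t ht)]
      simp) (Set.mem_Ici.2 ht) (Set.mem_Ici.2 le_rfl)
  simp only [Complex.ofReal_zero, mul_zero, Complex.exp_zero, mul_one, sub_zero] at this
  linarith

/-- Interior estimate for the derivative of a bounded harmonic function. -/
lemma norm_mul_le_of_hasWirtinger {ψ : ℂ → ℝ} {c : ℂ → ℂ} {B : ℝ} {s₀ : ℂ} (hs0 : s₀ ≠ 0)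
    (hc : DifferentiableOn ℂ c (Metric.ball s₀ ‖s₀‖))
    (h : ∀ s ∈ Metric.ball s₀ ‖s₀‖,
      HasWirtinger (fun x => (ψ x : ℂ)) (c s) ((starRingEnd ℂ) (c s)) s)
    (hB : ∀ s ∈ Metric.ball s₀ ‖s₀‖, |ψ s| ≤ B) : ‖s₀ * c s₀‖ ≤ Real.exp (2 * B) := by
  have hp : 0 < ‖s₀‖ := norm_pos_iff.2 hs0
  obtain ⟨g, hg⟩ := hc.isExactOn_ball
  have hmem0 : s₀ ∈ Metric.ball s₀ ‖s₀‖ := Metric.mem_ball_self hp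
  have hconst : ∀ s ∈ Metric.ball s₀ ‖s₀‖, ψ s - 2 * (g s).re = ψ s₀ - 2 * (g s₀).re := by
    have hd : ∀ s ∈ Metric.ball s₀ ‖s₀‖,
        HasWirtinger (fun x => ((ψ x - 2 * (g x).re : ℝ) : ℂ)) 0 0 s := fun s hs => by
      refine (((h s hs).sub (HasWirtinger.two_mul_re (hg s hs))).congr_of_eventuallyEq
        (Eventually.of_forall fun x => ?_)).of_eq (by ring) (by ring)
      push_cast; ring
    intro s hs
    have := (convex_ball s₀ ‖s₀‖).is_const_of_fderivWithin_eq_zero (𝕜 := ℝ)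
      (f := fun x => ((ψ x - 2 * (g x).re : ℝ) : ℂ))
      (fun t ht => (hd t ht).differentiableAt.differentiableWithinAt)
      (fun t ht => by
        have h5 := (hd t ht)
        unfold HasWirtinger at h5
        rw [h5.hasFDerivWithinAt.fderivWithin (Metric.isOpen_ball.uniqueDiffOn t ht)]
        ext v <;> simp) hs hmem0
    exact_mod_cast this
  set k := ψ s₀ - 2 * (g s₀).re
  -- F is holomorphic with |F| = e^ψ between e^{-B} and e^B. Cauchy's estimate on the disk of half
  -- the radius bounds F' = 2cF, and the lower bound on |F| then bounds c.
  set F : ℂ → ℂ := fun s => Complex.exp (2 * g s + k) with hF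
  have hFn : ∀ s ∈ Metric.ball s₀ ‖s₀‖, ‖F s‖ = Real.exp (ψ s) := fun s hs => by
    rw [hF, Complex.norm_exp]
    congr 1
    have := hconst s hs
    simp
    linarith
  have hFd : ∀ s ∈ Metric.ball s₀ ‖s₀‖, HasDerivAt F (F s * (2 * c s)) s := fun s hs =>
    (((hg s hs).const_mul 2).add_const _).cexp
  have hsub : Metric.closedBall s₀ (‖s₀‖ / 2) ⊆ Metric.ball s₀ ‖s₀‖ :=
    Metric.closedBall_subset_ball (by linarith)
  have hcauchy := Complex.norm_deriv_le_of_forall_mem_sphere_norm_le (c := s₀) (f := F)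
    (C := Real.exp B) (half_pos hp)
    ⟨fun s hs => ((hFd s (hsub (Metric.ball_subset_closedBall hs))).differentiableAt
      ).differentiableWithinAt, fun s hs => ((hFd s (hsub (by
        rwa [closure_ball _ (half_pos hp).ne'] at hs))).continuousAt).continuousWithinAt⟩
    (fun s hs => by
      have hs' := hsub (Metric.sphere_subset_closedBall hs)
      rw [hFn s hs']
      exact Real.exp_le_exp.2 ((le_abs_self _).trans (hB s hs')))
  rw [(hFd s₀ hmem0).deriv, norm_mul, hFn s₀ hmem0, norm_mul, Complex.norm_ofNat,
    le_div_iff₀ (half_pos hp)] at hcauchy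
  have h1 : Real.exp (-B) ≤ Real.exp (ψ s₀) :=
    Real.exp_le_exp.2 (neg_le_of_abs_le (hB s₀ hmem0))
  have h2 : Real.exp (-B) * ‖s₀ * c s₀‖ ≤ Real.exp B := by
    calc Real.exp (-B) * ‖s₀ * c s₀‖ ≤ Real.exp (ψ s₀) * ‖s₀ * c s₀‖ := by gcongr
      _ = Real.exp (ψ s₀) * (2 * ‖c s₀‖) * (‖s₀‖ / 2) := by rw [norm_mul]; ring
      _ ≤ _ := hcauchy
  calc ‖s₀ * c s₀‖ = Real.exp B * (Real.exp (-B) * ‖s₀ * c s₀‖) := by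
        rw [← mul_assoc, ← Real.exp_add]; simp
    _ ≤ Real.exp B * Real.exp B := by gcongr
    _ = _ := by rw [← Real.exp_add]; ring_nf

/-- A bounded harmonic function on a punctured disk is the real part of a holomorphic function. -/
lemma exists_eq_two_mul_re_of_bounded {ψ : ℂ → ℝ} {c : ℂ → ℂ} {r B : ℝ} (hr : 0 < r)
    (hc : DifferentiableOn ℂ c (Metric.ball 0 r \ {0}))
    (h : ∀ s ∈ Metric.ball (0 : ℂ) r, s ≠ 0 →
      HasWirtinger (fun x => (ψ x : ℂ)) (c s) ((starRingEnd ℂ) (c s)) s)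
    (hB : ∀ s ∈ Metric.ball (0 : ℂ) r, s ≠ 0 → |ψ s| ≤ B) :
    ∃ f : ℂ → ℂ, AnalyticAt ℂ f 0 ∧ ∀ᶠ s in 𝓝[≠] (0 : ℂ), ψ s = 2 * (f s).re := by
  set ρ := r / 2 with hρ
  have hρ0 : 0 < ρ := half_pos hr
  have hsubr : Metric.ball (0 : ℂ) ρ ⊆ Metric.ball 0 r := Metric.ball_subset_ball (by linarith)
  have hsub0 : ∀ s₀ ∈ Metric.ball (0 : ℂ) ρ, Metric.ball s₀ ‖s₀‖ ⊆ Metric.ball 0 r \ {0} := by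
    intro s₀ hs₀ s hs
    rw [mem_ball_zero_iff] at hs₀
    rw [mem_ball_iff_norm] at hs
    refine ⟨?_, ?_⟩
    · rw [mem_ball_zero_iff]
      have := norm_sub_norm_le s s₀
      linarith
    · rintro rfl
      simp at hs
  have hφd : DifferentiableOn ℂ (fun s => s * c s) (Metric.ball 0 ρ \ {0}) :=
    differentiableOn_id.mul (hc.mono (Set.sdiff_subset_sdiff_left hsubr))
  -- The interior estimate bounds s c(s), so c has at most a simple pole b/s at 0.
  have hφ := Complex.differentiableOn_update_limUnder_of_bddAbove (Metric.ball_mem_nhds 0 hρ0) hφd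
    ⟨Real.exp (2 * B), by
      rintro _ ⟨s, hs, rfl⟩
      have hs' := hsub0 s hs.1
      exact norm_mul_le_of_hasWirtinger hs.2 (hc.mono hs')
        (fun x hx => h x (hs' hx).1 (hs' hx).2) (fun x hx => hB x (hs' hx).1 (hs' hx).2)⟩
  set φ := Function.update (fun s => s * c s) 0 (limUnder (𝓝[≠] (0 : ℂ)) fun s => s * c s) with hφe
  have hφs : ∀ s, s ≠ 0 → φ s = s * c s := fun s hs => by simp [hφe, hs]
  have hd : DifferentiableOn ℂ (dslope φ 0) (Metric.ball 0 ρ) :=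
    (Complex.differentiableOn_dslope (Metric.ball_mem_nhds 0 hρ0)).2 hφ
  obtain ⟨f, hf⟩ := hd.isExactOn_ball
  set b := φ 0
  have hcb : ∀ s, s ≠ 0 → c s - dslope φ 0 s = b / s := fun s hs => by
    have := sub_smul_dslope φ 0 s
    rw [sub_zero, smul_eq_mul, hφs s hs] at this
    field_simp
    linear_combination -this
  have hW : ∀ s ∈ Metric.ball (0 : ℂ) ρ, s ≠ 0 →
      HasWirtinger (fun x => ((ψ x - 2 * (f x).re : ℝ) : ℂ)) (b / s)
        ((starRingEnd ℂ) (b / s)) s := fun s hs hs0 => by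
    refine (((h s (hsubr hs) hs0).sub (HasWirtinger.two_mul_re (hf s hs))).congr_of_eventuallyEq
      (Eventually.of_forall fun x => ?_)).of_eq (hcb s hs0) (by rw [← hcb s hs0, map_sub])
    push_cast; ring
  set s₀ : ℂ := ((ρ / 2 : ℝ) : ℂ) with hs₀
  have hns₀ : ‖s₀‖ = ρ / 2 := by rw [hs₀, Complex.norm_real, Real.norm_of_nonneg (by positivity)]
  have hs₀m : s₀ ∈ Metric.ball (0 : ℂ) ρ := by rw [mem_ball_zero_iff, hns₀]; linarith
  have hs₀0 : s₀ ≠ 0 := by rw [← norm_pos_iff, hns₀]; positivity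
  obtain ⟨Q, hQ⟩ : ∃ Q, ∀ s ∈ Metric.closedBall (0 : ℂ) (ρ / 2), |(f s).re| ≤ Q := by
    have := (isCompact_closedBall (0 : ℂ) (ρ / 2)).exists_bound_of_continuousOn
      (f := f) fun s hs => (hf s (Metric.closedBall_subset_ball (by linarith) hs)
        ).continuousAt.continuousWithinAt
    obtain ⟨Q, hQ⟩ := this
    exact ⟨Q, fun s hs => (Complex.abs_re_le_norm _).trans (hQ s hs)⟩
  -- Along the spiral s₀ e^{qt}, which stays in the disk, ψ - 2 Re f grows linearly with slope 2
  -- Re(bq), yet it is bounded. The choices q = -1 and q = i give b = 0.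
  have hbq : ∀ q : ℂ, q.re ≤ 0 → (b * q).re = 0 := by
    intro q hq
    by_contra hne
    have hbd : ∀ t : ℝ, 0 ≤ t → |2 * (b * q).re * t| ≤ (B + 2 * Q) + (B + 2 * Q) := by
      intro t ht
      have h1 := eq_add_mul_of_hasWirtinger_div (ψ := fun x => ψ x - 2 * (f x).re) hW hs₀m hs₀0
        hq ht
      have hbound : ∀ s ∈ Metric.closedBall (0 : ℂ) (ρ / 2), s ≠ 0 →
          |ψ s - 2 * (f s).re| ≤ B + 2 * Q := by
        intro s hs hs0
        have h2 := hB s (hsubr (Metric.closedBall_subset_ball (by linarith) hs)) hs0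
        have h3 := hQ s hs
        rw [abs_le] at h2 h3 ⊢
        constructor <;> linarith [h2.1, h2.2, h3.1, h3.2]
      have hm : s₀ * Complex.exp (q * t) ∈ Metric.closedBall (0 : ℂ) (ρ / 2) := by
        rw [mem_closedBall_zero_iff, norm_mul, hns₀, Complex.norm_exp]
        refine mul_le_of_le_one_right (by positivity) (Real.exp_le_one_iff.2 ?_)
        simpa using mul_nonpos_of_nonpos_of_nonneg hq ht
      have h4 := hbound _ hm (mul_ne_zero hs₀0 (Complex.exp_ne_zero _))
      have h5 := hbound s₀ (by rw [mem_closedBall_zero_iff, hns₀]) hs₀0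
      rw [h1] at h4
      rw [abs_le] at h4 h5 ⊢
      constructor <;> linarith [h4.1, h4.2, h5.1, h5.2]
    set K := (B + 2 * Q) + (B + 2 * Q)
    have hpos : 0 < |2 * (b * q).re| := abs_pos.2 (mul_ne_zero two_ne_zero hne)
    have hK : 0 ≤ K := (abs_nonneg _).trans (hbd 0 le_rfl)
    have := hbd ((K + 1) / |2 * (b * q).re|) (by positivity)
    rw [abs_mul, abs_of_nonneg (a := (K + 1) / |2 * (b * q).re|) (by positivity),
      mul_div_cancel₀ _ hpos.ne'] at this
    linarith
  have hb0 : b = 0 := by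
    apply Complex.ext
    · simpa using hbq (-1) (by simp)
    · simpa using hbq Complex.I (by simp)
  -- With b = 0 the function is constant along spirals, and the spiral with q = log(s/s₀) reaches s
  -- in unit time.
  have hconst : ∀ s : ℂ, s ≠ 0 → ‖s‖ ≤ ρ / 2 →
      ψ s - 2 * (f s).re = ψ s₀ - 2 * (f s₀).re := by
    intro s hs hsn
    have hre : (Complex.log (s / s₀)).re ≤ 0 := by
      rw [Complex.log_re]
      refine Real.log_nonpos (norm_nonneg _) ?_
      rw [norm_div, hns₀]
      exact div_le_one_of_le₀ hsn (by positivity)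
    have h1 := eq_add_mul_of_hasWirtinger_div (ψ := fun x => ψ x - 2 * (f x).re) hW hs₀m hs₀0
      hre zero_le_one
    rw [Complex.ofReal_one, mul_one, Complex.exp_log (div_ne_zero hs hs₀0),
      mul_div_cancel₀ _ hs₀0, hb0] at h1
    simpa using h1
  set k := ψ s₀ - 2 * (f s₀).re
  refine ⟨fun s => f s + (k / 2 : ℝ), ?_, ?_⟩
  · have hfd : DifferentiableOn ℂ f (Metric.ball 0 ρ) := fun s hs =>
      (hf s hs).differentiableAt.differentiableWithinAt
    exact (hfd.analyticAt (Metric.ball_mem_nhds 0 hρ0)).add analyticAt_const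
  · have : ∀ᶠ s in 𝓝 (0 : ℂ), ‖s‖ ≤ ρ / 2 := by
      filter_upwards [Metric.ball_mem_nhds (0 : ℂ) (half_pos hρ0)] with s hs
      exact (mem_ball_zero_iff.1 hs).le
    filter_upwards [nhdsWithin_le_nhds this, self_mem_nhdsWithin] with s hs hs0
    have := hconst s hs0 hs
    rw [Complex.add_re, Complex.ofReal_re]
    linarith

/-- The function log F - p log|s| has the holomorphic ∂-derivative c - p/(2s), hence is harmonic,
and the two growth bounds say that its modulus is at most log K. -/
lemma exists_eq_norm_pow_mul_norm_exp_sq {F : ℂ → ℝ} {c : ℂ → ℂ} {p : ℕ} {K : ℝ}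
    (hc : ∀ᶠ s in 𝓝[≠] (0 : ℂ), DifferentiableAt ℂ c s) (hpos : ∀ᶠ s in 𝓝[≠] (0 : ℂ), 0 < F s)
    (h : ∀ᶠ s in 𝓝[≠] (0 : ℂ), HasWirtinger (fun x => (F x : ℂ)) (c s * F s)
      ((starRingEnd ℂ) (c s * F s)) s)
    (hle : ∀ᶠ s in 𝓝[≠] (0 : ℂ), F s ≤ K * ‖s‖ ^ p)
    (hge : ∀ᶠ s in 𝓝[≠] (0 : ℂ), ‖s‖ ^ p ≤ K * F s) :
    ∃ f : ℂ → ℂ, AnalyticAt ℂ f 0 ∧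
      ∀ᶠ s in 𝓝[≠] (0 : ℂ), F s = ‖s‖ ^ p * ‖Complex.exp (f s)‖ ^ 2 := by
  have hall := hc.and (hpos.and (h.and (hle.and hge)))
  rw [eventually_nhdsWithin_iff, Metric.eventually_nhds_iff_ball] at hall
  obtain ⟨r, hr, hall⟩ := hall
  have hψ : ∀ s ∈ Metric.ball (0 : ℂ) r, s ≠ 0 →
      HasWirtinger (fun x => ((Real.log (F x) - p * Real.log ‖x‖ : ℝ) : ℂ)) (c s - p / (2 * s))
        ((starRingEnd ℂ) (c s - p / (2 * s))) s := by
    intro s hs hs0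
    obtain ⟨-, hF, hW, -⟩ := hall s hs hs0
    have h1 := HasWirtinger.real_comp (ρ := F) (Real.hasDerivAt_log hF.ne') hW
    have h2 := HasWirtinger.real_comp (ρ := fun x => ‖x‖) (Real.hasDerivAt_log (norm_ne_zero_iff.2
      hs0)) (HasWirtinger.norm_hol (hasDerivAt_id s) hs0)
    have hFc : (F s : ℂ) ≠ 0 := by exact_mod_cast hF.ne'
    have hsn : (‖s‖ : ℂ) ≠ 0 := by simpa using hs0
    have e1 : (((F s)⁻¹ : ℝ) : ℂ) * (c s * F s) - p * (((‖s‖⁻¹ : ℝ) : ℂ) *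
        (‖id s‖ * 1 / (2 * id s))) = c s - p / (2 * s) := by
      push_cast
      simp only [id]
      field_simp
    refine ((h1.sub (h2.const_mul p)).congr_of_eventuallyEq
      (Eventually.of_forall fun x => ?_)).of_eq e1 ?_
    · push_cast; rfl
    · simp only [← e1, map_sub, map_mul, Complex.conj_ofReal, map_natCast, id]
  have hK : ∀ s ∈ Metric.ball (0 : ℂ) r, s ≠ 0 → 0 < K := fun s hs hs0 => by
    obtain ⟨-, hF, -, h1, -⟩ := hall s hs hs0
    have : 0 < ‖s‖ ^ p := pow_pos (norm_pos_iff.2 hs0) p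
    by_contra hcon
    nlinarith
  obtain ⟨f, hf, hfe⟩ := exists_eq_two_mul_re_of_bounded
    (ψ := fun x => Real.log (F x) - p * Real.log ‖x‖) (c := fun s => c s - p / (2 * s))
    (B := Real.log K) hr
    (fun s hs => by
      refine DifferentiableAt.differentiableWithinAt ?_
      have hs0 : s ≠ 0 := hs.2
      exact (hall s hs.1 hs.2).1.sub ((differentiableAt_const _).div
        ((differentiableAt_const _).mul differentiableAt_id) (mul_ne_zero two_ne_zero hs0)))
    hψ (fun s hs hs0 => by
      obtain ⟨-, hF, -, h1, h2⟩ := hall s hs hs0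
      have hn : 0 < ‖s‖ ^ p := pow_pos (norm_pos_iff.2 hs0) p
      have hK0 := hK s hs hs0
      have h3 := Real.log_le_log hF h1
      have h4 := Real.log_le_log hn h2
      rw [Real.log_mul hK0.ne' hn.ne', Real.log_pow] at h3
      rw [Real.log_mul hK0.ne' hF.ne', Real.log_pow] at h4
      rw [abs_le]
      constructor <;> linarith)
  refine ⟨f, hf, ?_⟩
  filter_upwards [hfe, hpos, self_mem_nhdsWithin] with s hs hF hs0
  have hn : 0 < ‖s‖ ^ p := pow_pos (norm_pos_iff.2 hs0) p
  rw [Complex.norm_exp, ← Real.exp_nat_mul, Nat.cast_ofNat, ← hs, Real.exp_sub, Real.exp_log hF,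
    ← Real.log_pow, Real.exp_log hn]
  field_simp

/-! ### Germs of holomorphic functions -/

lemma AnalyticAt.exists_differentiableOn_ball {f : ℂ → ℂ} (hf : AnalyticAt ℂ f 0) :
    ∃ r : ℝ, 0 < r ∧ DifferentiableOn ℂ f (Metric.ball 0 r) := by
  obtain ⟨r, hr, h⟩ := hf.exists_ball_analyticOnNhd
  exact ⟨r, hr, h.differentiableOn⟩

lemma AnalyticAt.exists_even_odd {f : ℂ → ℂ} (hf : AnalyticAt ℂ f 0) :
    ∃ f₀ f₁ : ℂ → ℂ, AnalyticAt ℂ f₀ 0 ∧ AnalyticAt ℂ f₁ 0 ∧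
      ∀ᶠ s in 𝓝 0, f s = f₀ (s ^ 2) + s * f₁ (s ^ 2) := by
  obtain ⟨r, hr, h⟩ := HiggsLocal.AnalyticAt.exists_differentiableOn_ball hf
  obtain ⟨f₀, f₁, h₀, h₁, he⟩ := HiggsLocal.exists_even_odd hr h
  have hr2 : Metric.ball (0 : ℂ) (r ^ 2) ∈ 𝓝 0 := Metric.ball_mem_nhds 0 (by positivity)
  exact ⟨f₀, f₁, h₀.analyticAt hr2, h₁.analyticAt hr2,
    eventually_of_mem (Metric.ball_mem_nhds 0 hr) he⟩

lemma AnalyticAt.exists_pow_eq {f : ℂ → ℂ} (hf : AnalyticAt ℂ f 0) (h0 : f 0 ≠ 0) {p : ℕ}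
    (hp : p ≠ 0) : ∃ k : ℂ → ℂ, AnalyticAt ℂ k 0 ∧ k 0 ≠ 0 ∧ ∀ᶠ s in 𝓝 0, k s ^ p = f s := by
  obtain ⟨r, hr, h⟩ := HiggsLocal.AnalyticAt.exists_differentiableOn_ball hf
  obtain ⟨r', hr', h'⟩ := Metric.eventually_nhds_iff_ball.1 (hf.continuousAt.eventually_ne h0)
  have hm : 0 < min r r' := lt_min hr hr'
  obtain ⟨k, hk, hke⟩ := exists_pow_eq_of_ne_zero (h.mono (Metric.ball_subset_ball
    (min_le_left r r'))) (fun w hw => h' w (Metric.ball_subset_ball (min_le_right r r') hw)) hp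
  exact ⟨k, hk.analyticAt (Metric.ball_mem_nhds 0 hm), (hke 0 (Metric.mem_ball_self hm)).1,
    eventually_of_mem (Metric.ball_mem_nhds 0 hm) fun s hs => (hke s hs).2⟩

lemma AnalyticAt.exists_mul_deriv_add_eq {f : ℂ → ℂ} (hf : AnalyticAt ℂ f 0) :
    ∃ b : ℂ → ℂ, AnalyticAt ℂ b 0 ∧ ∀ᶠ w in 𝓝 0, w * deriv b w + 3 / 2 * b w = f w := by
  obtain ⟨r, hr, h⟩ := HiggsLocal.AnalyticAt.exists_differentiableOn_ball hf
  obtain ⟨b, hb, hbe⟩ := exists_mul_deriv_add_three_halves_mul_eq hr h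
  exact ⟨b, hb.analyticAt (Metric.ball_mem_nhds 0 hr),
    eventually_of_mem (Metric.ball_mem_nhds 0 hr) hbe⟩

/-- Every small w ≠ 0 is the square of a small s ≠ 0. Identities proved with eigenvectors depending
on s thus descend to w. -/
lemma eventually_of_eventually_sq {Q : ℂ → Prop} (h : ∀ᶠ s in 𝓝[≠] (0 : ℂ), Q (s ^ 2)) :
    ∀ᶠ w in 𝓝[≠] (0 : ℂ), Q w := by
  rw [eventually_nhdsWithin_iff, Metric.eventually_nhds_iff_ball] at h ⊢
  obtain ⟨r, hr, h⟩ := h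
  refine ⟨r ^ 2, by positivity, fun w hw hw0 => ?_⟩
  have hsq := cpow_half_sq w
  rw [← hsq]
  refine h _ ?_ fun h0 => hw0 ?_
  · rw [mem_ball_zero_iff] at hw ⊢
    rw [← hsq, norm_pow] at hw
    exact lt_of_pow_lt_pow_left₀ 2 hr.le hw
  · rw [Set.mem_singleton_iff] at h0 ⊢
    rw [← hsq, h0]; simp

lemma tendsto_sq_nhdsNE : Tendsto (fun s : ℂ => s ^ 2) (𝓝[≠] 0) (𝓝[≠] 0) := by
  refine tendsto_nhdsWithin_iff.2 ⟨?_, ?_⟩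
  · have : ContinuousAt (fun s : ℂ => s ^ 2) 0 := by fun_prop
    simpa [ContinuousAt] using this.tendsto.mono_left nhdsWithin_le_nhds
  · filter_upwards [self_mem_nhdsWithin] with s hs
    exact pow_ne_zero 2 hs

lemma tendsto_neg_nhdsNE : Tendsto (fun s : ℂ => -s) (𝓝[≠] 0) (𝓝[≠] 0) := by
  refine tendsto_nhdsWithin_iff.2 ⟨?_, ?_⟩
  · have : ContinuousAt (fun s : ℂ => -s) 0 := by fun_prop
    simpa [ContinuousAt] using this.tendsto.mono_left nhdsWithin_le_nhds
  · filter_upwards [self_mem_nhdsWithin] with s hs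
    exact neg_ne_zero.2 hs

/-- The implicit function theorem for a holomorphic equation `G (s, y) = 0`. -/
lemma exists_analyticAt_implicit {G : ℂ × ℂ → ℂ} {y₀ d : ℂ} (hG : ContDiffAt ℂ ω G (0, y₀))
    (h0 : G (0, y₀) = 0) (hd : HasDerivAt (fun y => G (0, y)) d y₀) (hd0 : d ≠ 0) :
    ∃ y : ℂ → ℂ, AnalyticAt ℂ y 0 ∧ y 0 = y₀ ∧ ∀ᶠ s in 𝓝 0, G (s, y s) = 0 := by
  have hinv : (fderiv ℂ G (0, y₀) ∘L .inr ℂ ℂ ℂ).IsInvertible := by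
    have h1 : HasDerivAt (fun y : ℂ => ((0 : ℂ), y)) (0, 1) y₀ :=
      (hasDerivAt_const y₀ (0 : ℂ)).prodMk (hasDerivAt_id y₀)
    have h2 := (hG.differentiableAt (by simp)).hasFDerivAt.comp_hasDerivAt y₀ h1
    have h3 : fderiv ℂ G (0, y₀) (0, 1) = d := h2.unique hd
    refine ⟨ContinuousLinearEquiv.unitsEquivAut ℂ (Units.mk0 d hd0), ?_⟩
    ext
    simp [h3]
  refine ⟨hG.implicitFunction (by simp) hinv,
    (hG.contDiffAt_implicitFunction (by simp) hinv).analyticAt,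
    hG.implicitFunction_apply_self (by simp) hinv, ?_⟩
  filter_upwards [hG.eventually_apply_implicitFunction (by simp) hinv] with s hs
  rw [hs, h0]

/-! ### Eigenvectors and eigenvalues -/

section Eigen

variable {ι κ : Type*} [Fintype ι] [DecidableEq ι] [Fintype κ] [DecidableEq κ]

/-- Jacobi's formula. -/
lemma hasDerivAt_det {A : ℂ → Matrix ι ι ℂ} {A' : Matrix ι ι ℂ} {w : ℂ}
    (h : ∀ i j, HasDerivAt (fun x => A x i j) (A' i j) w) :
    HasDerivAt (fun x => (A x).det) ((A w).adjugate * A').trace w := by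
  have h1 : HasDerivAt (fun x => (A x).det) (∑ σ : Equiv.Perm ι, ((Equiv.Perm.sign σ : ℤ) : ℂ) *
      ∑ i, (∏ j ∈ Finset.univ.erase i, A w (σ j) j) • A' (σ i) i) w := by
    simp only [Matrix.det_apply']
    exact HasDerivAt.fun_sum fun σ _ =>
      (HasDerivAt.fun_finsetProd fun i _ => h (σ i) i).const_mul _
  refine h1.congr_deriv ?_
  have h2 : ∀ i, ((A w).adjugate * A') i i = ((A w).updateCol i fun k => A' k i).det := fun i => by
    rw [← Matrix.cramer_apply, Matrix.cramer_eq_adjugate_mulVec]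
    rfl
  simp only [Matrix.trace, Matrix.diag_apply, h2, Matrix.det_apply', Finset.mul_sum]
  rw [Finset.sum_comm]
  refine Finset.sum_congr rfl fun i _ => Finset.sum_congr rfl fun σ _ => ?_
  congr 1
  rw [← Finset.mul_prod_erase _ _ (Finset.mem_univ i), Matrix.updateCol_self, smul_eq_mul, mul_comm]
  congr 1
  refine Finset.prod_congr rfl fun j hj => ?_
  rw [Matrix.updateCol_ne (Finset.ne_of_mem_erase hj)]

/-- By Jacobi's formula both partial derivatives of det(λ - Φ(w)) are traces against the adjugate,
so its vanishing would be a singular point of the spectral curve. A nonzero column of the adjugate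
later serves as an eigenvector. -/
lemma adjugate_ne_zero_of_smooth {Φ : ℂ → Matrix ι ι ℂ} {U : Set ℂ} {w lam : ℂ}
    (hs : SpectralCurveSmooth U Φ) (hw : w ∈ U)
    (hΦ : ∀ i j, DifferentiableAt ℂ (fun x => Φ x i j) w) (h0 : (Φ w).charpoly.eval lam = 0) :
    (Matrix.scalar ι lam - Φ w).adjugate ≠ 0 := by
  intro hadj
  have h1 : HasDerivAt (fun x => (Matrix.scalar ι x - Φ w).det) 0 lam := by
    have := hasDerivAt_det (A := fun x => Matrix.scalar ι x - Φ w) (A' := 1) (w := lam)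
      fun i j => by
        simp only [Matrix.sub_apply, Matrix.scalar_apply, Matrix.diagonal_apply, Matrix.one_apply]
        split_ifs
        · exact (hasDerivAt_id lam).sub_const _
        · exact (hasDerivAt_const lam (0 : ℂ)).sub_const _
    rwa [hadj, Matrix.zero_mul, Matrix.trace_zero] at this
  have h2 : HasDerivAt (fun x => (Matrix.scalar ι lam - Φ x).det) 0 w := by
    have := hasDerivAt_det (A := fun x => Matrix.scalar ι lam - Φ x)
      (A' := Matrix.of fun i j => -deriv (fun x => Φ x i j) w) (w := w)
      fun i j => by
        simp only [Matrix.sub_apply, Matrix.of_apply]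
        exact (hΦ i j).hasDerivAt.const_sub _
    rwa [hadj, Matrix.zero_mul, Matrix.trace_zero] at this
  have h3 := (Φ w).charpoly.hasDerivAt lam
  simp only [Matrix.eval_charpoly] at h3
  rcases hs w hw lam h0 with h | h
  · exact h (h3.unique h1)
  · refine h ?_
    simp only [Matrix.eval_charpoly]
    exact h2.deriv

/-- Eigenvectors of a normal matrix are orthogonal. -/
lemma dotProduct_mulVec_eq_zero_of_normal {H A : Matrix ι ι ℂ} (hH : H.PosDef)
    (hA : comm A (adj H A) = 0) {lam mu : ℂ} (hne : lam ≠ mu) {u v : ι → ℂ}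
    (hu : A *ᵥ u = lam • u) (hv : A *ᵥ v = mu • v) : star u ⬝ᵥ (H *ᵥ v) = 0 := by
  -- B is normal and kills v, so the norm of B^† v equals that of Bv and B^† v = 0. Pairing with u
  -- gives (λ - μ)^* h(v, u) = 0.
  set B := A - mu • (1 : Matrix ι ι ℂ) with hB
  have hdet : IsUnit H.det := hH.det_pos.ne'.isUnit
  have hadj : adj H B = adj H A - (starRingEnd ℂ) mu • 1 := by
    simp only [adj, hB, Matrix.conjTranspose_sub, Matrix.conjTranspose_smul,
      Matrix.conjTranspose_one, mul_sub, sub_mul, Matrix.mul_smul, Matrix.smul_mul, mul_one,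
      Matrix.nonsing_inv_mul _ hdet, Complex.star_def]
  have hcomm : B * adj H B = adj H B * B := by
    have h1 : A * adj H A = adj H A * A := sub_eq_zero.1 hA
    rw [hadj, hB]
    simp only [sub_mul, mul_sub, h1, Matrix.smul_mul, Matrix.mul_smul, one_mul, mul_one]
    rw [smul_comm]
    abel
  have hBv : B *ᵥ v = 0 := by
    rw [hB, Matrix.sub_mulVec, hv, Matrix.smul_mulVec, Matrix.one_mulVec, sub_self]
  have hBu : B *ᵥ u = (lam - mu) • u := by
    rw [hB, Matrix.sub_mulVec, hu, Matrix.smul_mulVec, Matrix.one_mulVec, sub_smul]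
  have hmove : ∀ x y : ι → ℂ, star x ⬝ᵥ (Bᴴ *ᵥ y) = star (B *ᵥ x) ⬝ᵥ y := fun x y => by
    rw [Matrix.star_mulVec, Matrix.dotProduct_mulVec]
  have hHx : H *ᵥ (adj H B *ᵥ v) = Bᴴ *ᵥ (H *ᵥ v) := by
    rw [Matrix.mulVec_mulVec, adj, ← mul_assoc, ← mul_assoc, Matrix.mul_nonsing_inv _ hdet, one_mul,
      Matrix.mulVec_mulVec]
  have hx : adj H B *ᵥ v = 0 := by
    by_contra hne
    have := hH.dotProduct_mulVec_pos hne
    rw [hHx, hmove, Matrix.mulVec_mulVec, hcomm, ← Matrix.mulVec_mulVec, hBv, Matrix.mulVec_zero,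
      star_zero, zero_dotProduct] at this
    exact this.ne rfl
  have h2 := hmove u (H *ᵥ v)
  rw [← hHx, hx, Matrix.mulVec_zero, dotProduct_zero, hBu, star_smul, smul_dotProduct,
    smul_eq_mul] at h2
  exact (mul_eq_zero.1 h2.symm).resolve_left (star_ne_zero.2 (sub_ne_zero.2 hne))

lemma eval_derivative_prod_X_sub_C (Λ : κ → ℂ) (a : κ) :
    (∏ b, (Polynomial.X - Polynomial.C (Λ b))).derivative.eval (Λ a) =
      ∏ b ∈ Finset.univ.erase a, (Λ a - Λ b) := by
  rw [Polynomial.derivative_prod_finset, Polynomial.eval_finsetSum,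
    Finset.sum_eq_single a]
  · simp [Polynomial.eval_prod]
  · intro b _ hb
    have : a ∈ Finset.univ.erase b := Finset.mem_erase.2 ⟨hb.symm, Finset.mem_univ a⟩
    rw [Polynomial.eval_mul, Polynomial.eval_prod, Finset.prod_eq_zero this (by simp), zero_mul]
  · simp

/-- The discriminant is, up to sign, the resultant with the derivative, that is, the product of the
derivative over the roots. The sign is left open because only absolute values are compared. -/
lemma discr_prod_X_sub_C [Nonempty κ] (Λ : κ → ℂ) : ∃ e : ℕ, (∏ b, (Polynomial.X -
    Polynomial.C (Λ b))).discr = (-1) ^ e * ∏ a, ∏ b ∈ Finset.univ.erase a, (Λ a - Λ b) := by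
  set f : Polynomial ℂ := ∏ b, (Polynomial.X - Polynomial.C (Λ b)) with hf
  have hmonic : f.Monic := Polynomial.monic_prod_of_monic _ _ fun b _ =>
    Polynomial.monic_X_sub_C _
  have hroots : f.roots = Finset.univ.val.map Λ := by
    have := Polynomial.roots_multiset_prod_X_sub_C (Finset.univ.val.map Λ)
    rwa [Multiset.map_map] at this
  have hsplit : f.Splits := IsAlgClosed.splits f
  have hdeg : 0 < f.degree := by
    rw [Polynomial.degree_eq_natDegree hmonic.ne_zero, hsplit.natDegree_eq_card_roots, hroots]
    simp [Fintype.card_pos]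
  have h1 := Polynomial.resultant_deriv hdeg
  rw [Polynomial.resultant_eq_prod_eval _ _ _ (Polynomial.natDegree_derivative_le f) hsplit,
    hmonic.leadingCoeff, one_pow, one_mul, mul_one, hroots, Multiset.map_map] at h1
  refine ⟨f.natDegree * (f.natDegree - 1) / 2, ?_⟩
  have h2 : (Multiset.map ((fun x => f.derivative.eval x) ∘ Λ) Finset.univ.val).prod =
      ∏ a, ∏ b ∈ Finset.univ.erase a, (Λ a - Λ b) :=
    Finset.prod_congr rfl fun a _ => eval_derivative_prod_X_sub_C Λ a
  rw [h2] at h1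
  rw [h1, ← mul_assoc, ← pow_add, ← two_mul, pow_mul]
  simp

lemma charpoly_eq_prod {A : Matrix ι ι ℂ} {Λ : κ → ℂ} (hΛ : Function.Injective Λ)
    (hcard : Fintype.card κ = Fintype.card ι) (h : ∀ a, A.charpoly.eval (Λ a) = 0) :
    A.charpoly = ∏ a, (Polynomial.X - Polynomial.C (Λ a)) := by
  refine Polynomial.eq_of_monic_of_dvd_of_natDegree_le
    (Polynomial.monic_prod_of_monic _ _ fun b _ => Polynomial.monic_X_sub_C _) A.charpoly_monic
    ?_ ?_
  · refine Finset.prod_dvd_of_coprime (fun a _ b _ hab => ?_) fun a _ => ?_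
    · exact Polynomial.pairwise_coprime_X_sub_C hΛ hab
    · exact Polynomial.dvd_iff_isRoot.2 (h a)
  · rw [A.charpoly_natDegree_eq_dim, Polynomial.natDegree_prod_of_monic _ _ fun b _ =>
      Polynomial.monic_X_sub_C _]
    simp [hcard]

/-- An intertwiner is injective if it does not kill eigenvectors. -/
lemma eq_zero_of_mulVec_eq_zero {A : Matrix ι ι ℂ} {J : Matrix κ κ ℂ} {g : Matrix ι κ ℂ}
    (h : A * g = g * J) (he : ∀ (x : κ → ℂ) (mu : ℂ), x ≠ 0 → J *ᵥ x = mu • x → g *ᵥ x ≠ 0)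
    {x : κ → ℂ} (hx : g *ᵥ x = 0) : x = 0 := by
  by_contra hx0
  -- The kernel of an intertwiner is invariant under J. If nonzero, it contains an eigenvector of J,
  -- against the hypothesis.
  set W : Submodule ℂ (κ → ℂ) := LinearMap.ker (Matrix.mulVecLin g)
  have hW : ∀ y ∈ W, Matrix.mulVecLin J y ∈ W := fun y hy => by
    rw [LinearMap.mem_ker, Matrix.mulVecLin_apply] at hy ⊢
    rw [Matrix.mulVecLin_apply, Matrix.mulVec_mulVec, ← h, ← Matrix.mulVec_mulVec, hy,
      Matrix.mulVec_zero]
  have hxW : x ∈ W := by rwa [LinearMap.mem_ker, Matrix.mulVecLin_apply]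
  haveI : Nontrivial W := ⟨⟨x, hxW⟩, 0, fun h0 => hx0 (congrArg Subtype.val h0)⟩
  obtain ⟨mu, hmu⟩ := Module.End.exists_eigenvalue ((Matrix.mulVecLin J).restrict hW)
  obtain ⟨y, hy⟩ := hmu.exists_hasEigenvector
  have h1 := congrArg Subtype.val hy.apply_eq_smul
  refine he y mu (fun h0 => hy.2 (Subtype.ext h0)) ?_ ?_
  · simpa using h1
  · exact LinearMap.mem_ker.1 y.2

/-- After the two index types are identified, the inverse is given by Cramer's rule, whose
determinants are holomorphic. -/
lemma exists_holMat_inv {g : ℂ → Matrix ι κ ℂ} {S : Set ℂ}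
    (hcard : Fintype.card ι = Fintype.card κ)
    (hg : ∀ w ∈ S, ∀ a b, DifferentiableAt ℂ (fun x => g x a b) w)
    (hinj : ∀ w ∈ S, ∀ x, g w *ᵥ x = 0 → x = 0) :
    ∃ ginv : ℂ → Matrix κ ι ℂ, ∀ w ∈ S, g w * ginv w = 1 ∧ ginv w * g w = 1 ∧
      ∀ a b, DifferentiableAt ℂ (fun x => ginv x a b) w := by
  set e := Fintype.equivOfCardEq hcard
  set q : ℂ → Matrix ι ι ℂ := fun w => (g w).submatrix id e with hq
  have hdet : ∀ w ∈ S, (q w).det ≠ 0 := by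
    intro w hw h0
    obtain ⟨v, hv, hv0⟩ := Matrix.exists_mulVec_eq_zero_iff.2 h0
    have h1 : g w *ᵥ (v ∘ e.symm) = 0 := by
      rw [← hv0]
      ext i
      simp only [hq, Matrix.mulVec, dotProduct, Matrix.submatrix_apply, id, Function.comp]
      exact (Equiv.sum_comp e fun k => g w i k * v (e.symm k)).symm.trans (by simp)
    refine hv (funext fun i => ?_)
    have := congrFun (hinj w hw _ h1) (e i)
    simpa using this
  have hgq : ∀ w, g w = (q w).submatrix id e.symm := fun w => by ext i j; simp [hq]
  refine ⟨fun w => ((q w)⁻¹).submatrix e.symm id, fun w hw => ⟨?_, ?_, fun a b => ?_⟩⟩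
  · rw [hgq w, Matrix.submatrix_mul_equiv, Matrix.mul_nonsing_inv _ (hdet w hw).isUnit]
    simp
  · have h2 : (q w).submatrix id e.symm = (q w).submatrix (Equiv.refl ι) e.symm := rfl
    have h3 : (((q w)⁻¹).submatrix e.symm id : Matrix κ ι ℂ) =
      ((q w)⁻¹).submatrix e.symm (Equiv.refl ι) := rfl
    rw [hgq w, h2]
    refine (congrArg (· * _) h3).trans ?_
    rw [Matrix.submatrix_mul_equiv, Matrix.nonsing_inv_mul _ (hdet w hw).isUnit,
      Matrix.submatrix_one_equiv]
  · have hdd : ∀ B : ℂ → Matrix ι ι ℂ, (∀ i j, DifferentiableAt ℂ (fun x => B x i j) w) →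
        DifferentiableAt ℂ (fun x => (B x).det) w := fun B hB =>
      (hasDerivAt_det (A := B) (A' := Matrix.of fun i j => deriv (fun x => B x i j) w)
        fun i j => (hB i j).hasDerivAt).differentiableAt
    have hqd : ∀ i j, DifferentiableAt ℂ (fun x => q x i j) w := fun i j => hg w hw i (e j)
    have h4 : (fun x => ((q x)⁻¹).submatrix e.symm id a b) = fun x =>
        ((q x).det)⁻¹ * ((q x).updateRow b (Pi.single (e.symm a) 1)).det := by
      funext x
      rw [Matrix.submatrix_apply, Matrix.inv_def, Matrix.smul_apply, Matrix.adjugate_apply,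
        Ring.inverse_eq_inv', smul_eq_mul, id]
    rw [h4]
    refine ((hdd q hqd).inv (hdet w hw)).mul (hdd _ fun i j => ?_)
    by_cases hi : i = b
    · subst hi; simp
    · simpa [Matrix.updateRow_ne hi] using hqd i j

end Eigen

/-! ### Germs of eigenvalues and eigenvectors -/

/-- The roots of a polynomial with at most double roots. -/
lemma exists_enumeration_roots {p : Polynomial ℂ} (hp : p ≠ 0)
    (h2 : ∀ x, p.rootMultiplicity x ≤ 2) :
    ∃ (d m : ℕ) (x : Fin d → ℂ) (y : Fin m → ℂ), Function.Injective (Sum.elim x y) ∧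
      (∀ j, p.rootMultiplicity (x j) = 2) ∧ (∀ k, p.rootMultiplicity (y k) = 1) ∧
      2 * d + m = p.natDegree := by
  classical
  set D := p.roots.toFinset.filter fun x => p.rootMultiplicity x = 2 with hD
  set S := p.roots.toFinset.filter fun x => p.rootMultiplicity x = 1 with hS
  have hDm : ∀ j, p.rootMultiplicity (D.equivFin.symm j : ℂ) = 2 := fun j =>
    (Finset.mem_filter.1 (D.equivFin.symm j).2).2
  have hSm : ∀ j, p.rootMultiplicity (S.equivFin.symm j : ℂ) = 1 := fun j =>
    (Finset.mem_filter.1 (S.equivFin.symm j).2).2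
  refine ⟨D.card, S.card, fun j => D.equivFin.symm j, fun k => S.equivFin.symm k, ?_, hDm, hSm, ?_⟩
  · refine Function.Injective.sumElim (Subtype.val_injective.comp D.equivFin.symm.injective)
      (Subtype.val_injective.comp S.equivFin.symm.injective) fun j k hjk => ?_
    have h1 := hDm j
    rw [hjk, hSm k] at h1
    omega
  · rw [(IsAlgClosed.splits p).natDegree_eq_card_roots, ← Multiset.toFinset_sum_count_eq]
    have h3 : ∀ x ∈ p.roots.toFinset, p.roots.count x =
        2 * (if p.rootMultiplicity x = 2 then 1 else 0) +
          if p.rootMultiplicity x = 1 then 1 else 0 := by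
      intro x hx
      rw [Polynomial.count_roots]
      have h4 := (Polynomial.rootMultiplicity_pos hp).2
        ((Polynomial.mem_roots hp).1 (Multiset.mem_toFinset.1 hx))
      have h5 := h2 x
      have : p.rootMultiplicity x = 1 ∨ p.rootMultiplicity x = 2 := by omega
      rcases this with h | h <;> simp [h]
    rw [Finset.sum_congr rfl h3, Finset.sum_add_distrib, ← Finset.mul_sum, Finset.sum_boole,
      Finset.sum_boole]
    simp [hD, hS]

section Coefficients

variable {ι : Type*} [Fintype ι] [DecidableEq ι]

/-- The coefficients of the characteristic polynomial are holomorphic. -/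
lemma analyticAt_charpoly_coeff {Φ : ℂ → Matrix ι ι ℂ} {w : ℂ}
    (hΦ : ∀ i j, AnalyticAt ℂ (fun x => Φ x i j) w) (k : ℕ) :
    AnalyticAt ℂ (fun x => (Φ x).charpoly.coeff k) w := by
  have hprod : ∀ (s : Finset ι) (f : ι → ℂ → Polynomial ℂ),
      (∀ i ∈ s, ∀ k, AnalyticAt ℂ (fun x => (f i x).coeff k) w) →
      ∀ k, AnalyticAt ℂ (fun x => (∏ i ∈ s, f i x).coeff k) w := by
    intro s f
    induction s using Finset.induction_on with
    | empty => intro _ k; simpa using analyticAt_const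
    | insert a s ha ih =>
      intro hf k
      simp only [Finset.prod_insert ha, Polynomial.coeff_mul]
      exact Finset.analyticAt_fun_sum _ fun x _ => (hf a (Finset.mem_insert_self a s) _).mul
        (ih (fun i hi => hf i (Finset.mem_insert_of_mem hi)) _)
  simp only [Matrix.charpoly, Matrix.det_apply, Polynomial.finsetSum_coeff]
  refine Finset.analyticAt_fun_sum _ fun σ _ => ?_
  have h1 := hprod Finset.univ (fun i x => (Φ x).charmatrix (σ i) i) (fun i _ k => by
    simp only [Matrix.charmatrix_apply, Polynomial.coeff_sub, Polynomial.coeff_C]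
    refine AnalyticAt.sub analyticAt_const ?_
    split_ifs
    · exact hΦ _ _
    · exact analyticAt_const) k
  rcases Int.units_eq_one_or (Equiv.Perm.sign σ) with h | h
  · simpa [h] using h1
  · exact h1.neg.congr (Eventually.of_forall fun x => by simp [h])

lemma charpoly_eval_eq_sum (A : Matrix ι ι ℂ) (x : ℂ) : A.charpoly.eval x =
    ∑ k ∈ Finset.range (Fintype.card ι + 1), A.charpoly.coeff k * x ^ k := by
  rw [Polynomial.eval_eq_sum_range, A.charpoly_natDegree_eq_dim]

lemma exists_simple_root_germ {Φ : ℂ → Matrix ι ι ℂ}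
    (hΦ : ∀ i j, AnalyticAt ℂ (fun x => Φ x i j) 0) {y₀ : ℂ}
    (h1 : (Φ 0).charpoly.rootMultiplicity y₀ = 1) :
    ∃ y : ℂ → ℂ, AnalyticAt ℂ y 0 ∧ y 0 = y₀ ∧ ∀ᶠ s in 𝓝 0, (Φ s).charpoly.eval (y s) = 0 := by
  have hne : (Φ 0).charpoly ≠ 0 := (Φ 0).charpoly_monic.ne_zero
  have hroot : (Φ 0).charpoly.eval y₀ = 0 :=
    (Polynomial.rootMultiplicity_pos hne).1 (by omega)
  have hder : (Φ 0).charpoly.derivative.eval y₀ ≠ 0 := fun h => by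
    have := (Polynomial.one_lt_rootMultiplicity_iff_isRoot hne).2 ⟨hroot, h⟩
    omega
  refine exists_analyticAt_implicit (G := fun q => (Φ q.1).charpoly.eval q.2)
    (d := (Φ 0).charpoly.derivative.eval y₀) ?_ hroot ((Φ 0).charpoly.hasDerivAt y₀) hder
  simp only [charpoly_eval_eq_sum]
  refine ContDiffAt.sum fun k _ => ContDiffAt.mul ?_ (contDiffAt_snd.pow k)
  exact ((analyticAt_charpoly_coeff hΦ k).contDiffAt.comp ((0 : ℂ), y₀) contDiffAt_fst :)

/-- Split the characteristic polynomial as (x - x₀)² c(x) + w B(w, x). Under w = s², x = x₀ + s y it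
becomes s² (y² c + B). Smoothness gives B(0, x₀) ≠ 0, so the second factor has a simple root y₀ ≠ 0
at s = 0. The implicit function theorem continues it, and L'(0) = y₀. -/
lemma exists_double_root_germ {Φ : ℂ → Matrix ι ι ℂ}
    (hΦ : ∀ i j, AnalyticAt ℂ (fun x => Φ x i j) 0) {x₀ : ℂ}
    (h2 : (Φ 0).charpoly.rootMultiplicity x₀ = 2)
    (hs : deriv (fun x => (Φ x).charpoly.eval x₀) 0 ≠ 0) :
    ∃ L : ℂ → ℂ, AnalyticAt ℂ L 0 ∧ L 0 = x₀ ∧ deriv L 0 ≠ 0 ∧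
      ∀ᶠ s in 𝓝 0, (Φ (s ^ 2)).charpoly.eval (L s) = 0 := by
  have hne : (Φ 0).charpoly ≠ 0 := (Φ 0).charpoly_monic.ne_zero
  obtain ⟨c, hc, hcd⟩ := Polynomial.exists_eq_pow_rootMultiplicity_mul_and_not_dvd _ hne x₀
  rw [h2] at hc
  rw [Polynomial.dvd_iff_isRoot, Polynomial.IsRoot] at hcd
  set b : ℕ → ℂ → ℂ := fun k w => (Φ w).charpoly.coeff k with hb
  have hban : ∀ k, AnalyticAt ℂ (b k) 0 := fun k => analyticAt_charpoly_coeff hΦ k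
  have hbd : ∀ k, AnalyticAt ℂ (dslope (b k) 0) 0 := fun k => by
    obtain ⟨r, hr, h⟩ := HiggsLocal.AnalyticAt.exists_differentiableOn_ball (hban k)
    exact ((Complex.differentiableOn_dslope (Metric.ball_mem_nhds 0 hr)).2 h).analyticAt
      (Metric.ball_mem_nhds 0 hr)
  set B : ℂ → ℂ → ℂ := fun w x =>
    ∑ k ∈ Finset.range (Fintype.card ι + 1), dslope (b k) 0 w * x ^ k with hB
  have hP : ∀ w x, (Φ w).charpoly.eval x = (x - x₀) ^ 2 * c.eval x + w * B w x := by
    intro w x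
    have h3 : (x - x₀) ^ 2 * c.eval x = (Φ 0).charpoly.eval x := by rw [hc]; simp
    rw [h3, charpoly_eval_eq_sum, charpoly_eval_eq_sum, hB, Finset.mul_sum,
      ← Finset.sum_add_distrib]
    refine Finset.sum_congr rfl fun k _ => ?_
    have := sub_smul_dslope (b k) 0 w
    rw [sub_zero, smul_eq_mul] at this
    linear_combination (-x ^ k) * this
  have hB0 : B 0 x₀ ≠ 0 := by
    have h3 : HasDerivAt (fun x => (Φ x).charpoly.eval x₀) (B 0 x₀) 0 := by
      simp only [charpoly_eval_eq_sum, hB, dslope_same]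
      exact HasDerivAt.fun_sum fun k _ => (hban k).differentiableAt.hasDerivAt.mul_const _
    rwa [h3.deriv] at hs
  obtain ⟨y₀, hy₀⟩ : ∃ y₀ : ℂ, y₀ ^ 2 = -B 0 x₀ / c.eval x₀ :=
    ⟨_, cpow_half_sq _⟩
  have hy0 : y₀ ≠ 0 := by
    rintro rfl
    rw [eq_div_iff hcd] at hy₀
    simp at hy₀
    exact hB0 hy₀
  obtain ⟨y, hy, hyy, hye⟩ := exists_analyticAt_implicit
    (G := fun q => B (q.1 ^ 2) (x₀ + q.1 * q.2) + q.2 ^ 2 * c.eval (x₀ + q.1 * q.2))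
    (y₀ := y₀) (d := 2 * y₀ * c.eval x₀) (by
      have ha : ContDiffAt ℂ ω (fun q : ℂ × ℂ => x₀ + q.1 * q.2) (0, y₀) :=
        contDiffAt_const.add (contDiffAt_fst.mul contDiffAt_snd)
      refine ContDiffAt.add ?_ ((contDiffAt_snd.pow 2).mul ?_)
      · refine ContDiffAt.sum fun k _ => ContDiffAt.mul ?_ (ha.pow k)
        have h4 : ContDiffAt ℂ ω (dslope (b k) 0) ((fun q : ℂ × ℂ => q.1 ^ 2) (0, y₀)) := by
          simpa using (hbd k).contDiffAt
        exact (h4.comp ((0 : ℂ), y₀) (contDiffAt_fst.pow 2) :)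
      · exact (c.contDiff_aeval ω).contDiffAt.comp ((0 : ℂ), y₀) ha)
    (by simp only [zero_mul, add_zero, hy₀, ne_eq, OfNat.ofNat_ne_zero, not_false_eq_true, zero_pow]
        field_simp; ring)
    (by
      simp only [zero_mul, add_zero, ne_eq, OfNat.ofNat_ne_zero, not_false_eq_true, zero_pow]
      refine ((((hasDerivAt_id y₀).pow 2).mul_const _).const_add _).congr_deriv ?_
      simp)
    (mul_ne_zero (mul_ne_zero two_ne_zero hy0) hcd)
  refine ⟨fun s => x₀ + s * y s, analyticAt_const.add (analyticAt_id.mul hy), by simp, ?_, ?_⟩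
  · have h5 := ((hasDerivAt_id (0 : ℂ)).mul hy.differentiableAt.hasDerivAt).const_add x₀
    have h6 : deriv (fun s => x₀ + s * y s) 0 = y₀ := by
      refine (h5.congr_deriv ?_).deriv
      simp [hyy]
    rwa [h6]
  · filter_upwards [hye] with s hs
    rw [hP]
    linear_combination s ^ 2 * hs

/-- At an eigenvalue, (λ - Ψ) times its adjugate is det · 1 = 0, so the columns of the adjugate are
eigenvectors. A column that is nonzero at 0 is taken. -/
lemma exists_eigenvector_germ {Ψ : ℂ → Matrix ι ι ℂ}
    (hΨ : ∀ i j, AnalyticAt ℂ (fun x => Ψ x i j) 0) {L : ℂ → ℂ} (hL : AnalyticAt ℂ L 0)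
    (hroot : ∀ᶠ s in 𝓝 0, (Ψ s).charpoly.eval (L s) = 0)
    (hadj : (Matrix.scalar ι (L 0) - Ψ 0).adjugate ≠ 0) :
    ∃ v : ℂ → ι → ℂ, (∀ i, AnalyticAt ℂ (fun s => v s i) 0) ∧ v 0 ≠ 0 ∧
      ∀ᶠ s in 𝓝 0, Ψ s *ᵥ v s = L s • v s := by
  obtain ⟨i₀, a, ha⟩ : ∃ i a, (Matrix.scalar ι (L 0) - Ψ 0).adjugate i a ≠ 0 := by
    by_contra! h
    exact hadj (Matrix.ext h)
  refine ⟨fun s i => (Matrix.scalar ι (L s) - Ψ s).adjugate i a, fun i => ?_,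
    fun h => ha (congrFun h i₀), ?_⟩
  · simp only [Matrix.adjugate_apply, Matrix.det_apply']
    refine Finset.analyticAt_fun_sum _ fun σ _ => analyticAt_const.mul
      (Finset.analyticAt_fun_prod _ fun k _ => ?_)
    by_cases hk : σ k = a
    · simpa [Matrix.updateRow_apply, hk] using analyticAt_const
    · simp only [Matrix.updateRow_ne hk, Matrix.sub_apply, Matrix.scalar_apply,
        Matrix.diagonal_apply]
      refine AnalyticAt.sub ?_ (hΨ _ _)
      split_ifs
      · exact hL
      · exact analyticAt_const
  · filter_upwards [hroot] with s hs
    rw [Matrix.eval_charpoly] at hs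
    have h1 := Matrix.mul_adjugate (Matrix.scalar ι (L s) - Ψ s)
    rw [hs, zero_smul, sub_mul] at h1
    ext i
    have h2 := congrFun (congrFun h1 i) a
    rw [Matrix.sub_apply, Matrix.scalar_apply, Matrix.diagonal_mul, Matrix.zero_apply] at h2
    rw [Pi.smul_apply, smul_eq_mul]
    exact (sub_eq_zero.1 h2).symm

end Coefficients

/-! ### The eigenvalues near a branch point -/

/-- Germs of eigenvalues and eigenvectors of `Φ` at `0`: those with a double eigenvalue at `0` are
functions of `s`, where `w = s²`. -/
structure IsSpectralGerm {n d m : ℕ} (Φ : ℂ → Matrix (Fin n) (Fin n) ℂ) (L : Fin d → ℂ → ℂ)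
    (mu : Fin m → ℂ → ℂ) (v : Fin d → ℂ → Fin n → ℂ) (u : Fin m → ℂ → Fin n → ℂ) : Prop where
  card : 2 * d + m = n
  L_an : ∀ j, AnalyticAt ℂ (L j) 0
  mu_an : ∀ k, AnalyticAt ℂ (mu k) 0
  v_an : ∀ j i, AnalyticAt ℂ (fun s => v j s i) 0
  u_an : ∀ k i, AnalyticAt ℂ (fun s => u k s i) 0
  inj : Function.Injective (Sum.elim (fun j => L j 0) fun k => mu k 0)
  L_deriv : ∀ j, deriv (L j) 0 ≠ 0
  v_ne : ∀ j, v j 0 ≠ 0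
  u_ne : ∀ k, u k 0 ≠ 0
  v_eig : ∀ j, ∀ᶠ s in 𝓝 0, Φ (s ^ 2) *ᵥ v j s = L j s • v j s
  u_eig : ∀ k, ∀ᶠ w in 𝓝 0, Φ w *ᵥ u k w = mu k w • u k w

lemma AnalyticAt.comp_neg_zero {f : ℂ → ℂ} (h : AnalyticAt ℂ f 0) :
    AnalyticAt ℂ (fun s => f (-s)) 0 :=
  AnalyticAt.comp (f := fun s : ℂ => -s) (by simpa using h) (by fun_prop)

lemma AnalyticAt.comp_sq_zero {f : ℂ → ℂ} (h : AnalyticAt ℂ f 0) :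
    AnalyticAt ℂ (fun s => f (s ^ 2)) 0 :=
  AnalyticAt.comp (f := fun s : ℂ => s ^ 2) (by simpa using h) (by fun_prop)

lemma exists_isSpectralGerm {n : ℕ} {U : Set ℂ} (hU : IsOpen U) (h0 : (0 : ℂ) ∈ U)
    {Φ : ℂ → Matrix (Fin n) (Fin n) ℂ} (hΦ : HolMatOn Φ U) (hcross : SimpleEigenvalueCrossing U Φ) :
    ∃ (d m : ℕ) (L : Fin d → ℂ → ℂ) (mu : Fin m → ℂ → ℂ) (v : Fin d → ℂ → Fin n → ℂ)
      (u : Fin m → ℂ → Fin n → ℂ), IsSpectralGerm Φ L mu v u := by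
  have han : ∀ i j, AnalyticAt ℂ (fun x => Φ x i j) 0 := fun i j =>
    (hΦ i j).analyticAt (hU.mem_nhds h0)
  have hne : (Φ 0).charpoly ≠ 0 := (Φ 0).charpoly_monic.ne_zero
  obtain ⟨d, m, x, y, hinj, hx, hy, hcard⟩ := exists_enumeration_roots hne (hcross.2 0 h0)
  rw [(Φ 0).charpoly_natDegree_eq_dim, Fintype.card_fin] at hcard
  have hxroot : ∀ j, (Φ 0).charpoly.eval (x j) = 0 := fun j =>
    (Polynomial.rootMultiplicity_pos hne).1 (by rw [hx]; norm_num)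
  have hyroot : ∀ j, (Φ 0).charpoly.eval (y j) = 0 := fun j =>
    (Polynomial.rootMultiplicity_pos hne).1 (by rw [hy]; norm_num)
  -- At a double root the derivative in λ vanishes, so smoothness forces the derivative in w to be
  -- nonzero.
  have hder : ∀ j, deriv (fun w => (Φ w).charpoly.eval (x j)) 0 ≠ 0 := fun j => by
    refine (hcross.1 0 h0 (x j) (hxroot j)).resolve_left fun h => h ?_
    exact ((Polynomial.one_lt_rootMultiplicity_iff_isRoot hne).1 (by rw [hx]; norm_num)).2
  choose L hL hL0 hLd hLr using fun j => exists_double_root_germ han (hx j) (hder j)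
  choose mu hmu hmu0 hmur using fun k => exists_simple_root_germ han (hy k)
  have hadj : ∀ lam, (Φ 0).charpoly.eval lam = 0 →
      (Matrix.scalar (Fin n) lam - Φ 0).adjugate ≠ 0 := fun lam h =>
    adjugate_ne_zero_of_smooth hcross.1 h0 (fun i j => (han i j).differentiableAt) h
  have hsq : ∀ i j, AnalyticAt ℂ (fun s => Φ (s ^ 2) i j) 0 := fun i j =>
    AnalyticAt.comp_sq_zero (han i j)
  choose v hv hv0 hve using fun j => exists_eigenvector_germ hsq (hL j) (hLr j)
    (by rw [hL0]; simpa using hadj _ (hxroot j))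
  choose u hu hu0 hue using fun k => exists_eigenvector_germ han (hmu k) (hmur k)
    (by rw [hmu0]; simpa using hadj _ (hyroot k))
  refine ⟨d, m, L, mu, v, u, hcard, hL, hmu, hv, hu, ?_, hLd, hv0, hu0, hve, hue⟩
  simpa only [hL0, hmu0] using hinj

section Germ

variable {n d m : ℕ} {Φ : ℂ → Matrix (Fin n) (Fin n) ℂ} {L : Fin d → ℂ → ℂ}
  {mu : Fin m → ℂ → ℂ} {v : Fin d → ℂ → Fin n → ℂ} {u : Fin m → ℂ → Fin n → ℂ}

/-- All eigenvalues of `Φ (s²)`. -/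
def eigenvalue (L : Fin d → ℂ → ℂ) (mu : Fin m → ℂ → ℂ) : BlockIdx d m → ℂ → ℂ
  | Sum.inl (i, j), s => if i = 0 then L j s else L j (-s)
  | Sum.inr k, s => mu k (s ^ 2)

/-- The eigenvectors of `Φ (s²)` as the columns of a matrix. -/
def eigenMat (v : Fin d → ℂ → Fin n → ℂ) (u : Fin m → ℂ → Fin n → ℂ) (s : ℂ) :
    Matrix (Fin n) (BlockIdx d m) ℂ := Matrix.of fun r a =>
  match a with
  | Sum.inl (i, j) => if i = 0 then v j s r else v j (-s) r
  | Sum.inr k => u k (s ^ 2) r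

/-- The order of vanishing of a difference of eigenvalues. -/
def pairOrder : BlockIdx d m → BlockIdx d m → ℕ
  | Sum.inl x, Sum.inl y => if x.2 = y.2 then 1 else 0
  | _, _ => 0

/-- The parabolic weight of an eigenline. -/
def lineOrder : BlockIdx d m → ℕ
  | Sum.inl _ => 1
  | Sum.inr _ => 0

lemma tendsto_neg_nhds_zero : Tendsto (fun s : ℂ => -s) (𝓝 0) (𝓝 0) := by
  simpa using (continuous_neg (G := ℂ)).tendsto 0

lemma tendsto_sq_nhds_zero : Tendsto (fun s : ℂ => s ^ 2) (𝓝 0) (𝓝 0) := by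
  simpa using (continuous_pow (M := ℂ) 2).tendsto 0

namespace IsSpectralGerm

lemma eigenvalue_an (h : IsSpectralGerm Φ L mu v u) (a : BlockIdx d m) :
    AnalyticAt ℂ (eigenvalue L mu a) 0 := by
  rcases a with ⟨i, j⟩ | k
  · by_cases hi : i = 0
    · exact (h.L_an j).congr (Eventually.of_forall fun s => by simp [eigenvalue, hi])
    · exact (AnalyticAt.comp_neg_zero (h.L_an j)).congr
        (Eventually.of_forall fun s => by simp [eigenvalue, hi])
  · exact AnalyticAt.comp_sq_zero (h.mu_an k)

lemma eigenMat_an (h : IsSpectralGerm Φ L mu v u) (r : Fin n) (a : BlockIdx d m) :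
    AnalyticAt ℂ (fun s => eigenMat v u s r a) 0 := by
  rcases a with ⟨i, j⟩ | k
  · by_cases hi : i = 0
    · simpa [eigenMat, hi] using h.v_an j r
    · simpa [eigenMat, hi] using AnalyticAt.comp_neg_zero (h.v_an j r)
  · exact AnalyticAt.comp_sq_zero (h.u_an k r)

lemma eigenMat_col_ne (h : IsSpectralGerm Φ L mu v u) (a : BlockIdx d m) :
    ∃ r, eigenMat v u 0 r a ≠ 0 := by
  rcases a with ⟨i, j⟩ | k
  · obtain ⟨r, hr⟩ := Function.ne_iff.1 (h.v_ne j)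
    exact ⟨r, by simpa [eigenMat] using hr⟩
  · obtain ⟨r, hr⟩ := Function.ne_iff.1 (h.u_ne k)
    exact ⟨r, by simpa [eigenMat] using hr⟩

lemma mulVec_eigenMat (h : IsSpectralGerm Φ L mu v u) (a : BlockIdx d m) :
    ∀ᶠ s in 𝓝 0, (Φ (s ^ 2) *ᵥ fun r => eigenMat v u s r a) =
      eigenvalue L mu a s • fun r => eigenMat v u s r a := by
  rcases a with ⟨i, j⟩ | k
  · by_cases hi : i = 0
    · simpa [eigenMat, eigenvalue, hi] using h.v_eig j
    · have := tendsto_neg_nhds_zero.eventually (h.v_eig j)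
      simpa [eigenMat, eigenvalue, hi] using this
  · exact tendsto_sq_nhds_zero.eventually (h.u_eig k)

/-- Two sheets of the same pair differ by L(s) - L(-s), which has derivative 2L'(0) ≠ 0 and so a
simple zero. Eigenvalues of different germs already differ at 0. -/
lemma eigenvalue_sub (h : IsSpectralGerm Φ L mu v u) {a b : BlockIdx d m} (hab : a ≠ b) :
    ∃ q : ℂ → ℂ, AnalyticAt ℂ q 0 ∧ q 0 ≠ 0 ∧ ∀ s,
      eigenvalue L mu a s - eigenvalue L mu b s = s ^ pairOrder a b * q s := by
  have hgen : pairOrder a b = 0 → eigenvalue L mu a 0 ≠ eigenvalue L mu b 0 →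
      ∃ q : ℂ → ℂ, AnalyticAt ℂ q 0 ∧ q 0 ≠ 0 ∧ ∀ s,
      eigenvalue L mu a s - eigenvalue L mu b s = s ^ pairOrder a b * q s := fun h1 h2 =>
    ⟨fun s => eigenvalue L mu a s - eigenvalue L mu b s,
      (h.eigenvalue_an a).sub (h.eigenvalue_an b), sub_ne_zero.2 h2, fun s => by simp [h1]⟩
  have hpair : ∀ j, ∃ q : ℂ → ℂ, AnalyticAt ℂ q 0 ∧ q 0 ≠ 0 ∧ ∀ s, L j s - L j (-s) = s * q s := by
    intro j
    have hf : AnalyticAt ℂ (fun s => L j s - L j (-s)) 0 :=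
      (h.L_an j).sub (AnalyticAt.comp_neg_zero (h.L_an j))
    obtain ⟨r, hr, hd⟩ := HiggsLocal.AnalyticAt.exists_differentiableOn_ball hf
    refine ⟨dslope (fun s => L j s - L j (-s)) 0,
      ((Complex.differentiableOn_dslope (Metric.ball_mem_nhds 0 hr)).2 hd).analyticAt
      (Metric.ball_mem_nhds 0 hr), ?_, fun s => ?_⟩
    · have h1 : HasDerivAt (L j) (deriv (L j) 0) (-0) := by
        simpa using (h.L_an j).differentiableAt.hasDerivAt
      have h2 := (h.L_an j).differentiableAt.hasDerivAt.sub (h1.scomp 0 (hasDerivAt_neg (0 : ℂ)))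
      have h3 : deriv (fun s => L j s - L j (-s)) 0 = 2 * deriv (L j) 0 := by
        refine HasDerivAt.deriv (h2.congr_deriv ?_)
        simp; ring
      rw [dslope_same, h3]
      exact mul_ne_zero two_ne_zero (h.L_deriv j)
    · have := sub_smul_dslope (fun s => L j s - L j (-s)) 0 s
      simpa using this.symm
  rcases a with ⟨i, j⟩ | k <;> rcases b with ⟨i', j'⟩ | k'
  · by_cases hj : j = j'
    · subst hj
      obtain ⟨q, hq, hq0, hqe⟩ := hpair j
      by_cases hi : i = 0
      · have hi' : i' ≠ 0 := fun h' => hab (by rw [hi, h'])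
        exact ⟨q, hq, hq0, fun s => by simpa [eigenvalue, pairOrder, hi, hi'] using hqe s⟩
      · have hi' : i' = 0 := by
          by_contra h'
          exact hab (by congr 2; omega)
        exact ⟨fun s => -q s, hq.neg, neg_ne_zero.2 hq0, fun s => by
          have := hqe s
          simp only [eigenvalue, pairOrder, hi, hi', if_true, if_false, pow_one]
          linear_combination -this⟩
    · refine hgen (by simp [pairOrder, hj]) ?_
      simpa [eigenvalue] using fun h' => hj (Sum.inl_injective (h.inj (a₁ := Sum.inl j)
        (a₂ := Sum.inl j') h'))
  · refine hgen rfl ?_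
    simpa [eigenvalue] using fun h' => Sum.inl_ne_inr (h.inj (a₁ := Sum.inl j)
        (a₂ := Sum.inr k') h')
  · refine hgen rfl ?_
    simpa [eigenvalue] using fun h' => Sum.inr_ne_inl (h.inj (a₁ := Sum.inr k)
        (a₂ := Sum.inl j') h')
  · refine hgen rfl ?_
    simpa [eigenvalue] using fun h' => hab (congrArg _ (Sum.inr_injective
      (h.inj (a₁ := Sum.inr k) (a₂ := Sum.inr k') h')))

lemma eigenvalue_injective (h : IsSpectralGerm Φ L mu v u) :
    ∀ᶠ s in 𝓝[≠] (0 : ℂ), Function.Injective fun a => eigenvalue L mu a s := by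
  have h1 : ∀ a b : BlockIdx d m, a ≠ b →
      ∀ᶠ s in 𝓝[≠] (0 : ℂ), eigenvalue L mu a s ≠ eigenvalue L mu b s := by
    intro a b hab
    obtain ⟨q, hq, hq0, hqe⟩ := h.eigenvalue_sub hab
    filter_upwards [nhdsWithin_le_nhds (hq.continuousAt.eventually_ne hq0),
      self_mem_nhdsWithin] with s hs hs0
    rw [← sub_ne_zero, hqe]
    exact mul_ne_zero (pow_ne_zero _ hs0) hs
  have h2 : ∀ᶠ s in 𝓝[≠] (0 : ℂ), ∀ a b : BlockIdx d m, a ≠ b →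
      eigenvalue L mu a s ≠ eigenvalue L mu b s := by
    simp only [eventually_all]
    exact fun a b hab => h1 a b hab
  filter_upwards [h2] with s hs a b hab
  by_contra hne
  exact hs a b hne hab

lemma card_blockIdx (h : IsSpectralGerm Φ L mu v u) :
    Fintype.card (BlockIdx d m) = Fintype.card (Fin n) := by
  simp [h.card]

lemma charpoly_eq (h : IsSpectralGerm Φ L mu v u) :
    ∀ᶠ s in 𝓝[≠] (0 : ℂ), (Φ (s ^ 2)).charpoly =
      ∏ a, (Polynomial.X - Polynomial.C (eigenvalue L mu a s)) := by
  have h1 : ∀ᶠ s in 𝓝 (0 : ℂ), ∀ a, (Φ (s ^ 2)).charpoly.eval (eigenvalue L mu a s) = 0 := by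
    rw [eventually_all]
    intro a
    obtain ⟨r, hr⟩ := h.eigenMat_col_ne a
    filter_upwards [h.mulVec_eigenMat a, (h.eigenMat_an r a).continuousAt.eventually_ne hr]
      with s hs hs0
    rw [Matrix.eval_charpoly]
    refine Matrix.exists_mulVec_eq_zero_iff.1 ⟨fun r => eigenMat v u s r a,
      fun h' => hs0 (congrFun h' r), ?_⟩
    rw [Matrix.sub_mulVec, hs, sub_eq_zero]
    ext i
    simp [Matrix.mulVec_diagonal]
  filter_upwards [h.eigenvalue_injective, nhdsWithin_le_nhds h1] with s hs hs1
  exact charpoly_eq_prod hs h.card_blockIdx hs1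

lemma sum_pairOrder (a : BlockIdx d m) :
    ∑ b ∈ Finset.univ.erase a, pairOrder a b = lineOrder a := by
  rcases a with ⟨i, j⟩ | k
  · have h1 : ∑ b, pairOrder (Sum.inl (i, j) : BlockIdx d m) b = 2 := by
      rw [Fintype.sum_sum_type, Fintype.sum_prod_type]
      simp [pairOrder]
    rw [← Finset.add_sum_erase _ _ (Finset.mem_univ (Sum.inl (i, j) : BlockIdx d m))] at h1
    have h2 : pairOrder (Sum.inl (i, j) : BlockIdx d m) (Sum.inl (i, j)) = 1 := by
      simp [pairOrder]
    rw [h2] at h1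
    exact Nat.add_left_cancel h1
  · exact Finset.sum_eq_zero fun b _ => rfl

lemma eval_derivative (h : IsSpectralGerm Φ L mu v u) (a : BlockIdx d m) :
    ∃ q : ℂ → ℂ, AnalyticAt ℂ q 0 ∧ q 0 ≠ 0 ∧ ∀ s,
      ∏ b ∈ Finset.univ.erase a, (eigenvalue L mu a s - eigenvalue L mu b s) =
        s ^ lineOrder a * q s := by
  choose! q hq hq0 hqe using fun b (hb : a ≠ b) => h.eigenvalue_sub hb
  refine ⟨fun s => ∏ b ∈ Finset.univ.erase a, q b s, Finset.analyticAt_fun_prod _ fun b hb =>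
    hq b (Finset.ne_of_mem_erase hb).symm, Finset.prod_ne_zero_iff.2 fun b hb =>
    hq0 b (Finset.ne_of_mem_erase hb).symm, fun s => ?_⟩
  rw [← sum_pairOrder, ← Finset.prod_pow_eq_pow_sum, ← Finset.prod_mul_distrib]
  exact Finset.prod_congr rfl fun b hb => hqe b (Finset.ne_of_mem_erase hb).symm s

/-- The number of pairs is the order of the discriminant. -/
lemma eq_of_order (h : IsSpectralGerm Φ L mu v u) {ℓ : ℕ} (hℓ : 0 < ℓ)
    (hord : analyticOrderAt (fun w => (Φ w).discr) 0 = (ℓ : ℕ∞)) : d = ℓ := by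
  have han : AnalyticAt ℂ (fun w => (Φ w).discr) 0 := by
    by_contra hn
    rw [analyticOrderAt_of_not_analyticAt hn] at hord
    exact hℓ.ne (by exact_mod_cast hord)
  obtain ⟨g, hg, hg0, hge⟩ := (han.analyticOrderAt_eq_natCast).1 hord
  choose q hq hq0 hqe using h.eval_derivative
  -- The discriminant of the empty matrix is one and has no zero, so this case is excluded.
  by_cases hn : IsEmpty (BlockIdx d m)
  · exfalso
    have hn0 : n = 0 := by
      have := h.card_blockIdx
      rw [Fintype.card_eq_zero, Fintype.card_fin] at this
      exact this.symm
    subst hn0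
    have h1 := hge.self_of_nhds
    have h2 : (Φ 0).discr = 1 := by
      have h3 : (Φ 0).charpoly = Polynomial.C 1 := by simp [Matrix.charpoly]
      rw [Matrix.discr, h3, Polynomial.discr_C]
    simp only [h2, sub_self, zero_pow hℓ.ne', zero_smul] at h1
    exact one_ne_zero h1
  rw [not_isEmpty_iff] at hn
  -- The order of the discriminant in s is computed twice: each of the 2d paired sheets contributes
  -- one, and w^ℓ is s^{2ℓ}. The other factors are nonzero at 0, so d = ℓ.
  have h1 : ∀ᶠ s in 𝓝[≠] (0 : ℂ), ‖s‖ ^ (2 * d) * ‖∏ a, q a s‖ = ‖s‖ ^ (2 * ℓ) * ‖g (s ^ 2)‖ := by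
    filter_upwards [h.charpoly_eq, tendsto_sq_nhdsNE.eventually (nhdsWithin_le_nhds hge)]
      with s hs hs2
    obtain ⟨e, he⟩ := discr_prod_X_sub_C fun a => eigenvalue L mu a s
    rw [Matrix.discr, hs, he, Finset.prod_congr rfl fun a _ => hqe a s, Finset.prod_mul_distrib,
      Finset.prod_pow_eq_pow_sum, sub_zero, smul_eq_mul] at hs2
    have h3 : ∑ a : BlockIdx d m, lineOrder a = 2 * d := by
      rw [Fintype.sum_sum_type, Fintype.sum_prod_type]
      simp [lineOrder]
    rw [h3] at hs2
    have := congrArg norm hs2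
    simpa [norm_mul, norm_pow, pow_mul] using this
  have hA : ContinuousAt (fun s => ‖∏ a, q a s‖) 0 :=
    (Finset.analyticAt_fun_prod _ fun a _ => hq a).continuousAt.norm
  have hB : ContinuousAt (fun s : ℂ => ‖g (s ^ 2)‖) 0 :=
    (AnalyticAt.comp_sq_zero hg).continuousAt.norm
  have hA0 : ‖∏ a, q a 0‖ ≠ 0 := norm_ne_zero_iff.2 (Finset.prod_ne_zero_iff.2 fun a _ => hq0 a)
  have hB0 : ‖g (0 ^ 2)‖ ≠ 0 := by simpa using hg0
  have hlim : ∀ k : ℕ, 0 < k → Tendsto (fun s : ℂ => ‖s‖ ^ k) (𝓝[≠] 0) (𝓝 0) := fun k hk => by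
    have : ContinuousAt (fun s : ℂ => ‖s‖ ^ k) 0 := by fun_prop
    simpa [ContinuousAt, hk.ne'] using this.tendsto.mono_left nhdsWithin_le_nhds
  rcases lt_trichotomy d ℓ with hlt | heq | hgt
  · exfalso
    have h4 : ∀ᶠ s in 𝓝[≠] (0 : ℂ), ‖∏ a, q a s‖ = ‖s‖ ^ (2 * (ℓ - d)) * ‖g (s ^ 2)‖ := by
      filter_upwards [h1, self_mem_nhdsWithin] with s hs hs0
      have hp : 0 < ‖s‖ ^ (2 * d) := pow_pos (norm_pos_iff.2 hs0) _
      have h5 : 2 * ℓ = 2 * d + 2 * (ℓ - d) := by omega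
      rw [h5, pow_add, mul_assoc] at hs
      exact mul_left_cancel₀ hp.ne' hs
    have h6 := (hlim (2 * (ℓ - d)) (by omega)).mul (hB.tendsto.mono_left nhdsWithin_le_nhds)
    rw [zero_mul] at h6
    exact hA0 (tendsto_nhds_unique (hA.tendsto.mono_left nhdsWithin_le_nhds)
      (h6.congr' (h4.mono fun s hs => hs.symm)))
  · exact heq
  · exfalso
    have h4 : ∀ᶠ s in 𝓝[≠] (0 : ℂ), ‖g (s ^ 2)‖ = ‖s‖ ^ (2 * (d - ℓ)) * ‖∏ a, q a s‖ := by
      filter_upwards [h1, self_mem_nhdsWithin] with s hs hs0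
      have hp : 0 < ‖s‖ ^ (2 * ℓ) := pow_pos (norm_pos_iff.2 hs0) _
      have h5 : 2 * d = 2 * ℓ + 2 * (d - ℓ) := by omega
      rw [h5, pow_add, mul_assoc] at hs
      exact mul_left_cancel₀ hp.ne' hs.symm
    have h6 := (hlim (2 * (d - ℓ)) (by omega)).mul (hA.tendsto.mono_left nhdsWithin_le_nhds)
    rw [zero_mul] at h6
    exact hB0 (tendsto_nhds_unique (hB.tendsto.mono_left nhdsWithin_le_nhds)
      (h6.congr' (h4.mono fun s hs => hs.symm)))

end IsSpectralGerm

end Germ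

/-! ### The limiting metric on the eigenlines -/

lemma eventually_nhds_of_nhdsNE {P : ℂ → Prop} (h : ∀ᶠ x in 𝓝[≠] (0 : ℂ), P x) :
    ∀ᶠ s in 𝓝[≠] (0 : ℂ), ∀ᶠ x in 𝓝 s, P x := by
  filter_upwards [eventually_eventually_nhdsWithin.2 h, self_mem_nhdsWithin] with s hs hs0
  rwa [isOpen_compl_singleton.nhdsWithin_eq hs0] at hs

lemma HasWirtinger.eq_conj_of_real {F : ℂ → ℝ} {a b w : ℂ}
    (h : HasWirtinger (fun x => (F x : ℂ)) a b w) : b = (starRingEnd ℂ) a := by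
  have h1 := h.conj
  simp only [Complex.conj_ofReal] at h1
  exact (h.unique h1).2

section Metric

variable {ι : Type*} [Fintype ι] [DecidableEq ι] {U : Set ℂ} {Φ H : ℂ → Matrix ι ι ℂ}

lemma IsLimitingMetric.contDiffAt (hH : IsLimitingMetric U Φ H) {w : ℂ}
    (hw : ∀ᶠ x in 𝓝 w, x ∈ U ∧ (Φ x).discr ≠ 0) (i j : ι) :
    ContDiffAt ℝ ∞ (fun x => H x i j) w :=
  (hH.smooth i j).contDiffAt hw

/-- The connection matrix of a flat metric is holomorphic. -/
lemma IsLimitingMetric.differentiableAt_connection (hH : IsLimitingMetric U Φ H) {w : ℂ}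
    (hw : ∀ᶠ x in 𝓝 w, x ∈ U ∧ (Φ x).discr ≠ 0) (i j : ι) :
    DifferentiableAt ℂ (fun x => ((H x)⁻¹ * dMat H x) i j) w := by
  have hw' := hw.self_of_nhds
  have hdd : ∀ i j, DifferentiableAt ℝ (fun x => dMat H x i j) w := fun i j => by
    have h1 : ContDiffAt ℝ 1 (fderiv ℝ fun y => H y i j) w :=
      (hH.contDiffAt hw i j).fderiv_right (by norm_cast)
    have h2 := h1.differentiableAt (by norm_num)
    exact ((h2.clm_apply (differentiableAt_const _)).sub
      ((h2.clm_apply (differentiableAt_const _)).const_mul Complex.I)).const_mul _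
  have hdet : ∀ B : ℂ → Matrix ι ι ℂ, (∀ i j, ContDiffAt ℝ 1 (fun x => B x i j) w) →
      DifferentiableAt ℝ (fun x => (B x).det) w := fun B hB => by
    simp only [Matrix.det_apply']
    exact (ContDiffAt.sum fun σ _ => contDiffAt_const.mul
      (contDiffAt_prod fun k _ => hB _ _)).differentiableAt one_ne_zero
  have hdH : ∀ i j, ContDiffAt ℝ 1 (fun x => H x i j) w := fun i j =>
    (hH.contDiffAt hw i j).of_le (by norm_cast)
  refine differentiableAt_complex_of_dwbar ?_ (congrFun (congrFun (hH.flat w hw'.1 hw'.2) i) j)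
  simp only [Matrix.mul_apply, Matrix.inv_def, Matrix.smul_apply, Matrix.adjugate_apply,
    Ring.inverse_eq_inv', smul_eq_mul]
  refine DifferentiableAt.fun_sum fun k _ => (((hdet H hdH).inv
    (hH.posDef w hw'.1 hw'.2).det_pos.ne').mul (hdet _ fun a b => ?_)).mul (hdd k j)
  by_cases ha : a = k
  · subst ha; simpa using contDiffAt_const
  · simpa [Matrix.updateRow_ne ha] using hdH a b

lemma conjTranspose_mul_mul_apply {κ : Type*} (A : Matrix ι ι ℂ) (G : Matrix ι κ ℂ) (a b : κ) :
    (Gᴴ * A * G) a b = star (fun r => G r a) ⬝ᵥ (A *ᵥ fun r => G r b) := by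
  rw [Matrix.mul_assoc]
  rfl

/-- The derivative of the Gram matrix of a holomorphic frame. -/
lemma hasWirtinger_gram {κ : Type*} {G : ℂ → Matrix ι κ ℂ} {G' : Matrix ι κ ℂ} {s : ℂ}
    (hG : ∀ r a, HasDerivAt (fun x => G x r a) (G' r a) s)
    (hH : ∀ i j, DifferentiableAt ℝ (fun x => H x i j) (s ^ 2)) (a : κ) :
    ∃ b, HasWirtinger (fun x => ((G x)ᴴ * H (x ^ 2) * G x) a a)
      (((G s)ᴴ * ((2 * s) • (dMat H (s ^ 2) * G s) + H (s ^ 2) * G')) a a) b s := by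
  have hsq : HasDerivAt (fun x : ℂ => x ^ 2) (2 * s) s := by simpa using hasDerivAt_pow 2 s
  have h1 := HasWirtinger.sum (s := Finset.univ) fun (r : ι) _ =>
    ((HasWirtinger.of_hasDerivAt (hG r a)).conj).mul (HasWirtinger.sum (s := Finset.univ)
      fun (k : ι) _ => ((HasWirtinger.of_differentiableAt (hH r k)).comp_hol hsq).mul
        (HasWirtinger.of_hasDerivAt (hG k a)))
  refine ⟨_, (h1.congr_of_eventuallyEq (Eventually.of_forall fun x => ?_)).of_eq ?_ rfl⟩
  · rw [conjTranspose_mul_mul_apply]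
    rfl
  · simp only [Matrix.mul_apply, Matrix.add_apply, Matrix.smul_apply, Matrix.conjTranspose_apply,
      smul_eq_mul, map_zero, zero_mul, zero_add, Finset.mul_sum, dMat, Matrix.of_apply,
      ← Finset.sum_add_distrib, Complex.star_def]
    refine Finset.sum_congr rfl fun r _ => Finset.sum_congr rfl fun k _ => ?_
    ring

end Metric

section Germ

variable {n d m : ℕ} {U : Set ℂ} {Φ H : ℂ → Matrix (Fin n) (Fin n) ℂ} {L : Fin d → ℂ → ℂ}
  {mu : Fin m → ℂ → ℂ} {v : Fin d → ℂ → Fin n → ℂ} {u : Fin m → ℂ → Fin n → ℂ}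

namespace IsSpectralGerm

lemma mul_eigenMat (h : IsSpectralGerm Φ L mu v u) :
    ∀ᶠ s in 𝓝 0, Φ (s ^ 2) * eigenMat v u s =
      eigenMat v u s * Matrix.diagonal fun a => eigenvalue L mu a s := by
  filter_upwards [eventually_all.2 h.mulVec_eigenMat] with s hs
  ext r a
  have := congrFun (hs a) r
  rw [Matrix.mul_diagonal, mul_comm]
  exact this

lemma eigenMat_ne_zero (h : IsSpectralGerm Φ L mu v u) :
    ∀ᶠ s in 𝓝 0, ∀ a, (fun r => eigenMat v u s r a) ≠ 0 := by
  rw [eventually_all]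
  intro a
  obtain ⟨r, hr⟩ := h.eigenMat_col_ne a
  filter_upwards [(h.eigenMat_an r a).continuousAt.eventually_ne hr] with s hs h0
  exact hs (congrFun h0 r)

lemma gram_off_diagonal (h : IsSpectralGerm Φ L mu v u) (hH : IsLimitingMetric U Φ H)
    (hd : ∀ᶠ w in 𝓝[≠] (0 : ℂ), w ∈ U ∧ (Φ w).discr ≠ 0) :
    ∀ᶠ s in 𝓝[≠] (0 : ℂ), ∀ a b, a ≠ b →
      ((eigenMat v u s)ᴴ * H (s ^ 2) * eigenMat v u s) a b = 0 := by
  filter_upwards [tendsto_sq_nhdsNE.eventually hd, h.eigenvalue_injective,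
    nhdsWithin_le_nhds (eventually_all.2 h.mulVec_eigenMat)] with s hs hinj he a b hab
  rw [conjTranspose_mul_mul_apply]
  exact dotProduct_mulVec_eq_zero_of_normal (hH.posDef _ hs.1 hs.2) (hH.normal _ hs.1 hs.2)
    (fun h' => hab (hinj h')) (he a) (he b)

lemma gram_diagonal_pos (h : IsSpectralGerm Φ L mu v u) (hH : IsLimitingMetric U Φ H)
    (hd : ∀ᶠ w in 𝓝[≠] (0 : ℂ), w ∈ U ∧ (Φ w).discr ≠ 0) :
    ∀ᶠ s in 𝓝[≠] (0 : ℂ), ∀ a,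
      0 < ((eigenMat v u s)ᴴ * H (s ^ 2) * eigenMat v u s) a a := by
  filter_upwards [tendsto_sq_nhdsNE.eventually hd, nhdsWithin_le_nhds h.eigenMat_ne_zero]
    with s hs h0 a
  rw [conjTranspose_mul_mul_apply]
  exact (hH.posDef _ hs.1 hs.2).dotProduct_mulVec_pos (h0 a)

lemma eigenMat_injective (h : IsSpectralGerm Φ L mu v u) :
    ∀ᶠ s in 𝓝[≠] (0 : ℂ), ∀ x, eigenMat v u s *ᵥ x = 0 → x = 0 := by
  filter_upwards [nhdsWithin_le_nhds h.mul_eigenMat, h.eigenvalue_injective,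
    nhdsWithin_le_nhds h.eigenMat_ne_zero] with s hs hinj h0 x hx
  refine eq_zero_of_mulVec_eq_zero hs (fun y lam hy hye hg => ?_) hx
  obtain ⟨a, ha⟩ := Function.ne_iff.1 hy
  have h1 : ∀ b, (eigenvalue L mu b s - lam) * y b = 0 := fun b => by
    have := congrFun hye b
    rw [Matrix.mulVec_diagonal, Pi.smul_apply, smul_eq_mul] at this
    linear_combination this
  have ha' : eigenvalue L mu a s = lam :=
    sub_eq_zero.1 ((mul_eq_zero.1 (h1 a)).resolve_right ha)
  have h2 : ∀ b, b ≠ a → y b = 0 := fun b hb =>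
    (mul_eq_zero.1 (h1 b)).resolve_left (sub_ne_zero.2 fun h' => hb (hinj (h'.trans ha'.symm)))
  refine h0 a (funext fun r => ?_)
  have h3 := congrFun hg r
  rw [Matrix.mulVec, dotProduct, Finset.sum_eq_single a (fun b _ hb => by rw [h2 b hb, mul_zero])
    (by simp)] at h3
  exact (mul_eq_zero.1 h3).resolve_right ha

/-- Growth of the metric on an eigenline. -/
lemma gram_bounds (h : IsSpectralGerm Φ L mu v u) (hH : IsLimitingMetric U Φ H) (h0 : (0 : ℂ) ∈ U)
    (a : BlockIdx d m) : ∃ K : ℝ, ∀ᶠ s in 𝓝[≠] (0 : ℂ),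
      (((eigenMat v u s)ᴴ * H (s ^ 2) * eigenMat v u s) a a).re ≤ K * ‖s‖ ^ lineOrder a ∧
      ‖s‖ ^ lineOrder a ≤ K * (((eigenMat v u s)ᴴ * H (s ^ 2) * eigenMat v u s) a a).re := by
  obtain ⟨C, hC, hCe⟩ := hH.adapted 0 h0
  obtain ⟨q, hq, hq0, hqe⟩ := h.eval_derivative a
  -- The comparison function |∂_λ char| |v|² equals |s|^p θ(s), with θ continuous and positive at 0.
  -- Bounding θ between half and twice its value at 0 gives the constants.
  set θ : ℂ → ℝ := fun s => ‖q s‖ * ∑ r, ‖eigenMat v u s r a‖ ^ 2 with hθ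
  have hθc : ContinuousAt θ 0 := by
    refine hq.continuousAt.norm.mul (tendsto_finsetSum _ fun r _ => ?_)
    exact ((h.eigenMat_an r a).continuousAt.norm.pow 2).tendsto
  have hθ0 : 0 < θ 0 := by
    obtain ⟨r, hr⟩ := h.eigenMat_col_ne a
    refine mul_pos (norm_pos_iff.2 hq0) (Finset.sum_pos' (fun _ _ => by positivity)
      ⟨r, Finset.mem_univ r, ?_⟩)
    have := norm_pos_iff.2 hr
    positivity
  refine ⟨max (C * (2 * θ 0)) (C * (2 / θ 0)), ?_⟩
  filter_upwards [tendsto_sq_nhdsNE.eventually hCe, nhdsWithin_le_nhds (h.mulVec_eigenMat a),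
    h.charpoly_eq, nhdsWithin_le_nhds (hθc.eventually (lt_mem_nhds (half_lt_self hθ0))),
    nhdsWithin_le_nhds (hθc.eventually (gt_mem_nhds (by linarith : θ 0 < 2 * θ 0)))]
    with s hs he hchar hlo hhi
  obtain ⟨h1, h2⟩ := hs _ _ he
  rw [hchar, eval_derivative_prod_X_sub_C (fun a => eigenvalue L mu a s) a, hqe, norm_mul, norm_pow, ← conjTranspose_mul_mul_apply]
    at h1 h2
  set F := (((eigenMat v u s)ᴴ * H (s ^ 2) * eigenMat v u s) a a).re
  have hp : 0 ≤ ‖s‖ ^ lineOrder a := by positivity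
  have h1' : F ≤ C * (‖s‖ ^ lineOrder a * θ s) := by
    refine h1.trans (le_of_eq ?_)
    simp only [hθ]; ring
  have h2' : ‖s‖ ^ lineOrder a * θ s ≤ C * F := by
    refine (le_of_eq ?_).trans h2
    simp only [hθ]; ring
  have hF : 0 ≤ F := by
    have : 0 ≤ C * F := le_trans (mul_nonneg hp (by linarith)) h2'
    exact nonneg_of_mul_nonneg_right this hC
  constructor
  · calc F ≤ C * (‖s‖ ^ lineOrder a * θ s) := h1'
      _ ≤ C * (‖s‖ ^ lineOrder a * (2 * θ 0)) := by gcongr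
      _ = C * (2 * θ 0) * ‖s‖ ^ lineOrder a := by ring
      _ ≤ _ := by gcongr; exact le_max_left _ _
  · calc ‖s‖ ^ lineOrder a = 2 / θ 0 * (‖s‖ ^ lineOrder a * (θ 0 / 2)) := by field_simp
      _ ≤ 2 / θ 0 * (‖s‖ ^ lineOrder a * θ s) := by gcongr
      _ ≤ 2 / θ 0 * (C * F) := by gcongr
      _ = C * (2 / θ 0) * F := by ring
      _ ≤ _ := by gcongr; exact le_max_right _ _

/-- On an eigenline, the limiting metric is `|s|^p |e^f|²`. -/
lemma exists_gram_eq (h : IsSpectralGerm Φ L mu v u) (hH : IsLimitingMetric U Φ H)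
    (h0 : (0 : ℂ) ∈ U) (hd : ∀ᶠ w in 𝓝[≠] (0 : ℂ), w ∈ U ∧ (Φ w).discr ≠ 0)
    (a : BlockIdx d m) : ∃ f : ℂ → ℂ, AnalyticAt ℂ f 0 ∧ ∀ᶠ s in 𝓝[≠] (0 : ℂ),
      ((eigenMat v u s)ᴴ * H (s ^ 2) * eigenMat v u s) a a =
        ((‖s‖ ^ lineOrder a * ‖Complex.exp (f s)‖ ^ 2 : ℝ) : ℂ) := by
  set G := eigenMat v u with hG
  set F : ℂ → ℝ := fun s => (((G s)ᴴ * H (s ^ 2) * G s) a a).re with hF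
  have hpos := h.gram_diagonal_pos hH hd
  have hFr : ∀ᶠ s in 𝓝[≠] (0 : ℂ), ((G s)ᴴ * H (s ^ 2) * G s) a a = (F s : ℂ) := by
    filter_upwards [hpos] with s hs
    exact (Complex.eq_re_of_ofReal_le (hs a).le :)
  have hGan : ∀ᶠ s in 𝓝 (0 : ℂ), ∀ r b, AnalyticAt ℂ (fun x => G x r b) s := by
    simp only [eventually_all]
    exact fun r b => (h.eigenMat_an r b).eventually_analyticAt
  obtain ⟨Ginv, hGinv⟩ := exists_holMat_inv (g := G)
    (S := {s | (∀ r b, AnalyticAt ℂ (fun x => G x r b) s) ∧ ∀ x, G s *ᵥ x = 0 → x = 0})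
    h.card_blockIdx.symm (fun s hs r b => (hs.1 r b).differentiableAt) (fun s hs => hs.2)
  set A : ℂ → Matrix (Fin n) (Fin n) ℂ := fun w => (H w)⁻¹ * dMat H w with hA
  set G' : ℂ → Matrix (Fin n) (BlockIdx d m) ℂ := fun s => Matrix.of fun r b =>
    deriv (fun x => G x r b) s with hG'
  -- The Gram matrix satisfies ∂(G^* H G) = (G^* H G) G⁻¹(2s A G + G'), where A = H⁻¹∂H is
  -- holomorphic by flatness. As the Gram matrix is diagonal, its diagonal entry satisfies ∂F = cF
  -- with c holomorphic.
  set c : ℂ → ℂ := fun s => (Ginv s * ((2 * s) • (A (s ^ 2) * G s) + G' s)) a a with hc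
  have hd2 := tendsto_sq_nhdsNE.eventually (eventually_nhds_of_nhdsNE hd)
  obtain ⟨K, hK⟩ := h.gram_bounds hH h0 a
  have hcd : ∀ᶠ s in 𝓝[≠] (0 : ℂ), DifferentiableAt ℂ c s := by
    filter_upwards [nhdsWithin_le_nhds hGan, h.eigenMat_injective, hd2] with s hs hinj hds
    have hsq : DifferentiableAt ℂ (fun x : ℂ => x ^ 2) s := by fun_prop
    simp only [hc, Matrix.mul_apply (M := Ginv _), Matrix.add_apply, Matrix.smul_apply,
      Matrix.mul_apply (M := A _), smul_eq_mul]
    refine DifferentiableAt.fun_sum fun k _ => ((hGinv s ⟨hs, hinj⟩).2.2 a k).mul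
      (DifferentiableAt.add (DifferentiableAt.mul (by fun_prop) (DifferentiableAt.fun_sum
        fun l _ => DifferentiableAt.mul ?_ (hs l a).differentiableAt))
        (hs k a).deriv.differentiableAt)
    exact ((hH.differentiableAt_connection hds k l).comp s hsq :)
  have hFp : ∀ᶠ s in 𝓝[≠] (0 : ℂ), 0 < F s := by
    filter_upwards [hpos] with s hs
    exact (Complex.pos_iff.1 (hs a)).1
  have hFW : ∀ᶠ s in 𝓝[≠] (0 : ℂ), HasWirtinger (fun x => (F x : ℂ)) (c s * F s)
      ((starRingEnd ℂ) (c s * F s)) s := by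
    filter_upwards [nhdsWithin_le_nhds hGan, h.eigenMat_injective, hd2,
      eventually_nhds_of_nhdsNE hFr, h.gram_off_diagonal hH hd] with s hs hinj hds hFs hoff
    obtain ⟨b, hb⟩ := hasWirtinger_gram (H := H) (G := G) (G' := G' s) (s := s)
      (fun r a => (hs r a).differentiableAt.hasDerivAt)
      (fun i j => (hH.contDiffAt hds i j).differentiableAt (by norm_num)) a
    have hdet : IsUnit (H (s ^ 2)).det :=
      (hH.posDef _ hds.self_of_nhds.1 hds.self_of_nhds.2).det_pos.ne'.isUnit
    have h1 : (G s)ᴴ * ((2 * s) • (dMat H (s ^ 2) * G s) + H (s ^ 2) * G' s) =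
        ((G s)ᴴ * H (s ^ 2) * G s) * (Ginv s * ((2 * s) • (A (s ^ 2) * G s) + G' s)) := by
      have h2 : dMat H (s ^ 2) = H (s ^ 2) * A (s ^ 2) := by
        rw [hA]
        simp only
        rw [← Matrix.mul_assoc, Matrix.mul_nonsing_inv _ hdet, Matrix.one_mul]
      have h3 : G s * (Ginv s * ((2 * s) • (A (s ^ 2) * G s) + G' s)) =
          (2 * s) • (A (s ^ 2) * G s) + G' s := by
        rw [← Matrix.mul_assoc, (hGinv s ⟨hs, hinj⟩).1, Matrix.one_mul]
      rw [Matrix.mul_assoc _ (G s), h3, h2]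
      simp only [Matrix.mul_add, Matrix.mul_smul, Matrix.mul_assoc]
    have h4 : ((G s)ᴴ * ((2 * s) • (dMat H (s ^ 2) * G s) + H (s ^ 2) * G' s)) a a =
        c s * F s := by
      rw [h1, Matrix.mul_apply, Finset.sum_eq_single a
        (fun k _ hk => by rw [hoff a k hk.symm, zero_mul]) (by simp), hFs.self_of_nhds, mul_comm]
    have h5 : HasWirtinger (fun x => (F x : ℂ)) (c s * F s) b s := by
      rw [h4] at hb
      exact hb.congr_of_eventuallyEq (hFs.mono fun x hx => hx.symm)
    exact h5.of_eq rfl h5.eq_conj_of_real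
  obtain ⟨f, hf, hfe⟩ := exists_eq_norm_pow_mul_norm_exp_sq hcd hFp hFW
    (hK.mono fun s hs => hs.1) (hK.mono fun s hs => hs.2)
  refine ⟨f, hf, ?_⟩
  filter_upwards [hFr, hfe] with s hs hs'
  rw [hs, hs']

end IsSpectralGerm

end Germ

/-! ### The adapted frame -/

/-- With z = w k² and K = k³ the expression k z' equals K + (2/3) w K'. The equation for k thus
becomes w K' + (3/2) K = (3/2) κ, and K(0) = κ(0) ≠ 0 allows a cube root. Then √z z' = s κ with √z =
s k. -/
lemma exists_coordinate {κ : ℂ → ℂ} (hκ : AnalyticAt ℂ κ 0) (h0 : κ 0 ≠ 0) :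
    ∃ k : ℂ → ℂ, AnalyticAt ℂ k 0 ∧ k 0 ≠ 0 ∧
      ∀ᶠ w in 𝓝 0, k w * deriv (fun x => x * k x ^ 2) w = κ w := by
  obtain ⟨K, hK, hKe⟩ := AnalyticAt.exists_mul_deriv_add_eq
    (f := fun w => 3 / 2 * κ w) (analyticAt_const.mul hκ)
  have hK0 : K 0 = κ 0 := by
    have := hKe.self_of_nhds
    rw [zero_mul, zero_add] at this
    exact mul_left_cancel₀ (by norm_num) this
  obtain ⟨k, hk, hk0, hke⟩ := AnalyticAt.exists_pow_eq hK (by rwa [hK0]) (p := 3) (by norm_num)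
  refine ⟨k, hk, hk0, ?_⟩
  have hder : (fun w => k w ^ 3) =ᶠ[𝓝 0] K := hke
  filter_upwards [hKe, hke, hder.deriv, hk.eventually_analyticAt] with w h1 h2 h3 h4
  have hd := h4.differentiableAt.hasDerivAt
  have h5 : deriv (fun x => x * k x ^ 2) w = k w ^ 2 + w * (2 * k w * deriv k w) := by
    refine (((hasDerivAt_id w).mul (hd.pow 2)).congr_deriv ?_).deriv
    simp
  have h6 : deriv (fun x => k x ^ 3) w = 3 * k w ^ 2 * deriv k w :=
    ((hd.pow 3).congr_deriv (by simp)).deriv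
  rw [h6] at h3
  rw [h5]
  linear_combination 2 / 3 * h1 + h2 + (2 / 3) * w * h3

lemma exists_injOn_ball {z : ℂ → ℂ} (hz : AnalyticAt ℂ z 0) (h0 : deriv z 0 ≠ 0) :
    ∃ r : ℝ, 0 < r ∧ Set.InjOn z (Metric.ball 0 r) := by
  have h1 := hz.hasStrictDerivAt.hasStrictFDerivAt_equiv h0
  obtain ⟨r, hr, h⟩ := Metric.eventually_nhds_iff_ball.1 h1.eventually_left_inverse
  exact ⟨r, hr, fun x hx y hy hxy => by rw [← h x hx, ← h y hy, hxy]⟩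

/-! ### From eigenvectors to the frame -/

section Transform

variable {n ℓ m : ℕ} {Φ H : Matrix (Fin n) (Fin n) ℂ} {G g : Matrix (Fin n) (BlockIdx ℓ m) ℂ}
  {s : ℂ} {k lh z' : Fin ℓ → ℂ} {mu : Fin m → ℂ}

lemma blockMat_one : blockMat (fun _ : Fin ℓ => 1) (fun _ : Fin m => (1 : ℂ)) = 1 := by
  have h : (fun _ : Fin ℓ => (1 : Matrix (Fin 2) (Fin 2) ℂ)) = 1 := rfl
  rw [blockMat, h, Matrix.blockDiagonal_one, Matrix.diagonal_one, Matrix.fromBlocks_one]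

lemma blockMat_conjTranspose (A : Fin ℓ → Matrix (Fin 2) (Fin 2) ℂ) (c : Fin m → ℂ) :
    (blockMat A c)ᴴ = blockMat (fun j => (A j)ᴴ) (fun k => (starRingEnd ℂ) (c k)) := by
  simp only [blockMat, Matrix.fromBlocks_conjTranspose, Matrix.blockDiagonal_conjTranspose,
    Matrix.conjTranspose_zero, Matrix.diagonal_conjTranspose]
  rfl

lemma eq_mul_blockMat_inv (hs : s ≠ 0) (hk : ∀ j, k j ≠ 0)
    (hG : G = g * blockMat (ℓ := ℓ) (m := m) (fun j => !![s * k j, -(s * k j); 1, 1]) (fun _ => 1)) :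
    g = G * blockMat (ℓ := ℓ) (m := m) (fun j => !![1 / (2 * (s * k j)), 1 / 2; -1 / (2 * (s * k j)), 1 / 2])
      (fun _ => 1) := by
  rw [hG, Matrix.mul_assoc, blockMat_mul]
  have h1 : (fun j => !![s * k j, -(s * k j); 1, 1] *
      !![1 / (2 * (s * k j)), 1 / 2; -1 / (2 * (s * k j)), 1 / 2]) =
      fun _ : Fin ℓ => (1 : Matrix (Fin 2) (Fin 2) ℂ) := by
    funext j
    have := hk j
    ext a b
    fin_cases a <;> fin_cases b <;> simp [Matrix.mul_apply, Fin.sum_univ_two] <;> field_simp <;>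
      norm_num
  rw [h1]
  simp only [mul_one, blockMat_one, Matrix.mul_one]

/-- Eigenvectors `e₂ ± √z e₁` give the normal form of the Higgs field. -/
lemma mul_eq_mul_blockMat (hs : s ≠ 0) (hk : ∀ j, k j ≠ 0)
    (hG : G = g * blockMat (ℓ := ℓ) (m := m) (fun j => !![s * k j, -(s * k j); 1, 1]) (fun _ => 1))
    (hΦ : Φ * G = G * blockMat (ℓ := ℓ) (m := m) (fun j => !![lh j + s * (k j * z' j), 0;
      0, lh j - s * (k j * z' j)]) mu) :
    Φ * g = g * blockMat (ℓ := ℓ) (m := m) (fun j => !![lh j, s ^ 2 * k j ^ 2 * z' j; z' j, lh j]) mu := by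
  rw [eq_mul_blockMat_inv hs hk hG, ← Matrix.mul_assoc, hΦ, Matrix.mul_assoc, Matrix.mul_assoc,
    blockMat_mul, blockMat_mul]
  congr 1
  simp only [mul_one, one_mul]
  congr 1
  funext j
  have := hk j
  ext a b
  fin_cases a <;> fin_cases b <;> simp [Matrix.mul_apply, Fin.sum_univ_two] <;> field_simp <;>
    ring

/-- Eigenvectors `e₂ ± √z e₁` give the normal form of the metric. -/
lemma conjTranspose_mul_mul_eq_blockMat (hs : s ≠ 0) (hk : ∀ j, k j ≠ 0)
    (hG : G = g * blockMat (ℓ := ℓ) (m := m) (fun j => !![s * k j, -(s * k j); 1, 1]) (fun _ => 1))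
    (hH : Gᴴ * H * G = blockMat (ℓ := ℓ) (m := m) (fun j => !![2 * (‖s‖ * ‖k j‖ : ℂ), 0; 0, 2 * (‖s‖ * ‖k j‖ : ℂ)])
      (fun _ => 1)) :
    gᴴ * H * g = blockMat (ℓ := ℓ) (m := m) (fun j =>
      !![((‖s ^ 2 * k j ^ 2‖ ^ (-(1 / 2) : ℝ) : ℝ) : ℂ), 0;
        0, ((‖s ^ 2 * k j ^ 2‖ ^ (1 / 2 : ℝ) : ℝ) : ℂ)]) (fun _ => 1) := by
  rw [eq_mul_blockMat_inv hs hk hG, Matrix.conjTranspose_mul, blockMat_conjTranspose]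
  have h1 : ∀ A B : Matrix (BlockIdx ℓ m) (BlockIdx ℓ m) ℂ, A * Gᴴ * H * (G * B) =
      A * (Gᴴ * H * G) * B := fun A B => by simp only [Matrix.mul_assoc]
  rw [h1, hH, blockMat_mul, blockMat_mul]
  simp only [map_one, mul_one]
  congr 1
  funext j
  have hkj := hk j
  have hp : 0 < ‖s‖ * ‖k j‖ := mul_pos (norm_pos_iff.2 hs) (norm_pos_iff.2 hkj)
  have h2 : ‖s ^ 2 * k j ^ 2‖ = (‖s‖ * ‖k j‖) ^ 2 := by
    rw [norm_mul, norm_pow, norm_pow]; ring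
  have h3 : ‖s ^ 2 * k j ^ 2‖ ^ (1 / 2 : ℝ) = ‖s‖ * ‖k j‖ := by
    rw [h2, ← Real.sqrt_eq_rpow, Real.sqrt_sq hp.le]
  have h4 : ‖s ^ 2 * k j ^ 2‖ ^ (-(1 / 2) : ℝ) = (‖s‖ * ‖k j‖)⁻¹ := by
    rw [Real.rpow_neg (norm_nonneg _), h3]
  rw [h3, h4]
  have hsn : (‖s‖ : ℂ) ≠ 0 := by simpa using hs
  have hkn : (‖k j‖ : ℂ) ≠ 0 := by simpa using hkj
  have hs1 : (starRingEnd ℂ) s ≠ 0 := by simpa using hs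
  have hk1 : (starRingEnd ℂ) (k j) ≠ 0 := by simpa using hkj
  have hc2 : (starRingEnd ℂ) 2 = 2 := map_ofNat _ 2
  have e1 := norm_mul_norm_eq s
  have e2 := norm_mul_norm_eq (k j)
  ext a b
  fin_cases a <;> fin_cases b
  · simp [Matrix.mul_apply, Fin.sum_univ_two, hc2]
    field_simp
    linear_combination (2 * ‖k j‖ * ‖k j‖ : ℂ) * e1 + 2 * s * (starRingEnd ℂ) s * e2
  · simp [Matrix.mul_apply, Fin.sum_univ_two, hc2]
    field_simp
    try ring1
  · simp [Matrix.mul_apply, Fin.sum_univ_two, hc2]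
    field_simp
    try ring1
  · simp [Matrix.mul_apply, Fin.sum_univ_two, hc2]
    ring

end Transform

section Construction

variable {n d m : ℕ} {U : Set ℂ} {Φ H : ℂ → Matrix (Fin n) (Fin n) ℂ} {L : Fin d → ℂ → ℂ}
  {mu : Fin m → ℂ → ℂ} {v : Fin d → ℂ → Fin n → ℂ} {u : Fin m → ℂ → Fin n → ℂ}

/-- The Gram matrix of the eigenvectors. -/
def gram (H : ℂ → Matrix (Fin n) (Fin n) ℂ) (v : Fin d → ℂ → Fin n → ℂ)
    (u : Fin m → ℂ → Fin n → ℂ) (s : ℂ) : Matrix (BlockIdx d m) (BlockIdx d m) ℂ :=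
  (eigenMat v u s)ᴴ * H (s ^ 2) * eigenMat v u s

lemma gram_inl_one (j : Fin d) (s : ℂ) :
    gram H v u s (Sum.inl (1, j)) (Sum.inl (1, j)) =
      gram H v u (-s) (Sum.inl (0, j)) (Sum.inl (0, j)) := by
  simp only [gram, conjTranspose_mul_mul_apply, neg_sq]
  rfl

lemma gram_inr_neg (k : Fin m) (s : ℂ) :
    gram H v u (-s) (Sum.inr k) (Sum.inr k) = gram H v u s (Sum.inr k) (Sum.inr k) := by
  simp only [gram, conjTranspose_mul_mul_apply, neg_sq, eigenMat, Matrix.of_apply]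

/-- The normalized frame of a block. -/
lemma IsSpectralGerm.exists_block (h : IsSpectralGerm Φ L mu v u) (j : Fin d) {f : ℂ → ℂ}
    (hf : AnalyticAt ℂ f 0) : ∃ (k lh c : ℂ → ℂ) (e₁ e₂ : ℂ → Fin n → ℂ),
      AnalyticAt ℂ k 0 ∧ k 0 ≠ 0 ∧ AnalyticAt ℂ lh 0 ∧ deriv (fun x => x * k x ^ 2) 0 ≠ 0 ∧
      (∀ r, AnalyticAt ℂ (fun w => e₁ w r) 0) ∧ (∀ r, AnalyticAt ℂ (fun w => e₂ w r) 0) ∧ c 0 ≠ 0 ∧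
      (∀ᶠ s in 𝓝 0, L j s = lh (s ^ 2) + s * (k (s ^ 2) * deriv (fun x => x * k x ^ 2) (s ^ 2))) ∧
      (∀ᶠ s in 𝓝 0, ∀ r, v j s r * c s = s * k (s ^ 2) * e₁ (s ^ 2) r + e₂ (s ^ 2) r) ∧
      ∀ᶠ s in 𝓝 0, ‖c s‖ ^ 2 * ‖Complex.exp (f s)‖ ^ 2 = 2 * ‖k (s ^ 2)‖ := by
  obtain ⟨lh, κ, hlh, hκ, hLe⟩ := AnalyticAt.exists_even_odd (h.L_an j)
  have hκ0 : κ 0 ≠ 0 := by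
    have h1 : HasDerivAt (fun s => lh (s ^ 2) + s * κ (s ^ 2)) (κ 0) 0 := by
      have hl : HasDerivAt (fun s : ℂ => lh (s ^ 2)) 0 0 := by
        have h2 : HasDerivAt lh (deriv lh 0) ((0 : ℂ) ^ 2) := by
          simpa using hlh.differentiableAt.hasDerivAt
        refine (h2.comp (0 : ℂ) (hasDerivAt_pow 2 (0 : ℂ))).congr_deriv ?_
        simp
      have h3 := (hasDerivAt_id (0 : ℂ)).mul
        (AnalyticAt.comp_sq_zero hκ).differentiableAt.hasDerivAt
      refine (hl.add h3).congr_deriv ?_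
      simp
    have h4 := h.L_deriv j
    have h5 : L j =ᶠ[𝓝 0] fun s => lh (s ^ 2) + s * κ (s ^ 2) := hLe
    rwa [h5.deriv_eq, h1.deriv] at h4
  obtain ⟨k, hk, hk0, hke⟩ := exists_coordinate hκ hκ0
  obtain ⟨k₂, hk₂, hk₂0, hk₂e⟩ := AnalyticAt.exists_pow_eq hk hk0 (p := 2) two_ne_zero
  -- The factor cancels e^f and contributes 2|k|, so when v has squared norm |s| |e^f|², the vector
  -- c v has squared norm 2|s||k| = 2|z|^{1/2}, that of e₂ + √z e₁ in the model metric. The even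
  -- part of c v is e₂ and its odd part is s k e₁.
  set c : ℂ → ℂ := fun s => (Real.sqrt 2 : ℂ) * Complex.exp (-f s) * k₂ (s ^ 2) with hc
  have hcan : AnalyticAt ℂ c 0 :=
    (analyticAt_const.mul hf.neg.cexp).mul (AnalyticAt.comp_sq_zero hk₂)
  choose v₀ v₁ hv₀ hv₁ hve using fun r =>
    AnalyticAt.exists_even_odd ((h.v_an j r).mul hcan)
  refine ⟨k, lh, c, fun w r => v₁ r w / k w, fun w r => v₀ r w, hk, hk0, hlh, ?_,
    fun r => (hv₁ r).div hk hk0, hv₀, ?_, ?_, ?_, ?_⟩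
  · have := hke.self_of_nhds
    exact fun h' => hκ0 (by rw [← this, h', mul_zero])
  · simp only [hc]
    refine mul_ne_zero (mul_ne_zero ?_ (Complex.exp_ne_zero _)) (by simpa using hk₂0)
    exact_mod_cast (Real.sqrt_pos.2 two_pos).ne'
  · filter_upwards [hLe, tendsto_sq_nhds_zero.eventually hke] with s hs hs2
    rw [hs, hs2]
  · filter_upwards [eventually_all.2 hve,
      tendsto_sq_nhds_zero.eventually (hk.continuousAt.eventually_ne hk0)] with s hs hs2 r
    have := hs r
    simp only [Pi.mul_apply] at this
    rw [this]
    field_simp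
    ring
  · filter_upwards [tendsto_sq_nhds_zero.eventually hk₂e] with s hs
    have h2 : ‖k (s ^ 2)‖ = ‖k₂ (s ^ 2)‖ ^ 2 := by rw [← hs, norm_pow]
    have h3 : ‖Complex.exp (-f s)‖ * ‖Complex.exp (f s)‖ = 1 := by
      rw [← norm_mul, ← Complex.exp_add]; simp
    have h4 : ‖(Real.sqrt 2 : ℂ)‖ ^ 2 = 2 := by
      rw [Complex.norm_real, Real.norm_eq_abs, sq_abs, Real.sq_sqrt two_pos.le]
    rw [hc, norm_mul, norm_mul, h2]
    calc _ = ‖(Real.sqrt 2 : ℂ)‖ ^ 2 * (‖Complex.exp (-f s)‖ * ‖Complex.exp (f s)‖) ^ 2 *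
          ‖k₂ (s ^ 2)‖ ^ 2 := by ring
      _ = _ := by rw [h3, h4]; ring

/-- The normalization of a simple eigenvector. -/
lemma exists_simple_normalization {f : ℂ → ℂ} (hf : AnalyticAt ℂ f 0)
    (heven : ∀ᶠ s in 𝓝[≠] (0 : ℂ), ‖Complex.exp (f (-s))‖ ^ 2 = ‖Complex.exp (f s)‖ ^ 2) :
    ∃ c : ℂ → ℂ, AnalyticAt ℂ c 0 ∧ c 0 ≠ 0 ∧
      ∀ᶠ s in 𝓝[≠] (0 : ℂ), ‖c (s ^ 2)‖ ^ 2 * ‖Complex.exp (f s)‖ ^ 2 = 1 := by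
  obtain ⟨f₀, f₁, hf₀, hf₁, hfe⟩ := AnalyticAt.exists_even_odd hf
  refine ⟨fun w => Complex.exp (-f₀ w), hf₀.neg.cexp, Complex.exp_ne_zero _, ?_⟩
  filter_upwards [heven, nhdsWithin_le_nhds hfe,
    nhdsWithin_le_nhds (tendsto_neg_nhds_zero.eventually hfe)] with s h1 h2 h3
  rw [neg_sq] at h3
  rw [h2, h3, sq_eq_sq₀ (norm_nonneg _) (norm_nonneg _), Complex.norm_exp, Complex.norm_exp,
    Real.exp_eq_exp] at h1
  -- Since |e^f| is even in s, the odd part of f is purely imaginary. Hence |e^f| = |e^{f₀}|, and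
  -- the normalizing factor is a function of w alone.
  have h4 : (s * f₁ (s ^ 2)).re = 0 := by
    simp only [Complex.add_re, neg_mul, Complex.neg_re] at h1
    linarith
  rw [h2, ← mul_pow, ← norm_mul, ← Complex.exp_add, Complex.norm_exp]
  simp [Complex.add_re, h4]

/-- The columns of the frame. -/
def frameMat (e₁ e₂ : Fin d → ℂ → Fin n → ℂ) (b : Fin m → ℂ → Fin n → ℂ) (w : ℂ) :
    Matrix (Fin n) (BlockIdx d m) ℂ := Matrix.of fun r a =>
  match a with
  | Sum.inl (i, j) => if i = 0 then e₁ j w r else e₂ j w r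
  | Sum.inr k => b k w r

/-- At the branch point, the frame is linearly independent. -/
lemma frameMat_injective {A : Matrix (Fin n) (Fin n) ℂ} {e₁ e₂ : Fin d → ℂ → Fin n → ℂ}
    {b : Fin m → ℂ → Fin n → ℂ} {x₀ z' : Fin d → ℂ} {y₀ : Fin m → ℂ} {w : ℂ}
    (hinj : Function.Injective (Sum.elim x₀ y₀)) (hz : ∀ j, z' j ≠ 0)
    (he : ∀ j, e₂ j w ≠ 0) (hb : ∀ k, b k w ≠ 0)
    (hA : A * frameMat e₁ e₂ b w = frameMat e₁ e₂ b w *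
      blockMat (ℓ := d) (m := m) (fun j => !![x₀ j, 0; z' j, x₀ j]) y₀)
    {x : BlockIdx d m → ℂ} (hx : frameMat e₁ e₂ b w *ᵥ x = 0) : x = 0 := by
  refine eq_zero_of_mulVec_eq_zero hA (fun y lam hy hye hg => hy ?_) hx
  -- An eigenvector of the Jordan matrix has no component along the first vectors of the 2×2 blocks.
  -- As the eigenvalues are distinct, it is supported on a single index, so its image is a multiple
  -- of a nonzero column.
  have h0 : ∀ j, (x₀ j - lam) * y (Sum.inl (0, j)) = 0 := fun j => by
    have := congrFun hye (Sum.inl (0, j))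
    simp [Matrix.mulVec, dotProduct, Fintype.sum_sum_type, Fintype.sum_prod_type] at this
    rcases this with h | h <;> simp [h]
  have h1 : ∀ j, z' j * y (Sum.inl (0, j)) + (x₀ j - lam) * y (Sum.inl (1, j)) = 0 := fun j => by
    have := congrFun hye (Sum.inl (1, j))
    simp [Matrix.mulVec, dotProduct, Fintype.sum_sum_type, Fintype.sum_prod_type] at this
    linear_combination this
  have h2 : ∀ k, (y₀ k - lam) * y (Sum.inr k) = 0 := fun k => by
    have := congrFun hye (Sum.inr k)
    simp [Matrix.mulVec, dotProduct, Fintype.sum_sum_type, Fintype.sum_prod_type] at this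
    rcases this with h | h <;> simp [h]
  have h3 : ∀ j, y (Sum.inl (0, j)) = 0 := fun j => by
    rcases mul_eq_zero.1 (h0 j) with h | h
    · have := h1 j
      rw [h, zero_mul, add_zero] at this
      exact (mul_eq_zero.1 this).resolve_left (hz j)
    · exact h
  set Y : Fin d ⊕ Fin m → ℂ := Sum.elim (fun j => y (Sum.inl (1, j))) fun k => y (Sum.inr k)
    with hY
  set col : Fin d ⊕ Fin m → Fin n → ℂ := Sum.elim (fun j => e₂ j w) fun k => b k w with hcol
  have h4 : ∀ a, (Sum.elim x₀ y₀ a - lam) * Y a = 0 := by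
    rintro (j | k)
    · have := h1 j
      rw [h3, mul_zero, zero_add] at this
      exact this
    · exact h2 k
  have h5 : ∀ r, ∑ a, col a r * Y a = 0 := fun r => by
    have := congrFun hg r
    simp [Matrix.mulVec, dotProduct, Fintype.sum_sum_type, Fintype.sum_prod_type, h3,
      frameMat] at this
    rw [Fintype.sum_sum_type]
    exact this
  have h6 : ∀ a, Y a = 0 := by
    intro a
    by_contra ha
    have ha' : Sum.elim x₀ y₀ a = lam := sub_eq_zero.1 ((mul_eq_zero.1 (h4 a)).resolve_right ha)
    have hne : col a ≠ 0 := by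
      rcases a with j | k
      · exact he j
      · exact hb k
    refine hne (funext fun r => ?_)
    have := h5 r
    rw [Finset.sum_eq_single a (fun a' _ hne' => by
      rw [(mul_eq_zero.1 (h4 a')).resolve_left (sub_ne_zero.2 fun h' =>
        hne' (hinj (h'.trans ha'.symm))), mul_zero]) (by simp)] at this
    exact (mul_eq_zero.1 this).resolve_right ha
  funext a
  rcases a with ⟨i, j⟩ | k
  · fin_cases i
    · exact h3 j
    · exact h6 (Sum.inl j)
  · exact h6 (Sum.inr k)

lemma eventually_mulVec_injective {ι κ : Type*} [Fintype ι] [DecidableEq ι] [Fintype κ]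
    [DecidableEq κ] {g : ℂ → Matrix ι κ ℂ} (hcard : Fintype.card ι = Fintype.card κ)
    (hg : ∀ a b, ContinuousAt (fun x => g x a b) 0) (h0 : ∀ x, g 0 *ᵥ x = 0 → x = 0) :
    ∀ᶠ w in 𝓝 0, ∀ x, g w *ᵥ x = 0 → x = 0 := by
  set e := Fintype.equivOfCardEq hcard
  have hmul : ∀ w (x : κ → ℂ), (g w).submatrix id e *ᵥ (x ∘ e) = g w *ᵥ x := fun w x => by
    ext i
    exact Equiv.sum_comp e fun k => g w i k * x k
  have hdet : ((g 0).submatrix id e).det ≠ 0 := fun hd => by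
    obtain ⟨y, hy, hy0⟩ := Matrix.exists_mulVec_eq_zero_iff.2 hd
    have h1 := h0 (y ∘ e.symm) (by rw [← hmul, Function.comp_assoc]; simpa using hy0)
    refine hy (funext fun i => ?_)
    simpa using congrFun h1 (e i)
  have hc : ContinuousAt (fun w => ((g w).submatrix id e).det) 0 := by
    simp only [Matrix.det_apply', Matrix.submatrix_apply, id]
    exact tendsto_finsetSum _ fun σ _ => tendsto_const_nhds.mul
      (tendsto_finsetProd _ fun k _ => (hg _ _).tendsto)
  filter_upwards [hc.eventually_ne hdet] with w hw x hx
  by_contra hne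
  refine hw (Matrix.exists_mulVec_eq_zero_iff.1 ⟨x ∘ e, fun h' => hne ?_, by rw [hmul, hx]⟩)
  funext k
  simpa using congrFun h' (e.symm k)

end Construction

lemma diagonal_eq_blockMat {d m : ℕ} (D : BlockIdx d m → ℂ) : Matrix.diagonal D =
    blockMat (fun j => !![D (Sum.inl (0, j)), 0; 0, D (Sum.inl (1, j))])
      (fun k => D (Sum.inr k)) := by
  ext a b
  rcases a with ⟨i, j⟩ | k <;> rcases b with ⟨i', j'⟩ | k'
  · by_cases hj : j = j'
    · subst hj
      fin_cases i <;> fin_cases i' <;> simp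
    · simp [hj]
  · simp
  · simp
  · simp [Matrix.diagonal_apply]

lemma LocalModel.higgs_analyticAt {d m : ℕ} {M : LocalModel d m} {w : ℂ}
    (hz : ∀ j, AnalyticAt ℂ (M.z j) w) (hlh : ∀ j, AnalyticAt ℂ (M.lamHat j) w)
    (hl : ∀ k, AnalyticAt ℂ (M.lam k) w) (a b : BlockIdx d m) :
    AnalyticAt ℂ (fun x => M.higgs x a b) w := by
  rcases a with ⟨i, j⟩ | k <;> rcases b with ⟨i', j'⟩ | k'
  · by_cases hj : j = j'
    · subst hj
      fin_cases i <;> fin_cases i' <;> simp [LocalModel.higgs]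
      · exact hlh j
      · exact (hz j).mul (hz j).deriv
      · exact (hz j).deriv
      · exact hlh j
    · simpa [LocalModel.higgs, hj] using analyticAt_const
  · simpa [LocalModel.higgs] using analyticAt_const
  · simpa [LocalModel.higgs] using analyticAt_const
  · by_cases hk : k = k'
    · simpa [LocalModel.higgs, hk] using hl k'
    · simpa [LocalModel.higgs, hk] using analyticAt_const

/-- Existence of a frame in which the Higgs field and the limiting metric have the normal form. -/
theorem exists_isAdaptedFrame {n ℓ : ℕ} (hℓ : 0 < ℓ) {U : Set ℂ} (hU : IsOpen U)
    (h0 : (0 : ℂ) ∈ U) {Φ : ℂ → Matrix (Fin n) (Fin n) ℂ} (hΦ : IsSLHiggsField U Φ)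
    (hcross : SimpleEigenvalueCrossing U Φ)
    (hord : analyticOrderAt (fun w => (Φ w).discr) 0 = (ℓ : ℕ∞))
    {H : ℂ → Matrix (Fin n) (Fin n) ℂ} (hH : IsLimitingMetric U Φ H) :
    ∃ R : ℝ, 0 < R ∧ ∃ (M : LocalModel ℓ (n - 2 * ℓ))
      (g : ℂ → Matrix (Fin n) (BlockIdx ℓ (n - 2 * ℓ)) ℂ)
      (ginv : ℂ → Matrix (BlockIdx ℓ (n - 2 * ℓ)) (Fin n) ℂ),
      IsAdaptedFrame U Φ H R M g ginv := by
  obtain ⟨d, m, L, mu, v, u, h⟩ := exists_isSpectralGerm hU h0 hΦ.1 hcross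
  obtain rfl : d = ℓ := h.eq_of_order hℓ hord
  obtain rfl : m = n - 2 * d := by have := h.card; omega
  have hdisc : ∀ᶠ w in 𝓝[≠] (0 : ℂ), w ∈ U ∧ (Φ w).discr ≠ 0 := by
    have han : AnalyticAt ℂ (fun w => (Φ w).discr) 0 := by
      by_contra hn
      rw [analyticOrderAt_of_not_analyticAt hn] at hord
      exact hℓ.ne (by exact_mod_cast hord)
    obtain ⟨q, hq, hq0, hqe⟩ := (han.analyticOrderAt_eq_natCast).1 hord
    filter_upwards [nhdsWithin_le_nhds (hU.mem_nhds h0), nhdsWithin_le_nhds hqe,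
      nhdsWithin_le_nhds (hq.continuousAt.eventually_ne hq0), self_mem_nhdsWithin]
      with w h1 h2 h3 h4
    refine ⟨h1, ?_⟩
    rw [h2, sub_zero]
    exact smul_ne_zero (pow_ne_zero _ h4) h3
  choose f hf hfe using h.exists_gram_eq hH h0 hdisc
  choose k lh c e₁ e₂ hk hk0 hlh hz0 he₁ he₂ hc0 hL hv hc using
    fun j => h.exists_block j (hf (Sum.inl (0, j)))
  have heven : ∀ i, ∀ᶠ s in 𝓝[≠] (0 : ℂ), ‖Complex.exp (f (Sum.inr i) (-s))‖ ^ 2 =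
      ‖Complex.exp (f (Sum.inr i) s)‖ ^ 2 := by
    intro i
    filter_upwards [hfe (Sum.inr i), tendsto_neg_nhdsNE.eventually (hfe (Sum.inr i))] with s h1 h2
    have h3 := gram_inr_neg (H := H) (v := v) (u := u) i s
    rw [gram, gram, h1, h2] at h3
    simp only [lineOrder, pow_zero, one_mul] at h3
    exact_mod_cast h3
  choose c' hc' hc'0 hc'e using fun i => exists_simple_normalization (hf (Sum.inr i)) (heven i)
  set b : Fin (n - 2 * d) → ℂ → Fin n → ℂ := fun i w r => u i w r * c' i w with hb
  set g := frameMat e₁ e₂ b with hg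
  set M : LocalModel d (n - 2 * d) := ⟨fun j w => w * k j w ^ 2, lh, mu⟩ with hM
  have hzan : ∀ j, AnalyticAt ℂ (M.z j) 0 := fun j => analyticAt_id.mul ((hk j).pow 2)
  have hgan : ∀ r a, AnalyticAt ℂ (fun w => g w r a) 0 := by
    rintro r (⟨i, j⟩ | i)
    · fin_cases i
      · exact he₁ j r
      · exact he₂ j r
    · exact (h.u_an i r).mul (hc' i)
  set cc : ℂ → BlockIdx d (n - 2 * d) → ℂ := fun s a => match a with
    | Sum.inl (i, j) => if i = 0 then c j s else c j (-s)
    | Sum.inr i => c' i (s ^ 2) with hcc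
  -- The rescaled eigenvectors are e₂ ± √z e₁ with √z = s k. This expresses the two-valued
  -- eigenframe through a single-valued frame in w.
  have hGg : ∀ᶠ s in 𝓝 (0 : ℂ), eigenMat v u s * Matrix.diagonal (cc s) = g (s ^ 2) *
      blockMat (ℓ := d) (m := n - 2 * d)
        (fun j => !![s * k j (s ^ 2), -(s * k j (s ^ 2)); 1, 1]) (fun _ => 1) := by
    filter_upwards [eventually_all.2 hv,
      eventually_all.2 fun j => tendsto_neg_nhds_zero.eventually (hv j)] with s h1 h2
    ext r a
    rw [Matrix.mul_diagonal]
    rcases a with ⟨i, j⟩ | i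
    · fin_cases i
      · have := h1 j r
        simp [Matrix.mul_apply, Fintype.sum_sum_type, Fintype.sum_prod_type, eigenMat, hcc, hg,
          frameMat]
        linear_combination this
      · have := h2 j r
        rw [neg_sq] at this
        simp [Matrix.mul_apply, Fintype.sum_sum_type, Fintype.sum_prod_type, eigenMat, hcc, hg,
          frameMat]
        linear_combination this
    · simp [Matrix.mul_apply, Fintype.sum_sum_type, Fintype.sum_prod_type, eigenMat, hcc, hg,
        frameMat, hb]
  have hΦG : ∀ᶠ s in 𝓝 (0 : ℂ), Φ (s ^ 2) * (eigenMat v u s * Matrix.diagonal (cc s)) =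
      eigenMat v u s * Matrix.diagonal (cc s) * blockMat (ℓ := d) (m := n - 2 * d) (fun j =>
        !![lh j (s ^ 2) + s * (k j (s ^ 2) * deriv (M.z j) (s ^ 2)), 0;
          0, lh j (s ^ 2) - s * (k j (s ^ 2) * deriv (M.z j) (s ^ 2))]) (fun i => mu i (s ^ 2)) := by
    filter_upwards [h.mul_eigenMat, eventually_all.2 hL,
      eventually_all.2 fun j => tendsto_neg_nhds_zero.eventually (hL j)] with s h1 h2 h3
    have h4 : Matrix.diagonal (fun a => eigenvalue L mu a s) =
        blockMat (ℓ := d) (m := n - 2 * d) (fun j =>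
        !![lh j (s ^ 2) + s * (k j (s ^ 2) * deriv (M.z j) (s ^ 2)), 0;
          0, lh j (s ^ 2) - s * (k j (s ^ 2) * deriv (M.z j) (s ^ 2))])
          (fun i => mu i (s ^ 2)) := by
      rw [diagonal_eq_blockMat]
      congr 1
      funext j
      have e2 : eigenvalue L mu (Sum.inl (0, j)) s = _ := h2 j
      have e3 : eigenvalue L mu (Sum.inl (1, j)) s = _ := h3 j
      rw [e2, e3, neg_sq, neg_mul, ← sub_eq_add_neg]
    rw [← h4, ← Matrix.mul_assoc, h1, Matrix.mul_assoc, Matrix.mul_assoc,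
      Matrix.diagonal_mul_diagonal, Matrix.diagonal_mul_diagonal]
    simp only [mul_comm]
  have hGH : ∀ᶠ s in 𝓝[≠] (0 : ℂ), (eigenMat v u s * Matrix.diagonal (cc s))ᴴ * H (s ^ 2) *
      (eigenMat v u s * Matrix.diagonal (cc s)) = blockMat (ℓ := d) (m := n - 2 * d)
        (fun j => !![2 * (‖s‖ * ‖k j (s ^ 2)‖ : ℂ), 0; 0, 2 * (‖s‖ * ‖k j (s ^ 2)‖ : ℂ)])
        (fun _ => 1) := by
    filter_upwards [h.gram_off_diagonal hH hdisc, eventually_all.2 hfe,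
      eventually_all.2 fun a => tendsto_neg_nhdsNE.eventually (hfe a),
      nhdsWithin_le_nhds (eventually_all.2 hc),
      nhdsWithin_le_nhds (eventually_all.2 fun j => tendsto_neg_nhds_zero.eventually (hc j)),
      eventually_all.2 hc'e] with s hoff h1 h2 h3 h4 h5
    have h6 : (eigenMat v u s)ᴴ * H (s ^ 2) * eigenMat v u s =
        Matrix.diagonal fun a => gram H v u s a a := by
      ext x y
      by_cases hxy : x = y
      · subst hxy; simp [gram]
      · rw [hoff x y hxy, Matrix.diagonal_apply_ne _ hxy]
    have h7 : (eigenMat v u s * Matrix.diagonal (cc s))ᴴ * H (s ^ 2) *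
        (eigenMat v u s * Matrix.diagonal (cc s)) = Matrix.diagonal (star (cc s)) *
          ((eigenMat v u s)ᴴ * H (s ^ 2) * eigenMat v u s) * Matrix.diagonal (cc s) := by
      rw [Matrix.conjTranspose_mul, Matrix.diagonal_conjTranspose]
      simp only [Matrix.mul_assoc]
    have h8 : ∀ z : ℂ, (starRingEnd ℂ) z * z = ((‖z‖ ^ 2 : ℝ) : ℂ) := fun z => by
      rw [mul_comm, Complex.mul_conj, Complex.normSq_eq_norm_sq]
    rw [h7, h6, Matrix.diagonal_mul_diagonal, Matrix.diagonal_mul_diagonal, diagonal_eq_blockMat]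
    have key : ∀ (z : ℂ) (x : ℝ) (y : ℝ), ‖z‖ ^ 2 * x = y →
        (starRingEnd ℂ) z * (x : ℂ) * z = (y : ℂ) := fun z x y hxy => by
      rw [mul_right_comm, h8, ← Complex.ofReal_mul, hxy]
    congr 1
    · funext j
      have e1 : gram H v u s (Sum.inl (0, j)) (Sum.inl (0, j)) = _ := h1 (Sum.inl (0, j))
      have e2 : gram H v u s (Sum.inl (1, j)) (Sum.inl (1, j)) = _ :=
        (gram_inl_one j s).trans (h2 (Sum.inl (0, j)))
      have e3 := h3 j
      have e4 := h4 j
      rw [neg_sq] at e4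
      have e5 := key (c j s) _ (2 * (‖s‖ * ‖k j (s ^ 2)‖)) (show ‖c j s‖ ^ 2 *
        (‖s‖ ^ lineOrder (Sum.inl (0, j) : BlockIdx d (n - 2 * d)) *
          ‖Complex.exp (f (Sum.inl (0, j)) s)‖ ^ 2) = _ by
          simp only [lineOrder, pow_one]; linear_combination ‖s‖ * e3)
      have e6 := key (c j (-s)) _ (2 * (‖s‖ * ‖k j (s ^ 2)‖)) (show ‖c j (-s)‖ ^ 2 *
        (‖-s‖ ^ lineOrder (Sum.inl (0, j) : BlockIdx d (n - 2 * d)) *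
          ‖Complex.exp (f (Sum.inl (0, j)) (-s))‖ ^ 2) = _ by
          simp only [lineOrder, pow_one, norm_neg]; linear_combination ‖s‖ * e4)
      rw [← e1] at e5
      rw [← e2] at e6
      push_cast at e5 e6
      simp only [Pi.star_apply, Complex.star_def]
      rw [← e5]
      nth_rewrite 2 [e5]
      rw [← e6]
      rfl
    · funext i
      have e1 : gram H v u s (Sum.inr i) (Sum.inr i) = _ := h1 (Sum.inr i)
      have e5 := key (c' i (s ^ 2)) _ 1 (show ‖c' i (s ^ 2)‖ ^ 2 *
        (‖s‖ ^ lineOrder (Sum.inr i : BlockIdx d (n - 2 * d)) *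
          ‖Complex.exp (f (Sum.inr i) s)‖ ^ 2) = _ by
          simpa only [lineOrder, pow_zero, one_mul] using h5 i)
      rw [← e1, Complex.ofReal_one] at e5
      exact e5
  have hkne : ∀ᶠ s in 𝓝 (0 : ℂ), ∀ j, k j (s ^ 2) ≠ 0 := eventually_all.2 fun j =>
    tendsto_sq_nhds_zero.eventually ((hk j).continuousAt.eventually_ne (hk0 j))
  -- For s ≠ 0 the eigenvectors are independent and determine the normal form. At w = 0 they
  -- collide, so the identity there is recovered by continuity.
  have hhiggs : ∀ᶠ w in 𝓝[≠] (0 : ℂ), Φ w * g w = g w * M.higgs w := by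
    refine eventually_of_eventually_sq ?_
    filter_upwards [nhdsWithin_le_nhds hGg, nhdsWithin_le_nhds hΦG, nhdsWithin_le_nhds hkne,
      self_mem_nhdsWithin] with s h1 h2 h3 h4
    exact mul_eq_mul_blockMat h4 h3 h1 h2
  have hmetric : ∀ᶠ w in 𝓝[≠] (0 : ℂ), (g w)ᴴ * H w * g w = M.hInf w := by
    refine eventually_of_eventually_sq ?_
    filter_upwards [nhdsWithin_le_nhds hGg, hGH, nhdsWithin_le_nhds hkne,
      self_mem_nhdsWithin] with s h1 h2 h3 h4
    exact conjTranspose_mul_mul_eq_blockMat h4 h3 h1 h2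
  have hMan := M.higgs_analyticAt hzan hlh h.mu_an
  have hΦan : ∀ i j, AnalyticAt ℂ (fun x => Φ x i j) 0 := fun i j =>
    (hΦ.1 i j).analyticAt (hU.mem_nhds h0)
  have hhiggs0 : Φ 0 * g 0 = g 0 * M.higgs 0 := by
    ext r a
    have hc1 : ContinuousAt (fun w => (Φ w * g w) r a) 0 := by
      simp only [Matrix.mul_apply]
      exact (Finset.analyticAt_fun_sum _ fun i _ => (hΦan r i).mul (hgan i a)).continuousAt
    have hc2 : ContinuousAt (fun w => (g w * M.higgs w) r a) 0 := by
      simp only [Matrix.mul_apply]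
      exact (Finset.analyticAt_fun_sum _ fun i _ => (hgan r i).mul (hMan i a)).continuousAt
    refine tendsto_nhds_unique (l := 𝓝[≠] (0 : ℂ)) (hc1.tendsto.mono_left nhdsWithin_le_nhds)
      ((hc2.tendsto.mono_left nhdsWithin_le_nhds).congr' ?_)
    filter_upwards [hhiggs] with w hw
    rw [hw]
  -- Independence at the branch point cannot come from the colliding eigenvectors; it follows from
  -- the Jordan form of Φ(0) on the frame.
  have hinj0 : ∀ x, g 0 *ᵥ x = 0 → x = 0 := by
    intro x hx
    have hLlh : ∀ j, L j 0 = lh j 0 := fun j => by simpa using (hL j).self_of_nhds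
    refine frameMat_injective (A := Φ 0) (x₀ := fun j => lh j 0) (y₀ := fun i => mu i 0)
      (z' := fun j => deriv (M.z j) 0) ?_ hz0 (fun j h' => ?_) (fun i h' => ?_) ?_ hx
    · simpa only [← hLlh] using h.inj
    · obtain ⟨r, hr⟩ := Function.ne_iff.1 (h.v_ne j)
      have := (hv j).self_of_nhds r
      simp [h'] at this
      exact this.elim hr (hc0 j)
    · obtain ⟨r, hr⟩ := Function.ne_iff.1 (h.u_ne i)
      exact mul_ne_zero hr (hc'0 i) (congrFun h' r)
    · rw [← hg, hhiggs0]
      congr 1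
      simp only [LocalModel.higgs, hM, zero_mul]
  choose ρ hρ hρi using fun j => exists_injOn_ball (hzan j) (hz0 j)
  have hall : ∀ᶠ w in 𝓝 (0 : ℂ), w ∈ U ∧ (w ≠ 0 → (Φ w).discr ≠ 0) ∧
      (∀ j, AnalyticAt ℂ (M.z j) w) ∧ (∀ j, AnalyticAt ℂ (lh j) w) ∧
      (∀ i, AnalyticAt ℂ (mu i) w) ∧ (∀ r a, AnalyticAt ℂ (fun x => g x r a) w) ∧
      (∀ x, g w *ᵥ x = 0 → x = 0) ∧ (w ≠ 0 → Φ w * g w = g w * M.higgs w) ∧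
      (w ≠ 0 → (g w)ᴴ * H w * g w = M.hInf w) ∧ ∀ j, w ∈ Metric.ball 0 (ρ j) := by
    filter_upwards [hU.mem_nhds h0, eventually_nhdsWithin_iff.1 hdisc,
      eventually_all.2 fun j => (hzan j).eventually_analyticAt,
      eventually_all.2 fun j => (hlh j).eventually_analyticAt,
      eventually_all.2 fun i => (h.mu_an i).eventually_analyticAt,
      eventually_all.2 fun r => eventually_all.2 fun a => (hgan r a).eventually_analyticAt,
      eventually_mulVec_injective h.card_blockIdx.symm (fun r a => (hgan r a).continuousAt) hinj0,
      eventually_nhdsWithin_iff.1 hhiggs, eventually_nhdsWithin_iff.1 hmetric,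
      eventually_all.2 fun j => Metric.ball_mem_nhds (0 : ℂ) (hρ j)]
      with w a1 a2 a3 a4 a5 a6 a7 a8 a9 a10
    exact ⟨a1, fun hw => (a2 hw).2, a3, a4, a5, a6, a7, a8, a9, a10⟩
  obtain ⟨R, hR, hall⟩ := Metric.eventually_nhds_iff_ball.1 hall
  obtain ⟨ginv, hginv⟩ := exists_holMat_inv (g := g) (S := Metric.ball 0 R) h.card_blockIdx.symm
    (fun w hw r a => ((hall w hw).2.2.2.2.2.1 r a).differentiableAt)
    (fun w hw => (hall w hw).2.2.2.2.2.2.1)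
  refine ⟨R, hR, M, g, ginv, fun w hw => (hall w hw).1, fun w hw => (hall w hw).2.1,
    fun j w hw => ((hall w hw).2.2.1 j).differentiableAt.differentiableWithinAt,
    fun j => (hρi j).mono fun w hw => (hall w hw).2.2.2.2.2.2.2.2.2 j, fun j => by simp [hM],
    fun j w hw => ((hall w hw).2.2.2.1 j).differentiableAt.differentiableWithinAt,
    fun j w hw => ((hall w hw).2.2.2.2.1 j).differentiableAt.differentiableWithinAt,
    fun r a w hw => ((hall w hw).2.2.2.2.2.1 r a).differentiableAt.differentiableWithinAt,
    fun r a w hw => ((hginv w hw).2.2 r a).differentiableWithinAt, fun w hw => (hginv w hw).1,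
    fun w hw => (hginv w hw).2.1, fun w hw => ?_, fun w hw => (hall w hw).2.2.2.2.2.2.2.2.1⟩
  have h1 : Φ w * g w = g w * M.higgs w := by
    by_cases hw0 : w = 0
    · rw [hw0]; exact hhiggs0
    · exact (hall w hw).2.2.2.2.2.2.2.1 hw0
  rw [Matrix.mul_assoc, h1, ← Matrix.mul_assoc, (hginv w hw).2.1, Matrix.one_mul]

end HiggsLocal

end

/-! ### Assembly of the main theorem -/

theorem mainTheorem5 (n ℓ : ℕ) (hℓ : 0 < ℓ) (U : Set ℂ) (hU : IsOpen U) (h0 : (0 : ℂ) ∈ U)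
    (Φ : ℂ → Matrix (Fin n) (Fin n) ℂ) (hΦ : HiggsLocal.IsSLHiggsField U Φ)
    (hcross : HiggsLocal.SimpleEigenvalueCrossing U Φ)
    (hord : analyticOrderAt (fun w => (Φ w).discr) 0 = (ℓ : ℕ∞))
    (H : ℂ → Matrix (Fin n) (Fin n) ℂ) (hH : HiggsLocal.IsLimitingMetric U Φ H) :
    -- existence of the local frame and coordinates
    (∃ R : ℝ, 0 < R ∧ ∃ (M : HiggsLocal.LocalModel ℓ (n - 2 * ℓ))
      (g : ℂ → Matrix (Fin n) (HiggsLocal.BlockIdx ℓ (n - 2 * ℓ)) ℂ)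
      (ginv : ℂ → Matrix (HiggsLocal.BlockIdx ℓ (n - 2 * ℓ)) (Fin n) ℂ),
      HiggsLocal.IsAdaptedFrame U Φ H R M g ginv) ∧
    -- in every such frame, on every smaller disk `D`:
    ∀ (R : ℝ) (M : HiggsLocal.LocalModel ℓ (n - 2 * ℓ))
      (g : ℂ → Matrix (Fin n) (HiggsLocal.BlockIdx ℓ (n - 2 * ℓ)) ℂ)
      (ginv : ℂ → Matrix (HiggsLocal.BlockIdx ℓ (n - 2 * ℓ)) (Fin n) ℂ),
      HiggsLocal.IsAdaptedFrame U Φ H R M g ginv →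
      ∀ E V : ℂ → Matrix (HiggsLocal.BlockIdx ℓ (n - 2 * ℓ)) (HiggsLocal.BlockIdx ℓ (n - 2 * ℓ)) ℂ,
      HiggsLocal.IsDeformation M.higgs (Metric.ball 0 R) E V →
      ∀ ρ : ℝ, 0 < ρ → ρ < R →
      ∃ d : HiggsLocal.DeformationData ℓ (n - 2 * ℓ),
        -- the normal form of the deformation, and its uniqueness
        d.HolOn (Metric.ball 0 ρ) ∧
        (∃ γ, HiggsLocal.IsGauge M.higgs (Metric.ball 0 ρ) γ E V 0 (d.phiDot M)) ∧
        (∀ d' : HiggsLocal.DeformationData ℓ (n - 2 * ℓ), d'.HolOn (Metric.ball 0 ρ) →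
          (∃ γ, HiggsLocal.IsGauge M.higgs (Metric.ball 0 ρ) γ E V 0 (d'.phiDot M)) →
          d'.EqOn d (Metric.ball 0 ρ)) ∧
        -- the normal form of the variation of the limiting metric
        (∀ t : ℝ, HiggsLocal.IsLimitingVariation (fun w => (t : ℂ) • M.higgs w) M.hInf
          (Metric.ball 0 ρ \ {0}) 0 (fun w => (t : ℂ) • d.phiDot M w) (d.nuInf M)) ∧
        (∀ ν, HiggsLocal.IsLimitingVariation M.higgs M.hInf (Metric.ball 0 ρ \ {0}) E V ν →
          (∀ w ∈ Metric.ball (0 : ℂ) ρ \ {0}, HiggsLocal.dbarMat ν w = E w) →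
          (∃ C : ℝ, ∀ᶠ w in nhdsWithin 0 {0}ᶜ, ∀ a b, ‖(ν w - d.nuInf M w) a b‖ ≤ C) →
          ∃ γ, HiggsLocal.IsGauge M.higgs (Metric.ball 0 ρ) γ E V 0 (d.phiDot M) ∧
            ∀ w ∈ Metric.ball (0 : ℂ) ρ \ {0}, ν w + γ w = d.nuInf M w) ∧
        -- exponential decay of the difference of the metrics on the disk
        (∀ (χ : ℝ → ℝ) (u : ℝ → ℝ → ℝ) (Ω : Set ℂ)
          (νapp : ℝ → ℂ →
            Matrix (HiggsLocal.BlockIdx ℓ (n - 2 * ℓ)) (HiggsLocal.BlockIdx ℓ (n - 2 * ℓ)) ℂ),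
          HiggsLocal.IsCutoff χ →
          (∀ t : ℝ, 0 < t → HiggsLocal.IsModelFunction t (u t)) →
          IsOpen Ω → closure Ω ⊆ Metric.ball 0 ρ →
          (∀ j, ∀ w ∈ Metric.ball (0 : ℂ) ρ, χ ‖M.z j w‖ ≠ 0 → w ∈ Ω) →
          (∀ t : ℝ, 0 < t →
            HiggsLocal.IsAppVariation M d χ (u t) t (Metric.ball 0 ρ) Ω (νapp t)) →
          (∀ t : ℝ, 0 < t →
            MeasureTheory.IntegrableOn
              (HiggsLocal.density (fun w => (t : ℂ) • M.higgs w) (M.hApp χ (u t)) 0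
                (fun w => (t : ℂ) • d.phiDot M w) (νapp t)) (Metric.ball 0 ρ) ∧
            MeasureTheory.IntegrableOn
              (HiggsLocal.density (fun w => (t : ℂ) • M.higgs w) M.hInf 0
                (fun w => (t : ℂ) • d.phiDot M w) (d.nuInf M)) (Metric.ball 0 ρ)) ∧
          ∃ c : ℝ, 0 < c ∧
            (fun t : ℝ =>
              HiggsLocal.normSq (fun w => (t : ℂ) • M.higgs w) (M.hApp χ (u t)) 0
                  (fun w => (t : ℂ) • d.phiDot M w) (νapp t) (Metric.ball 0 ρ)
                - HiggsLocal.normSq (fun w => (t : ℂ) • M.higgs w) M.hInf 0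
                  (fun w => (t : ℂ) • d.phiDot M w) (d.nuInf M) (Metric.ball 0 ρ))
              =O[Filter.atTop] fun t : ℝ => Real.exp (-c * t)) := by
  refine ⟨HiggsLocal.exists_isAdaptedFrame hℓ hU h0 hΦ hcross hord hH, ?_⟩
  intro R M g ginv hF E V hEV ρ hρ hρR
  have hs := hcross.1
  -- The normal form is built on a disk slightly larger than D. Its data are then bounded up to the
  -- boundary of D, as the integral estimates need.
  obtain ⟨σ, hρσ, hσR⟩ := exists_between hρR
  have hsub : Metric.ball (0 : ℂ) ρ ⊆ Metric.ball 0 σ := Metric.ball_subset_ball hρσ.le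
  obtain ⟨d, hd, γ, hγ⟩ := hF.exists_gauge_normalForm hs hEV (hρ.trans hρσ) hσR
  have hdρ : d.HolOn (Metric.ball 0 ρ) := ⟨fun j => (hd.lamHatDot j).mono hsub,
    fun j => (hd.P j).mono hsub, fun j => (hd.lamDot j).mono hsub⟩
  have hγρ : HiggsLocal.IsGauge M.higgs (Metric.ball 0 ρ) γ E V 0 (d.phiDot M) :=
    ⟨fun a b => (hγ.smooth a b).mono hsub, fun w hw => hγ.eta w (hsub hw),
      fun w hw => hγ.phi w (hsub hw)⟩
  refine ⟨d, hdρ, ⟨γ, hγρ⟩, fun d' _ h' => ?_, HiggsLocal.isLimitingVariation_nuInf hF hρR.le hdρ,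
    fun ν hν hνE hb => HiggsLocal.exists_gauge_to_nuInf hF hρ hρR.le hdρ hγρ hν hνE hb, ?_⟩
  · obtain ⟨γ', hγ'⟩ := h'
    exact hF.normalForm_unique hs (Metric.ball_subset_ball hρR.le) hγρ hγ'
  · intro χ u Ω νapp hχ hu hΩ hcl hχΩ hν
    exact HiggsLocal.expDecay_normSq_sub hF hs hℓ hρ hρσ hσR.le hd hχ hu hΩ hcl hχΩ hν
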